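/- Let $\mathbb K$ be an algebraically closed field and let $X=C_n$ be a primitive multiple curve of multiplicity $n$ over $\mathbb K$: an irreducible Cohen–Macaulay scheme of finite type over $\mathbb K$ whose reduced subscheme $C$ is a smooth projective curve, whose nilradical ideal sheaf $\mathcal N\subset\mathcal O_X$ is locally principal, and such that $n$ is the least natural number with $\mathcal N^n=0$. Let $\eta$ be the generic point of $X$. All sheaves are coherent. For a sheaf $\mathcal E$ on $X$ let $G_i(\mathcal E)=\mathcal N^i\mathcal E/\mathcal N^{i+1}\mathcal E$, a sheaf on $C$; the generalized rank and degree of $\mathcal E$ are $\mathrm{Rk}(\mathcal E)=\sum_{i=0}^{n-1}\mathrm{rk}\,G_i(\mathcal E)$ and $\mathrm{Deg}(\mathcal E)=\sum_{i=0}^{n-1}\deg G_i(\mathcal E)$, and its slope is $\mu(\mathcal E)=\mathrm{Deg}(\mathcal E)/\mathrm{Rk}(\mathcal E)$. A sheaf is pure if it and all its non-zero subsheaves have support of dimension $1$. A pure sheaf $\mathcal F$ is semistable if $\mu(\mathcal E)\le\mu(\mathcal F)$ for every non-zero subsheaf $\mathcal E\subseteq\mathcal F$, and stable if $\mu(\mathcal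 E)<\mu(\mathcal F)$ for every non-zero proper subsheaf $\mathcal E$. A generalized line bundle on $X$ is a pure sheaf $\mathcal F$ such that $\mathcal F_\eta\cong\mathcal O_{X,\eta}$. For a sheaf $\mathcal G$ on $X$ and $i\ge 1$ write $\mathcal G|_{C_i}=\mathcal G/\mathcal N^i\mathcal G$, let $\overline{\mathcal G}_i=(\mathcal G|_{C_i})^{\vee\vee}$, where $(-)^\vee=\mathcal Hom(-,\mathcal O_X)$, and let $\mathcal T_i(\mathcal G)$ be the kernel of the natural map $\mathcal G|_{C_i}\to\overline{\mathcal G}_i$. The indices of a generalized line bundle $\mathcal F$ are $b_i=h^0\big(C,\mathcal T_i(\overline{\mathcal F}_{i+1})\big)$, i.e. the total length of the finitely supported sheaf $\mathcal T_i(\overline{\mathcal F}_{i+1})$, for $1\le i\le n-1$. **Theorem.** Let $\mathcal F$ be a generalized line bundle on $X$ with indices $b_1,\dots,b_{n-1}$. Then $\mathcal F$ is semistable if and only if $$i\sum_{j=i}^{n-1}b_j-(n-i)\sum_{j=1}^{i-1}b_j\;\le\;-\frac{i\,n\,(n-i)}{2}\deg(\mathcal N/\mathcal N^2)\qquad\text{for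 all }1\le i\le n-1 .$$ It is stable if and only if all these inequalities are strict. -/

import Mathlib

open CategoryTheory AlgebraicGeometry TopologicalSpace

universe u

noncomputable section

namespace GenLineBundle

/-! ### Commutative algebra: graded pieces, relative degree, pure quotients -/

section Algebra

variable (R : Type u) [CommRing R] (M : Type u) [AddCommGroup M] [Module R M]

/-- The `i`-th term `N ^ i M` of the first canonical filtration of a module `M`, where `N` is the
nilradical of the ring. -/
abbrev nilFiltration (i : ℕ) : Submodule R M := nilradical R ^ i • (⊤ : Submodule R M)

/-- The `i`-th piece `G_i(M) = N ^ i M / N (N ^ i M) = N ^ i M / N ^ (i + 1) M` of the first graded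
object of `M`. It is a module over `R` and over the reduced ring `R ⧸ N`. -/
abbrev GrPiece (i : ℕ) : Type u :=
  nilFiltration R M i ⧸ (nilradical R • (⊤ : Submodule R (nilFiltration R M i)))

/-- The restriction `M|_{C_i} = M / N ^ i M`. -/
abbrev Restr (i : ℕ) : Type u := M ⧸ nilFiltration R M i

/-- The canonical map from `M|_{C_i}` to its double dual. -/
abbrev toBidual (i : ℕ) : Restr R M i →ₗ[R] Module.Dual R (Module.Dual R (Restr R M i)) :=
  Module.Dual.eval R (Restr R M i)

/-- The `i`-th pure quotient of `M`, i.e. the double dual of `M|_{C_i}`. -/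
abbrev PureQuot (i : ℕ) : Type u := Module.Dual R (Module.Dual R (Restr R M i))

/-- `T_i(M)`, the kernel of the canonical map from `M|_{C_i}` to the `i`-th pure quotient. -/
abbrev torsionKer (i : ℕ) : Submodule R (Restr R M i) := LinearMap.ker (toBidual R M i)

end Algebra

section Semilinear

variable {R S : Type u} [CommRing R] [CommRing S] {σ : R →+* S}

lemma map_mem_nilradical_pow {i : ℕ} {r : R} (hr : r ∈ nilradical R ^ i) :
    σ r ∈ nilradical S ^ i := by
  have h : (nilradical R).map σ ≤ nilradical S := by
    rw [Ideal.map_le_iff_le_comap]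
    intro a ha
    rw [Ideal.mem_comap, mem_nilradical]
    exact (mem_nilradical.1 ha).map σ
  have h2 := Ideal.mem_map_of_mem σ hr
  rw [Ideal.map_pow] at h2
  exact Ideal.pow_right_mono h i h2

variable {M V : Type u} [AddCommGroup M] [Module R M] [AddCommGroup V] [Module S V]

lemma map_mem_nilFiltration (φ : M →ₛₗ[σ] V) (i : ℕ) {m : M} (hm : m ∈ nilFiltration R M i) :
    φ m ∈ nilFiltration S V i := by
  refine Submodule.smul_induction_on hm ?_ ?_
  · intro r hr n _
    rw [φ.map_smulₛₗ]
    exact Submodule.smul_mem_smul (map_mem_nilradical_pow hr) trivial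
  · intro x y hx hy
    rw [map_add]
    exact add_mem hx hy

/-- The map `N ^ i M → N ^ i V` induced by a semilinear map `M → V`. -/
def nilFiltrationMap (φ : M →ₛₗ[σ] V) (i : ℕ) :
    nilFiltration R M i →ₛₗ[σ] nilFiltration S V i where
  toFun m := ⟨φ m, map_mem_nilFiltration φ i m.2⟩
  map_add' _ _ := Subtype.ext (map_add φ _ _)
  map_smul' _ _ := Subtype.ext (φ.map_smulₛₗ _ _)

/-- The map `G_i(M) → G_i(V)` induced by a semilinear map `M → V`. -/
def grMap (φ : M →ₛₗ[σ] V) (i : ℕ) : GrPiece R M i →ₛₗ[σ] GrPiece S V i :=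
  Submodule.mapQ _ _ (nilFiltrationMap φ i) (by
    intro m hm
    have h1 : m ∈ nilradical R ^ 1 • (⊤ : Submodule R (nilFiltration R M i)) := by
      rwa [pow_one]
    have h : nilFiltrationMap φ i m ∈
        nilradical S ^ 1 • (⊤ : Submodule S (nilFiltration S V i)) :=
      map_mem_nilFiltration (nilFiltrationMap φ i) 1 h1
    rw [pow_one] at h
    exact h)

/-- The degree of a module `M` over the local ring `R` of a curve at a point, relative to a frame
`b` of the generic stalk `V`, where `φ : M → V` is the specialization map: the length of the torsion
`ker φ`, plus the index `[L : Λ] = length (L / (L ∩ Λ)) - length (Λ / (L ∩ Λ))` of the lattice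
`L = φ(M)` with respect to the lattice `Λ` spanned by `b` over `R`. -/
def localDegree (φ : M →ₛₗ[σ] V) {ι : Type*} (b : ι → V) : ℤ :=
  letI : Module R V := Module.compHom V σ
  let φ' : M →ₗ[R] V := { toFun := φ, map_add' := map_add φ, map_smul' := φ.map_smulₛₗ }
  let L : Submodule R V := LinearMap.range φ'
  let Λ : Submodule R V := Submodule.span R (Set.range b)
  ((Module.length R (LinearMap.ker φ')).toNat : ℤ) +
    ((Module.length R (L ⧸ Λ.submoduleOf L)).toNat : ℤ) -
    ((Module.length R (Λ ⧸ L.submoduleOf Λ)).toNat : ℤ)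

end Semilinear

/-! ### Stalks of sheaves of modules -/

section Stalks

variable {X : Scheme.{u}}

/-- The stalk of a sheaf of `𝒪_X`-modules. -/
abbrev Stalk (F : X.Modules) (x : X) : Type u := ↑(TopCat.Presheaf.stalk F.presheaf x)

/-- The stalk of a sheaf of `𝒪_X`-modules at `x` is a module over the local ring `𝒪_{X,x}`. -/
instance stalkModule (F : X.Modules) (x : X) : Module (X.presheaf.stalk x) (Stalk F x) :=
  PresheafOfModules.instModuleCarrierStalkCommRingCatCarrierAbPresheafOpensCarrier
    (R := X.presheaf) F.val x

lemma germ_smul (F : X.Modules) (x : X) (U : X.Opens) (hx : x ∈ U) (r : Γ(X, U)) (m : Γ(F, U)) :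
    (TopCat.Presheaf.germ F.presheaf U x hx (r • m) : Stalk F x) =
      (X.presheaf.germ U x hx r : X.presheaf.stalk x) •
        (TopCat.Presheaf.germ F.presheaf U x hx m : Stalk F x) :=
  PresheafOfModules.germ_smul (R := X.presheaf) F.val x U hx r m

variable [IrreducibleSpace X]

lemma genericPoint_specializes' (x : X) : genericPoint X ⤳ x :=
  (genericPoint_spec X).specializes trivial

/-- The specialization map `𝒪_{X,x} → 𝒪_{X,η}`, where `η` is the generic point of `X`. -/
def ringToGeneric (x : X) : X.presheaf.stalk x →+* X.presheaf.stalk (genericPoint X) :=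
  (X.presheaf.stalkSpecializes (genericPoint_specializes' x)).hom

/-- The specialization map `F_x → F_η`, where `η` is the generic point of `X`. -/
def toGeneric (F : X.Modules) (x : X) :
    Stalk F x →ₛₗ[ringToGeneric x] Stalk F (genericPoint X) where
  toFun m := F.presheaf.stalkSpecializes (genericPoint_specializes' x) m
  map_add' a b := map_add (F.presheaf.stalkSpecializes (genericPoint_specializes' x)).hom a b
  map_smul' r m := by
    obtain ⟨U, hxU, r, rfl⟩ := X.presheaf.exists_germ_eq r
    obtain ⟨V, hxV, m, rfl⟩ := F.presheaf.exists_germ_eq m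
    have hx : x ∈ U ⊓ V := ⟨hxU, hxV⟩
    rw [← TopCat.Presheaf.germ_res_apply X.presheaf (homOfLE (inf_le_left : U ⊓ V ≤ U)) x hx r,
      ← TopCat.Presheaf.germ_res_apply F.presheaf (homOfLE (inf_le_right : U ⊓ V ≤ V)) x hx m,
      ← germ_smul]
    generalize (X.presheaf.map (homOfLE (inf_le_left : U ⊓ V ≤ U)).op) r = r'
    generalize (F.presheaf.map (homOfLE (inf_le_right : U ⊓ V ≤ V)).op) m = m'
    have h1 : ∀ t, F.presheaf.stalkSpecializes (genericPoint_specializes' x)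
        (F.presheaf.germ (U ⊓ V) x hx t) = _ := fun t =>
      TopCat.Presheaf.germ_stalkSpecializes_apply F.presheaf hx (genericPoint_specializes' x) t
    have h3 : ringToGeneric x (X.presheaf.germ (U ⊓ V) x hx r') = _ :=
      TopCat.Presheaf.germ_stalkSpecializes_apply X.presheaf hx (genericPoint_specializes' x) r'
    rw [h1, h1, h3, germ_smul]

end Stalks

/-! ### Coherent sheaves, rank, degree, slope and (semi)stability -/

section Sheaves

variable {X : Scheme.{u}}

/-- Coherent sheaves (on a noetherian scheme): quasi-coherent sheaves of finite type. -/
structure IsCoherent (F : X.Modules) : Prop where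
  quasicoherent : SheafOfModules.IsQuasicoherent (R := X.ringCatSheaf) F
  finiteType : SheafOfModules.IsFiniteType (R := X.ringCatSheaf) F

/-- The dimension of a sheaf: the dimension of its support. -/
def sheafDim (F : X.Modules) : WithBot ℕ∞ :=
  topologicalKrullDim {x : X | Nontrivial (Stalk F x)}

/-- Pure (coherent) sheaves of dimension `1`. -/
structure IsPure (F : X.Modules) : Prop where
  dim_eq_one : sheafDim F = 1
  dim_subsheaf : ∀ (E : X.Modules) (f : E ⟶ F), Mono f → IsCoherent E → ¬ Limits.IsZero E →
    sheafDim E = 1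

/-- The structure sheaf as a module over itself. -/
abbrev structureModule (X : Scheme.{u}) : X.Modules := SheafOfModules.unit X.ringCatSheaf

variable [IrreducibleSpace X]

/-- The generic stalk of the sheaf `G_i(F) = N ^ i F / N ^ (i + 1) F` on the reduced curve `C`, a
vector space over the function field `𝒪_{X,η} / N_η` of `C`. -/
abbrev GrGeneric (F : X.Modules) (i : ℕ) : Type u :=
  GrPiece (X.presheaf.stalk (genericPoint X)) (Stalk F (genericPoint X)) i

/-- The function field of the reduced curve `C`. -/
abbrev CurveField (X : Scheme.{u}) [IrreducibleSpace X] : Type u :=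
  X.presheaf.stalk (genericPoint X) ⧸ nilradical (X.presheaf.stalk (genericPoint X))

/-- The rank of the sheaf `G_i(F)` on the reduced curve `C`. -/
def grRank (F : X.Modules) (i : ℕ) : ℕ :=
  Module.finrank (CurveField X) (GrGeneric F i)

/-- A basis of the generic stalk of `G_i(F)` over the function field of `C`. -/
def grFrame (F : X.Modules) (i : ℕ) : Fin (grRank F i) → GrGeneric F i :=
  open Classical in
  if h : Nonempty (Module.Basis (Fin (grRank F i)) (CurveField X) (GrGeneric F i)) then h.some
  else 0

/-- The degree of the coherent sheaf `G_i(F)` on the smooth projective curve `C`: the length of its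
torsion plus the degree of the divisor of the rational section of the determinant of the torsion
free quotient given by a rational frame. As principal divisors on `C` have degree zero, it does not
depend on the frame. -/
def grDeg (F : X.Modules) (i : ℕ) : ℤ :=
  ∑ᶠ x ∈ closedPoints X, localDegree (grMap (toGeneric F x) i) (grFrame F i)

/-- The degree of the conormal sheaf `N / N ^ 2` of the reduced curve `C` in `X`; the conormal sheaf
is the piece `G_1(𝒪_X)`. -/
def conormalDeg (X : Scheme.{u}) [IrreducibleSpace X] : ℤ := grDeg (structureModule X) 1

/-- The generalized rank of a sheaf on a curve of multiplicity `n`: the rank of its first graded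
object. -/
def genRank (n : ℕ) (F : X.Modules) : ℕ := ∑ i ∈ Finset.range n, grRank F i

/-- The generalized degree of a sheaf on a curve of multiplicity `n`: the degree of its first graded
object. -/
def genDeg (n : ℕ) (F : X.Modules) : ℤ := ∑ i ∈ Finset.range n, grDeg F i

/-- The slope of a sheaf on a curve of multiplicity `n`. -/
def slope (n : ℕ) (F : X.Modules) : ℚ := (genDeg n F : ℚ) / (genRank n F : ℚ)

/-- Semistability of a pure sheaf on a curve of multiplicity `n`. -/
def IsSemistable (n : ℕ) (F : X.Modules) : Prop :=
  ∀ (E : X.Modules) (f : E ⟶ F), Mono f → IsCoherent E → ¬ Limits.IsZero E →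
    slope n E ≤ slope n F

/-- Stability of a pure sheaf on a curve of multiplicity `n`. -/
def IsStable (n : ℕ) (F : X.Modules) : Prop :=
  ∀ (E : X.Modules) (f : E ⟶ F), Mono f → IsCoherent E → ¬ Limits.IsZero E → ¬ IsIso f →
    slope n E < slope n F

/-- Generalized line bundles: pure coherent sheaves that are generically isomorphic to the
structure sheaf. -/
structure IsGenLineBundle (F : X.Modules) : Prop where
  coherent : IsCoherent F
  pure : IsPure F
  generic : Nonempty
    (Stalk F (genericPoint X) ≃ₗ[X.presheaf.stalk (genericPoint X)]
      X.presheaf.stalk (genericPoint X))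

/-- The local `i`-th index of a generalized line bundle `F` at `x`: the length of the stalk at `x`
of the torsion sheaf `T_i` of the `(i + 1)`-st pure quotient of `F`. -/
def localIndex (F : X.Modules) (i : ℕ) (x : X) : ℕ :=
  (Module.length (X.presheaf.stalk x)
    (torsionKer (X.presheaf.stalk x) (PureQuot (X.presheaf.stalk x) (Stalk F x) (i + 1)) i)).toNat

/-- The `i`-th index of a generalized line bundle `F`: the dimension of the space of global sections
of the torsion sheaf `T_i` of the `(i + 1)`-st pure quotient of `F`. This sheaf has finite support,
so that (over an algebraically closed field) this is the sum of the lengths of its stalks. -/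
def index (F : X.Modules) (i : ℕ) : ℕ := ∑ᶠ x ∈ closedPoints X, localIndex F i x

end Sheaves

/-! ### Primitive multiple curves -/

/-- Cohen-Macaulay (noetherian) local rings: some regular sequence in the maximal ideal has length
equal to the dimension. -/
def IsCohenMacaulayLocal (R : Type u) [CommRing R] [IsLocalRing R] : Prop :=
  ∃ rs : List R, (∀ r ∈ rs, r ∈ IsLocalRing.maximalIdeal R) ∧
    RingTheory.Sequence.IsRegular R rs ∧ (rs.length : WithBot ℕ∞) = ringKrullDim R

/-- Primitive multiple curves of multiplicity `n` over a field `K`. Here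
`X.nilradical.subscheme` is the reduced subscheme `C` of `X`; recall that for a smooth curve
over a field, projective and proper are the same. -/
structure IsPrimitiveMultipleCurve (K : Type u) [Field K] (X : Scheme.{u})
    (s : X ⟶ Spec (CommRingCat.of K)) (n : ℕ) : Prop where
  irreducible : IrreducibleSpace X
  locallyOfFiniteType : LocallyOfFiniteType s
  quasiCompact : QuasiCompact s
  cohenMacaulay : ∀ x : X, IsCohenMacaulayLocal (X.presheaf.stalk x)
  smooth : SmoothOfRelativeDimension 1 (X.nilradical.subschemeι ≫ s)
  proper : IsProper (X.nilradical.subschemeι ≫ s)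
  multiplicity : IsLeast {m : ℕ | X.nilradical ^ m = ⊥} n
  locallyPrincipal : ∀ x : X, ∃ U : X.affineOpens, x ∈ U.1 ∧ (X.nilradical.ideal U).IsPrincipal

end GenLineBundle

end

/-! Let `Q` be the local ring of `X` at the generic point `η` and `V = F_η`. The nilradical of `Q`
is its maximal ideal and is generated by one element `g` with `g ^ n = 0 ≠ g ^ (n - 1)`, so `V ≅ Q`
is uniserial: its non-zero submodules are the `g ^ i V` with `i < n`. A non-zero coherent subsheaf
`E` of `F` therefore satisfies `E_η = g ^ i V` for one `i` (`exists_range_eq_span`). It lies in the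
sheaf `F⁽ⁱ⁾` of the sections of `F` whose germ at `η` lies in `g ^ i V`. Both have generalized rank
`n - i`, and the degree of `E` is at most that of `F⁽ⁱ⁾`, with equality only if the two agree at all
closed points (`slope_le`). Since `F⁽ⁱ⁾` is itself coherent (`isCoherent_genericSubsheaf`),
(semi)stability only has to be tested on `F⁽ⁱ⁾` for `1 ≤ i ≤ n - 1`. For `i = 0` the bound is the
slope of `F`, attained only by isomorphisms (`isIso_of_slope_eq`).

The slopes are computed from lattices. Purity makes `F_x → V` injective (`toGeneric_injective`), so
that `F` is a family of lattices `L_x` in `V`. At a closed point `x` the local ring `R` has maximal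
ideal `(t, y)`, where `y` generates the nilradical, and by Cohen-Macaulayness all elements outside
the nilradical are regular (`exists_isMultipleLocalRing`). Write `y = u g` in `Q` and let `w_x` be
minus the order at `x` of the residue class of `u`. If `e` generates a generic stalk with
annihilator `N ^ m`, the local degree of `G_j` for `j < m` is `[y ^ j L : y ^ j R e] - [y ^ (j + 1)
L : y ^ (j + 1) R e] + j w_x + ord_x c`, where `c` is the coordinate of the chosen frame
(`localDegree_grMap`). The orders of `c` sum to zero over `x`, the indices telescope over `j`, and
the `w_x` sum to the conormal degree when `n > 1` (`conormalDeg_eq`). Hence the generalized degree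
is `∑ [L_x : R e] + m (m - 1) / 2 * ∑ w_x` (`genDeg_eq`).

For `F⁽ⁱ⁾` the lattice is `L ∩ y ^ i V`. Filter it by the `y ^ j V`. In the `j`-th step the image of
`L ∩ y ^ j V` contains the image of `y ^ j L`, and the colength is the local index `b_j(x)`. The
index of the image of `y ^ j L` is a number `d_x` independent of `j`, because multiplication by `y ^
j` identifies `V / y V` with `y ^ j V / y ^ (j + 1) V`. This gives `[L ∩ y ^ i V : R g ^ i e] = ∑_{j
≥ i} b_j(x) + (n - i) (d_x + i w_x)` (`idx_inf_range_pow_smul`). To recognize the colength as the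
length of the torsion sheaf `T_j` of the `(j + 1)`-st pure quotient (`length_torsionKer_pureQuot`),
the double dual of `L / y ^ (j + 1) L` has to be the image of `L` in `V / y ^ (j + 1) V`. That image
is reflexive because the rings `R / t ^ a` have simple socle (`exists_socle`). In the comparison of
the slopes of `F⁽ⁱ⁾` and `F` the `d_x` cancel and the stated inequality remains
(`slope_inequality_iff`).

The vanishing of the degree of principal divisors is `IsPrimitiveMultipleCurve.product_formula`. By
the valuative criterion the closed points are the places of the function field over `K`, and for
these the formula follows by taking norms down to a rational function field. -/

open Opposite

noncomputable section

namespace GenLineBundle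

/-! ### Subsheaves given by conditions on germs, and maps on stalks -/

section

variable {X : Scheme.{u}}

/-- The subpresheaf of sections whose germs lie in prescribed submodules of the stalks. -/
def germSubmodule (F : X.Modules) (W : ∀ x : X, Submodule (X.presheaf.stalk x) (Stalk F x)) :
    PresheafOfModules.Submodule F.val where
  obj U :=
    { carrier := {s : Γ(F, U.unop) | ∀ (x : X) (hx : x ∈ U.unop),
        (F.presheaf.germ U.unop x hx s : Stalk F x) ∈ W x}
      add_mem' := by
        intro a b ha hb x hx
        have := (W x).add_mem (ha x hx) (hb x hx)
        exact (map_add (F.presheaf.germ U.unop x hx).hom (a : Γ(F, U.unop)) b).symm ▸ this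
      zero_mem' := by
        intro x hx
        have := (W x).zero_mem
        rwa [← map_zero (F.presheaf.germ U.unop x hx).hom] at this
      smul_mem' := by
        intro r s hs x hx
        have := (W x).smul_mem (X.presheaf.germ U.unop x hx r) (hs x hx)
        exact (germ_smul F x U.unop hx r s).symm ▸ this }
  map {U V} f := by
    intro s hs x hx
    have := hs x (f.unop.le hx)
    rwa [← TopCat.Presheaf.germ_res_apply F.presheaf f.unop x hx s] at this

/-- Sections are glued in `F`; the condition is stalkwise, so the glued section satisfies it at `x`
because some member of the cover containing `x` does. -/
theorem germSubmodule_isSheaf (F : X.Modules)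
    (W : ∀ x : X, Submodule (X.presheaf.stalk x) (Stalk F x)) :
    TopCat.Presheaf.IsSheaf (X := X) (germSubmodule F W).toPresheafOfModules.presheaf := by
  rw [TopCat.Presheaf.isSheaf_iff_isSheaf_comp (forget Ab)]
  rw [TopCat.Presheaf.isSheaf_iff_isSheafUniqueGluing_types]
  intro ι U sf hsf
  have hF : TopCat.Presheaf.IsSheaf F.presheaf := F.isSheaf
  let sf' : ∀ i, Γ(F, U i) := fun i => (sf i).1
  have hcomp : TopCat.Presheaf.IsCompatible F.presheaf U sf' := by
    intro i j
    exact congrArg Subtype.val (hsf i j)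
  obtain ⟨s, hs, hu⟩ := TopCat.Sheaf.existsUnique_gluing ⟨F.presheaf, hF⟩ U sf' hcomp
  refine ⟨⟨s, ?_⟩, ?_, ?_⟩
  · intro x hx
    obtain ⟨i, hi⟩ := Opens.mem_iSup.1 hx
    have h1 := (sf i).2 x hi
    have h2 := hs i
    have h3 := TopCat.Presheaf.germ_res_apply F.presheaf (Opens.leSupr U i) x hi s
    change F.presheaf.germ _ x hi (F.presheaf.map (Opens.leSupr U i).op s) = _ at h3
    have h2' : F.presheaf.map (Opens.leSupr U i).op s = sf' i := h2
    rw [h2'] at h3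
    have h4 : (F.presheaf.germ _ x hx s : Stalk F x) = F.presheaf.germ _ x hi (sf' i) := h3.symm
    exact h4 ▸ h1
  · intro i
    exact Subtype.ext (hs i)
  · rintro ⟨t, ht⟩ h
    refine Subtype.ext (hu t fun i => ?_)
    exact congrArg Subtype.val (h i)

/-- The subsheaf of sections whose germs lie in prescribed submodules of the stalks. -/
def germSubsheaf (F : X.Modules) (W : ∀ x : X, Submodule (X.presheaf.stalk x) (Stalk F x)) :
    X.Modules where
  val := (germSubmodule F W).toPresheafOfModules
  isSheaf := germSubmodule_isSheaf F W

/-- The inclusion of `germSubsheaf`. -/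
def germSubsheafι (F : X.Modules) (W : ∀ x : X, Submodule (X.presheaf.stalk x) (Stalk F x)) :
    germSubsheaf F W ⟶ F := ⟨(germSubmodule F W).ι⟩

instance (F : X.Modules) (W : ∀ x : X, Submodule (X.presheaf.stalk x) (Stalk F x)) :
    Mono (germSubsheafι F W) := by
  apply (Scheme.Modules.toPresheafOfModules X).mono_of_mono_map
  exact inferInstanceAs (Mono (germSubmodule F W).ι)

lemma range_germSubsheafι_app (F : X.Modules)
    (W : ∀ x : X, Submodule (X.presheaf.stalk x) (Stalk F x)) (U : X.Opens) (s : Γ(F, U)) :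
    (∃ t, (germSubsheafι F W).app U t = s) ↔
      ∀ (x : X) (hx : x ∈ U), (F.presheaf.germ U x hx s : Stalk F x) ∈ W x :=
  ⟨fun ⟨t, ht⟩ => ht ▸ t.2, fun h => ⟨⟨s, h⟩, rfl⟩⟩

/-- The map on stalks induced by a morphism of sheaves of modules. -/
def stalkMap {E F : X.Modules} (f : E ⟶ F) (x : X) :
    Stalk E x →ₗ[X.presheaf.stalk x] Stalk F x where
  toFun := (TopCat.Presheaf.stalkFunctor Ab x).map f.mapPresheaf
  map_add' a b := map_add ((TopCat.Presheaf.stalkFunctor Ab x).map f.mapPresheaf).hom a b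
  map_smul' r m := by
    obtain ⟨U, hxU, r, rfl⟩ := X.presheaf.exists_germ_eq r
    obtain ⟨V, hxV, m, rfl⟩ := E.presheaf.exists_germ_eq m
    have hx : x ∈ U ⊓ V := ⟨hxU, hxV⟩
    rw [← TopCat.Presheaf.germ_res_apply X.presheaf (homOfLE (inf_le_left : U ⊓ V ≤ U)) x hx r,
      ← TopCat.Presheaf.germ_res_apply E.presheaf (homOfLE (inf_le_right : U ⊓ V ≤ V)) x hx m,
      ← germ_smul]
    generalize (X.presheaf.map (homOfLE (inf_le_left : U ⊓ V ≤ U)).op) r = r'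
    generalize (E.presheaf.map (homOfLE (inf_le_right : U ⊓ V ≤ V)).op) m = m'
    have h1 : ∀ t, (TopCat.Presheaf.stalkFunctor Ab x).map f.mapPresheaf
        (E.presheaf.germ (U ⊓ V) x hx t) = F.presheaf.germ (U ⊓ V) x hx (f.app _ t) := fun t =>
      TopCat.Presheaf.stalkFunctor_map_germ_apply (U ⊓ V) x hx f.mapPresheaf t
    rw [h1, h1, Scheme.Modules.Hom.app_smul, germ_smul]
    rfl

lemma stalkMap_germ {E F : X.Modules} (f : E ⟶ F) (x : X) (U : X.Opens) (hx : x ∈ U)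
    (s : Γ(E, U)) : stalkMap f x (E.presheaf.germ U x hx s) =
      (F.presheaf.germ U x hx (f.app U s) : Stalk F x) :=
  TopCat.Presheaf.stalkFunctor_map_germ_apply U x hx f.mapPresheaf s

lemma app_injective {E F : X.Modules} (f : E ⟶ F) [Mono f] (U : X.Opens) :
    Function.Injective (f.app U) := by
  have : Mono ((Scheme.Modules.toPresheaf X).map f) := inferInstance
  have h2 : Mono (((Scheme.Modules.toPresheaf X).map f).app (op U)) := inferInstance
  exact (AddCommGrpCat.mono_iff_injective _).1 h2

lemma stalkMap_injective {E F : X.Modules} (f : E ⟶ F) [Mono f] (x : X) :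
    Function.Injective (stalkMap f x) := by
  rw [injective_iff_map_eq_zero]
  intro m hm
  obtain ⟨U, hxU, m, rfl⟩ := E.presheaf.exists_germ_eq m
  rw [stalkMap_germ] at hm
  have h0 : F.presheaf.germ U x hxU (f.app U m) = F.presheaf.germ U x hxU 0 := by
    rw [hm, map_zero]
  obtain ⟨V, hV, iU, iU', h⟩ := F.presheaf.germ_eq x hxU hxU _ _ h0
  rw [map_zero] at h
  have h1 : f.app V (E.presheaf.map iU.op m) = 0 := by
    rw [← h]
    exact congr($(f.mapPresheaf.naturality iU.op) m)
  have h2 : E.presheaf.map iU.op m = 0 := app_injective f V (h1.trans (map_zero _).symm)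
  rw [← TopCat.Presheaf.germ_res_apply E.presheaf iU x hV, h2, map_zero]

lemma isIso_of_stalkMap_bijective {E F : X.Modules} (f : E ⟶ F)
    (h : ∀ x, Function.Bijective (stalkMap f x)) : IsIso f := by
  rw [← isIso_iff_of_reflects_iso _ (Scheme.Modules.toPresheaf X)]
  let E' : TopCat.Sheaf Ab X := ⟨E.presheaf, E.isSheaf⟩
  let F' : TopCat.Sheaf Ab X := ⟨F.presheaf, F.isSheaf⟩
  let f' : E' ⟶ F' := ⟨f.mapPresheaf⟩
  have : ∀ x : X, IsIso ((TopCat.Presheaf.stalkFunctor Ab x).map f'.1) := fun x => by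
    rw [ConcreteCategory.isIso_iff_bijective]
    exact h x
  have h3 : IsIso f' := TopCat.Presheaf.isIso_of_stalkFunctor_map_iso f'
  exact (TopCat.Sheaf.forget Ab X).map_isIso f'

/-- The zero endomorphism is bijective on all stalks, hence an isomorphism, and only a zero object
has an invertible zero endomorphism. -/
lemma isZero_of_stalk_subsingleton (F : X.Modules) (h : ∀ x, Subsingleton (Stalk F x)) :
    Limits.IsZero F := by
  have : IsIso (0 : F ⟶ F) := isIso_of_stalkMap_bijective _ fun x =>
    ⟨fun a b _ => Subsingleton.elim a b, fun b => ⟨b, Subsingleton.elim _ _⟩⟩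
  rw [Limits.IsZero.iff_id_eq_zero]
  exact (Limits.isIsoZeroEquiv F F this).1

lemma stalk_subsingleton_of_isZero (F : X.Modules) (h : Limits.IsZero F) (x : X) :
    Subsingleton (Stalk F x) := by
  have h1 : 𝟙 F = 0 := h.eq_of_src _ _
  refine ⟨fun a b => ?_⟩
  have key : ∀ a : Stalk F x, a = 0 := fun a => by
    obtain ⟨U, hxU, m, rfl⟩ := F.presheaf.exists_germ_eq a
    have h2 : m = 0 := by
      have := congr(($h1).app U m)
      simpa using this
    rw [h2, map_zero]
  rw [key a, key b]

lemma toGeneric_stalkMap [IrreducibleSpace X] {E F : X.Modules} (f : E ⟶ F) (x : X)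
    (m : Stalk E x) :
    toGeneric F x (stalkMap f x m) = stalkMap f (genericPoint X) (toGeneric E x m) := by
  obtain ⟨U, hxU, m, rfl⟩ := E.presheaf.exists_germ_eq m
  have h1 : ∀ (G : X.Modules) (t : Γ(G, U)), toGeneric G x (G.presheaf.germ U x hxU t) =
    (G.presheaf.germ U _ ((genericPoint_specializes' x).mem_open U.isOpen hxU) t :
      Stalk G (genericPoint X)) := fun G t =>
    TopCat.Presheaf.germ_stalkSpecializes_apply G.presheaf hxU (genericPoint_specializes' x) t
  rw [stalkMap_germ, h1, h1, stalkMap_germ]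

end

/-! ### Local generators of sheaves of finite type -/

section

variable {X : Scheme.{u}}

/-- The germs of a family of sections over `U`, at points of `U`, and everything elsewhere. -/
def germSpan (F : X.Modules) {ι : Type*} (U : X.Opens) (s : ι → Γ(F, U)) (x : X) :
    Submodule (X.presheaf.stalk x) (Stalk F x) :=
  ⨅ hx : x ∈ U, Submodule.span _ (Set.range fun i => (F.presheaf.germ U x hx (s i) : Stalk F x))

lemma mem_germSpan (F : X.Modules) {ι : Type*} (U : X.Opens) (s : ι → Γ(F, U)) (i : ι)
    (V : X.Opens) (hV : V ≤ U) (x : X) (hx : x ∈ V) :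
    (F.presheaf.germ V x hx (F.presheaf.map (homOfLE hV).op (s i)) : Stalk F x) ∈
      germSpan F U s x := by
  rw [germSpan, Submodule.mem_iInf]
  intro hxU
  have := TopCat.Presheaf.germ_res_apply F.presheaf (homOfLE hV) x hx (s i)
  rw [this]
  exact Submodule.subset_span ⟨i, rfl⟩

/-- Restriction to `U` keeps `f` a monomorphism, and a monomorphism that is also an epimorphism is
invertible here; the inverse provides preimages over every open subset of `U`. -/
lemma app_surjective_of_epi_over {E F : X.Modules} (f : E ⟶ F) [Mono f] (U : X.Opens)
    (h : Epi (SheafOfModules.Hom.over (R := X.ringCatSheaf) f U)) (V : X.Opens) (hV : V ≤ U)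
    (m : Γ(F, V)) : ∃ m', f.app V m' = m := by
  have hmono : Mono (SheafOfModules.Hom.over (R := X.ringCatSheaf) f U) := by
    apply (SheafOfModules.forget _).mono_of_mono_map
    apply PresheafOfModules.mono_of_injective
    intro V
    exact app_injective f V.unop.left
  have hiso : IsIso (SheafOfModules.Hom.over (R := X.ringCatSheaf) f U) :=
    isIso_of_mono_of_epi _
  let g := inv (SheafOfModules.Hom.over (R := X.ringCatSheaf) f U)
  have hg : g ≫ SheafOfModules.Hom.over (R := X.ringCatSheaf) f U = 𝟙 _ := by simp [g]
  refine ⟨g.val.app (op (Over.mk (homOfLE hV))) m, ?_⟩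
  exact congr((($hg).val.app (op (Over.mk (homOfLE hV)))) m)

lemma over_sections_eval (F : X.Modules) (U : X.Opens)
    (t : (SheafOfModules.over (R := X.ringCatSheaf) F U).sections) (V : (Over U)ᵒᵖ) :
    t.1 V = F.presheaf.map V.unop.hom.op (t.1 (op (Over.mk (𝟙 U))) : Γ(F, U)) :=
  (t.2 (Over.homMk V.unop.hom : V.unop ⟶ Over.mk (𝟙 U)).op).symm

/-- The generating sections lie in the subsheaf spanned by their own germs, so the epimorphism from
the free sheaf factors through the inclusion. -/
lemma epi_over_germSubsheafι (F : X.Modules) (U : X.Opens)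
    (G : (SheafOfModules.over (R := X.ringCatSheaf) F U).GeneratingSections) :
    Epi (SheafOfModules.Hom.over (R := X.ringCatSheaf) (germSubsheafι F
      (germSpan F U fun i => ((G.s i).1 (op (Over.mk (𝟙 U))) : Γ(F, U)))) U) := by
  let s : G.I → Γ(F, U) := fun i => (G.s i).1 (op (Over.mk (𝟙 U)))
  let t : G.I → (SheafOfModules.over (R := X.ringCatSheaf)
      (germSubsheaf F (germSpan F U s)) U).sections := fun i =>
    PresheafOfModules.sectionsMk (fun V => ⟨(G.s i).1 V, fun z hz => by
      have h := mem_germSpan F U s i V.unop.left V.unop.hom.le z hz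
      have h2 := over_sections_eval F U (G.s i) V
      exact h2 ▸ h⟩) (by
      intro V W g
      apply Subtype.ext
      exact (G.s i).2 g)
  have h1 : (SheafOfModules.over (R := X.ringCatSheaf)
      (germSubsheaf F (germSpan F U s)) U).freeHomEquiv.symm t ≫
      SheafOfModules.Hom.over (R := X.ringCatSheaf) (germSubsheafι F (germSpan F U s)) U
        = G.π := by
    rw [SheafOfModules.freeHomEquiv_symm_comp]
    rfl
  have : Epi ((SheafOfModules.over (R := X.ringCatSheaf)
      (germSubsheaf F (germSpan F U s)) U).freeHomEquiv.symm t ≫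
      SheafOfModules.Hom.over (R := X.ringCatSheaf) (germSubsheafι F (germSpan F U s)) U) := by
    rw [h1]; infer_instance
  exact epi_of_epi ((SheafOfModules.over (R := X.ringCatSheaf)
      (germSubsheaf F (germSpan F U s)) U).freeHomEquiv.symm t) _

/-- The sections over `U` underlying a family of generating sections of the restriction to `U`. -/
def overSections (F : X.Modules) (U : X.Opens)
    (G : (SheafOfModules.over (R := X.ringCatSheaf) F U).GeneratingSections) (i : G.I) :
    Γ(F, U) := (G.s i).1 (op (Over.mk (𝟙 U)))

lemma germSpan_overSections (F : X.Modules) (U : X.Opens)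
    (G : (SheafOfModules.over (R := X.ringCatSheaf) F U).GeneratingSections) (z : X)
    (hz : z ∈ U) : germSpan F U (overSections F U G) z = ⊤ := by
  rw [eq_top_iff]
  intro m _
  obtain ⟨V, hzV, m, rfl⟩ := F.presheaf.exists_germ_eq m
  have hz' : z ∈ V ⊓ U := ⟨hzV, hz⟩
  rw [← TopCat.Presheaf.germ_res_apply F.presheaf (homOfLE (inf_le_left : V ⊓ U ≤ V)) z hz']
  generalize F.presheaf.map (homOfLE (inf_le_left : V ⊓ U ≤ V)).op m = m'
  have hsurj := app_surjective_of_epi_over _ _ (epi_over_germSubsheafι F U G) _ inf_le_right m'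
  exact (range_germSubsheafι_app F _ _ m').1 hsurj z hz'

/-- This turns the site-theoretic definition of finite type into a concrete one: near each point
finitely many sections generate all stalks. It is the form in which finite type is used later. -/
theorem exists_germSpan_eq_top (F : X.Modules)
    (hF : SheafOfModules.IsFiniteType (R := X.ringCatSheaf) F) (x : X) :
    ∃ (U : X.Opens) (_ : x ∈ U) (ι : Type u) (_ : Finite ι) (s : ι → Γ(F, U)),
      ∀ z ∈ U, germSpan F U s z = ⊤ := by
  obtain ⟨σ, hσ⟩ := hF.exists_localGeneratorsData
  have hc := σ.coversTop
  rw [Opens.coversTop_iff] at hc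
  have hx : x ∈ iSup σ.X := by rw [hc]; trivial
  obtain ⟨j, hj⟩ := Opens.mem_iSup.1 hx
  exact ⟨σ.X j, hj, _, (hσ.isFiniteType j).finite, overSections F (σ.X j) (σ.generators j),
    germSpan_overSections F (σ.X j) (σ.generators j)⟩

end

/-! ### Coherence from presentations on affine open sets -/

section

variable {X : Scheme.{u}}

/-- Restricting along `fromSpec` and then along `isoSpec` is the restriction to `U`. -/
def restrictFromSpecIso {U : X.Opens} (hU : IsAffineOpen U) :
    Scheme.Modules.restrictFunctor hU.fromSpec ⋙
      Scheme.Modules.restrictFunctor hU.isoSpec.hom ≅ Scheme.Modules.restrictFunctor U.ι :=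
  (Scheme.Modules.restrictFunctorComp _ _).symm ≪≫
    Scheme.Modules.restrictFunctorCongr (by rw [hU.isoSpec_hom_fromSpec])

/-- A presentation on an open subscheme, as a presentation on the slice site. -/
def presentationOverOfRestrict (E : X.Modules) {U : X.Opens}
    (P : SheafOfModules.Presentation (R := (U : Scheme.{u}).ringCatSheaf) (E.restrict U.ι)) :
    SheafOfModules.Presentation (SheafOfModules.over (R := X.ringCatSheaf) E U) :=
  let e : SheafOfModules (X.ringCatSheaf.over U) ≌
    SheafOfModules (U : Scheme.{u}).ringCatSheaf := Scheme.Modules.overEquiv U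
  let i : e.inverse.obj (E.restrict U.ι) ≅ SheafOfModules.over (R := X.ringCatSheaf) E U :=
    e.inverse.mapIso ((Scheme.Modules.overFunctorEquiv U).symm.app E) ≪≫
      (e.unitIso.app (SheafOfModules.over (R := X.ringCatSheaf) E U)).symm
  haveI : Limits.PreservesColimitsOfSize.{u, u} e.inverse :=
    e.symm.toAdjunction.leftAdjoint_preservesColimits
  SheafOfModules.Presentation.ofIsIso i.hom (P.map e.inverse (e.unitIso.app (SheafOfModules.unit _)))

/-- A presentation on an affine open subscheme, as a presentation on the slice site. -/
def presentationOver (E : X.Modules) {U : X.Opens} (hU : IsAffineOpen U)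
    (P : SheafOfModules.Presentation (R := (Spec Γ(X, U)).ringCatSheaf)
      (E.restrict hU.fromSpec)) :
    SheafOfModules.Presentation (SheafOfModules.over (R := X.ringCatSheaf) E U) :=
  let i := (restrictFromSpecIso hU).app E
  haveI : IsIso (C := SheafOfModules (U : Scheme.{u}).ringCatSheaf) i.hom :=
    inferInstanceAs (IsIso (C := (U : Scheme.{u}).Modules) i.hom)
  presentationOverOfRestrict E (SheafOfModules.Presentation.ofIsIso
    (R := (U : Scheme.{u}).ringCatSheaf) i.hom
    (Scheme.Modules.presentationRestrict (M := E.restrict hU.fromSpec) hU.isoSpec.hom P))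

/-- Quasi-coherence and finite type are both defined by data on a cover by slice sites; carrying the
affine presentations over to the slices yields both at once. -/
lemma isCoherent_of_local_presentation (E : X.Modules)
    (h : ∀ x : X, ∃ (U : X.Opens) (hU : IsAffineOpen U)
      (P : SheafOfModules.Presentation (R := (Spec Γ(X, U)).ringCatSheaf)
        (E.restrict hU.fromSpec)), x ∈ U ∧ Finite P.generators.I) : IsCoherent E := by
  choose U hU P hx hfin using h
  have hc : (Opens.grothendieckTopology X).CoversTop U := by
    rw [Opens.coversTop_iff, IsOpenCover, eq_top_iff]
    exact fun x _ => Opens.mem_iSup.2 ⟨x, hx x⟩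
  let q : SheafOfModules.QuasicoherentData.{u} (R := X.ringCatSheaf) E :=
    { I := X
      X := U
      coversTop := hc
      presentation := fun x => presentationOver E (hU x) (P x) }
  have hq : q.localGeneratorsData.IsFiniteType :=
    { isFiniteType := fun x => { finite := hfin x } }
  have hft : SheafOfModules.IsFiniteType (R := X.ringCatSheaf) E :=
    { exists_localGeneratorsData := ⟨q.localGeneratorsData, hq⟩ }
  exact ⟨q.isQuasicoherent, hft⟩

lemma exists_finite_presentation {R : CommRingCat.{u}} (M : (Spec R).Modules)
    (h : IsIso M.fromTildeΓ)
    (hfin : Module.Finite R ((modulesSpecToSheaf.obj M).presheaf.obj (op ⊤))) :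
    ∃ P : SheafOfModules.Presentation (R := (Spec R).ringCatSheaf) M,
      Finite P.generators.I := by
  obtain ⟨s, hs⟩ := hfin.fg_top
  -- Only the generators have to be finite in number; the relations are all elements of the kernel.
  let P := presentationTilde ((modulesSpecToSheaf.obj M).presheaf.obj (op ⊤))
    (s : Set ((modulesSpecToSheaf.obj M).presheaf.obj (op ⊤))) hs _ (Submodule.span_eq _)
  have : IsIso (C := SheafOfModules (Spec R).ringCatSheaf) M.fromTildeΓ := h
  refine ⟨SheafOfModules.Presentation.ofIsIso (R := (Spec R).ringCatSheaf) M.fromTildeΓ P, ?_⟩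
  exact s.finite_toSet

/-! ### Subsheaves defined by a subspace of the generic stalk -/

section Generic

variable [IrreducibleSpace X]

/-- The subsheaf of the sections whose germ at the generic point lies in a given subspace. -/
def genericSubsheaf (F : X.Modules)
    (W : Submodule (X.presheaf.stalk (genericPoint X)) (Stalk F (genericPoint X))) : X.Modules :=
  germSubsheaf F fun x => W.comap (toGeneric F x)

/-- The inclusion of `genericSubsheaf`. -/
def genericSubsheafι (F : X.Modules)
    (W : Submodule (X.presheaf.stalk (genericPoint X)) (Stalk F (genericPoint X))) :
    genericSubsheaf F W ⟶ F := germSubsheafι F _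

instance (F : X.Modules)
    (W : Submodule (X.presheaf.stalk (genericPoint X)) (Stalk F (genericPoint X))) :
    Mono (genericSubsheafι F W) := inferInstanceAs (Mono (germSubsheafι F _))

lemma toGeneric_germ (F : X.Modules) (x : X) (U : X.Opens) (hx : x ∈ U) (s : Γ(F, U)) :
    toGeneric F x (F.presheaf.germ U x hx s) =
      (F.presheaf.germ U _ ((genericPoint_specializes' x).mem_open U.isOpen hx) s :
        Stalk F (genericPoint X)) :=
  TopCat.Presheaf.germ_stalkSpecializes_apply F.presheaf hx (genericPoint_specializes' x) s

lemma range_genericSubsheafι_app (F : X.Modules)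
    (W : Submodule (X.presheaf.stalk (genericPoint X)) (Stalk F (genericPoint X)))
    (U : X.Opens) (s : Γ(F, U)) :
    (∃ t, (genericSubsheafι F W).app U t = s) ↔ ∀ h : genericPoint X ∈ U,
      (F.presheaf.germ U (genericPoint X) h s : Stalk F (genericPoint X)) ∈ W := by
  refine (range_germSubsheafι_app F _ U s).trans ⟨fun h hU => ?_, fun h x hx => ?_⟩
  · have := h _ hU
    rwa [Submodule.mem_comap, toGeneric_germ] at this
  · rw [Submodule.mem_comap, toGeneric_germ]
    exact h _

lemma range_stalkMap_genericSubsheafι (F : X.Modules)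
    (W : Submodule (X.presheaf.stalk (genericPoint X)) (Stalk F (genericPoint X))) (x : X) :
    LinearMap.range (stalkMap (genericSubsheafι F W) x) = W.comap (toGeneric F x) := by
  ext m
  constructor
  · rintro ⟨e, rfl⟩
    obtain ⟨U, hxU, t, rfl⟩ := (genericSubsheaf F W).presheaf.exists_germ_eq e
    rw [stalkMap_germ]
    exact (range_germSubsheafι_app F _ U _).1 ⟨t, rfl⟩ x hxU
  · intro hm
    obtain ⟨U, hxU, s, rfl⟩ := F.presheaf.exists_germ_eq m
    obtain ⟨t, ht⟩ := (range_genericSubsheafι_app F W U s).2 fun h => by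
      rwa [Submodule.mem_comap, toGeneric_germ] at hm
    exact ⟨_, (stalkMap_germ _ _ _ hxU t).trans (by rw [ht])⟩

lemma eq_zero_of_notMem_genericPoint (F : X.Modules) (U : X.Opens) (hU : genericPoint X ∉ U)
    (s : Γ(F, U)) : s = 0 := by
  refine TopCat.Presheaf.section_ext ⟨F.presheaf, F.isSheaf⟩ U s 0 fun x hx => ?_
  exact absurd ((genericPoint_specializes' x).mem_open U.isOpen hx) hU

/-- Denominators are cleared in the ambient localization `N'`. The hypothesis `h` is saturation: a
numerator in `M'` that agrees with an element of `N` already comes from `M`. Its second alternative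
serves basic open sets that are empty, over which everything vanishes. -/
lemma isLocalizedModule_away_of_injective {R M N M' N' : Type*} [CommRing R] [AddCommGroup M]
    [AddCommGroup N] [AddCommGroup M'] [AddCommGroup N'] [Module R M] [Module R N] [Module R M']
    [Module R N'] (r : R) (φ : M →ₗ[R] N) (φ' : M' →ₗ[R] N') (a : M →ₗ[R] M') (b : N →ₗ[R] N')
    (ha : Function.Injective a) (hb : Function.Injective b) (hab : ∀ x, b (φ x) = φ' (a x))
    (hN : IsUnit (algebraMap R (Module.End R N) r)) [hφ : IsLocalizedModule.Away r φ']
    (h : ∀ (x : N) (y : M'), b x = φ' y → (∃ t, a t = y) ∨ x = 0) :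
    IsLocalizedModule.Away r φ := by
  refine IsLocalizedModule.Away.mk_of_addCommGroup hN (fun x => ?_) (fun x hx => ?_)
  · obtain ⟨⟨y, ⟨_, n, rfl⟩⟩, hy⟩ := IsLocalizedModule.surj (.powers r) φ' (b x)
    have hy' : b (r ^ n • x) = φ' y := by rw [map_smul]; exact hy
    rcases h _ _ hy' with ⟨t, rfl⟩ | h0
    · exact ⟨n, t, hb (by rw [hy', hab])⟩
    · exact ⟨n, 0, by rw [h0, map_zero]⟩
  · have h1 : φ' (a x) = 0 := by rw [← hab, hx, map_zero]
    obtain ⟨⟨_, n, rfl⟩, hn⟩ := (IsLocalizedModule.eq_zero_iff (.powers r) φ').mp h1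
    refine ⟨n, ha ?_⟩
    rw [map_smul, map_zero]
    exact hn

/-- Membership in the subsheaf is tested at `η` alone, so it can be read off after restriction to
any open set containing `η`; an open set without `η` carries only the zero section. -/
lemma exists_eq_or_eq_zero_of_res_eq (F : X.Modules)
    (W : Submodule (X.presheaf.stalk (genericPoint X)) (Stalk F (genericPoint X)))
    {U V : X.Opens} (i : V ⟶ U) (x : Γ(genericSubsheaf F W, V)) (y : Γ(F, U))
    (h : (genericSubsheafι F W).app V x = F.presheaf.map i.op y) :
    (∃ t, (genericSubsheafι F W).app U t = y) ∨ x = 0 := by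
  by_cases hη : genericPoint X ∈ V
  · left
    refine (range_genericSubsheafι_app F W U y).2 fun _ => ?_
    have h2 := (range_genericSubsheafι_app F W V _).1 ⟨x, rfl⟩ hη
    have h3 := TopCat.Presheaf.germ_res_apply F.presheaf i (genericPoint X) hη y
    exact (h3.symm.trans (congrArg _ h.symm)) ▸ h2
  · exact .inr (eq_zero_of_notMem_genericPoint (genericSubsheaf F W) V hη x)

lemma isLocalizing_of_injective {R : CommRingCat.{u}} {E F : TopCat.Sheaf (ModuleCat R) (Spec R)}
    (ρ : E ⟶ F) (hF : IsLocalizing F)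
    (hi : ∀ f : R, Function.Injective (ρ.hom.app (op (PrimeSpectrum.basicOpen f))).hom)
    (hi' : Function.Injective (ρ.hom.app (op ⊤)).hom)
    (hE : ∀ f : R, IsUnit (algebraMap R (Module.End R
      (E.obj.obj (op (PrimeSpectrum.basicOpen f)))) f))
    (h : ∀ (f : R) (x : E.obj.obj (op (PrimeSpectrum.basicOpen f))) (y : F.obj.obj (op ⊤)),
      (ρ.hom.app (op (PrimeSpectrum.basicOpen f))).hom x =
        (F.obj.map (PrimeSpectrum.basicOpen f).leTop.op).hom y →
      (∃ t, (ρ.hom.app (op ⊤)).hom t = y) ∨ x = 0) :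
    IsLocalizing E := by
  intro f
  have hf := hF f
  have hn : ∀ x, (ρ.hom.app (op (PrimeSpectrum.basicOpen f))).hom
      ((E.obj.map (PrimeSpectrum.basicOpen f).leTop.op).hom x) =
      (F.obj.map (PrimeSpectrum.basicOpen f).leTop.op).hom ((ρ.hom.app (op ⊤)).hom x) :=
    fun x => congr($(ρ.hom.naturality (PrimeSpectrum.basicOpen f).leTop.op) x)
  exact isLocalizedModule_away_of_injective f
    (E.obj.map (PrimeSpectrum.basicOpen f).leTop.op).hom
    (F.obj.map (PrimeSpectrum.basicOpen f).leTop.op).hom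
    (ρ.hom.app (op ⊤)).hom
    (ρ.hom.app (op (PrimeSpectrum.basicOpen f))).hom
    hi' (hi f) hn (hE f) (hφ := hf) (h f)

set_option maxHeartbeats 1000000 in
lemma genericSubsheaf_localizing {R : CommRingCat.{u}} (j : Spec R ⟶ X) [IsOpenImmersion j]
    (F : X.Modules)
    (W : Submodule (X.presheaf.stalk (genericPoint X)) (Stalk F (genericPoint X)))
    (hF : IsLocalizing (modulesSpecToSheaf.obj (F.restrict j))) :
    IsLocalizing (modulesSpecToSheaf.obj ((genericSubsheaf F W).restrict j)) :=
  isLocalizing_of_injective (modulesSpecToSheaf.map <| (Scheme.Modules.restrictFunctor j).map (genericSubsheafι F W)) hF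
    (fun f => app_injective (genericSubsheafι F W) (j ''ᵁ (PrimeSpectrum.basicOpen f)))
    (app_injective (genericSubsheafι F W) (j ''ᵁ ⊤))
    (fun f => Scheme.Modules.isUnit_algebraMap_end_of_le_basicOpen f le_rfl)
    (fun f x y hxy => exists_eq_or_eq_zero_of_res_eq F W
    (homOfLE (Scheme.Hom.image_mono j (le_top : PrimeSpectrum.basicOpen f ≤ ⊤))) x y hxy)

end Generic

end

/-! ### Finiteness of sections and coherence of generic subsheaves -/

section

variable {X : Scheme.{u}}

lemma map_mem_span_of_mem_span (F : X.Modules) {ι : Type*} {U V : X.Opens} (i : V ⟶ U)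
    (s : ι → Γ(F, U)) {m : Γ(F, U)} (hm : m ∈ Submodule.span Γ(X, U) (Set.range s)) :
    F.presheaf.map i.op m ∈
      Submodule.span Γ(X, V) (Set.range fun k => F.presheaf.map i.op (s k)) := by
  induction hm using Submodule.span_induction with
  | mem x hx =>
    obtain ⟨k, rfl⟩ := hx
    exact Submodule.subset_span ⟨k, rfl⟩
  | zero => rw [map_zero]; exact zero_mem _
  | add x y _ _ hx hy => rw [map_add]; exact add_mem hx hy
  | smul a x _ hx => rw [Scheme.Modules.map_smul]; exact Submodule.smul_mem _ _ hx

/-- A section whose germ is a combination of germs is locally a combination of sections. -/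
lemma exists_map_mem_span (F : X.Modules) {ι : Type*} {U : X.Opens} (s : ι → Γ(F, U)) (x : X)
    (hx : x ∈ U) (m : Γ(F, U)) (hm : (F.presheaf.germ U x hx m : Stalk F x) ∈
      Submodule.span (X.presheaf.stalk x)
        (Set.range fun i => (F.presheaf.germ U x hx (s i) : Stalk F x))) :
    ∃ (V : X.Opens) (i : V ⟶ U), x ∈ V ∧ F.presheaf.map i.op m ∈
      Submodule.span Γ(X, V) (Set.range fun k => F.presheaf.map i.op (s k)) := by
  -- The induction over the span takes place on germs and shrinks the neighbourhood at each step. It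
  -- yields a combination `m'` with the germ of `m`; the two agree after one further restriction.
  have key : ∃ (V : X.Opens) (i : V ⟶ U) (hxV : x ∈ V) (m' : Γ(F, V)),
      F.presheaf.germ V x hxV m' = F.presheaf.germ U x hx m ∧ m' ∈
      Submodule.span Γ(X, V) (Set.range fun k => F.presheaf.map i.op (s k)) := by
    have hres : ∀ {V W : X.Opens} (i : V ⟶ U) (j : W ⟶ V) (m' : Γ(F, V)), m' ∈
        Submodule.span Γ(X, V) (Set.range fun k => F.presheaf.map i.op (s k)) →
        F.presheaf.map j.op m' ∈
        Submodule.span Γ(X, W) (Set.range fun k => F.presheaf.map (j ≫ i).op (s k)) := by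
      intro V W i j m' h
      have := map_mem_span_of_mem_span F j _ h
      simpa only [op_comp, Functor.map_comp, ConcreteCategory.comp_apply] using this
    generalize (F.presheaf.germ U x hx m : Stalk F x) = e at hm
    induction hm using Submodule.span_induction with
    | mem x hx =>
      obtain ⟨k, rfl⟩ := hx
      exact ⟨U, 𝟙 U, ‹_›, s k, rfl, Submodule.subset_span ⟨k, by simp⟩⟩
    | zero => exact ⟨U, 𝟙 U, hx, 0, map_zero _, zero_mem _⟩
    | add y z _ _ hy hz =>
      obtain ⟨V, i, hV, m', rfl, hm'⟩ := hy
      obtain ⟨W, j, hW, m'', rfl, hm''⟩ := hz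
      refine ⟨V ⊓ W, homOfLE inf_le_left ≫ i, ⟨hV, hW⟩,
        F.presheaf.map (homOfLE (inf_le_left : V ⊓ W ≤ V)).op m' +
        F.presheaf.map (homOfLE (inf_le_right : V ⊓ W ≤ W)).op m'', ?_, add_mem ?_ ?_⟩
      · rw [map_add]
        exact congrArg₂ _ (TopCat.Presheaf.germ_res_apply F.presheaf _ x _ m')
          (TopCat.Presheaf.germ_res_apply F.presheaf _ x _ m'')
      · exact hres i _ _ hm'
      · exact hres j (homOfLE (inf_le_right : V ⊓ W ≤ W)) _ hm''
    | smul r y _ hy =>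
      obtain ⟨V, i, hV, m', rfl, hm'⟩ := hy
      obtain ⟨W, hW, r, rfl⟩ := X.presheaf.exists_germ_eq r
      refine ⟨V ⊓ W, homOfLE inf_le_left ≫ i, ⟨hV, hW⟩,
        X.presheaf.map (homOfLE (inf_le_right : V ⊓ W ≤ W)).op r •
        F.presheaf.map (homOfLE (inf_le_left : V ⊓ W ≤ V)).op m', ?_,
        Submodule.smul_mem _ _ (hres i _ _ hm')⟩
      refine (germ_smul F x _ _ _ _).trans ?_
      congr 1
      · exact TopCat.Presheaf.germ_res_apply X.presheaf _ x _ r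
      · exact TopCat.Presheaf.germ_res_apply F.presheaf _ x _ m'
  obtain ⟨V, i, hV, m', h, hm'⟩ := key
  obtain ⟨W, hW, j, k, hjk⟩ := F.presheaf.germ_eq x hV hx _ _ h
  refine ⟨W, k, hW, ?_⟩
  rw [← hjk]
  have := map_mem_span_of_mem_span F j _ hm'
  obtain rfl : k = j ≫ i := Subsingleton.elim _ _
  simpa only [op_comp, Functor.map_comp, ConcreteCategory.comp_apply] using this

lemma exists_pow_smul_mem_span {A B M N ι : Type*} [CommRing A] [CommRing B] [Algebra A B]
    [AddCommGroup M] [AddCommGroup N] [Module A M] [Module A N] [Module B N] [IsScalarTower A B N]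
    (f : A) [IsLocalization.Away f B] (φ : M →ₗ[A] N) [IsLocalizedModule.Away f φ]
    (s : ι → M) (m : M) (hm : φ m ∈ Submodule.span B (Set.range fun i => φ (s i))) :
    ∃ k : ℕ, f ^ k • m ∈ Submodule.span A (Set.range s) := by
  have h : Submodule.span B (Set.range fun i => φ (s i)) ≤
      (Submodule.span A (Set.range s)).localized' B (.powers f) φ := by
    rw [Submodule.span_le]
    rintro _ ⟨i, rfl⟩
    exact ⟨s i, Submodule.subset_span ⟨i, rfl⟩, 1, by simp⟩
  obtain ⟨m', hm', ⟨_, k, rfl⟩, h⟩ := h hm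
  rw [IsLocalizedModule.mk'_eq_iff, Submonoid.smul_def, ← map_smul] at h
  obtain ⟨⟨_, l, rfl⟩, hl⟩ := (IsLocalizedModule.eq_iff_exists (.powers f) φ).1 h
  refine ⟨l + k, ?_⟩
  rw [pow_add, mul_smul]
  have : f ^ l • m' = f ^ l • f ^ k • m := hl
  rw [← this]
  exact Submodule.smul_mem _ _ hm'

/-- The ideal of the multipliers carrying `m` into the span is contained in no maximal ideal, so it
contains `1`. -/
lemma finite_of_forall_exists_smul_mem {A M ι : Type*} [CommRing A]
    [AddCommGroup M] [Module A M] [Finite ι] (s : ι → M)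
    (h : ∀ (m : M) (p : PrimeSpectrum A), ∃ f ∉ p.asIdeal, f • m ∈ Submodule.span A (Set.range s)) :
    Module.Finite A M := by
  refine ⟨⟨(Set.finite_range s).toFinset, ?_⟩⟩
  rw [Set.Finite.coe_toFinset, eq_top_iff]
  intro m _
  by_contra hm
  let I : Ideal A := (Submodule.span A (Set.range s)).comap (LinearMap.toSpanSingleton A M m)
  have hI : I ≠ ⊤ := fun h => hm (by
    have : (1 : A) ∈ I := h ▸ trivial
    simpa [I] using this)
  obtain ⟨p, hp, hle⟩ := Ideal.exists_le_maximal I hI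
  obtain ⟨f, hf, hfm⟩ := h m ⟨p, hp.isPrime⟩
  exact hf (hle (by simpa [I] using hfm))

lemma map_comp_mem_span (F : X.Modules) {ι : Type*} {U V W : X.Opens} (j : W ⟶ V) (i : V ⟶ U)
    (s : ι → Γ(F, U)) (m : Γ(F, U)) (hm : F.presheaf.map i.op m ∈
      Submodule.span Γ(X, V) (Set.range fun k => F.presheaf.map i.op (s k))) :
    F.presheaf.map (j ≫ i).op m ∈
      Submodule.span Γ(X, W) (Set.range fun k => F.presheaf.map (j ≫ i).op (s k)) := by
  simpa only [op_comp, Functor.map_comp, ConcreteCategory.comp_apply] using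
    map_mem_span_of_mem_span F j _ hm

/-- Restriction of global sections, as a linear map over the base ring. -/
def restrictTopLinear {R : CommRingCat.{u}} (M : (Spec R).Modules) (D : (Spec R).Opens) :
    Γ(M, ⊤) →ₗ[R] Γ(M, D) where
  toFun := M.presheaf.map (homOfLE le_top).op
  map_add' := map_add _
  map_smul' r x := Scheme.Modules.map_smul_Spec _ r x

lemma restrictTopLinear_isLocalizedModule {R : CommRingCat.{u}} (M : (Spec R).Modules) (f : R)
    (D : (Spec R).Opens) (hD : D = PrimeSpectrum.basicOpen f)
    (hM : IsLocalizing (modulesSpecToSheaf.obj M)) :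
    IsLocalizedModule.Away f (restrictTopLinear M D) := by
  subst hD
  exact hM f

lemma mem_span_restrict {Y : Scheme.{u}} (F : X.Modules) (j : Y ⟶ X) [IsOpenImmersion j]
    {ι : Type*} (V : Y.Opens) (s : ι → Γ(F, j ''ᵁ V)) {m : Γ(F, j ''ᵁ V)}
    (hm : m ∈ Submodule.span Γ(X, j ''ᵁ V) (Set.range s)) :
    (F.restrictAppIso j V).inv m ∈
      Submodule.span Γ(Y, V) (Set.range fun i => (F.restrictAppIso j V).inv (s i)) := by
  induction hm using Submodule.span_induction with
  | mem x hx =>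
    obtain ⟨k, rfl⟩ := hx
    exact Submodule.subset_span ⟨k, rfl⟩
  | zero => rw [map_zero]; exact zero_mem _
  | add x y _ _ hx hy => rw [map_add]; exact add_mem hx hy
  | smul a x _ hx =>
    have h : (F.restrictAppIso j V).inv (a • x) =
      (j.appIso V).hom a • (F.restrictAppIso j V).inv x :=
      congr($(Scheme.Modules.smul_restrictAppIso_inv j F V a) x)
    rw [h]
    exact Submodule.smul_mem _ _ hx

/-- Near a prime `p` a global section is a combination of the `s i`, first as a germ, then on some
basic open set `D(f)` around `p`. As sections over `D(f)` are a localization, `f ^ k` times the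
section lies in the span of the `s i`, and these multipliers suffice prime by prime. -/
lemma finite_sections_restrict {R : CommRingCat.{u}} (j : Spec R ⟶ X) [IsOpenImmersion j]
    (F : X.Modules) (hF : IsLocalizing (modulesSpecToSheaf.obj (F.restrict j)))
    {ι : Type*} [Finite ι] (s : ι → Γ(F, j ''ᵁ ⊤))
    (hs : ∀ z ∈ j ''ᵁ ⊤, germSpan F (j ''ᵁ ⊤) s z = ⊤) :
    Module.Finite R Γ(F.restrict j, ⊤) := by
  refine finite_of_forall_exists_smul_mem (fun i => (F.restrictAppIso j ⊤).inv (s i)) ?_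
  intro m p
  have hp : j p ∈ j ''ᵁ ⊤ := ⟨p, trivial, rfl⟩
  have hm : (F.presheaf.germ _ (j p) hp m : Stalk F (j p)) ∈ germSpan F (j ''ᵁ ⊤) s (j p) := by
    rw [hs _ hp]; trivial
  rw [germSpan, Submodule.mem_iInf] at hm
  obtain ⟨V, i, hV, h⟩ := exists_map_mem_span F s (j p) hp m (hm hp)
  obtain ⟨_, ⟨_, ⟨f, rfl⟩, rfl⟩, hf, hfV⟩ := PrimeSpectrum.isBasis_basic_opens.exists_subset_of_mem_open
    (show p ∈ (j ⁻¹ᵁ V : Set (Spec R)) from hV) (j ⁻¹ᵁ V).isOpen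
  let D : (Spec R).Opens := PrimeSpectrum.basicOpen f
  have hDV : j ''ᵁ D ≤ V := by
    rintro _ ⟨y, hy, rfl⟩
    exact hfV hy
  have h2 := map_comp_mem_span F (homOfLE hDV) i s m h
  let φ := restrictTopLinear (F.restrict j) D
  have hφ : ∀ y, φ ((F.restrictAppIso j ⊤).inv y) =
    (F.restrictAppIso j D).inv (F.presheaf.map (homOfLE hDV ≫ i).op y) := fun _ => rfl
  have h3 := mem_span_restrict F j D _ h2
  simp only [← hφ] at h3
  have : IsLocalizedModule.Away f φ := restrictTopLinear_isLocalizedModule _ f D rfl hF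
  have : IsLocalization.Away f Γ(Spec R, D) :=
    IsAffineOpen.instAwayCarrierObjOppositeOpensCarrierCarrierCommRingCatSpecPresheafOpOpensBasicOpen
  obtain ⟨k, hk⟩ := exists_pow_smul_mem_span (B := Γ(Spec R, D)) f φ
    (fun i => (F.restrictAppIso j ⊤).inv (s i)) m h3
  exact ⟨f ^ k, fun h => hf (p.2.mem_of_pow_mem _ h), hk⟩

/-- A subsheaf of a coherent sheaf on a locally noetherian scheme that is cut out by a condition
at the generic point is coherent. -/
theorem isCoherent_genericSubsheaf [IrreducibleSpace X] [IsLocallyNoetherian X] (F : X.Modules)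
    (hF : IsCoherent F)
    (W : Submodule (X.presheaf.stalk (genericPoint X)) (Stalk F (genericPoint X))) :
    IsCoherent (genericSubsheaf F W) := by
  refine isCoherent_of_local_presentation _ fun x => ?_
  obtain ⟨V, hxV, ι, _, s, hs⟩ := exists_germSpan_eq_top F hF.finiteType x
  obtain ⟨_, ⟨U, hU, rfl⟩, hxU, hUV⟩ := X.isBasis_affineOpens.exists_subset_of_mem_open hxV V.isOpen
  have hU : IsAffineOpen U := hU
  have hUV : U ≤ V := hUV
  have hle : hU.fromSpec ''ᵁ ⊤ ≤ V := by
    rintro _ ⟨y, -, rfl⟩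
    exact hUV (hU.range_fromSpec.le ⟨y, rfl⟩)
  have := hF.quasicoherent
  have hqc : SheafOfModules.IsQuasicoherent (R := (Spec Γ(X, U)).ringCatSheaf)
    (F.restrict hU.fromSpec) := Scheme.Modules.isQuasicoherent_restrictFunctor _ _
  have hloc : IsLocalizing (modulesSpecToSheaf.obj (F.restrict hU.fromSpec)) := by
    rw [← isIso_fromTildeΓ_iff_isLocalizing]
    exact Scheme.Modules.isIso_fromTildeΓ_of_isQuasicoherent _
  have hfin := finite_sections_restrict hU.fromSpec F hloc
    (fun i => F.presheaf.map (homOfLE hle).op (s i)) (fun z hz => by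
      have := hs z (hle hz)
      rw [germSpan, iInf_pos (hle hz)] at this
      rw [germSpan, iInf_pos hz, ← this]
      congr 2
      ext i
      exact TopCat.Presheaf.germ_res_apply F.presheaf (homOfLE hle) z hz (s i))
  have hloc' := genericSubsheaf_localizing hU.fromSpec F W hloc
  have hN : IsNoetherianRing Γ(X, U) := IsLocallyNoetherian.component_noetherian ⟨U, hU⟩
  have hfin' : Module.Finite Γ(X, U) ((modulesSpecToSheaf.obj
      ((genericSubsheaf F W).restrict hU.fromSpec)).presheaf.obj (op ⊤)) := by
    -- The sections of the subsheaf embed into those of `F`, a finite module over a Noetherian ring.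
    let ρ : (genericSubsheaf F W).restrict hU.fromSpec ⟶ F.restrict hU.fromSpec :=
      (Scheme.Modules.restrictFunctor hU.fromSpec).map (genericSubsheafι F W)
    have : Module.Finite Γ(X, U) ((modulesSpecToSheaf.obj (F.restrict hU.fromSpec)).obj.obj (op ⊤)) :=
      hfin
    have : IsNoetherian Γ(X, U) ((modulesSpecToSheaf.obj (F.restrict hU.fromSpec)).obj.obj (op ⊤)) :=
      isNoetherian_of_isNoetherianRing_of_finite _ _
    exact Module.Finite.of_injective ((modulesSpecToSheaf.map ρ).hom.app (op ⊤)).hom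
      (app_injective (genericSubsheafι F W) _)
  obtain ⟨P, hP⟩ := exists_finite_presentation _
    ((isIso_fromTildeΓ_iff_isLocalizing _).2 hloc') hfin'
  exact ⟨U, hU, P, hxU, hP⟩

end

/-! ### Relative lengths and indices of submodules -/

section RelLength

variable {R V V' : Type*} [CommRing R] [AddCommGroup V] [Module R V] [AddCommGroup V'] [Module R V']

lemma enat_add_ne_top {a b : ℕ∞} : a + b ≠ ⊤ ↔ a ≠ ⊤ ∧ b ≠ ⊤ := WithTop.add_ne_top

/-- The length of `A / (A ∩ B)`. -/
abbrev relLength (A B : Submodule R V) : ℕ∞ := Module.length R (A ⧸ B.submoduleOf A)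

lemma relLength_inf (A B : Submodule R V) : relLength A (A ⊓ B) = relLength A B := by
  have : (A ⊓ B).submoduleOf A = B.submoduleOf A := by
    ext x; simp [Submodule.submoduleOf]
  rw [relLength, this]

lemma relLength_eq_zero {A B : Submodule R V} : relLength A B = 0 ↔ A ≤ B := by
  rw [relLength, Module.length_eq_zero_iff, Submodule.Quotient.subsingleton_iff,
    Submodule.submoduleOf, Submodule.comap_subtype_eq_top]

lemma relLength_self (A : Submodule R V) : relLength A A = 0 := relLength_eq_zero.2 le_rfl

/-- The behaviour of relative lengths under a linear map. -/
lemma relLength_map (f : V →ₗ[R] V') {A B : Submodule R V} (h : B ≤ A) :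
    relLength A B = relLength (A.map f) (B.map f) +
      relLength (A ⊓ LinearMap.ker f) (B ⊓ LinearMap.ker f) := by
  let K := LinearMap.ker f
  let g : (↥(A ⊓ K) ⧸ (B ⊓ K).submoduleOf (A ⊓ K)) →ₗ[R] A ⧸ B.submoduleOf A :=
    Submodule.mapQ _ _ (Submodule.inclusion inf_le_left) (fun x hx => hx.1)
  let f' : (A ⧸ B.submoduleOf A) →ₗ[R] (A.map f) ⧸ (B.map f).submoduleOf (A.map f) :=
    Submodule.mapQ _ _ (f.submoduleMap A) (fun x hx => ⟨x, hx, rfl⟩)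
  have hg : Function.Injective g := by
    rw [injective_iff_map_eq_zero]
    intro x hx
    obtain ⟨x, rfl⟩ := Submodule.Quotient.mk_surjective _ x
    have hx' : x.1 ∈ B := (Submodule.Quotient.mk_eq_zero (B.submoduleOf A)).1 hx
    exact (Submodule.Quotient.mk_eq_zero _).2 ⟨hx', x.2.2⟩
  have hf' : Function.Surjective f' := by
    intro y
    obtain ⟨⟨_, x, hx, rfl⟩, rfl⟩ := Submodule.Quotient.mk_surjective _ y
    exact ⟨Submodule.Quotient.mk ⟨x, hx⟩, rfl⟩
  have he : Function.Exact g f' := by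
    intro x
    obtain ⟨x, rfl⟩ := Submodule.Quotient.mk_surjective _ x
    refine (Submodule.Quotient.mk_eq_zero _).trans ?_
    constructor
    · rintro ⟨b, hb, hbx⟩
      have hbx' : f b = f x := hbx
      refine ⟨Submodule.Quotient.mk ⟨x - b, A.sub_mem x.2 (h hb), ?_⟩, ?_⟩
      · refine LinearMap.mem_ker.2 ?_
        rw [map_sub, hbx', sub_self]
      · refine (Submodule.Quotient.eq _).2 ?_
        change (x - b - x : V) ∈ B
        simpa using hb
    · rintro ⟨z, hz⟩
      obtain ⟨z, rfl⟩ := Submodule.Quotient.mk_surjective _ z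
      have h1 : (z : V) - x ∈ B := (Submodule.Quotient.eq (B.submoduleOf A)).1 hz
      refine ⟨x - z, ?_, ?_⟩
      · rw [← neg_sub]; exact B.neg_mem h1
      · rw [map_sub, LinearMap.mem_ker.1 z.2.2, sub_zero]; rfl
  rw [relLength, Module.length_eq_add_of_exact g f' hg hf' he, add_comm]

lemma relLength_trans {A B C : Submodule R V} (h1 : C ≤ B) (h2 : B ≤ A) :
    relLength A C = relLength A B + relLength B C := by
  let g : (B ⧸ C.submoduleOf B) →ₗ[R] A ⧸ C.submoduleOf A :=
    Submodule.mapQ _ _ (Submodule.inclusion h2) (fun x hx => hx)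
  let f : (A ⧸ C.submoduleOf A) →ₗ[R] A ⧸ B.submoduleOf A :=
    Submodule.factor (fun x hx => h1 hx)
  have hg : Function.Injective g := by
    rw [injective_iff_map_eq_zero]
    intro x hx
    obtain ⟨x, rfl⟩ := Submodule.Quotient.mk_surjective _ x
    have hx' : x.1 ∈ C := (Submodule.Quotient.mk_eq_zero (C.submoduleOf A)).1 hx
    exact (Submodule.Quotient.mk_eq_zero _).2 hx'
  have hf : Function.Surjective f := Submodule.factor_surjective _
  have he : Function.Exact g f := by
    intro x
    obtain ⟨x, rfl⟩ := Submodule.Quotient.mk_surjective _ x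
    have : f (Submodule.Quotient.mk x) = Submodule.Quotient.mk x := rfl
    rw [this, Submodule.Quotient.mk_eq_zero]
    constructor
    · intro hb
      exact ⟨Submodule.Quotient.mk ⟨x, hb⟩, rfl⟩
    · rintro ⟨z, hz⟩
      obtain ⟨z, rfl⟩ := Submodule.Quotient.mk_surjective _ z
      have h3 : (z : V) - x ∈ C := (Submodule.Quotient.eq (C.submoduleOf A)).1 hz
      have := B.sub_mem z.2 (h1 h3)
      rwa [sub_sub_cancel] at this
  rw [relLength, Module.length_eq_add_of_exact g f hg hf he, add_comm]

lemma relLength_mono_left {A A' : Submodule R V} (h : A ≤ A') (B : Submodule R V) :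
    relLength A B ≤ relLength A' B := by
  refine Module.length_le_of_injective (Submodule.mapQ _ _ (Submodule.inclusion h)
    (fun x hx => hx)) ?_
  rw [injective_iff_map_eq_zero]
  intro x hx
  obtain ⟨x, rfl⟩ := Submodule.Quotient.mk_surjective _ x
  have hx' : x.1 ∈ B := (Submodule.Quotient.mk_eq_zero (B.submoduleOf A')).1 hx
  exact (Submodule.Quotient.mk_eq_zero _).2 hx'

lemma relLength_anti_right (A : Submodule R V) {B B' : Submodule R V} (h : B ≤ B') :
    relLength A B' ≤ relLength A B :=
  Module.length_le_of_surjective (Submodule.factor (fun _ hx => h hx))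
    (Submodule.factor_surjective _)

/-- Submodules whose intersection has finite colength in both. -/
def Commensurable (A B : Submodule R V) : Prop := relLength A B ≠ ⊤ ∧ relLength B A ≠ ⊤

/-- The index `[A : B]` of commensurable submodules. -/
def idx (A B : Submodule R V) : ℤ := ((relLength A B).toNat : ℤ) - ((relLength B A).toNat : ℤ)

namespace Commensurable

variable {A B C : Submodule R V}

lemma symm (h : Commensurable A B) : Commensurable B A := ⟨h.2, h.1⟩

lemma relLength_inf_ne_top (h : Commensurable A B) (h' : Commensurable B C) :
    relLength A (A ⊓ B ⊓ C) ≠ ⊤ := by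
  rw [relLength_trans (B := A ⊓ B) inf_le_left inf_le_left, relLength_inf]
  have h2 : relLength (A ⊓ B) (A ⊓ B ⊓ C) ≠ ⊤ := by
    rw [relLength_inf]
    exact ne_top_of_le_ne_top h'.1 (relLength_mono_left inf_le_right C)
  exact enat_add_ne_top.2 ⟨h.1, h2⟩

lemma trans (h : Commensurable A B) (h' : Commensurable B C) : Commensurable A C := by
  refine ⟨ne_top_of_le_ne_top (h.relLength_inf_ne_top h')
    (relLength_anti_right A inf_le_right), ne_top_of_le_ne_top
      (h'.symm.relLength_inf_ne_top h.symm) (relLength_anti_right C inf_le_right)⟩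

end Commensurable

/-- Any common submodule of finite colength computes the index, not only the intersection. This
freedom makes additivity of the index formal. -/
lemma idx_eq_sub {A B D : Submodule R V} (hA : D ≤ A) (hB : D ≤ B) (hA' : relLength A D ≠ ⊤)
    (hB' : relLength B D ≠ ⊤) :
    idx A B = ((relLength A D).toNat : ℤ) - ((relLength B D).toNat : ℤ) := by
  have h1 := relLength_trans (le_inf hA hB) (inf_le_left : A ⊓ B ≤ A)
  have h2 := relLength_trans (le_inf hA hB) (inf_le_right : A ⊓ B ≤ B)
  rw [relLength_inf] at h1
  rw [inf_comm A B, relLength_inf, inf_comm B A] at h2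
  rw [h1, enat_add_ne_top] at hA'
  rw [h2, enat_add_ne_top] at hB'
  rw [h1, h2, ENat.toNat_add hA'.1 hA'.2, ENat.toNat_add hB'.1 hB'.2, idx]
  push_cast
  ring

lemma idx_self (A : Submodule R V) : idx A A = 0 := sub_self _

lemma idx_symm (A B : Submodule R V) : idx A B = -idx B A := (neg_sub _ _).symm

lemma idx_of_le {A B : Submodule R V} (h : B ≤ A) : idx A B = ((relLength A B).toNat : ℤ) := by
  rw [idx, relLength_eq_zero.2 h]; simp

lemma idx_add {A B C : Submodule R V} (h : Commensurable A B) (h' : Commensurable B C) :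
    idx A B + idx B C = idx A C := by
  have hA := h.relLength_inf_ne_top h'
  have hC := h'.symm.relLength_inf_ne_top h.symm
  have e : C ⊓ B ⊓ A = A ⊓ B ⊓ C := by rw [inf_comm C B, inf_assoc, inf_comm C A, ← inf_assoc,
    inf_comm B A]
  rw [e] at hC
  have hB : relLength B (A ⊓ B ⊓ C) ≠ ⊤ := by
    have := h.symm.relLength_inf_ne_top (h.trans h')
    rwa [inf_comm B A] at this
  -- All three indices are measured against `A ⊓ B ⊓ C`.
  rw [idx_eq_sub (inf_le_left.trans inf_le_left) (inf_le_left.trans inf_le_right) hA hB,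
    idx_eq_sub (inf_le_left.trans inf_le_right) inf_le_right hB hC,
    idx_eq_sub (inf_le_left.trans inf_le_left) inf_le_right hA hC]
  ring

variable (f : V →ₗ[R] V')

lemma relLength_map_ne_top {A B : Submodule R V} (h : relLength A B ≠ ⊤) :
    relLength (A.map f) (B.map f) ≠ ⊤ := by
  rw [← relLength_inf, relLength_map f inf_le_left, enat_add_ne_top] at h
  exact ne_top_of_le_ne_top h.1 (relLength_anti_right _ (Submodule.map_mono inf_le_right))

lemma relLength_inf_ker_ne_top {A B : Submodule R V} (h : relLength A B ≠ ⊤) :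
    relLength (A ⊓ LinearMap.ker f) (B ⊓ LinearMap.ker f) ≠ ⊤ := by
  rw [← relLength_inf, relLength_map f inf_le_left, enat_add_ne_top] at h
  exact ne_top_of_le_ne_top h.2 (relLength_anti_right _ (inf_le_inf_right _ inf_le_right))

lemma Commensurable.map {A B : Submodule R V} (h : Commensurable A B) :
    Commensurable (A.map f) (B.map f) :=
  ⟨relLength_map_ne_top f h.1, relLength_map_ne_top f h.2⟩

lemma Commensurable.inf_ker {A B : Submodule R V} (h : Commensurable A B) :
    Commensurable (A ⊓ LinearMap.ker f) (B ⊓ LinearMap.ker f) :=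
  ⟨relLength_inf_ker_ne_top f h.1, relLength_inf_ker_ne_top f h.2⟩

lemma idx_map {A B : Submodule R V} (h : Commensurable A B) :
    idx A B = idx (A.map f) (B.map f) + idx (A ⊓ LinearMap.ker f) (B ⊓ LinearMap.ker f) := by
  have hA : relLength A (A ⊓ B) ≠ ⊤ := by rw [relLength_inf]; exact h.1
  have hB : relLength B (A ⊓ B) ≠ ⊤ := by rw [inf_comm, relLength_inf]; exact h.2
  have hA' := hA
  have hB' := hB
  rw [relLength_map f inf_le_left, enat_add_ne_top] at hA'
  rw [relLength_map f inf_le_right, enat_add_ne_top] at hB'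
  -- The image of `A ⊓ B` may be smaller than the intersection of the images, but it is a common
  -- submodule of finite colength, which is all that is needed.
  rw [idx_eq_sub inf_le_left inf_le_right hA hB,
    idx_eq_sub (Submodule.map_mono inf_le_left) (Submodule.map_mono inf_le_right) hA'.1 hB'.1,
    idx_eq_sub (inf_le_inf_right _ inf_le_left) (inf_le_inf_right _ inf_le_right) hA'.2 hB'.2,
    relLength_map f (inf_le_left : A ⊓ B ≤ A), relLength_map f (inf_le_right : A ⊓ B ≤ B),
    ENat.toNat_add hA'.1 hA'.2, ENat.toNat_add hB'.1 hB'.2]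
  push_cast
  ring

variable {f} in
lemma relLength_map_of_injective (hf : Function.Injective f) (A B : Submodule R V) :
    relLength (A.map f) (B.map f) = relLength A B := by
  have h := relLength_map f (inf_le_left : A ⊓ B ≤ A)
  rw [LinearMap.ker_eq_bot.2 hf, inf_bot_eq, inf_bot_eq, relLength_self, add_zero,
    Submodule.map_inf f hf, relLength_inf, relLength_inf] at h
  exact h.symm

variable {f} in
lemma idx_map_of_injective (hf : Function.Injective f) {A B : Submodule R V} :
    idx (A.map f) (B.map f) = idx A B := by
  rw [idx, idx, relLength_map_of_injective hf, relLength_map_of_injective hf]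

variable {f} in
lemma commensurable_map_of_injective (hf : Function.Injective f) {A B : Submodule R V} :
    Commensurable (A.map f) (B.map f) ↔ Commensurable A B := by
  rw [Commensurable, relLength_map_of_injective hf, relLength_map_of_injective hf, Commensurable]

/-- Maps with the same kernel have the same effect on indices. -/
lemma idx_map_eq_of_ker_eq {V'' : Type*} [AddCommGroup V''] [Module R V''] (g : V →ₗ[R] V'')
    (hfg : LinearMap.ker f = LinearMap.ker g) {A B : Submodule R V} (h : Commensurable A B) :
    idx (A.map f) (B.map f) = idx (A.map g) (B.map g) := by
  have h1 := idx_map f h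
  have h2 := idx_map g h
  rw [hfg] at h1
  linarith

/-- The contribution of one step of a filtration. -/
lemma length_ker_add_idx_range {M M' G : Type*} [AddCommGroup M] [Module R M] [AddCommGroup M']
    [Module R M'] [AddCommGroup G] [Module R G] (g : M →ₗ[R] V) (hg : Function.Injective g)
    (p : M →ₗ[R] M') (hp : Function.Surjective p) (π : V →ₗ[R] G) (h : M' →ₗ[R] G)
    (hc : ∀ m, h (p m) = π (g m)) (B : Submodule R V) (hB : Commensurable (LinearMap.range g) B)
    (hB' : Commensurable ((LinearMap.ker p).map g) (B ⊓ LinearMap.ker π)) :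
    ((Module.length R (LinearMap.ker h)).toNat : ℤ) + idx (LinearMap.range h) (B.map π) =
      idx (LinearMap.range g) B - idx ((LinearMap.ker p).map g) (B ⊓ LinearMap.ker π) := by
  have h1 : LinearMap.range h = (LinearMap.range g).map π := by
    ext x
    constructor
    · rintro ⟨y, rfl⟩
      obtain ⟨m, rfl⟩ := hp y
      exact ⟨g m, ⟨m, rfl⟩, (hc m).symm⟩
    · rintro ⟨_, ⟨m, rfl⟩, rfl⟩
      exact ⟨p m, hc m⟩
  have hle : (LinearMap.ker p).map g ≤ LinearMap.range g ⊓ LinearMap.ker π := by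
    rintro _ ⟨x, hx, rfl⟩
    refine ⟨⟨x, rfl⟩, LinearMap.mem_ker.2 ?_⟩
    rw [← hc, LinearMap.mem_ker.1 hx, map_zero]
  -- The kernel of `h` is the image under `p` of `g ⁻¹ (ker π)`, so it is the quotient of `range g ⊓
  -- ker π` by `g (ker p)`. The torsion term thus fills the gap left by the kernel part of the
  -- index.
  have h2 : Module.length R (LinearMap.ker h) =
      relLength (LinearMap.range g ⊓ LinearMap.ker π) ((LinearMap.ker p).map g) := by
    let K := (LinearMap.ker π).comap g
    let q : K →ₗ[R] LinearMap.ker h := p.restrict fun m hm => LinearMap.mem_ker.2 (by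
      rw [hc]; exact hm)
    have hq : LinearMap.ker q = (LinearMap.ker p).submoduleOf K := by
      ext x
      rw [LinearMap.mem_ker, Subtype.ext_iff]
      exact Iff.rfl
    have hqs : Function.Surjective q := by
      rintro ⟨x, hx⟩
      obtain ⟨m, rfl⟩ := hp x
      exact ⟨⟨m, by rw [LinearMap.mem_ker, hc] at hx; exact hx⟩, rfl⟩
    rw [← (q.quotKerEquivOfSurjective hqs).length_eq, hq]
    have hle' : LinearMap.ker p ≤ K := fun m hm => (hle ⟨m, hm, rfl⟩).2
    have h3 := relLength_map g hle'
    rw [LinearMap.ker_eq_bot.2 hg, inf_bot_eq, inf_bot_eq, relLength_self, add_zero,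
      Submodule.map_comap_eq] at h3
    exact h3
  have h4 := idx_map π hB
  have h6 := idx_add ((hB.inf_ker π).trans hB'.symm) hB'
  rw [h1, h2, ← idx_of_le hle]
  linarith

end RelLength

/-! ### Reflexivity through lengths of duals -/

section Duality

variable {R : Type*} [CommRing R]

lemma length_le_add_of_ker_le {A B C : Type*} [AddCommGroup A] [Module R A] [AddCommGroup B]
    [Module R B] [AddCommGroup C] [Module R C] (g : A →ₗ[R] B) (f : B →ₗ[R] C)
    (h : LinearMap.ker f ≤ LinearMap.range g) :
    Module.length R B ≤ Module.length R A + Module.length R C := by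
  rw [Module.length_eq_add_of_exact (LinearMap.ker f).subtype f.rangeRestrict
    (Submodule.subtype_injective _) f.surjective_rangeRestrict (by
      intro x
      simp [← LinearMap.mem_ker])]
  refine add_le_add ?_ (Module.length_le_of_injective _ (Submodule.subtype_injective _))
  exact (Module.length_le_of_injective _ (Submodule.inclusion_injective h)).trans
    (Module.length_le_of_surjective _ g.surjective_rangeRestrict)

/-- A map from a simple module is determined by the image of one generator, and that image lies in
the socle, which is a quotient of the residue field. -/
lemma length_hom_le_of_isSimpleModule [IsLocalRing R] {E : Type*} [AddCommGroup E] [Module R E]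
    (e₀ : E) (h₀ : ∀ r ∈ IsLocalRing.maximalIdeal R, r • e₀ = 0)
    (h : ∀ e : E, (∀ r ∈ IsLocalRing.maximalIdeal R, r • e = 0) → e ∈ Submodule.span R {e₀})
    (S : Type*) [AddCommGroup S] [Module R S] [IsSimpleModule R S] :
    Module.length R (S →ₗ[R] E) ≤ 1 := by
  have := IsSimpleModule.nontrivial R S
  obtain ⟨x, hx⟩ := exists_ne (0 : S)
  · have hspan : ∀ y : S, ∃ r : R, r • x = y := fun y => by
      have := IsSimpleModule.span_singleton_eq_top R hx
      exact Submodule.mem_span_singleton.1 (this ▸ Submodule.mem_top)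
    have hm : ∀ r ∈ IsLocalRing.maximalIdeal R, r • x = 0 := by
      have hmax := IsSimpleModule.ker_toSpanSingleton_isMaximal R hx
      rw [IsLocalRing.eq_maximalIdeal hmax |>.symm]
      intro r hr
      exact hr
    let g : (S →ₗ[R] E) →ₗ[R] E := LinearMap.applyₗ x
    have hg : Function.Injective g := by
      rw [injective_iff_map_eq_zero]
      intro φ hφ
      ext y
      obtain ⟨r, rfl⟩ := hspan y
      have : φ x = 0 := hφ
      rw [map_smul, this, smul_zero, LinearMap.zero_apply]
    have hr : LinearMap.range g ≤ Submodule.span R {e₀} := by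
      rintro _ ⟨φ, rfl⟩
      refine h _ fun r hr => ?_
      change r • φ x = 0
      rw [← map_smul, hm r hr, map_zero]
    let f : (R ⧸ IsLocalRing.maximalIdeal R) →ₗ[R] Submodule.span R {e₀} :=
      Submodule.liftQ _ (LinearMap.toSpanSingleton R _ ⟨e₀, Submodule.mem_span_singleton_self e₀⟩)
        (fun r hr => Subtype.ext (h₀ r hr))
    have hf : Function.Surjective f := by
      rintro ⟨y, hy⟩
      obtain ⟨r, rfl⟩ := Submodule.mem_span_singleton.1 hy
      exact ⟨Submodule.Quotient.mk r, rfl⟩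
    have : IsSimpleModule R (R ⧸ IsLocalRing.maximalIdeal R) :=
      isSimpleModule_iff_isCoatom.2 (IsLocalRing.maximalIdeal.isMaximal R).out
    calc Module.length R (S →ₗ[R] E) ≤ Module.length R (Submodule.span R {e₀}) :=
          Module.length_le_of_injective (g.codRestrict _ fun φ => hr ⟨φ, rfl⟩)
            (fun a b hab => hg (congrArg Subtype.val hab))
      _ ≤ Module.length R (R ⧸ IsLocalRing.maximalIdeal R) :=
          Module.length_le_of_surjective f hf
      _ = 1 := Module.length_eq_one R _

/-- If the socle of `E` is simple, then `Hom(-, E)` does not increase lengths. -/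
lemma length_hom_le [IsLocalRing R] {E : Type*} [AddCommGroup E] [Module R E]
    (e₀ : E) (h₀ : ∀ r ∈ IsLocalRing.maximalIdeal R, r • e₀ = 0)
    (h : ∀ e : E, (∀ r ∈ IsLocalRing.maximalIdeal R, r • e = 0) → e ∈ Submodule.span R {e₀})
    (T : Type*) [AddCommGroup T] [Module R T] (hT : IsFiniteLength R T) :
    Module.length R (T →ₗ[R] E) ≤ Module.length R T := by
  induction hT with
  | of_subsingleton =>
    rename_i M _ _ _
    have : Subsingleton (M →ₗ[R] E) := ⟨fun a b => by ext x; simp [Subsingleton.elim x 0]⟩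
    rw [Module.length_eq_zero]
    exact zero_le
  | of_simple_quotient _ ih =>
    rename_i M _ _ N _ _
    calc Module.length R (M →ₗ[R] E)
        ≤ Module.length R ((M ⧸ N) →ₗ[R] E) + Module.length R (N →ₗ[R] E) :=
          length_le_add_of_ker_le (LinearMap.lcomp R E N.mkQ) (LinearMap.lcomp R E N.subtype) (by
            intro φ hφ
            refine ⟨N.liftQ φ fun x hx => ?_, by ext; rfl⟩
            exact congr($hφ ⟨x, hx⟩))
      _ ≤ 1 + Module.length R N := add_le_add (length_hom_le_of_isSimpleModule e₀ h₀ h _) ih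
      _ = Module.length R M := by
          rw [Module.length_eq_add_of_exact N.subtype N.mkQ N.subtype_injective N.mkQ_surjective
            (LinearMap.exact_subtype_mkQ N), Module.length_eq_one R (M ⧸ N), add_comm]

/-- The cokernel of the dual of an injection `g` embeds into `Hom(coker g, R / s)`. -/
lemma length_coker_dualMap_le (s : R) (hs : ∀ r, s * r = 0 → r = 0)
    {P A : Type*} [AddCommGroup P] [Module R P] [AddCommGroup A] [Module R A] (g : P →ₗ[R] A)
    (hg : Function.Injective g) (hsA : ∀ a, ∃ p, g p = s • a) :
    Module.length R (Module.Dual R P ⧸ LinearMap.range g.dualMap) ≤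
      Module.length R ((A ⧸ LinearMap.range g) →ₗ[R] (R ⧸ Ideal.span {s})) := by
  choose c hc using hsA
  -- Since `s A` lies in the image of `g`, multiplication by `s` factors through a map `σ : A → P`.
  let σ : A →ₗ[R] P :=
    { toFun := c
      map_add' := fun a b => hg (by rw [hc, map_add, hc, hc, smul_add])
      map_smul' := fun r a => hg (by rw [hc, RingHom.id_apply, map_smul, hc, smul_comm]) }
  have hσ : ∀ p, σ (g p) = s • p := fun p => hg (by rw [map_smul]; exact hc _)
  let Ψ : Module.Dual R P →ₗ[R] (A ⧸ LinearMap.range g) →ₗ[R] (R ⧸ Ideal.span {s}) :=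
    { toFun := fun h => (LinearMap.range g).liftQ ((Ideal.span {s}).mkQ ∘ₗ h ∘ₗ σ) (by
        rintro _ ⟨p, rfl⟩
        refine (Submodule.Quotient.mk_eq_zero _).2 ?_
        change h (σ (g p)) ∈ Ideal.span {s}
        rw [hσ, map_smul]
        exact Ideal.mul_mem_right _ _ (Ideal.mem_span_singleton_self s))
      map_add' := fun h h' => by ext; rfl
      map_smul' := fun r h => by ext; rfl }
  -- If `h ∘ σ` takes values in the ideal of `s`, dividing it by the regular element `s` gives a
  -- functional on `A` that extends `h`.
  have hker : LinearMap.ker Ψ ≤ LinearMap.range g.dualMap := by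
    intro h hh
    have h1 : ∀ a, ∃ r, s * r = h (σ a) := by
      intro a
      have h2 : Ψ h (Submodule.Quotient.mk a) = 0 := by rw [LinearMap.mem_ker.1 hh]; rfl
      have h3 : h (σ a) ∈ Ideal.span {s} := (Submodule.Quotient.mk_eq_zero _).1 h2
      obtain ⟨r, hr⟩ := Ideal.mem_span_singleton'.1 h3
      exact ⟨r, by rw [mul_comm, hr]⟩
    choose d hd using h1
    have hs' : ∀ a b, s * a = s * b → a = b := fun a b hab =>
      sub_eq_zero.1 (hs _ (by rw [mul_sub, hab, sub_self]))
    refine ⟨{ toFun := d, map_add' := fun a b => hs' _ _ ?_, map_smul' := fun r a => hs' _ _ ?_ }, ?_⟩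
    · rw [hd, mul_add, hd, hd, map_add, map_add]
    · rw [hd, map_smul, map_smul, RingHom.id_apply, smul_eq_mul, smul_eq_mul, ← hd]; ring
    · ext p
      refine hs' _ _ ?_
      change s * d (g p) = _
      rw [hd, hσ, map_smul, smul_eq_mul]
  let q : (Module.Dual R P ⧸ LinearMap.ker Ψ) →ₗ[R]
    (Module.Dual R P ⧸ LinearMap.range g.dualMap) := Submodule.factor hker
  calc _ ≤ Module.length R (Module.Dual R P ⧸ LinearMap.ker Ψ) :=
        Module.length_le_of_surjective q (Submodule.factor_surjective hker)
    _ = Module.length R (LinearMap.range Ψ) := Ψ.quotKerEquivRange.length_eq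
    _ ≤ _ := Module.length_le_of_injective _ (Submodule.subtype_injective _)

/-- A torsionless module is reflexive if it contains a submodule of finite colength that is,
provided that `R / s` has simple socle. -/
theorem eval_surjective_of_submodule [IsLocalRing R] (s : R) (hs : ∀ r, s * r = 0 → r = 0)
    (e₀ : R ⧸ Ideal.span {s}) (h₀ : ∀ r ∈ IsLocalRing.maximalIdeal R, r • e₀ = 0)
    (hsoc : ∀ e : R ⧸ Ideal.span {s}, (∀ r ∈ IsLocalRing.maximalIdeal R, r • e = 0) →
      e ∈ Submodule.span R {e₀})
    {A : Type*} [AddCommGroup A] [Module R A] (J : Submodule R A) (hsA : ∀ a : A, s • a ∈ J)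
    (hfin : IsFiniteLength R (A ⧸ J)) (hJ : Function.Surjective (Module.Dual.eval R J))
    (hA : Function.Injective (Module.Dual.eval R A)) :
    Function.Surjective (Module.Dual.eval R A) := by
  -- Dualizing `J ⊆ A` twice does not increase the colength `ℓ`, because `Hom(-, R / s)` does not
  -- increase lengths. As `J` equals its double dual, the copy of `J` has colength at most `ℓ` in
  -- the double dual of `A`, and exactly `ℓ` in `A`; so `A` is the whole double dual.
  let ℓ := Module.length R (A ⧸ J)
  have hℓ : ℓ ≠ ⊤ := Module.length_ne_top_iff.2 hfin
  let g := J.subtype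
  have hr : LinearMap.range g = J := J.range_subtype
  have h1 : Module.length R (Module.Dual R J ⧸ LinearMap.range g.dualMap) ≤ ℓ := by
    have := length_coker_dualMap_le s hs g J.subtype_injective fun a => ⟨⟨s • a, hsA a⟩, rfl⟩
    refine this.trans ?_
    rw [hr]
    exact length_hom_le e₀ h₀ hsoc _ hfin
  have hfin1 : IsFiniteLength R (Module.Dual R J ⧸ LinearMap.range g.dualMap) :=
    Module.length_ne_top_iff.1 (ne_top_of_le_ne_top hℓ h1)
  have hinj : Function.Injective g.dualMap := by
    rw [injective_iff_map_eq_zero]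
    intro h hh
    ext a
    refine hs _ ?_
    have : h (s • a) = 0 := congr($hh ⟨s • a, hsA a⟩)
    rwa [map_smul] at this
  have h2 : Module.length R (Module.Dual R (Module.Dual R A) ⧸
      LinearMap.range g.dualMap.dualMap) ≤ ℓ := by
    have := length_coker_dualMap_le s hs g.dualMap hinj fun h => by
      refine ⟨{ toFun := fun a => h ⟨s • a, hsA a⟩, map_add' := ?_, map_smul' := ?_ }, ?_⟩
      · intro a b
        rw [← map_add]
        congr 1
        exact Subtype.ext (smul_add _ _ _)
      · intro r a
        rw [RingHom.id_apply, ← map_smul]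
        congr 1
        exact Subtype.ext (smul_comm _ _ _)
      · ext a
        exact h.map_smul s a
    exact (this.trans (length_hom_le e₀ h₀ hsoc _ hfin1)).trans h1
  have hW : LinearMap.range g.dualMap.dualMap = J.map (Module.Dual.eval R A) := by
    ext x
    constructor
    · rintro ⟨y, rfl⟩
      obtain ⟨j, rfl⟩ := hJ y
      exact ⟨j, j.2, rfl⟩
    · rintro ⟨j, hj, rfl⟩
      exact ⟨Module.Dual.eval R J ⟨j, hj⟩, rfl⟩
  rw [hW] at h2
  let ev := Module.Dual.eval R A
  have h3 : relLength (⊤ : Submodule R (Module.Dual R (Module.Dual R A))) (J.map ev) ≤ ℓ := by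
    refine le_trans (Module.length_le_of_injective (Submodule.mapQ _ (J.map ev)
      (Submodule.subtype ⊤) fun x hx => hx) ?_) h2
    rw [injective_iff_map_eq_zero]
    intro x hx
    obtain ⟨x, rfl⟩ := Submodule.Quotient.mk_surjective _ x
    exact (Submodule.Quotient.mk_eq_zero _).2 ((Submodule.Quotient.mk_eq_zero (J.map ev)).1 hx)
  have h4 : relLength (LinearMap.range ev) (J.map ev) = ℓ := by
    have h5 := relLength_map ev (le_top : J ≤ ⊤)
    rw [LinearMap.ker_eq_bot.2 hA, inf_bot_eq, inf_bot_eq, relLength_self, add_zero,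
      Submodule.map_top] at h5
    rw [← h5]
    refine LinearEquiv.length_eq (Submodule.Quotient.equiv _ _ Submodule.topEquiv ?_)
    ext x
    constructor
    · rintro ⟨y, hy, rfl⟩; exact hy
    · intro hx; exact ⟨⟨x, trivial⟩, hx, rfl⟩
  rw [relLength_trans (LinearMap.map_le_range) le_top, h4] at h3
  have h6 : relLength (⊤ : Submodule R (Module.Dual R (Module.Dual R A))) (LinearMap.range ev) = 0 := by
    by_contra h
    have h7 : ℓ < relLength (⊤ : Submodule R (Module.Dual R (Module.Dual R A))) (LinearMap.range ev) + ℓ := by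
      exact ENat.lt_add_left hℓ (pos_iff_ne_zero.2 h)
    exact absurd h3 (not_le.2 h7)
  exact LinearMap.range_eq_top.1 (top_le_iff.1 (relLength_eq_zero.1 h6))

end Duality

/-! ### Rings with principal prime nilradical -/

/-- Rings in which the nilradical is a principal prime ideal, with generator `y` of nilpotency
order `n`, and the elements outside the nilradical are nonzerodivisors. -/
structure IsMultipleRing (R : Type*) [CommRing R] (n : ℕ) (y : R) : Prop where
  nilradical_eq : nilradical R = Ideal.span {y}
  pow_eq_zero : y ^ n = 0
  pow_ne_zero : y ^ (n - 1) ≠ 0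
  pos : 0 < n
  isPrime : (nilradical R).IsPrime
  eq_zero_of_mul_eq_zero : ∀ s ∉ nilradical R, ∀ r, s * r = 0 → r = 0

/-- Local rings of primitive multiple curves at closed points: the maximal ideal is generated by
`t` and by the generator `y` of the nilradical. -/
structure IsMultipleLocalRing (R : Type*) [CommRing R] [IsLocalRing R] (n : ℕ) (t y : R) : Prop
    extends IsMultipleRing R n y where
  noetherian : IsNoetherianRing R
  maximalIdeal_eq : IsLocalRing.maximalIdeal R = Ideal.span {t, y}
  notMem : t ∉ nilradical R

namespace IsMultipleRing

variable {R : Type*} [CommRing R] {n : ℕ} {y : R}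

lemma mem_nilradical_iff (h : IsMultipleRing R n y) {r : R} :
    r ∈ nilradical R ↔ ∃ c, r = y * c := by
  rw [h.nilradical_eq, Ideal.mem_span_singleton]
  exact Iff.rfl

lemma exists_eq_pow_mul (h : IsMultipleRing R n y) (r : R) :
    r = 0 ∨ ∃ k < n, ∃ v ∉ nilradical R, r = y ^ k * v := by
  have key : ∀ j ≤ n, (∃ k < j, ∃ v ∉ nilradical R, r = y ^ k * v) ∨ ∃ v, r = y ^ j * v := by
    intro j
    induction j with
    | zero => exact fun _ => .inr ⟨r, by simp⟩
    | succ j ih =>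
      intro hj
      rcases ih (by omega) with ⟨k, hk, v, hv, hr⟩ | ⟨v, hr⟩
      · exact .inl ⟨k, by omega, v, hv, hr⟩
      · by_cases hv : v ∈ nilradical R
        · obtain ⟨c, rfl⟩ := h.mem_nilradical_iff.1 hv
          exact .inr ⟨c, by rw [hr]; ring⟩
        · exact .inl ⟨j, by omega, v, hv, hr⟩
  rcases key n le_rfl with h1 | ⟨v, hv⟩
  · exact .inr h1
  · exact .inl (by rw [hv, h.pow_eq_zero, zero_mul])

/-- Write `r = y ^ k * v` with `v` regular; then `y ^ (j + k) = 0`, and the nilpotency order of `y`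
forces `n ≤ j + k`. -/
lemma pow_mul_eq_zero (h : IsMultipleRing R n y) {j : ℕ} (hj : j ≤ n) {r : R}
    (hr : y ^ j * r = 0) : ∃ c, r = y ^ (n - j) * c := by
  rcases h.exists_eq_pow_mul r with rfl | ⟨k, hk, v, hv, rfl⟩
  · exact ⟨0, by simp⟩
  · have h1 : y ^ (j + k) = 0 := h.eq_zero_of_mul_eq_zero v hv _ (by rw [← hr]; ring)
    have h2 : n ≤ j + k := by
      by_contra h3
      refine h.pow_ne_zero ?_
      have : n - 1 = (j + k) + (n - 1 - (j + k)) := by omega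
      rw [this, pow_add, h1, zero_mul]
    refine ⟨y ^ (j + k - n) * v, ?_⟩
    have : k = n - j + (j + k - n) := by omega
    rw [← mul_assoc, ← pow_add, ← this]

end IsMultipleRing

/-! ### Local rings at closed points: finite length, socle, reflexivity -/

namespace IsMultipleLocalRing

variable {R : Type*} [CommRing R] [IsLocalRing R] {n : ℕ} {t y : R}

/-- A prime `p` containing `s` but not `t` would satisfy `p ≤ N + t p`, since the maximal ideal is
`(t, y)`. Nakayama then gives `p ≤ N`, which contradicts `s ∉ N`. So `t` lies in the radical of
`(s)`. -/
lemma exists_pow_mem (h : IsMultipleLocalRing R n t y) {s : R} (hs : s ∉ nilradical R) :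
    ∃ (a : ℕ) (c : R), t ^ a = s * c := by
  have : IsNoetherianRing R := h.noetherian
  have key : t ∈ (Ideal.span {s}).radical := by
    rw [Ideal.radical_eq_sInf, Submodule.mem_sInf]
    rintro p ⟨hsp, hp⟩
    by_contra ht
    have hN : nilradical R ≤ p := nilradical_le_prime p
    have hle : p ≤ nilradical R ⊔ Ideal.span {t} * p := by
      intro x hx
      have hxm : x ∈ IsLocalRing.maximalIdeal R :=
        (IsLocalRing.le_maximalIdeal hp.ne_top) hx
      rw [h.maximalIdeal_eq, Ideal.mem_span_pair] at hxm
      obtain ⟨a, b, rfl⟩ := hxm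
      have hb : b * y ∈ nilradical R := by
        rw [h.nilradical_eq]; exact Ideal.mul_mem_left _ _ (Ideal.mem_span_singleton_self y)
      have ha : a ∈ p := by
        have : a * t ∈ p := by
          have := p.sub_mem hx (hN hb)
          rwa [add_sub_cancel_right] at this
        exact (hp.mem_or_mem this).resolve_right ht
      rw [add_comm]
      refine Submodule.add_mem_sup hb ?_
      rw [mul_comm a t]
      exact Ideal.mul_mem_mul (Ideal.mem_span_singleton_self t) ha
    have htm : Ideal.span {t} ≤ Ideal.jacobson ⊥ := by
      rw [IsLocalRing.jacobson_eq_maximalIdeal ⊥ bot_ne_top, Ideal.span_singleton_le_iff_mem,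
        h.maximalIdeal_eq]
      exact Ideal.subset_span (by simp)
    have := Submodule.le_of_le_smul_of_le_jacobson_bot (I := Ideal.span {t}) (N := nilradical R)
      (N' := p) ((isNoetherianRing_iff_ideal_fg R).1 ‹_› p) htm hle
    exact hs (this (hsp (Ideal.mem_span_singleton_self s)))
  obtain ⟨a, ha⟩ := key
  obtain ⟨c, hc⟩ := Ideal.mem_span_singleton.1 ha
  exact ⟨a, c, hc⟩

lemma pow_notMem (h : IsMultipleLocalRing R n t y) (a : ℕ) : t ^ a ∉ nilradical R := fun h1 =>
  h.notMem (h.isPrime.mem_of_pow_mem a h1)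

/-- A prime containing `s` contains `t`, because `s` divides a power of `t`, and it contains the
nilpotent `y`; hence it is maximal. -/
lemma isArtinianRing_quotient (h : IsMultipleLocalRing R n t y) {s : R} (hs : s ∉ nilradical R) :
    IsArtinianRing (R ⧸ Ideal.span {s}) := by
  have : IsNoetherianRing R := h.noetherian
  have : Ring.KrullDimLE 0 (R ⧸ Ideal.span {s}) := by
    refine Ring.KrullDimLE.mk₀ fun p hp => ?_
    have hp' := hp.comap (Ideal.Quotient.mk (Ideal.span {s}))
    have hsp : s ∈ p.comap (Ideal.Quotient.mk (Ideal.span {s})) := by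
      rw [Ideal.mem_comap, Ideal.Quotient.eq_zero_iff_mem.2 (Ideal.mem_span_singleton_self s)]
      exact p.zero_mem
    have hm : p.comap (Ideal.Quotient.mk (Ideal.span {s})) = IsLocalRing.maximalIdeal R := by
      refine le_antisymm (IsLocalRing.le_maximalIdeal hp'.ne_top) ?_
      rw [h.maximalIdeal_eq, Ideal.span_le]
      rintro _ (rfl | rfl)
      · obtain ⟨a, c, hc⟩ := h.exists_pow_mem hs
        exact hp'.mem_of_pow_mem a (hc ▸ Ideal.mul_mem_right _ _ hsp)
      · exact hp'.mem_of_pow_mem n (h.pow_eq_zero ▸ Ideal.zero_mem _)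
    have := Ideal.map_comap_of_surjective _ Ideal.Quotient.mk_surjective p
    rw [← this, hm]
    refine Or.resolve_left (Ideal.map_eq_top_or_isMaximal_of_surjective _
      Ideal.Quotient.mk_surjective (IsLocalRing.maximalIdeal.isMaximal R)) fun h2 => ?_
    rw [← hm, this] at h2
    exact hp.ne_top h2
  exact IsNoetherianRing.isArtinianRing_of_krullDimLE_zero

lemma isFiniteLength (h : IsMultipleLocalRing R n t y) {s : R} (hs : s ∉ nilradical R)
    (M : Type*) [AddCommGroup M] [Module R M] [Module.Finite R M] (hM : ∀ m : M, s • m = 0) :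
    IsFiniteLength R M := by
  have : IsNoetherianRing R := h.noetherian
  have := h.isArtinianRing_quotient hs
  have htor : Module.IsTorsionBySet R M (Ideal.span {s}) := by
    rw [← Module.isTorsionBySet_iff_is_torsion_by_span]
    rintro m ⟨_, rfl⟩
    exact hM m
  let _ : Module (R ⧸ Ideal.span {s}) M := htor.module
  have : IsScalarTower R (R ⧸ Ideal.span {s}) M := htor.isScalarTower
  have : Module.Finite (R ⧸ Ideal.span {s}) M := Module.Finite.of_restrictScalars_finite R _ M
  rw [← Module.length_ne_top_iff,
    Module.length_eq_of_surjective (R := R ⧸ Ideal.span {s}) (S := R) Ideal.Quotient.mk_surjective]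
  exact Module.length_ne_top

/-- The socle of `R / t ^ a` is simple. -/
lemma exists_socle (h : IsMultipleLocalRing R n t y) (a : ℕ) :
    ∃ e₀ : R ⧸ Ideal.span {t ^ a}, (∀ r ∈ IsLocalRing.maximalIdeal R, r • e₀ = 0) ∧
      ∀ e : R ⧸ Ideal.span {t ^ a}, (∀ r ∈ IsLocalRing.maximalIdeal R, r • e = 0) →
        e ∈ Submodule.span R {e₀} := by
  have ht : t ∈ IsLocalRing.maximalIdeal R := by
    rw [h.maximalIdeal_eq]; exact Ideal.subset_span (by simp)
  have hy : y ∈ IsLocalRing.maximalIdeal R := by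
    rw [h.maximalIdeal_eq]; exact Ideal.subset_span (by simp)
  have hmk : ∀ x : R, (Ideal.Quotient.mk (Ideal.span {t ^ a}) x = 0 ↔ ∃ c, x = t ^ a * c) := by
    intro x
    rw [Ideal.Quotient.eq_zero_iff_mem, Ideal.mem_span_singleton]
    exact Iff.rfl
  cases a with
  | zero =>
    refine ⟨0, by simp, fun e _ => ?_⟩
    obtain ⟨e, rfl⟩ := Ideal.Quotient.mk_surjective e
    rw [(hmk e).2 ⟨e, by simp⟩]
    exact zero_mem _
  | succ a =>
    -- This element is killed by `t` modulo `t ^ (a + 1)`, and by `y` because `y ^ n = 0`.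
    refine ⟨Ideal.Quotient.mk _ (t ^ a * y ^ (n - 1)), ?_, ?_⟩
    · intro r hr
      rw [h.maximalIdeal_eq, Ideal.mem_span_pair] at hr
      obtain ⟨b, c, rfl⟩ := hr
      change Ideal.Quotient.mk _ ((b * t + c * y) * (t ^ a * y ^ (n - 1))) = 0
      refine (hmk _).2 ⟨b * y ^ (n - 1), ?_⟩
      have : y * y ^ (n - 1) = 0 := by
        rw [← pow_succ', Nat.sub_add_cancel h.pos, h.pow_eq_zero]
      linear_combination c * t ^ a * this
    · intro e he
      obtain ⟨e, rfl⟩ := Ideal.Quotient.mk_surjective e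
      obtain ⟨c, hc⟩ := (hmk _).1 (he t ht)
      obtain ⟨d, hd⟩ := (hmk _).1 (he y hy)
      have hreg := h.eq_zero_of_mul_eq_zero
      -- If `t` and `y` kill the class of `e`, then `e = t ^ a c` with `y c = t d`. Here `d` must be
      -- nilpotent, `d = y d'`, so `y (c - t d') = 0` and `c` lies in `(t, y ^ (n - 1))`.
      have h1 : e = t ^ a * c := sub_eq_zero.1 (hreg t h.notMem _ (by
        have : t * e = t ^ (a + 1) * c := hc
        rw [mul_sub, this]; ring))
      have h2 : y * c = t * d := sub_eq_zero.1 (hreg _ (h.pow_notMem a) _ (by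
        have : y * e = t ^ (a + 1) * d := hd
        rw [h1] at this
        linear_combination this))
      have h3 : d ∈ nilradical R := by
        refine (h.isPrime.mem_or_mem (?_ : t * d ∈ _)).resolve_left h.notMem
        rw [← h2]
        exact h.mem_nilradical_iff.2 ⟨c, rfl⟩
      obtain ⟨d', rfl⟩ := h.mem_nilradical_iff.1 h3
      obtain ⟨b, hb⟩ := h.pow_mul_eq_zero (j := 1) h.pos (r := c - t * d') (by
        linear_combination h2)
      refine Submodule.mem_span_singleton.2 ⟨b, ?_⟩
      change Ideal.Quotient.mk _ (b * (t ^ a * y ^ (n - 1))) = _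
      rw [← sub_eq_zero, ← map_sub]
      refine (hmk _).2 ⟨-d', ?_⟩
      rw [h1]
      linear_combination (-t ^ a) * hb

/-- Torsionless modules containing a copy of `R / y ^ k` of finite colength are reflexive. -/
theorem eval_surjective (h : IsMultipleLocalRing R n t y) {M : Type*} [AddCommGroup M] [Module R M]
    [Module.Finite R M] (hM : Function.Injective (Module.Dual.eval R M)) {k : ℕ} (hk : k ≤ n) (e : M)
    (he : ∀ r : R, r • e = 0 ↔ ∃ c, r = y ^ k * c) {s : R} (hs : s ∉ nilradical R)
    (hse : ∀ m : M, ∃ r : R, s • m = r • e) : Function.Surjective (Module.Dual.eval R M) := by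
  -- The multiplier `s` is replaced by a power of `t`, because the socle of `R / t ^ a` is known to
  -- be simple.
  obtain ⟨a, c, hac⟩ := h.exists_pow_mem hs
  obtain ⟨e₀, h₀, hsoc⟩ := h.exists_socle a
  have hta : ∀ m : M, t ^ a • m ∈ Submodule.span R {e} := by
    intro m
    obtain ⟨r, hr⟩ := hse m
    rw [hac, mul_comm, mul_smul, hr]
    exact Submodule.smul_mem _ _ (Submodule.smul_mem _ _ (Submodule.mem_span_singleton_self e))
  refine eval_surjective_of_submodule (t ^ a) (h.eq_zero_of_mul_eq_zero _ (h.pow_notMem a)) e₀ h₀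
    hsoc (Submodule.span R {e}) hta ?_ ?_ hM
  · refine h.isFiniteLength (h.pow_notMem a) _ fun m => ?_
    obtain ⟨m, rfl⟩ := Submodule.Quotient.mk_surjective _ m
    exact (Submodule.Quotient.mk_eq_zero _).2 (hta m)
  · intro g
    let e' : Submodule.span R {e} := ⟨e, Submodule.mem_span_singleton_self e⟩
    have hspan : ∀ x : Submodule.span R {e}, ∃ r : R, r • e' = x := fun ⟨x, hx⟩ => by
      obtain ⟨r, rfl⟩ := Submodule.mem_span_singleton.1 hx
      exact ⟨r, rfl⟩
    choose ρ hρ using hspan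
    have hdiff : ∀ r r' : R, r • e' = r' • e' → ∃ c, r = r' + y ^ k * c := by
      intro r r' hrr
      obtain ⟨c, hc⟩ := (he (r - r')).1 (by
        rw [sub_smul, sub_eq_zero]; exact congrArg Subtype.val hrr)
      exact ⟨c, by rw [← hc]; ring⟩
    have hyy : y ^ k * y ^ (n - k) = 0 := by
      rw [← pow_add, Nat.add_sub_cancel' hk, h.pow_eq_zero]
    -- The dual of `R e ≅ R / y ^ k` is again cyclic, generated by `e ↦ y ^ (n - k)`, and is killed
    -- by `y ^ k`. Evaluation at the multiples of `e` therefore exhausts the double dual.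
    let φ₀ : Module.Dual R (Submodule.span R {e}) :=
      { toFun := fun x => ρ x * y ^ (n - k)
        map_add' := fun x z => by
          obtain ⟨c, hc⟩ := hdiff (ρ (x + z)) (ρ x + ρ z) (by rw [add_smul, hρ, hρ, hρ])
          rw [hc]
          linear_combination c * hyy
        map_smul' := fun r x => by
          obtain ⟨c, hc⟩ := hdiff (ρ (r • x)) (r * ρ x) (by rw [mul_smul, hρ, hρ])
          rw [hc, RingHom.id_apply, smul_eq_mul]
          linear_combination c * hyy }
    have hφ₀ : ∀ r : R, φ₀ (r • e') = r * y ^ (n - k) := by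
      intro r
      obtain ⟨c, hc⟩ := hdiff (ρ (r • e')) r (hρ _)
      change ρ (r • e') * _ = _
      rw [hc]
      linear_combination c * hyy
    have hgen : ∀ φ : Module.Dual R (Submodule.span R {e}), ∃ r : R, φ = r • φ₀ := by
      intro φ
      have h1 : y ^ k * φ e' = 0 := by
        rw [← smul_eq_mul, ← map_smul]
        have : y ^ k • e' = 0 := Subtype.ext ((he _).2 ⟨1, by simp⟩)
        rw [this, map_zero]
      obtain ⟨r, hr⟩ := h.pow_mul_eq_zero hk h1
      refine ⟨r, ?_⟩
      ext x
      rw [← hρ x, map_smul, hr, LinearMap.smul_apply, hφ₀, smul_eq_mul, smul_eq_mul]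
      ring
    have h2 : y ^ k * g φ₀ = 0 := by
      rw [← smul_eq_mul, ← map_smul]
      have : y ^ k • φ₀ = 0 := by
        ext x
        rw [← hρ x, LinearMap.smul_apply, hφ₀, smul_eq_mul]
        simp only [LinearMap.zero_apply]
        linear_combination (ρ x) * hyy
      rw [this, map_zero]
    obtain ⟨r, hr⟩ := h.pow_mul_eq_zero hk h2
    refine ⟨r • e', ?_⟩
    ext φ
    obtain ⟨q, rfl⟩ := hgen φ
    rw [g.map_smul, hr]
    change (q • φ₀) (r • e') = _
    rw [LinearMap.smul_apply, hφ₀, smul_eq_mul, smul_eq_mul]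
    ring

end IsMultipleLocalRing

/-! ### Localization at the nilradical, and lattices in the generic fibre -/

section Pair

/-- The properties of the localization of a ring at its nilradical (assumed to be prime). -/
structure IsGenericLocalization (R Q : Type*) [CommRing R] [CommRing Q] [Algebra R Q] : Prop where
  isUnit : ∀ s ∉ nilradical R, IsUnit (algebraMap R Q s)
  exists_mul_eq : ∀ q : Q, ∃ s ∉ nilradical R, ∃ r, algebraMap R Q s * q = algebraMap R Q r
  injective : Function.Injective (algebraMap R Q)

variable {R Q : Type*} [CommRing R] [CommRing Q] [Algebra R Q] {n : ℕ} {y : R}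

namespace IsMultipleRing

lemma mul_notMem (h : IsMultipleRing R n y) {s s' : R} (hs : s ∉ nilradical R)
    (hs' : s' ∉ nilradical R) : s * s' ∉ nilradical R := fun hm =>
  (h.isPrime.mem_or_mem hm).elim hs hs'

lemma algebraMap_mem_nilradical (hQ : IsGenericLocalization R Q) {r : R} :
    algebraMap R Q r ∈ nilradical Q ↔ r ∈ nilradical R := by
  rw [mem_nilradical, mem_nilradical, IsNilpotent.map_iff hQ.injective]

lemma exists_eq_mul_of_mem (h : IsMultipleRing R n y) (hQ : IsGenericLocalization R Q) {q : Q}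
    (hq : q ∈ nilradical Q) : ∃ c, q = algebraMap R Q y * c := by
  obtain ⟨s, hs, r, hr⟩ := hQ.exists_mul_eq q
  have hr' : r ∈ nilradical R := by
    rw [← algebraMap_mem_nilradical hQ, ← hr]; exact Ideal.mul_mem_left _ _ hq
  obtain ⟨c, rfl⟩ := h.mem_nilradical_iff.1 hr'
  obtain ⟨v, hv⟩ := hQ.isUnit s hs
  refine ⟨↑v⁻¹ * algebraMap R Q c, ?_⟩
  rw [← hv, map_mul] at hr
  calc q = ↑v⁻¹ * (↑v * q) := by rw [← mul_assoc, Units.inv_mul, one_mul]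
    _ = _ := by rw [hr]; ring

lemma isUnit_of_notMem (hQ : IsGenericLocalization R Q) {q : Q} (hq : q ∉ nilradical Q) :
    IsUnit q := by
  obtain ⟨s, hs, r, hr⟩ := hQ.exists_mul_eq q
  have hr' : r ∉ nilradical R := by
    intro h
    apply hq
    rw [← algebraMap_mem_nilradical hQ, ← hr] at h
    obtain ⟨v, hv⟩ := hQ.isUnit s hs
    have := Ideal.mul_mem_left _ (↑v⁻¹ : Q) h
    rwa [← hv, ← mul_assoc, Units.inv_mul, one_mul] at this
  exact isUnit_of_mul_isUnit_right (hr ▸ hQ.isUnit r hr')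

lemma generic (h : IsMultipleRing R n y) (hQ : IsGenericLocalization R Q) :
    IsMultipleRing Q n (algebraMap R Q y) where
  nilradical_eq := by
    refine le_antisymm (fun q hq => ?_) ?_
    · obtain ⟨c, rfl⟩ := h.exists_eq_mul_of_mem hQ hq
      exact Ideal.mul_mem_right _ _ (Ideal.mem_span_singleton_self _)
    · rw [Ideal.span_singleton_le_iff_mem, algebraMap_mem_nilradical hQ]
      exact h.mem_nilradical_iff.2 ⟨1, by simp⟩
  pow_eq_zero := by rw [← map_pow, h.pow_eq_zero, map_zero]
  pow_ne_zero := by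
    rw [← map_pow, Ne, map_eq_zero_iff _ hQ.injective]
    exact h.pow_ne_zero
  pos := h.pos
  isPrime := by
    refine ⟨?_, fun {a b} hab => ?_⟩
    · rw [Ideal.ne_top_iff_one, ← map_one (algebraMap R Q), algebraMap_mem_nilradical hQ]
      exact (Ideal.ne_top_iff_one _).1 h.isPrime.ne_top
    · by_contra! hn
      have h1 := (isUnit_of_notMem hQ hn.1).mul (isUnit_of_notMem hQ hn.2)
      have := (nilradical Q).eq_top_of_isUnit_mem hab h1
      rw [Ideal.eq_top_iff_one, ← map_one (algebraMap R Q), algebraMap_mem_nilradical hQ] at this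
      exact (Ideal.ne_top_iff_one _).1 h.isPrime.ne_top this
  eq_zero_of_mul_eq_zero := fun s hs r hr => (isUnit_of_notMem hQ hs).mul_right_eq_zero.1 hr

/-- In both rings the ideal of `y ^ k` is the annihilator of `y ^ (n - k)`, and being annihilated
can be tested after the injection into `Q`. -/
lemma exists_eq_pow_mul_of_algebraMap (h : IsMultipleRing R n y) (hQ : IsGenericLocalization R Q)
    {k : ℕ} (hk : k ≤ n) {r : R} {q : Q} (hr : algebraMap R Q r = algebraMap R Q y ^ k * q) :
    ∃ c, r = y ^ k * c := by
  have h1 : y ^ (n - k) * r = 0 := by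
    apply hQ.injective
    rw [map_mul, map_pow, map_zero, hr, ← mul_assoc, ← pow_add, Nat.sub_add_cancel hk,
      ← map_pow, h.pow_eq_zero, map_zero, zero_mul]
  obtain ⟨c, hc⟩ := h.pow_mul_eq_zero (Nat.sub_le n k) h1
  rw [Nat.sub_sub_self hk] at hc
  exact ⟨c, hc⟩

/-- Two generators of the nilradical differ by a unit. -/
lemma exists_unit_mul_eq {Q : Type*} [CommRing Q] {g g' : Q} (h : IsMultipleRing Q n g)
    (hu : ∀ q ∉ nilradical Q, IsUnit q) (h' : nilradical Q = Ideal.span {g'}) :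
    ∃ v : Qˣ, g' = v * g := by
  obtain ⟨a, ha⟩ := h.mem_nilradical_iff.1 (h'.symm ▸ Ideal.mem_span_singleton_self g')
  obtain ⟨b, hb⟩ := Ideal.mem_span_singleton.1 (h' ▸ h.mem_nilradical_iff.2 ⟨1, (mul_one g).symm⟩)
  by_cases ha' : a ∈ nilradical Q
  · obtain ⟨c, rfl⟩ := h.mem_nilradical_iff.1 ha'
    have h1 : g = 0 := by
      have : IsUnit (1 - g * (c * b)) := hu _ fun hm => by
        have h2 : g * (c * b) ∈ nilradical Q := h.mem_nilradical_iff.2 ⟨_, rfl⟩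
        have := add_mem hm h2
        rw [sub_add_cancel] at this
        exact (Ideal.ne_top_iff_one _).1 h.isPrime.ne_top this
      refine this.mul_right_eq_zero.1 ?_
      rw [ha] at hb
      linear_combination hb
    refine ⟨1, ?_⟩
    rw [ha, h1]; simp
  · obtain ⟨v, rfl⟩ := hu a ha'
    exact ⟨v, by rw [ha, mul_comm]⟩

end IsMultipleRing

variable {V : Type*} [AddCommGroup V] [Module Q V] [Module R V] [IsScalarTower R Q V]

lemma exists_smul_mem_of_mem_span (h : IsMultipleRing R n y) (hQ : IsGenericLocalization R Q)
    (B : Submodule R V) {v : V} (hv : v ∈ Submodule.span Q (B : Set V)) :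
    ∃ s ∉ nilradical R, s • v ∈ B := by
  have h1 : (1 : R) ∉ nilradical R := (Ideal.ne_top_iff_one _).1 h.isPrime.ne_top
  induction hv using Submodule.span_induction with
  | mem x hx => exact ⟨1, h1, by rwa [one_smul]⟩
  | zero => exact ⟨1, h1, by simp⟩
  | add x z _ _ hx hz =>
    obtain ⟨s, hs, hx⟩ := hx
    obtain ⟨s', hs', hz⟩ := hz
    refine ⟨s * s', h.mul_notMem hs hs', ?_⟩
    rw [smul_add]
    refine B.add_mem ?_ ?_
    · rw [mul_comm, mul_smul]; exact B.smul_mem _ hx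
    · rw [mul_smul]; exact B.smul_mem _ hz
  | smul q x _ hx =>
    obtain ⟨s, hs, hx⟩ := hx
    obtain ⟨s', hs', r, hr⟩ := hQ.exists_mul_eq q
    refine ⟨s * s', h.mul_notMem hs hs', ?_⟩
    have : (s * s') • q • x = r • s • x := by
      rw [← algebraMap_smul Q (s * s'), ← algebraMap_smul Q r, ← algebraMap_smul Q s, smul_smul,
        smul_smul, map_mul, ← hr]
      congr 1
      ring
    rw [this]
    exact B.smul_mem _ hx

lemma exists_smul_le_of_fg (h : IsMultipleRing R n y) (hQ : IsGenericLocalization R Q)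
    (A B : Submodule R V) (hA : A.FG) (hB : Submodule.span Q (B : Set V) = ⊤) :
    ∃ s ∉ nilradical R, ∀ a ∈ A, s • a ∈ B := by
  refine Submodule.fg_induction (motive := fun A _ => ∃ s ∉ nilradical R, ∀ a ∈ A, s • a ∈ B)
    ?_ ?_ A hA
  · intro v
    obtain ⟨s, hs, hv⟩ := exists_smul_mem_of_mem_span h hQ B (v := v) (by rw [hB]; trivial)
    refine ⟨s, hs, fun a ha => ?_⟩
    obtain ⟨r, rfl⟩ := Submodule.mem_span_singleton.1 ha
    rw [smul_comm]
    exact B.smul_mem _ hv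
  · rintro A₁ A₂ _ _ ⟨s, hs, h1⟩ ⟨s', hs', h2⟩
    refine ⟨s * s', h.mul_notMem hs hs', fun a ha => ?_⟩
    obtain ⟨x, hx, z, hz, rfl⟩ := Submodule.mem_sup.1 ha
    rw [smul_add]
    refine B.add_mem ?_ ?_
    · rw [mul_comm, mul_smul]; exact B.smul_mem _ (h1 x hx)
    · rw [mul_smul]; exact B.smul_mem _ (h2 z hz)

/-- A common denominator `s` of finitely many generators kills `A / (A ⊓ B)`, which is then a finite
module over the Artinian ring `R / s`. -/
lemma relLength_ne_top_of_fg [IsLocalRing R] {t : R} (h : IsMultipleLocalRing R n t y)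
    (hQ : IsGenericLocalization R Q) (A B : Submodule R V) (hA : A.FG)
    (hB : Submodule.span Q (B : Set V) = ⊤) : relLength A B ≠ ⊤ := by
  obtain ⟨s, hs, hsA⟩ := exists_smul_le_of_fg h.toIsMultipleRing hQ A B hA hB
  have : Module.Finite R A := Module.Finite.iff_fg.2 hA
  refine Module.length_ne_top_iff.2 (h.isFiniteLength hs _ fun m => ?_)
  obtain ⟨m, rfl⟩ := Submodule.Quotient.mk_surjective _ m
  exact (Submodule.Quotient.mk_eq_zero (B.submoduleOf A)).2 (hsA m m.2)

/-- Finitely generated submodules that generate the generic fibre. -/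
structure IsLattice (Q : Type*) [CommRing Q] [Algebra R Q] {V : Type*} [AddCommGroup V] [Module Q V]
    [Module R V] (A : Submodule R V) : Prop where
  fg : A.FG
  span_eq_top : Submodule.span Q (A : Set V) = ⊤

lemma IsLattice.commensurable [IsLocalRing R] {t : R} (h : IsMultipleLocalRing R n t y)
    (hQ : IsGenericLocalization R Q) {A B : Submodule R V} (hA : IsLattice Q A)
    (hB : IsLattice Q B) : Commensurable A B :=
  ⟨relLength_ne_top_of_fg h hQ A B hA.fg hB.span_eq_top,
    relLength_ne_top_of_fg h hQ B A hB.fg hA.span_eq_top⟩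

/-- The vector `e` generates `V`, with annihilator `nilradical Q ^ m`. -/
structure IsGenerator (Q : Type*) [CommRing Q] {V : Type*} [AddCommGroup V] [Module Q V] (m : ℕ)
    (e : V) : Prop where
  exists_smul_eq : ∀ v : V, ∃ q : Q, q • e = v
  smul_eq_zero_iff : ∀ q : Q, q • e = 0 ↔ q ∈ nilradical Q ^ m

lemma IsGenerator.unit_smul {m : ℕ} {e : V} (he : IsGenerator Q m e) (v : Qˣ) :
    IsGenerator Q m (v • e) where
  exists_smul_eq x := by
    obtain ⟨q, hq⟩ := he.exists_smul_eq x
    exact ⟨q * ↑v⁻¹, by rw [mul_smul, Units.smul_def v, smul_smul (↑v⁻¹ : Q), Units.inv_mul,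
      one_smul, hq]⟩
  smul_eq_zero_iff q := by
    rw [Units.smul_def, smul_smul, he.smul_eq_zero_iff]
    refine ⟨fun h => ?_, fun h => Ideal.mul_mem_right _ _ h⟩
    have := Ideal.mul_mem_right (↑v⁻¹ : Q) _ h
    rwa [mul_assoc, Units.mul_inv, mul_one] at this

lemma IsGenerator.isLattice {m : ℕ} {e : V} (he : IsGenerator Q m e) :
    IsLattice Q (Submodule.span R {e}) where
  fg := Submodule.fg_span_singleton e
  span_eq_top := by
    rw [eq_top_iff]
    intro v _
    obtain ⟨q, rfl⟩ := he.exists_smul_eq v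
    exact Submodule.smul_mem _ _ (Submodule.subset_span (Submodule.mem_span_singleton_self e))

lemma mem_nilradical_pow_iff {Q : Type*} [CommRing Q] {g : Q} (h : nilradical Q = Ideal.span {g})
    {k : ℕ} {q : Q} : q ∈ nilradical Q ^ k ↔ ∃ c, q = g ^ k * c := by
  rw [h, Ideal.span_singleton_pow, Ideal.mem_span_singleton]
  exact Iff.rfl

/-- Multiplication by `y ^ j`. -/
abbrev powSMul (V : Type*) [AddCommGroup V] [Module R V] (y : R) (j : ℕ) : V →ₗ[R] V :=
  LinearMap.lsmul R V (y ^ j)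

/-- This rests on `y ^ j Q ∩ R = y ^ j R`. It is the local reason why all indices vanish wherever
the lattice is generated by one element. -/
lemma span_singleton_inf_range_powSMul (h : IsMultipleRing R n y) (hQ : IsGenericLocalization R Q)
    {m : ℕ} (hm : m ≤ n) {e : V} (he : IsGenerator Q m e) {j : ℕ} (hj : j ≤ m) :
    Submodule.span R {e} ⊓ LinearMap.range (powSMul V y j) =
      (Submodule.span R {e}).map (powSMul V y j) := by
  refine le_antisymm ?_ (le_inf ?_ LinearMap.map_le_range)
  · rintro _ ⟨h1, v, rfl⟩
    obtain ⟨r, hr⟩ := Submodule.mem_span_singleton.1 h1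
    obtain ⟨q, rfl⟩ := he.exists_smul_eq v
    have hg := h.generic hQ
    have h2 : (algebraMap R Q r - algebraMap R Q y ^ j * q) • e = 0 := by
      rw [sub_smul, algebraMap_smul, hr, mul_smul, ← map_pow, algebraMap_smul]
      exact sub_self _
    obtain ⟨c, hc⟩ := (mem_nilradical_pow_iff hg.nilradical_eq).1 ((he.smul_eq_zero_iff _).1 h2)
    obtain ⟨d, rfl⟩ := h.exists_eq_pow_mul_of_algebraMap hQ (hj.trans hm) (r := r)
      (q := q + algebraMap R Q y ^ (m - j) * c) (by
        have : m = j + (m - j) := by omega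
        rw [this, pow_add] at hc
        linear_combination hc)
    rw [← hr]
    exact ⟨d • e, Submodule.smul_mem _ _ (Submodule.mem_span_singleton_self e), by
      rw [mul_smul]; rfl⟩
  · rintro _ ⟨x, hx, rfl⟩
    exact Submodule.smul_mem _ _ hx

lemma map_powSMul_inf_range (h : IsMultipleRing R n y) (hQ : IsGenericLocalization R Q)
    {m : ℕ} (hm : m ≤ n) {e : V} (he : IsGenerator Q m e) {j : ℕ} (hj : j < m) :
    (Submodule.span R {e}).map (powSMul V y j) ⊓ LinearMap.range (powSMul V y (j + 1)) =
      (Submodule.span R {e}).map (powSMul V y (j + 1)) := by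
  rw [← span_singleton_inf_range_powSMul h hQ hm he hj,
    ← span_singleton_inf_range_powSMul h hQ hm he hj.le, inf_assoc]
  congr 1
  refine inf_eq_right.2 ?_
  rintro _ ⟨v, rfl⟩
  exact ⟨y • v, by simp [smul_smul, pow_succ, mul_comm]⟩

end Pair

/-! ### The local degree of a graded piece as a difference of indices -/

section LocalDegree

variable {R Q : Type u} [CommRing R] [CommRing Q] [Algebra R Q]

/-- The `R`-module structure built inside `localDegree` is the only one compatible with the scalar
tower, so any given one may be used instead. -/
lemma localDegree_eq {M V : Type u} [AddCommGroup M] [Module R M] [AddCommGroup V] [Module Q V]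
    [i1 : Module R V] [IsScalarTower R Q V] (φ : M →ₛₗ[algebraMap R Q] V) (φ' : M →ₗ[R] V)
    (h : ∀ m, φ' m = φ m) {ι : Type*} (b : ι → V) :
    localDegree φ b = ((Module.length R (LinearMap.ker φ')).toNat : ℤ) +
      idx (LinearMap.range φ') (Submodule.span R (Set.range b)) := by
  have hi : i1 = Module.compHom V (algebraMap R Q) :=
    Module.ext' _ _ fun r v => (algebraMap_smul Q r v).symm
  subst hi
  let _ : Module R V := Module.compHom V (algebraMap R Q)
  have hφ : φ' = { toFun := φ, map_add' := map_add φ, map_smul' := φ.map_smulₛₗ } :=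
    LinearMap.ext h
  rw [hφ, localDegree, idx, add_sub_assoc]

variable {n : ℕ} {y : R}

lemma nilFiltration_eq_range {R M : Type u} [CommRing R] [AddCommGroup M] [Module R M] {y : R}
    (hy : nilradical R = Ideal.span {y}) (j : ℕ) :
    nilFiltration R M j = LinearMap.range (powSMul M y j) := by
  rw [nilFiltration, hy, Ideal.span_singleton_pow, Submodule.ideal_span_singleton_smul]
  ext x
  rw [Submodule.mem_smul_pointwise_iff_exists]
  simp

lemma mem_nilFiltration_iff {R M : Type u} [CommRing R] [AddCommGroup M] [Module R M] {y : R}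
    (hy : nilradical R = Ideal.span {y}) {j : ℕ} {m : M} :
    m ∈ nilFiltration R M j ↔ ∃ m', y ^ j • m' = m := by
  rw [nilFiltration_eq_range hy]
  exact Iff.rfl

lemma mem_smul_top_nilFiltration_iff {R M : Type u} [CommRing R] [AddCommGroup M] [Module R M]
    {y : R} (hy : nilradical R = Ideal.span {y}) {j : ℕ} {m : nilFiltration R M j} :
    m ∈ nilradical R • (⊤ : Submodule R (nilFiltration R M j)) ↔
      ∃ m', y ^ (j + 1) • m' = (m : M) := by
  rw [hy, Submodule.ideal_span_singleton_smul, Submodule.mem_smul_pointwise_iff_exists]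
  constructor
  · rintro ⟨⟨z, hz⟩, -, rfl⟩
    obtain ⟨m', rfl⟩ := (mem_nilFiltration_iff hy).1 hz
    exact ⟨m', by rw [pow_succ', mul_smul]; rfl⟩
  · rintro ⟨m', hm'⟩
    refine ⟨⟨y ^ j • m', (mem_nilFiltration_iff hy).2 ⟨m', rfl⟩⟩, trivial, Subtype.ext ?_⟩
    rw [← hm', pow_succ', mul_smul]
    rfl

variable {V : Type u} [AddCommGroup V] [Module Q V] [Module R V] [IsScalarTower R Q V]

/-- The projection of `N ^ j V` to `G_j(V)`, linear over the base ring. -/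
def grProj (R : Type u) {Q : Type u} [CommRing R] [CommRing Q] [Algebra R Q] (V : Type u)
    [AddCommGroup V] [Module Q V] [Module R V] [IsScalarTower R Q V] (j : ℕ) :
    nilFiltration Q V j →ₗ[R] GrPiece Q V j :=
  (Submodule.mkQ (nilradical Q • (⊤ : Submodule Q (nilFiltration Q V j)))).restrictScalars R

lemma map_subtype_comap_of_le {P : Submodule Q V} {B : Submodule R V}
    (h : ∀ b ∈ B, b ∈ P) :
    (B.comap (P.subtype.restrictScalars R)).map (P.subtype.restrictScalars R) = B := by
  refine le_antisymm (Submodule.map_comap_le _ _) fun b hb => ⟨⟨b, h b hb⟩, hb, rfl⟩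

/-- The local degree of a graded piece of a lattice, relative to the frame given by a power of a
generator of the nilradical. -/
lemma localDegree_grMap_add (hR : nilradical R = Ideal.span {y})
    (hQ : nilradical Q = Ideal.span {algebraMap R Q y})
    {M : Type u} [AddCommGroup M] [Module R M] (φ : M →ₛₗ[algebraMap R Q] V) (φ' : M →ₗ[R] V)
    (h : ∀ m, φ' m = φ m) (hφ : Function.Injective φ') (j : ℕ) {ι : Type*} (b : ι → GrPiece Q V j)
    (B : Submodule R V) (hB : B ≤ LinearMap.range (powSMul V y j))
    (hc : Commensurable ((LinearMap.range φ').map (powSMul V y j)) B)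
    (hc' : Commensurable ((LinearMap.range φ').map (powSMul V y (j + 1)))
      (B ⊓ LinearMap.range (powSMul V y (j + 1))))
    (B' : Submodule R (nilFiltration Q V j))
    (hB' : B' = B.comap ((nilFiltration Q V j).subtype.restrictScalars R))
    (hb : Commensurable (B'.map (grProj R V j)) (Submodule.span R (Set.range b))) :
    localDegree (grMap φ j) b = idx ((LinearMap.range φ').map (powSMul V y j)) B -
      idx ((LinearMap.range φ').map (powSMul V y (j + 1)))
        (B ⊓ LinearMap.range (powSMul V y (j + 1))) +
      idx (B'.map (grProj R V j)) (Submodule.span R (Set.range b)) := by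
  subst hB'
  -- The indices are first taken inside `N ^ j V`, where the projection to `G_j(V)` is defined, and
  -- then pushed into `V` along the injection `ι`, which does not change them.
  let ι := (nilFiltration Q V j).subtype.restrictScalars R
  have hι : Function.Injective ι := Subtype.val_injective
  let g : nilFiltration R M j →ₗ[R] nilFiltration Q V j :=
    { toFun := nilFiltrationMap φ j
      map_add' := map_add _
      map_smul' := fun r m => by
        rw [LinearMap.map_smulₛₗ, algebraMap_smul, RingHom.id_apply] }
  have hg : ∀ m, ι (g m) = φ' m := fun m => (h m).symm
  have hginj : Function.Injective g := fun a b hab => Subtype.ext (hφ (by rw [← hg, ← hg, hab]))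
  let ĝ : GrPiece R M j →ₗ[R] GrPiece Q V j :=
    { toFun := grMap φ j
      map_add' := map_add _
      map_smul' := fun r m => by
        rw [LinearMap.map_smulₛₗ, algebraMap_smul, RingHom.id_apply] }
  let p := Submodule.mkQ (nilradical R • (⊤ : Submodule R (nilFiltration R M j)))
  have hle : ∀ v ∈ B, v ∈ nilFiltration Q V j := by
    intro v hv
    obtain ⟨w, rfl⟩ := hB hv
    refine (mem_nilFiltration_iff hQ).2 ⟨w, ?_⟩
    rw [← map_pow, algebraMap_smul]; rfl
  have e1 : (LinearMap.range g).map ι = (LinearMap.range φ').map (powSMul V y j) := by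
    ext x
    constructor
    · rintro ⟨_, ⟨⟨m, hm⟩, rfl⟩, rfl⟩
      obtain ⟨m', rfl⟩ := (mem_nilFiltration_iff hR).1 hm
      exact ⟨φ' m', ⟨m', rfl⟩, by rw [hg]; exact (map_smul φ' _ _).symm⟩
    · rintro ⟨_, ⟨m', rfl⟩, rfl⟩
      refine ⟨_, ⟨⟨y ^ j • m', (mem_nilFiltration_iff hR).2 ⟨m', rfl⟩⟩, rfl⟩, ?_⟩
      rw [hg]; exact map_smul φ' _ _
  have e2 : ((LinearMap.ker p).map g).map ι =
      (LinearMap.range φ').map (powSMul V y (j + 1)) := by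
    rw [Submodule.ker_mkQ]
    ext x
    constructor
    · rintro ⟨_, ⟨m, hm, rfl⟩, rfl⟩
      obtain ⟨m', hm'⟩ := (mem_smul_top_nilFiltration_iff hR).1 hm
      exact ⟨φ' m', ⟨m', rfl⟩, by rw [hg, ← hm']; exact (map_smul φ' _ _).symm⟩
    · rintro ⟨_, ⟨m', rfl⟩, rfl⟩
      have hm : y ^ (j + 1) • m' ∈ nilFiltration R M j :=
        (mem_nilFiltration_iff hR).2 ⟨y • m', by rw [smul_smul, ← pow_succ]⟩
      refine ⟨_, ⟨⟨y ^ (j + 1) • m', hm⟩, (mem_smul_top_nilFiltration_iff hR).2 ⟨m', rfl⟩,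
        rfl⟩, ?_⟩
      rw [hg]; exact map_smul φ' _ _
  have e3 := map_subtype_comap_of_le hle
  have e4 : (B.comap ι ⊓ LinearMap.ker (grProj R V j)).map ι =
      B ⊓ LinearMap.range (powSMul V y (j + 1)) := by
    ext x
    have key : ∀ v : nilFiltration Q V j, grProj R V j v = 0 ↔
        (v : V) ∈ LinearMap.range (powSMul V y (j + 1)) := by
      intro v
      refine (Submodule.Quotient.mk_eq_zero _).trans
        ((mem_smul_top_nilFiltration_iff hQ).trans ?_)
      simp only [← map_pow, algebraMap_smul]
      exact Iff.rfl
    constructor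
    · rintro ⟨v, ⟨hv, hv'⟩, rfl⟩
      exact ⟨hv, (key v).1 hv'⟩
    · rintro ⟨hx, hx'⟩
      exact ⟨⟨x, hle x hx⟩, ⟨hx, (key _).2 hx'⟩, rfl⟩
  have hC : Commensurable (LinearMap.range g) (B.comap ι) := by
    rw [← commensurable_map_of_injective hι, e1, e3]; exact hc
  have hC' : Commensurable ((LinearMap.ker p).map g) (B.comap ι ⊓ LinearMap.ker (grProj R V j)) := by
    rw [← commensurable_map_of_injective hι, e2, e4]; exact hc'
  have hcomm : ∀ m, ĝ (p m) = grProj R V j (g m) := fun m => rfl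
  have hs := length_ker_add_idx_range g hginj p (Submodule.mkQ_surjective _) (grProj R V j)
    ĝ hcomm (B.comap ι) hC hC'
  rw [← idx_map_of_injective hι, ← idx_map_of_injective hι (A := Submodule.map g _), e1, e2, e3,
    e4] at hs
  have hr : LinearMap.range ĝ = (LinearMap.range g).map (grProj R V j) := by
    ext x
    constructor
    · rintro ⟨z, rfl⟩
      obtain ⟨m, rfl⟩ := Submodule.mkQ_surjective _ z
      exact ⟨g m, ⟨m, rfl⟩, (hcomm m).symm⟩
    · rintro ⟨_, ⟨m, rfl⟩, rfl⟩
      exact ⟨p m, hcomm m⟩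
  have hadd := idx_add (A := LinearMap.range ĝ) (by rw [hr]; exact hC.map _) hb
  rw [localDegree_eq (grMap φ j) ĝ (fun _ => rfl), ← hs, ← hadd]
  ring

end LocalDegree

/-! ### Orders of elements of the residue field of the generic point -/

section Residue

/-- The residue field of the localization at the nilradical. -/
abbrev ResidueField (Q : Type*) [CommRing Q] : Type _ := Q ⧸ nilradical Q

variable (R : Type*) {Q : Type*} [CommRing R] [CommRing Q] [Algebra R Q]

/-- The submodule generated by an element of the residue field, over the base ring. -/
abbrev cyc (c : ResidueField Q) : Submodule R (ResidueField Q) := Submodule.span R {c}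

/-- The order of an element of the residue field. -/
def ordAt (c : ResidueField Q) : ℤ := idx (cyc R (1 : ResidueField Q)) (cyc R c)

lemma cyc_mul (a b : ResidueField Q) : cyc R (a * b) = (cyc R b).map (LinearMap.mulLeft R a) := by
  rw [cyc, cyc, Submodule.map_span, Set.image_singleton]
  rfl

variable {n : ℕ} {g : Q}

lemma isGenerator_residue (hg : IsMultipleRing Q n g) (hu : ∀ q ∉ nilradical Q, IsUnit q)
    {c : ResidueField Q} (hc : c ≠ 0) : IsGenerator Q 1 c := by
  obtain ⟨c, rfl⟩ := Ideal.Quotient.mk_surjective c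
  have hc' : c ∉ nilradical Q := fun h => hc (Ideal.Quotient.eq_zero_iff_mem.2 h)
  obtain ⟨v, rfl⟩ := hu c hc'
  constructor
  · intro x
    obtain ⟨x, rfl⟩ := Ideal.Quotient.mk_surjective x
    refine ⟨x * ↑v⁻¹, ?_⟩
    change Ideal.Quotient.mk _ (x * ↑v⁻¹ * v) = _
    rw [mul_assoc, Units.inv_mul, mul_one]
  · intro q
    rw [pow_one]
    refine Ideal.Quotient.eq_zero_iff_mem.trans ⟨fun h => ?_, fun h => Ideal.mul_mem_right _ _ h⟩
    exact (hg.isPrime.mem_or_mem (show q * v ∈ nilradical Q from h)).resolve_right hc'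

variable {R} [IsLocalRing R] {t y : R}

lemma cyc_commensurable (h : IsMultipleLocalRing R n t y) (hQ : IsGenericLocalization R Q)
    {b c : ResidueField Q} (hb : b ≠ 0) (hc : c ≠ 0) : Commensurable (cyc R b) (cyc R c) := by
  have hu := fun q (hq : q ∉ nilradical Q) => IsMultipleRing.isUnit_of_notMem hQ hq
  have hg := h.toIsMultipleRing.generic hQ
  exact (isGenerator_residue hg hu hb).isLattice.commensurable h hQ
    (isGenerator_residue hg hu hc).isLattice

lemma idx_cyc_mul (h : IsMultipleLocalRing R n t y) (hQ : IsGenericLocalization R Q)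
    {a : ResidueField Q} (ha : a ≠ 0) (b c : ResidueField Q) :
    idx (cyc R (a * b)) (cyc R (a * c)) = idx (cyc R b) (cyc R c) := by
  have : (nilradical Q).IsPrime := (h.toIsMultipleRing.generic hQ).isPrime
  rw [cyc_mul, cyc_mul]
  exact idx_map_of_injective (mul_right_injective₀ ha)

lemma ordAt_mul (h : IsMultipleLocalRing R n t y) (hQ : IsGenericLocalization R Q)
    {a b : ResidueField Q} (ha : a ≠ 0) (hb : b ≠ 0) :
    ordAt R (a * b) = ordAt R a + ordAt R b := by
  have : (nilradical Q).IsPrime := (h.toIsMultipleRing.generic hQ).isPrime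
  have h1 := idx_cyc_mul h hQ ha 1 b
  rw [mul_one] at h1
  rw [ordAt, ordAt, ordAt, ← h1]
  exact (idx_add (cyc_commensurable h hQ one_ne_zero ha)
    (cyc_commensurable h hQ ha (mul_ne_zero ha hb))).symm

lemma idx_cyc_pow (h : IsMultipleLocalRing R n t y) (hQ : IsGenericLocalization R Q)
    {a c : ResidueField Q} (ha : a ≠ 0) (hc : c ≠ 0) (j : ℕ) :
    idx (cyc R (a ^ j)) (cyc R c) = j * idx (cyc R a) (cyc R (1 : ResidueField Q)) + ordAt R c := by
  have : (nilradical Q).IsPrime := (h.toIsMultipleRing.generic hQ).isPrime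
  rw [ordAt, ← idx_add (cyc_commensurable h hQ (pow_ne_zero j ha) one_ne_zero)
    (cyc_commensurable h hQ one_ne_zero hc)]
  congr 1
  induction j with
  | zero => rw [pow_zero, idx_self]; simp
  | succ j ih =>
    rw [← idx_add (cyc_commensurable h hQ (pow_ne_zero _ ha) (pow_ne_zero j ha))
      (cyc_commensurable h hQ (pow_ne_zero j ha) one_ne_zero), ih]
    have := idx_cyc_mul h hQ (pow_ne_zero j ha) a 1
    rw [mul_one, ← pow_succ] at this
    rw [this]
    push_cast
    ring

end Residue

/-! ### Graded pieces of a cyclic generic fibre -/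

section Gr

variable {Q : Type u} [CommRing Q] {n : ℕ} {g : Q} {V : Type u} [AddCommGroup V] [Module Q V]

/-- The isomorphism sends the class of `q` to that of `q g ^ j e`. The formula is recorded because
one coordinate at `η` has to serve for all closed points, each with its own generator of the
nilradical. -/
lemma exists_grEquiv (hg : IsMultipleRing Q n g) {m : ℕ} (hm : m ≤ n) {e : V}
    (he : IsGenerator Q m e) {j : ℕ} (hj : j < m) :
    ∃ θ : ResidueField Q ≃ₗ[ResidueField Q] GrPiece Q V j,
      ∀ (q : Q) (x : nilFiltration Q V j), (x : V) = (q * g ^ j) • e →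
        θ (Ideal.Quotient.mk _ q) = Submodule.Quotient.mk x := by
  have hmem : ∀ q : Q, (q * g ^ j) • e ∈ nilFiltration Q V j := fun q =>
    (mem_nilFiltration_iff hg.nilradical_eq).2 ⟨q • e, by rw [smul_smul, mul_comm]⟩
  let γ : GrPiece Q V j := Submodule.Quotient.mk ⟨(1 * g ^ j) • e, hmem 1⟩
  let θ : ResidueField Q →ₗ[ResidueField Q] GrPiece Q V j := LinearMap.toSpanSingleton _ _ γ
  have hθ : ∀ (q : Q) (x : nilFiltration Q V j), (x : V) = (q * g ^ j) • e →
        θ (Ideal.Quotient.mk _ q) = Submodule.Quotient.mk x := by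
    intro q x hx
    refine congrArg Submodule.Quotient.mk (Subtype.ext ?_ :
      q • (⟨(1 * g ^ j) • e, hmem 1⟩ : nilFiltration Q V j) = x)
    rw [hx, Submodule.coe_smul, smul_smul, one_mul]
  refine ⟨LinearEquiv.ofBijective θ ⟨?_, ?_⟩, hθ⟩
  · rw [injective_iff_map_eq_zero]
    intro q hq
    obtain ⟨q, rfl⟩ := Ideal.Quotient.mk_surjective q
    rw [hθ q ⟨_, hmem q⟩ rfl, Submodule.Quotient.mk_eq_zero,
      mem_smul_top_nilFiltration_iff hg.nilradical_eq] at hq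
    obtain ⟨v, hv⟩ := hq
    obtain ⟨r, rfl⟩ := he.exists_smul_eq v
    have h0 : (q * g ^ j - g ^ (j + 1) * r) • e = 0 := by
      rw [sub_smul, mul_smul _ r, hv, sub_self]
    obtain ⟨c, hc⟩ := (mem_nilradical_pow_iff hg.nilradical_eq).1 ((he.smul_eq_zero_iff _).1 h0)
    rw [Ideal.Quotient.eq_zero_iff_mem]
    by_contra hq'
    -- The second factor is then a multiple of `g ^ (n - j)`, hence of `g` because `j < n`; so `q`
    -- is a multiple of `g`.
    have h1 : g ^ j * (q - g * (r + g ^ (m - (j + 1)) * c)) = 0 := by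
      have h2 : m = j + 1 + (m - (j + 1)) := by omega
      rw [h2, pow_add] at hc
      linear_combination hc
    obtain ⟨d, hd⟩ := hg.pow_mul_eq_zero (hj.le.trans hm) h1
    apply hq'
    rw [hg.mem_nilradical_iff]
    have h3 : n - j = n - j - 1 + 1 := by omega
    exact ⟨r + g ^ (m - (j + 1)) * c + g ^ (n - j - 1) * d, by
      rw [h3, pow_succ] at hd
      linear_combination hd⟩
  · intro x
    obtain ⟨⟨x, hx⟩, rfl⟩ := Submodule.Quotient.mk_surjective _ x
    obtain ⟨v, rfl⟩ := (mem_nilFiltration_iff hg.nilradical_eq).1 hx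
    obtain ⟨r, rfl⟩ := he.exists_smul_eq v
    exact ⟨Ideal.Quotient.mk _ r, hθ r _ (by
      change g ^ j • r • e = _
      rw [smul_smul, mul_comm])⟩

lemma subsingleton_grPiece (hg : IsMultipleRing Q n g) {m : ℕ} {e : V}
    (he : IsGenerator Q m e) {j : ℕ} (hj : m ≤ j) : Subsingleton (GrPiece Q V j) := by
  refine subsingleton_of_forall_eq 0 fun x => ?_
  obtain ⟨⟨x, hx⟩, rfl⟩ := Submodule.Quotient.mk_surjective _ x
  obtain ⟨v, rfl⟩ := (mem_nilFiltration_iff hg.nilradical_eq).1 hx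
  obtain ⟨r, rfl⟩ := he.exists_smul_eq v
  refine (Submodule.Quotient.mk_eq_zero _).2 ((mem_smul_top_nilFiltration_iff hg.nilradical_eq).2
    ⟨0, ?_⟩)
  change _ = g ^ j • r • e
  rw [smul_zero, smul_smul]
  refine ((he.smul_eq_zero_iff _).2 (Ideal.mul_mem_right _ _ (Ideal.pow_le_pow_right hj ?_))).symm
  exact Ideal.pow_mem_pow (hg.mem_nilradical_iff.2 ⟨1, (mul_one g).symm⟩) j

end Gr

/-! ### The local degree formula relative to a global frame -/

section LocalDegree

variable {R Q : Type u} [CommRing R] [IsLocalRing R] [CommRing Q] [Algebra R Q] {n : ℕ} {t y : R}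
  {V : Type u} [AddCommGroup V] [Module Q V] [Module R V] [IsScalarTower R Q V]
  {M : Type u} [AddCommGroup M] [Module R M]

/-- The one-step formula is applied to `B = y ^ j R e`. Because `y = u g`, the image of `B` in
`G_j`, identified with the residue field through `g ^ j e`, is generated by the class of `u ^ j`.
Comparing `u ^ j` with the frame coordinate `c` produces the last summand. -/
lemma localDegree_grMap (h : IsMultipleLocalRing R n t y) (hQ : IsGenericLocalization R Q)
    {g : Q} (hg : IsMultipleRing Q n g) {u : Q} (hu : u ∉ nilradical Q)
    (huy : algebraMap R Q y = u * g) {m : ℕ} (hm : m ≤ n) {e : V} (he : IsGenerator Q m e)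
    (φ : M →ₛₗ[algebraMap R Q] V) (φ' : M →ₗ[R] V) (hφφ : ∀ m, φ' m = φ m)
    (hφ : Function.Injective φ') (hA : IsLattice Q (LinearMap.range φ')) {j : ℕ} (hj : j < m)
    (θ : ResidueField Q ≃ₗ[ResidueField Q] GrPiece Q V j)
    (hθ : ∀ (q : Q) (x : nilFiltration Q V j), (x : V) = (q * g ^ j) • e →
        θ (Ideal.Quotient.mk _ q) = Submodule.Quotient.mk x)
    (c : ResidueField Q) (hc : c ≠ 0) {ι : Type*} (b : ι → GrPiece Q V j)
    (hb : Set.range b = {θ c}) :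
    localDegree (grMap φ j) b =
      idx ((LinearMap.range φ').map (powSMul V y j)) ((Submodule.span R {e}).map (powSMul V y j)) -
      idx ((LinearMap.range φ').map (powSMul V y (j + 1)))
        ((Submodule.span R {e}).map (powSMul V y (j + 1))) +
      (j * idx (cyc R (Ideal.Quotient.mk (nilradical Q) u)) (cyc R (1 : ResidueField Q)) +
        ordAt R c) := by
  have hgy := h.toIsMultipleRing.generic hQ
  have hu0 : Ideal.Quotient.mk (nilradical Q) u ≠ 0 := fun h' =>
    hu (Ideal.Quotient.eq_zero_iff_mem.1 h')
  have : (nilradical Q).IsPrime := hg.isPrime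
  have hcomm : Commensurable (LinearMap.range φ') (Submodule.span R {e}) :=
    hA.commensurable h hQ he.isLattice
  let θR : ResidueField Q →ₗ[R] GrPiece Q V j :=
    { toFun := θ
      map_add' := map_add θ
      map_smul' := fun r q => by
        obtain ⟨q, rfl⟩ := Ideal.Quotient.mk_surjective q
        have hmem : (q * g ^ j) • e ∈ nilFiltration Q V j :=
          (mem_nilFiltration_iff hg.nilradical_eq).2 ⟨q • e, by rw [smul_smul, mul_comm]⟩
        have hmem' : ((algebraMap R Q r * q) * g ^ j) • e ∈ nilFiltration Q V j := by
          rw [mul_assoc, mul_smul]; exact Submodule.smul_mem _ _ hmem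
        have h1 : r • Ideal.Quotient.mk (nilradical Q) q =
          Ideal.Quotient.mk (nilradical Q) (algebraMap R Q r * q) := by
          rw [map_mul, Algebra.smul_def]; rfl
        rw [h1, hθ _ ⟨_, hmem⟩ rfl, hθ _ ⟨_, hmem'⟩ rfl, RingHom.id_apply]
        refine congrArg Submodule.Quotient.mk (Subtype.ext ?_ : _ =
          r • (⟨(q * g ^ j) • e, hmem⟩ : nilFiltration Q V j))
        change (algebraMap R Q r * q * g ^ j) • e = r • ((q * g ^ j) • e)
        rw [mul_assoc, mul_smul, algebraMap_smul] }
  have hθinj : Function.Injective θR := θ.injective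
  have hbe : Submodule.span R (Set.range b) = (cyc R c).map θR := by
    rw [hb, Submodule.map_span, Set.image_singleton]; rfl
  let B := (Submodule.span R {e}).map (powSMul V y j)
  have hBe : (B.comap ((nilFiltration Q V j).subtype.restrictScalars R)).map (grProj R V j) =
      (cyc R (Ideal.Quotient.mk (nilradical Q) u ^ j)).map θR := by
    have hmem : (u ^ j * g ^ j) • e ∈ nilFiltration Q V j :=
      (mem_nilFiltration_iff hg.nilradical_eq).2 ⟨u ^ j • e, by rw [smul_smul, mul_comm]⟩
    have h1 : θR (Ideal.Quotient.mk (nilradical Q) u ^ j) = grProj R V j ⟨_, hmem⟩ := by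
      rw [← map_pow]; exact hθ _ ⟨_, hmem⟩ rfl
    rw [Submodule.map_span θR, Set.image_singleton, h1, ← Set.image_singleton (f := grProj R V j),
      ← Submodule.map_span]
    congr 1
    ext x
    have h2 : ((u ^ j * g ^ j) • e : V) = y ^ j • e := by
      rw [← mul_pow, ← huy, ← map_pow, algebraMap_smul]
    constructor
    · rintro ⟨v, hv, hx⟩
      obtain ⟨r, rfl⟩ := Submodule.mem_span_singleton.1 hv
      refine Submodule.mem_span_singleton.2 ⟨r, Subtype.ext ?_⟩
      change r • ((u ^ j * g ^ j) • e) = (x : V)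
      rw [h2, smul_comm]
      exact hx
    · intro hx
      obtain ⟨r, rfl⟩ := Submodule.mem_span_singleton.1 hx
      refine ⟨r • e, Submodule.smul_mem _ _ (Submodule.mem_span_singleton_self e), ?_⟩
      change y ^ j • r • e = r • ((u ^ j * g ^ j) • e)
      rw [h2, smul_comm]
  have hint := map_powSMul_inf_range h.toIsMultipleRing hQ hm he hj
  rw [localDegree_grMap_add h.nilradical_eq hgy.nilradical_eq φ φ' hφφ hφ j b B
    LinearMap.map_le_range (hcomm.map _) (by rw [hint]; exact hcomm.map _) _ rfl (by
      rw [hBe, hbe]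
      exact (cyc_commensurable h hQ (pow_ne_zero _ hu0) hc).map _), hBe, hbe, hint,
    idx_map_of_injective hθinj, idx_cyc_pow h hQ hu0 hc]

lemma localDegree_grMap_of_le (h : IsMultipleRing R n y) (hQ : IsGenericLocalization R Q)
    {m : ℕ} {e : V} (he : IsGenerator Q m e)
    (φ : M →ₛₗ[algebraMap R Q] V) (hφ : Function.Injective φ) {j : ℕ} (hj : m ≤ j)
    {ι : Type*} (b : ι → GrPiece Q V j) : localDegree (grMap φ j) b = 0 := by
  have hgy := h.generic hQ
  have h1 : Subsingleton (GrPiece Q V j) := subsingleton_grPiece hgy he hj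
  have h2 : Subsingleton (GrPiece R M j) := by
    refine subsingleton_of_forall_eq 0 fun x => ?_
    obtain ⟨⟨x, hx⟩, rfl⟩ := Submodule.Quotient.mk_surjective _ x
    obtain ⟨v, rfl⟩ := (mem_nilFiltration_iff h.nilradical_eq).1 hx
    refine (Submodule.Quotient.mk_eq_zero _).2 ((mem_smul_top_nilFiltration_iff h.nilradical_eq).2
      ⟨0, ?_⟩)
    rw [smul_zero]
    apply hφ
    rw [map_zero, LinearMap.map_smulₛₗ]
    obtain ⟨r, hr⟩ := he.exists_smul_eq (φ v)
    rw [← hr, smul_smul, map_pow]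
    refine ((he.smul_eq_zero_iff _).2
      (Ideal.mul_mem_right _ _ (Ideal.pow_le_pow_right hj ?_))).symm
    exact Ideal.pow_mem_pow (hgy.mem_nilradical_iff.2 ⟨1, (mul_one _).symm⟩) j
  let ĝ : GrPiece R M j →ₗ[R] GrPiece Q V j := 0
  rw [localDegree_eq (grMap φ j) ĝ (fun _ => Subsingleton.elim _ _), idx,
    Module.length_eq_zero, relLength_eq_zero.2 fun x _ => ?_, relLength_eq_zero.2 fun x _ => ?_]
  · simp
  all_goals rw [Subsingleton.elim x 0]; exact zero_mem _

end LocalDegree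

/-! ### Torsion kernels and double duals -/

section TorsionKer

variable {R : Type u} [CommRing R]

lemma mem_torsionKer_iff {M : Type u} [AddCommGroup M] [Module R M] {i : ℕ} {x : Restr R M i} :
    x ∈ torsionKer R M i ↔ ∀ f : Module.Dual R (Restr R M i), f x = 0 :=
  ⟨fun h f => congr($h f), fun h => LinearMap.ext h⟩

lemma length_torsionKer_congr {M M' : Type u} [AddCommGroup M] [Module R M] [AddCommGroup M']
    [Module R M'] (e : M ≃ₗ[R] M') (i : ℕ) :
    Module.length R (torsionKer R M i) = Module.length R (torsionKer R M' i) := by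
  let ē : Restr R M i ≃ₗ[R] Restr R M' i := Submodule.Quotient.equiv _ _ e (by
    rw [nilFiltration, nilFiltration, Submodule.map_smul'', Submodule.map_top,
      LinearMap.range_eq_top.2 e.surjective])
  have h : (torsionKer R M i).map (ē : Restr R M i →ₗ[R] Restr R M' i) = torsionKer R M' i := by
    ext x
    constructor
    · rintro ⟨x, hx, rfl⟩
      exact mem_torsionKer_iff.2 fun f => mem_torsionKer_iff.1 hx (f ∘ₗ (ē : _ →ₗ[R] _))
    · intro hx
      refine ⟨ē.symm x, mem_torsionKer_iff.2 fun f => ?_, ē.apply_symm_apply x⟩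
      exact mem_torsionKer_iff.1 hx (f ∘ₗ (ē.symm : _ →ₗ[R] _))
  rw [← h]
  exact (ē.submoduleMap _).length_eq

/-- The torsion kernel of `M`, when `M / N ^ i M` has a torsionless quotient with torsion kernel. -/
lemma length_torsionKer_eq {M V : Type u} [AddCommGroup M] [Module R M] [AddCommGroup V]
    [Module R V] (f : M →ₗ[R] V) (i : ℕ) (hf : nilFiltration R M i ≤ LinearMap.ker f)
    (ι : LinearMap.range f →ₗ[R] R) (hι : Function.Injective ι)
    (htor : ∀ m ∈ LinearMap.ker f, ∃ s : R, (∀ r, s * r = 0 → r = 0) ∧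
      s • m ∈ nilFiltration R M i) :
    Module.length R (torsionKer R M i) = relLength (LinearMap.ker f) (nilFiltration R M i) := by
  have h : torsionKer R M i = (LinearMap.ker f).map (nilFiltration R M i).mkQ := by
    ext x
    obtain ⟨x, rfl⟩ := Submodule.Quotient.mk_surjective _ x
    rw [mem_torsionKer_iff]
    constructor
    · intro hx
      refine ⟨x, ?_, rfl⟩
      have h1 := hx ((nilFiltration R M i).liftQ (ι ∘ₗ f.rangeRestrict) fun m hm => by
        have : f.rangeRestrict m = 0 := Subtype.ext (hf hm)
        rw [LinearMap.mem_ker, LinearMap.comp_apply, this, map_zero])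
      have h2 : ι (f.rangeRestrict x) = ι 0 := by rw [map_zero]; exact h1
      exact congrArg Subtype.val (hι h2)
    · rintro ⟨m, hm, hmx⟩ g
      rw [← hmx]
      obtain ⟨s, hs, hsm⟩ := htor m hm
      refine hs _ ?_
      rw [← smul_eq_mul, ← map_smul, ← map_smul]
      have : (nilFiltration R M i).mkQ (s • m) = 0 := (Submodule.Quotient.mk_eq_zero _).2 hsm
      rw [this, map_zero]
  rw [h]
  let q : LinearMap.ker f →ₗ[R] (LinearMap.ker f).map (nilFiltration R M i).mkQ :=
    (nilFiltration R M i).mkQ.submoduleMap _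
  have hq : LinearMap.ker q = (nilFiltration R M i).submoduleOf (LinearMap.ker f) := by
    ext x
    rw [LinearMap.mem_ker, Subtype.ext_iff]
    exact Submodule.Quotient.mk_eq_zero _
  rw [← (q.quotKerEquivOfSurjective
    ((nilFiltration R M i).mkQ.submoduleMap_surjective _)).length_eq, hq]

/-- Functionals with values in `R` vanish on elements killed by a regular element, so they factor
through the quotient by such elements. -/
lemma bijective_dualMap_of_torsion {M M' : Type*} [AddCommGroup M] [Module R M] [AddCommGroup M']
    [Module R M'] (p : M →ₗ[R] M') (hp : Function.Surjective p)
    (htor : ∀ m ∈ LinearMap.ker p, ∃ s : R, (∀ r, s * r = 0 → r = 0) ∧ s • m = 0) :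
    Function.Bijective p.dualMap := by
  constructor
  · intro f g hfg
    ext x
    obtain ⟨m, rfl⟩ := hp x
    exact congr($hfg m)
  · intro f
    have hk : LinearMap.ker p ≤ LinearMap.ker f := by
      intro m hm
      obtain ⟨s, hs, hsm⟩ := htor m hm
      refine hs _ ?_
      rw [← smul_eq_mul, ← map_smul, hsm, map_zero]
    refine ⟨(LinearMap.ker p).liftQ f hk ∘ₗ (p.quotKerEquivOfSurjective hp).symm, ?_⟩
    ext m
    have : (p.quotKerEquivOfSurjective hp).symm (p m) = Submodule.Quotient.mk m := by
      rw [LinearEquiv.symm_apply_eq]; rfl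
    simp only [LinearMap.dualMap_apply, LinearMap.comp_apply, LinearEquiv.coe_coe, this]
    rfl

lemma nonempty_bidual_equiv {M M' : Type*} [AddCommGroup M] [Module R M] [AddCommGroup M']
    [Module R M'] (p : M →ₗ[R] M') (hp : Function.Bijective p.dualMap)
    (hM' : Function.Bijective (Module.Dual.eval R M')) :
    Nonempty (Module.Dual R (Module.Dual R M) ≃ₗ[R] M') :=
  ⟨(LinearEquiv.ofBijective _ hp).dualMap.trans (LinearEquiv.ofBijective _ hM').symm⟩

end TorsionKer

/-! ### Local indices as colengths of lattices -/

section LocalIndex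

variable {R Q : Type u} [CommRing R] [CommRing Q] [Algebra R Q] {n : ℕ} {t y : R}
  {V : Type u} [AddCommGroup V] [Module Q V] [Module R V] [IsScalarTower R Q V]

/-- A common denominator moves the submodule into `R e ≅ R / y ^ k`, which embeds into `R` by
multiplication with `y ^ (n - k)`. -/
lemma exists_injective_to_ring (h : IsMultipleRing R n y) (hQ : IsGenericLocalization R Q)
    {k : ℕ} (hk : k ≤ n) {e : V} (he : IsGenerator Q k e) (A : Submodule R V) (hA : A.FG) :
    ∃ f : A →ₗ[R] R, Function.Injective f := by
  have hg := h.generic hQ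
  obtain ⟨s, hs, hsA⟩ := exists_smul_le_of_fg h hQ A (Submodule.span R {e}) hA
    (he.isLattice (R := R)).span_eq_top
  have hann : ∀ r : R, r • e = 0 → ∃ c, r = y ^ k * c := by
    intro r hr
    rw [← algebraMap_smul Q, he.smul_eq_zero_iff, mem_nilradical_pow_iff hg.nilradical_eq] at hr
    obtain ⟨c, hc⟩ := hr
    exact h.exists_eq_pow_mul_of_algebraMap hQ hk hc
  have hex : ∀ a : A, ∃ r : R, r • e = s • (a : V) := fun a =>
    Submodule.mem_span_singleton.1 (hsA a a.2)
  choose ρ hρ using hex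
  have hdiff : ∀ r r' : R, r • e = r' • e → r * y ^ (n - k) = r' * y ^ (n - k) := by
    intro r r' hrr
    obtain ⟨c, hc⟩ := hann (r - r') (by rw [sub_smul, hrr, sub_self])
    have hyy : y ^ k * y ^ (n - k) = 0 := by
      rw [← pow_add, Nat.add_sub_cancel' hk, h.pow_eq_zero]
    linear_combination y ^ (n - k) * hc + c * hyy
  refine ⟨{ toFun := fun a => ρ a * y ^ (n - k), map_add' := ?_, map_smul' := ?_ }, ?_⟩
  · intro a b
    rw [← add_mul]
    refine hdiff _ _ ?_
    rw [hρ, add_smul, hρ, hρ, Submodule.coe_add, smul_add]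
  · intro r a
    rw [RingHom.id_apply, smul_eq_mul, ← mul_assoc]
    refine hdiff _ _ ?_
    rw [hρ, mul_smul, hρ, Submodule.coe_smul, smul_comm]
  · rw [injective_iff_map_eq_zero]
    intro a ha
    have ha' : ρ a * y ^ (n - k) = 0 := ha
    obtain ⟨c, hc⟩ := h.pow_mul_eq_zero (Nat.sub_le n k) (r := ρ a) (by rw [mul_comm, ha'])
    rw [Nat.sub_sub_self hk] at hc
    have h1 : s • (a : V) = 0 := by
      rw [← hρ, hc, ← algebraMap_smul Q, he.smul_eq_zero_iff]
      exact (mem_nilradical_pow_iff hg.nilradical_eq).2 ⟨algebraMap R Q c, by simp⟩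
    obtain ⟨v, hv⟩ := hQ.isUnit s hs
    refine Subtype.ext ?_
    rw [← algebraMap_smul Q, ← hv] at h1
    have h2 : (↑v⁻¹ : Q) • (↑v : Q) • (a : V) = 0 := by rw [h1, smul_zero]
    rwa [smul_smul, Units.inv_mul, one_smul] at h2

/-- The projection to the quotient by a power of the nilradical. -/
def modPow (R : Type u) {Q : Type u} [CommRing R] [CommRing Q] [Algebra R Q] (V : Type u)
    [AddCommGroup V] [Module Q V] [Module R V] [IsScalarTower R Q V] (j : ℕ) :
    V →ₗ[R] Restr Q V j := (nilFiltration Q V j).mkQ.restrictScalars R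

lemma ker_modPow (h : IsMultipleRing R n y) (hQ : IsGenericLocalization R Q) (j : ℕ) :
    LinearMap.ker (modPow R (Q := Q) V j) = LinearMap.range (powSMul V y j) := by
  ext v
  refine (Submodule.Quotient.mk_eq_zero _).trans ?_
  rw [mem_nilFiltration_iff (h.generic hQ).nilradical_eq]
  simp only [← map_pow, algebraMap_smul]
  exact Iff.rfl

lemma IsGenerator.restr {g : Q} (h : IsMultipleRing Q n g) {m : ℕ} {e : V} (he : IsGenerator Q m e) {k : ℕ}
    (hk : k ≤ m) : IsGenerator Q k (Submodule.Quotient.mk e : Restr Q V k) where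
  exists_smul_eq v := by
    obtain ⟨v, rfl⟩ := Submodule.Quotient.mk_surjective _ v
    obtain ⟨q, rfl⟩ := he.exists_smul_eq v
    exact ⟨q, rfl⟩
  smul_eq_zero_iff q := by
    rw [← Submodule.Quotient.mk_smul, Submodule.Quotient.mk_eq_zero,
      mem_nilFiltration_iff h.nilradical_eq, mem_nilradical_pow_iff h.nilradical_eq]
    constructor
    · rintro ⟨v, hv⟩
      obtain ⟨r, rfl⟩ := he.exists_smul_eq v
      have h0 : (q - g ^ k * r) • e = 0 := by rw [sub_smul, mul_smul, hv, sub_self]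
      obtain ⟨c, hc⟩ := (mem_nilradical_pow_iff h.nilradical_eq).1 ((he.smul_eq_zero_iff _).1 h0)
      refine ⟨r + g ^ (m - k) * c, ?_⟩
      have : m = k + (m - k) := by omega
      rw [this, pow_add] at hc
      linear_combination hc
    · rintro ⟨c, rfl⟩
      exact ⟨c • e, by rw [smul_smul]⟩

variable {M : Type u} [AddCommGroup M] [Module R M]

lemma exists_mem_range_eq_smul (h : IsMultipleRing R n y) (hQ : IsGenericLocalization R Q)
    (φ : M →ₗ[R] V) (hA : IsLattice Q (LinearMap.range φ)) (v : V) :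
    ∃ s ∉ nilradical R, ∃ m, φ m = s • v := by
  obtain ⟨s, hs, m, hm⟩ := exists_smul_mem_of_mem_span h hQ (LinearMap.range φ) (v := v)
    (by rw [hA.span_eq_top]; trivial)
  exact ⟨s, hs, m, hm⟩

lemma modPow_eq_zero_iff (h : IsMultipleRing R n y) (hQ : IsGenericLocalization R Q) (j : ℕ)
    (v : V) : modPow R (Q := Q) V j v = 0 ↔ ∃ w : V, y ^ j • w = v := by
  have := ker_modPow (V := V) h hQ j
  rw [Submodule.ext_iff] at this
  exact this v

/-- The image of `M` in `V / N ^ j V`. -/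
abbrev modPowRange (Q : Type u) [CommRing Q] [Algebra R Q] [Module Q V] [IsScalarTower R Q V]
    (φ : M →ₗ[R] V) (j : ℕ) : Submodule R (Restr Q V j) :=
  LinearMap.range (modPow R (Q := Q) V j ∘ₗ φ)

lemma modPowRange_fg (φ : M →ₗ[R] V) (hA : IsLattice Q (LinearMap.range φ)) (j : ℕ) :
    (modPowRange Q φ j).FG := by
  have : modPowRange Q φ j = (LinearMap.range φ).map (modPow R V j) := LinearMap.range_comp _ _
  rw [this]; exact hA.fg.map _

/-- An element of the kernel is represented by `m` with `φ m = y ^ j v`. A regular `s` brings `v`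
into the lattice, and then `s m` is a `y ^ j`-multiple in `M`; so the kernel is torsion. -/
lemma exists_restr_to_modPowRange (h : IsMultipleRing R n y)
    (hQ : IsGenericLocalization R Q) (φ : M →ₗ[R] V) (hφ : Function.Injective φ)
    (hA : IsLattice Q (LinearMap.range φ)) (j : ℕ) :
    ∃ p : Restr R M j →ₗ[R] modPowRange Q φ j, Function.Surjective p ∧
      ∀ m ∈ LinearMap.ker p, ∃ s : R, (∀ r, s * r = 0 → r = 0) ∧ s • m = 0 := by
  have hle : nilFiltration R M j ≤ LinearMap.ker (modPow R (Q := Q) V j ∘ₗ φ) := by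
    intro m hm
    obtain ⟨m', rfl⟩ := (mem_nilFiltration_iff h.nilradical_eq).1 hm
    exact (modPow_eq_zero_iff h hQ j _).2 ⟨φ m', (map_smul φ _ _).symm⟩
  refine ⟨(nilFiltration R M j).liftQ (modPow R (Q := Q) V j ∘ₗ φ).rangeRestrict
    fun m hm => Subtype.ext (hle hm), ?_, ?_⟩
  · rintro ⟨_, m, rfl⟩
    exact ⟨Submodule.Quotient.mk m, rfl⟩
  · intro m hm
    obtain ⟨m, rfl⟩ := Submodule.Quotient.mk_surjective _ m
    obtain ⟨v, hv⟩ := (modPow_eq_zero_iff h hQ j (φ m)).1 (congrArg Subtype.val hm)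
    obtain ⟨s, hs, m', hm'⟩ := exists_mem_range_eq_smul h hQ φ hA v
    refine ⟨s, h.eq_zero_of_mul_eq_zero s hs, ?_⟩
    rw [← Submodule.Quotient.mk_smul]
    refine (Submodule.Quotient.mk_eq_zero _).2 ((mem_nilFiltration_iff h.nilradical_eq).2
      ⟨m', hφ ?_⟩)
    rw [map_smul, map_smul, hm', ← hv, smul_comm]

lemma bijective_eval_modPowRange [IsLocalRing R] (h : IsMultipleLocalRing R n t y)
    (hQ : IsGenericLocalization R Q) {e : V} (he : IsGenerator Q n e)
    (φ : M →ₗ[R] V) (hA : IsLattice Q (LinearMap.range φ)) {j : ℕ} (hj : j ≤ n) :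
    Function.Bijective (Module.Dual.eval R (modPowRange Q φ j)) := by
  have hN := h.toIsMultipleRing
  have hg := hN.generic hQ
  have hM'fg := modPowRange_fg (Q := Q) φ hA j
  have : Module.Finite R (modPowRange Q φ j) := Module.Finite.iff_fg.2 hM'fg
  obtain ⟨ι', hι'⟩ := exists_injective_to_ring hN hQ hj (he.restr hg hj) (modPowRange Q φ j) hM'fg
  have hinj : Function.Injective (Module.Dual.eval R (modPowRange Q φ j)) :=
    fun a b hab => hι' congr($hab ι')
  refine ⟨hinj, ?_⟩
  obtain ⟨s₀, hs₀, m₀, hm₀⟩ := exists_mem_range_eq_smul hN hQ φ hA e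
  have hψm₀ : (modPow R (Q := Q) V j ∘ₗ φ) m₀ =
      s₀ • (Submodule.Quotient.mk e : Restr Q V j) := by
    change modPow R V j (φ m₀) = _
    rw [hm₀, map_smul]; rfl
  obtain ⟨s₁, hs₁, hs₁M⟩ := exists_smul_le_of_fg hN hQ (modPowRange Q φ j)
    (Submodule.span R {(Submodule.Quotient.mk e : Restr Q V j)}) hM'fg
    ((he.restr hg hj).isLattice (R := R)).span_eq_top
  -- The generator is the image of `s₀ e`, which has the same annihilator as the class of `e` since
  -- `s₀` becomes a unit. The element `s₁` moves the whole image into the span of that class, so `s₀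
  -- * s₁` moves it into the span of the generator.
  refine h.eval_surjective hinj (k := j) hj
    ⟨(modPow R (Q := Q) V j ∘ₗ φ) m₀, m₀, rfl⟩ ?_ (s := s₀ * s₁) (hN.mul_notMem hs₀ hs₁) ?_
  · intro r
    have h1 : r • (⟨(modPow R (Q := Q) V j ∘ₗ φ) m₀, m₀, rfl⟩ : modPowRange Q φ j) = 0 ↔
        r • (modPow R (Q := Q) V j ∘ₗ φ) m₀ = 0 :=
      ⟨fun h => congrArg Subtype.val h, fun h => Subtype.ext h⟩
    rw [h1, hψm₀, smul_smul, ← algebraMap_smul Q, (he.restr hg hj).smul_eq_zero_iff,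
      mem_nilradical_pow_iff hg.nilradical_eq]
    constructor
    · rintro ⟨c, hc⟩
      obtain ⟨v, hv⟩ := hQ.isUnit s₀ hs₀
      refine hN.exists_eq_pow_mul_of_algebraMap hQ hj (q := c * ↑v⁻¹) ?_
      rw [map_mul, ← hv] at hc
      rw [← mul_assoc, ← hc, mul_assoc, Units.mul_inv, mul_one]
    · rintro ⟨c, rfl⟩
      exact ⟨algebraMap R Q (c * s₀), by simp [mul_assoc]⟩
  · rintro ⟨m, hm⟩
    obtain ⟨r, hr⟩ := Submodule.mem_span_singleton.1 (hs₁M m hm)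
    refine ⟨r, Subtype.ext ?_⟩
    change (s₀ * s₁) • m = r • (modPow R (Q := Q) V j ∘ₗ φ) m₀
    rw [mul_smul, ← hr, hψm₀, smul_comm]

/-- `M / N ^ j M` and its image in `V / N ^ j V` differ by torsion, so they have the same dual; the
image is reflexive, hence equal to the common double dual. -/
lemma nonempty_pureQuot_equiv [IsLocalRing R] (h : IsMultipleLocalRing R n t y)
    (hQ : IsGenericLocalization R Q) {e : V} (he : IsGenerator Q n e)
    (φ : M →ₗ[R] V) (hφ : Function.Injective φ) (hA : IsLattice Q (LinearMap.range φ)) {j : ℕ}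
    (hj : j ≤ n) :
    Nonempty (PureQuot R M j ≃ₗ[R] modPowRange Q φ j) := by
  obtain ⟨p, hp, hptor⟩ := exists_restr_to_modPowRange h.toIsMultipleRing hQ φ hφ hA j
  exact nonempty_bidual_equiv p (bijective_dualMap_of_torsion p hp hptor)
    (bijective_eval_modPowRange h hQ he φ hA hj)

/-- The map `f` to `V / N ^ j V` has torsionless image, and its kernel is torsion modulo `N ^ j`. So
`T_j` is the kernel of `f`, given by `L ∩ y ^ j V`, modulo the `y ^ j`-multiples. -/
lemma length_torsionKer_modPowRange (h : IsMultipleRing R n y)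
    (hQ : IsGenericLocalization R Q) {e : V} (he : IsGenerator Q n e)
    (φ : M →ₗ[R] V) (hφ : Function.Injective φ) (hA : IsLattice Q (LinearMap.range φ)) {j : ℕ}
    (hj : j ≤ n) (f : modPowRange Q φ (j + 1) →ₗ[R] Restr Q V j)
    (hf : ∀ m, f ⟨(modPow R (Q := Q) V (j + 1) ∘ₗ φ) m, m, rfl⟩ = modPow R V j (φ m)) :
    Module.length R (torsionKer R (modPowRange Q φ (j + 1)) j) =
      relLength ((LinearMap.range φ ⊓ LinearMap.range (powSMul V y j)).map
          (modPow R (Q := Q) V (j + 1)))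
        (((LinearMap.range φ).map (powSMul V y j)).map (modPow R (Q := Q) V (j + 1))) := by
  have hg := h.generic hQ
  have hkf : ∀ m, f ⟨(modPow R (Q := Q) V (j + 1) ∘ₗ φ) m, m, rfl⟩ = 0 ↔
      ∃ v : V, y ^ j • v = φ m := by
    intro m
    rw [hf, modPow_eq_zero_iff h hQ]
  have hfg : (LinearMap.range f).FG := by
    rw [LinearMap.range_eq_map]
    exact (Module.Finite.iff_fg.2 (modPowRange_fg (Q := Q) φ hA (j + 1))).fg_top.map f
  obtain ⟨ι, hι⟩ := exists_injective_to_ring h hQ hj (he.restr hg hj) (LinearMap.range f) hfg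
  rw [length_torsionKer_eq f j ?_ ι hι ?_,
    ← relLength_map_of_injective (modPowRange Q φ (j + 1)).subtype_injective]
  · congr 1
    · ext x
      constructor
      · rintro ⟨⟨_, m, rfl⟩, hm, rfl⟩
        exact ⟨φ m, ⟨⟨m, rfl⟩, (hkf m).1 hm⟩, rfl⟩
      · rintro ⟨_, ⟨⟨m, rfl⟩, hm⟩, rfl⟩
        exact ⟨⟨(modPow R (Q := Q) V (j + 1) ∘ₗ φ) m, m, rfl⟩, (hkf m).2 hm, rfl⟩
    · ext x
      constructor
      · rintro ⟨x, hx, rfl⟩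
        obtain ⟨⟨_, m, rfl⟩, rfl⟩ := (mem_nilFiltration_iff h.nilradical_eq).1 hx
        exact ⟨_, ⟨_, ⟨m, rfl⟩, rfl⟩, map_smul (modPow R (Q := Q) V (j + 1)) _ _⟩
      · rintro ⟨_, ⟨_, ⟨m, rfl⟩, rfl⟩, rfl⟩
        refine ⟨y ^ j • ⟨(modPow R (Q := Q) V (j + 1) ∘ₗ φ) m, m, rfl⟩,
          (mem_nilFiltration_iff h.nilradical_eq).2 ⟨_, rfl⟩, ?_⟩
        exact (map_smul (modPow R (Q := Q) V (j + 1)) _ _).symm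
  · intro x hx
    obtain ⟨⟨_, m, rfl⟩, rfl⟩ := (mem_nilFiltration_iff h.nilradical_eq).1 hx
    rw [LinearMap.mem_ker, map_smul, hf, ← map_smul, modPow_eq_zero_iff h hQ]
    exact ⟨φ m, rfl⟩
  · rintro ⟨_, m, rfl⟩ hm
    obtain ⟨v, hv⟩ := (hkf m).1 hm
    obtain ⟨s, hs, m', hm'⟩ := exists_mem_range_eq_smul h hQ φ hA v
    refine ⟨s, h.eq_zero_of_mul_eq_zero s hs, (mem_nilFiltration_iff h.nilradical_eq).2
      ⟨⟨(modPow R (Q := Q) V (j + 1) ∘ₗ φ) m', m', rfl⟩, ?_⟩⟩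
    refine Subtype.ext ?_
    change y ^ j • (modPow R (Q := Q) V (j + 1) ∘ₗ φ) m' =
      s • (modPow R (Q := Q) V (j + 1) ∘ₗ φ) m
    rw [← map_smul, ← map_smul]
    congr 1
    apply hφ
    rw [map_smul, map_smul, hm', ← hv, smul_comm]

lemma exists_modPowRange_to_restr {g : Q} (h : IsMultipleRing Q n g) (φ : M →ₗ[R] V) (j : ℕ) :
    ∃ f : modPowRange Q φ (j + 1) →ₗ[R] Restr Q V j,
      ∀ m, f ⟨(modPow R (Q := Q) V (j + 1) ∘ₗ φ) m, m, rfl⟩ = modPow R V j (φ m) := by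
  have hVle : nilFiltration Q V (j + 1) ≤ nilFiltration Q V j := by
    intro v hv
    obtain ⟨w, rfl⟩ := (mem_nilFiltration_iff h.nilradical_eq).1 hv
    exact (mem_nilFiltration_iff h.nilradical_eq).2
      ⟨g • w, by rw [smul_smul, ← pow_succ]⟩
  exact ⟨(Submodule.factor hVle).restrictScalars R ∘ₗ (modPowRange Q φ (j + 1)).subtype,
    fun m => rfl⟩

/-- The local indices of a lattice. -/
theorem length_torsionKer_pureQuot [IsLocalRing R] (h : IsMultipleLocalRing R n t y)
    (hQ : IsGenericLocalization R Q) {e : V} (he : IsGenerator Q n e)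
    (φ : M →ₗ[R] V) (hφ : Function.Injective φ) (hA : IsLattice Q (LinearMap.range φ)) {j : ℕ}
    (hj : j < n) :
    Module.length R (torsionKer R (PureQuot R M (j + 1)) j) =
      relLength ((LinearMap.range φ ⊓ LinearMap.range (powSMul V y j)).map
          (modPow R (Q := Q) V (j + 1)))
        (((LinearMap.range φ).map (powSMul V y j)).map (modPow R (Q := Q) V (j + 1))) := by
  obtain ⟨E⟩ := nonempty_pureQuot_equiv h hQ he φ hφ hA (Nat.succ_le_of_lt hj)
  obtain ⟨f, hf⟩ := exists_modPowRange_to_restr (h.toIsMultipleRing.generic hQ) φ j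
  exact (length_torsionKer_congr E j).trans
    (length_torsionKer_modPowRange h.toIsMultipleRing hQ he φ hφ hA hj.le f hf)

end LocalIndex

/-! ### The index of a lattice cut by the canonical filtration -/

section FiltrationIndex

variable {R Q : Type u} [CommRing R] [CommRing Q] [Algebra R Q] {n : ℕ} {t y : R}
  {V : Type u} [AddCommGroup V] [Module Q V] [Module R V] [IsScalarTower R Q V]

lemma range_powSMul_succ_le (j : ℕ) :
    LinearMap.range (powSMul V y (j + 1)) ≤ LinearMap.range (powSMul V y j) := by
  rintro _ ⟨v, rfl⟩
  exact ⟨y • v, by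
    change y ^ j • y • v = y ^ (j + 1) • v
    rw [smul_smul, pow_succ]⟩

lemma IsGenerator.pow_smul_eq_zero (h : IsMultipleRing R n y) (hQ : IsGenericLocalization R Q)
    {m : ℕ} {e : V} (he : IsGenerator Q m e) {j : ℕ} (hj : j ≤ m) (hm : m ≤ n) {v : V}
    (hv : y ^ j • v = 0) : ∃ w : V, y ^ (m - j) • w = v := by
  have hg := h.generic hQ
  obtain ⟨q, rfl⟩ := he.exists_smul_eq v
  have h1 : (algebraMap R Q y ^ j * q) • e = 0 := by
    rw [mul_smul, ← map_pow, algebraMap_smul, hv]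
  obtain ⟨c, hc⟩ := (mem_nilradical_pow_iff hg.nilradical_eq).1 ((he.smul_eq_zero_iff _).1 h1)
  have h2 : algebraMap R Q y ^ (n - m + j) * q = 0 := by
    rw [pow_add, mul_assoc, hc, ← mul_assoc, ← pow_add, Nat.sub_add_cancel hm, hg.pow_eq_zero,
      zero_mul]
  obtain ⟨d, hd⟩ := hg.pow_mul_eq_zero (by omega) h2
  refine ⟨d • e, ?_⟩
  rw [hd, mul_smul, ← map_pow, algebraMap_smul]
  congr 2
  omega

/-- Multiplication by `y ^ j` identifies `V / y V` with `y ^ j V / y ^ (j + 1) V`; its kernel `y ^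
(n - j) V` is contained in `y V` because `j < n`. Hence the image of `y ^ j L` contributes the same
index at every step. -/
lemma ker_modPow_comp_powSMul (h : IsMultipleRing R n y) (hQ : IsGenericLocalization R Q) {e : V}
    (he : IsGenerator Q n e) {j : ℕ} (hj : j < n) :
    LinearMap.ker (modPow R (Q := Q) V (j + 1) ∘ₗ powSMul V y j) =
      LinearMap.ker (modPow R (Q := Q) V 1) := by
  ext v
  rw [LinearMap.mem_ker, LinearMap.mem_ker, LinearMap.comp_apply, modPow_eq_zero_iff h hQ,
    modPow_eq_zero_iff h hQ]
  constructor
  · rintro ⟨w, hw⟩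
    have h1 : y ^ j • (v - y • w) = 0 := by
      rw [smul_sub, smul_smul, ← pow_succ, hw]
      exact sub_self _
    obtain ⟨w', hw'⟩ := he.pow_smul_eq_zero h hQ hj.le le_rfl h1
    refine ⟨w + y ^ (n - j - 1) • w', ?_⟩
    rw [smul_add, smul_smul, ← pow_add, show 1 + (n - j - 1) = n - j by omega, hw', pow_one]
    abel
  · rintro ⟨w, rfl⟩
    exact ⟨w, by
      change _ = y ^ j • y ^ 1 • w
      rw [smul_smul, pow_add]⟩

/-- The length of the `j`-th index of a lattice. -/
def latticeIndex (Q : Type u) [CommRing Q] [Algebra R Q] [Module Q V] [IsScalarTower R Q V] (y : R)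
    (A : Submodule R V) (j : ℕ) : ℕ∞ :=
  relLength ((A ⊓ LinearMap.range (powSMul V y j)).map (modPow R (Q := Q) V (j + 1)))
    ((A.map (powSMul V y j)).map (modPow R (Q := Q) V (j + 1)))

lemma map_powSMul_le (A : Submodule R V) (j : ℕ) :
    A.map (powSMul V y j) ≤ A ⊓ LinearMap.range (powSMul V y j) := by
  rintro _ ⟨a, ha, rfl⟩
  exact ⟨A.smul_mem _ ha, a, rfl⟩

/-- The map sending `q` to the class of `q • e`. -/
def residueToRestr (R : Type u) {Q : Type u} [CommRing R] [CommRing Q] [Algebra R Q] {V : Type u}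
    [AddCommGroup V] [Module Q V] [Module R V] [IsScalarTower R Q V] (e : V) :
    ResidueField Q →ₗ[R] Restr Q V 1 :=
  (Submodule.mapQ (nilradical Q) (nilFiltration Q V 1) (LinearMap.toSpanSingleton Q V e) (by
    intro q hq
    rw [Submodule.mem_comap, LinearMap.toSpanSingleton_apply, nilFiltration, pow_one]
    exact Submodule.smul_mem_smul hq trivial)).restrictScalars R

lemma residueToRestr_injective {g : Q} (h : IsMultipleRing Q n g) {e : V}
    (he : IsGenerator Q n e) : Function.Injective (residueToRestr R (Q := Q) e) := by
  rw [injective_iff_map_eq_zero]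
  intro q hq
  obtain ⟨q, rfl⟩ := Ideal.Quotient.mk_surjective q
  have h1 : q • e ∈ nilFiltration Q V 1 := (Submodule.Quotient.mk_eq_zero _).1 hq
  obtain ⟨v, hv⟩ := (mem_nilFiltration_iff h.nilradical_eq).1 h1
  obtain ⟨r, rfl⟩ := he.exists_smul_eq v
  have h2 : (q - g ^ 1 * r) • e = 0 := by rw [sub_smul, mul_smul, hv, sub_self]
  have h3 := Ideal.pow_le_self h.pos.ne' ((he.smul_eq_zero_iff _).1 h2)
  refine Ideal.Quotient.eq_zero_iff_mem.2 ?_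
  have h4 : g ^ 1 * r ∈ nilradical Q := h.mem_nilradical_iff.2 ⟨r, by rw [pow_one]⟩
  have := add_mem h3 h4
  rwa [sub_add_cancel] at this

lemma map_modPow_one_span (e : V) (q : Q) :
    (Submodule.span R {q • e}).map (modPow R (Q := Q) V 1) =
      (cyc R (Ideal.Quotient.mk (nilradical Q) q)).map (residueToRestr R e) := by
  rw [Submodule.map_span, Submodule.map_span, Set.image_singleton, Set.image_singleton]
  rfl

lemma idx_le_of_le {A A' B : Submodule R V} (hle : A' ≤ A) (hA : Commensurable A B)
    (hA' : Commensurable A' B) : idx A' B ≤ idx A B := by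
  have h1 := idx_add (hA.trans hA'.symm) hA'
  rw [idx_of_le hle] at h1
  linarith [Int.natCast_nonneg (relLength A A').toNat]

lemma eq_of_idx_eq {A A' B : Submodule R V} (hle : A' ≤ A) (hA : Commensurable A B)
    (hA' : Commensurable A' B) (h : idx A' B = idx A B) : A' = A := by
  have h1 := idx_add (hA.trans hA'.symm) hA'
  rw [idx_of_le hle, h] at h1
  have h2 : (relLength A A').toNat = 0 := by omega
  rw [ENat.toNat_eq_zero] at h2
  exact le_antisymm hle (relLength_eq_zero.1 (h2.resolve_right (hA.trans hA'.symm).1))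

variable [IsLocalRing R]

lemma commensurable_inf_range (h : IsMultipleLocalRing R n t y) (hQ : IsGenericLocalization R Q)
    {A B : Submodule R V} (hA : IsLattice Q A) (hB : IsLattice Q B) (j : ℕ) :
    Commensurable (A ⊓ LinearMap.range (powSMul V y j)) (B ⊓ LinearMap.range (powSMul V y j)) := by
  rw [← ker_modPow h.toIsMultipleRing hQ]
  exact (hA.commensurable h hQ hB).inf_ker _

/-- Reduction modulo `y ^ (j + 1)` splits the index into image and kernel. The kernel is the next
step of the filtration; the image is compared first with that of `y ^ j A`, which gives the lattice
index, and then with that of `y ^ j R e`, which gives the term independent of `j`. -/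
lemma idx_inf_range_step (h : IsMultipleLocalRing R n t y) (hQ : IsGenericLocalization R Q) {e : V}
    (he : IsGenerator Q n e) {A : Submodule R V} (hA : IsLattice Q A) {j : ℕ} (hj : j < n) :
    idx (A ⊓ LinearMap.range (powSMul V y j))
        (Submodule.span R {e} ⊓ LinearMap.range (powSMul V y j)) =
      (latticeIndex Q y A j).toNat +
        idx (A.map (modPow R (Q := Q) V 1))
          ((Submodule.span R {e}).map (modPow R (Q := Q) V 1)) +
        idx (A ⊓ LinearMap.range (powSMul V y (j + 1)))
          (Submodule.span R {e} ⊓ LinearMap.range (powSMul V y (j + 1))) := by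
  have hB : IsLattice Q (Submodule.span R {e}) := he.isLattice
  have hAB := hA.commensurable h hQ hB
  have hc := commensurable_inf_range h hQ hA hB j
  have hcm := hc.map (modPow R (Q := Q) V (j + 1))
  rw [span_singleton_inf_range_powSMul h.toIsMultipleRing hQ le_rfl he hj.le] at hcm
  have hcm' := (hAB.map (powSMul V y j)).map (modPow R (Q := Q) V (j + 1))
  rw [idx_map (modPow R (Q := Q) V (j + 1)) hc, ker_modPow h.toIsMultipleRing hQ,
    inf_assoc, inf_eq_right.2 (range_powSMul_succ_le j), inf_assoc,
    inf_eq_right.2 (range_powSMul_succ_le j),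
    span_singleton_inf_range_powSMul h.toIsMultipleRing hQ le_rfl he hj.le,
    ← idx_add (hcm.trans hcm'.symm) hcm',
    idx_of_le (Submodule.map_mono (map_powSMul_le A j)), ← Submodule.map_comp,
    ← Submodule.map_comp,
    idx_map_eq_of_ker_eq _ _ (ker_modPow_comp_powSMul h.toIsMultipleRing hQ he hj) hAB,
    Submodule.map_comp]
  rfl

lemma idx_inf_range (h : IsMultipleLocalRing R n t y) (hQ : IsGenericLocalization R Q) {e : V}
    (he : IsGenerator Q n e) {A : Submodule R V} (hA : IsLattice Q A) {i : ℕ} (hi : i ≤ n) :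
    idx (A ⊓ LinearMap.range (powSMul V y i))
        (Submodule.span R {e} ⊓ LinearMap.range (powSMul V y i)) =
      ∑ j ∈ Finset.Ico i n, ((latticeIndex Q y A j).toNat : ℤ) +
        ((n : ℤ) - i) * idx (A.map (modPow R (Q := Q) V 1))
          ((Submodule.span R {e}).map (modPow R (Q := Q) V 1)) := by
  induction hi using Nat.decreasingInduction with
  | self =>
    have : LinearMap.range (powSMul V y n) = ⊥ := by
      rw [powSMul, h.pow_eq_zero]
      refine LinearMap.range_eq_bot.2 (LinearMap.ext fun v => zero_smul _ _)
    rw [this, inf_bot_eq, inf_bot_eq, idx_self]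
    simp
  | of_succ j hj ih =>
    rw [idx_inf_range_step h hQ he hA hj, ih, Finset.sum_eq_sum_Ico_succ_bot hj]
    push_cast
    ring

/-- The index of the intersection of a lattice with a step of the canonical filtration. -/
theorem idx_inf_range_pow_smul (h : IsMultipleLocalRing R n t y) (hQ : IsGenericLocalization R Q)
    {g : Q} (hg : IsMultipleRing Q n g) {u : Q} (hu : u ∉ nilradical Q)
    (huy : algebraMap R Q y = u * g) {e : V} (he : IsGenerator Q n e) {A : Submodule R V}
    (hA : IsLattice Q A) {i : ℕ} (hi : i ≤ n) :
    Commensurable (A ⊓ LinearMap.range (powSMul V y i)) (Submodule.span R {g ^ i • e}) ∧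
    idx (A ⊓ LinearMap.range (powSMul V y i)) (Submodule.span R {g ^ i • e}) =
      ∑ j ∈ Finset.Ico i n, ((latticeIndex Q y A j).toNat : ℤ) +
        ((n : ℤ) - i) * (idx (A.map (modPow R (Q := Q) V 1))
          ((Submodule.span R {e}).map (modPow R (Q := Q) V 1)) +
          i * idx (cyc R (Ideal.Quotient.mk (nilradical Q) u)) (cyc R 1)) := by
  obtain ⟨v, rfl⟩ := IsMultipleRing.isUnit_of_notMem hQ hu
  have : (nilradical Q).IsPrime := hg.isPrime
  have hmk : Ideal.Quotient.mk (nilradical Q) (v : Q) ≠ 0 := fun h0 =>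
    hu (Ideal.Quotient.eq_zero_iff_mem.1 h0)
  -- Since `y` becomes `v * g`, this unit satisfies `y ^ i • v' • e = g ^ i • e`. The filtration
  -- formula is applied with the generator `v' • e`; replacing it by `e` modulo the nilradical costs
  -- the order of `v'`, which is the summand with the factor `i`.
  let v' : Qˣ := (v⁻¹) ^ i
  have hmk' : Ideal.Quotient.mk (nilradical Q) (v' : Q) ≠ 0 := fun h0 =>
    hg.isPrime.ne_top (Ideal.eq_top_of_isUnit_mem _ (Ideal.Quotient.eq_zero_iff_mem.1 h0) v'.isUnit)
  have he' := he.unit_smul v'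
  have hspan : Submodule.span R {v' • e} ⊓ LinearMap.range (powSMul V y i) =
      Submodule.span R {g ^ i • e} := by
    rw [span_singleton_inf_range_powSMul h.toIsMultipleRing hQ le_rfl he' hi, Submodule.map_span,
      Set.image_singleton]
    have : powSMul V y i (v' • e) = g ^ i • e := by
      change y ^ i • (v' : Q) • e = _
      rw [← algebraMap_smul Q (y ^ i), smul_smul, map_pow, huy]
      congr 1
      simp only [v', Units.val_pow_eq_pow_val]
      rw [← mul_pow, mul_right_comm, Units.mul_inv, one_mul]
    rw [this]
  have hc := commensurable_inf_range h hQ hA (he'.isLattice (R := R)) i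
  have h1 := idx_inf_range h hQ he' hA hi
  rw [hspan] at h1 hc
  refine ⟨hc, ?_⟩
  rw [h1]
  congr 2
  have hcA := (hA.commensurable h hQ (he.isLattice (R := R))).map (modPow R (Q := Q) V 1)
  have hce := ((he.isLattice (R := R)).commensurable h hQ (he'.isLattice (R := R))).map
    (modPow R (Q := Q) V 1)
  rw [← idx_add hcA hce]
  congr 1
  have h2 := map_modPow_one_span (R := R) e (1 : Q)
  have h3 := map_modPow_one_span (R := R) e (v' : Q)
  rw [one_smul] at h2
  change idx _ ((Submodule.span R {(v' : Q) • e}).map _) = _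
  rw [h2, h3, idx_map_of_injective (residueToRestr_injective hg he), map_one]
  change ordAt R (Ideal.Quotient.mk (nilradical Q) (v' : Q)) = _
  have h4 := idx_cyc_pow h hQ hmk hmk' i
  have h5 : Ideal.Quotient.mk (nilradical Q) (v : Q) ^ i *
      Ideal.Quotient.mk (nilradical Q) (v' : Q) = 1 := by
    simp only [v', Units.val_pow_eq_pow_val]
    rw [← map_pow, ← map_mul, ← mul_pow, Units.mul_inv, one_pow, map_one]
  have h6 := ordAt_mul h hQ (pow_ne_zero i hmk) hmk'
  have h7 : ordAt R (Ideal.Quotient.mk (nilradical Q) (v : Q) ^ i) =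
      - (i * idx (cyc R (Ideal.Quotient.mk (nilradical Q) (v : Q))) (cyc R 1)) := by
    have := idx_cyc_pow h hQ hmk (one_ne_zero : (1 : ResidueField Q) ≠ 0) i
    have h8 : ordAt R (1 : ResidueField Q) = 0 := idx_self _
    rw [h8, add_zero] at this
    rw [ordAt, idx_symm, this]
  rw [h5, h7] at h6
  have h8 : ordAt R (1 : ResidueField Q) = 0 := idx_self _
  rw [h8] at h6
  linarith

end FiltrationIndex

/-! ### Cotangent spaces of smooth curves -/

section SmoothCurve

lemma algebraMap_quotient_bijective {K B : Type*} [Field K] [IsAlgClosed K] [CommRing B]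
    [Algebra K B] [Algebra.FiniteType K B] (m : Ideal B) [m.IsMaximal] :
    Function.Bijective (algebraMap K (B ⧸ m)) := by
  let _ : Field (B ⧸ m) := Ideal.Quotient.field m
  have : Module.Finite K (B ⧸ m) := finite_of_finite_type_of_isJacobsonRing K (B ⧸ m)
  exact IsAlgClosed.algebraMap_bijective_of_isIntegral

/-- The maximal ideals of a smooth curve over an algebraically closed field are principal modulo
their square. -/
lemma exists_maximal_le_span_sup_sq {K B : Type*} [Field K] [IsAlgClosed K] [CommRing B]
    [Algebra K B] [h : Algebra.IsStandardSmoothOfRelativeDimension 1 K B] (m : Ideal B)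
    [m.IsMaximal] : ∃ t ∈ m, m ≤ Ideal.span {t} ⊔ m ^ 2 := by
  have : Algebra.IsStandardSmooth K B := h.isStandardSmooth
  have : Nontrivial B := ⟨0, 1, fun h01 => Ideal.IsPrime.ne_top (I := m) inferInstance
    ((Ideal.eq_top_iff_one m).2 (h01 ▸ m.zero_mem))⟩
  have hrank : Module.finrank B Ω[B⁄K] = 1 := by
    rw [Module.finrank, Algebra.IsStandardSmoothOfRelativeDimension.rank_kaehlerDifferential 1]
    simp
  have : Module.Finite B Ω[B⁄K] := Module.finite_of_finrank_eq_succ hrank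
  let bas := Module.finBasisOfFinrankEq B Ω[B⁄K] hrank
  let ω := bas 0
  have hω : ∀ v, ∃ c : B, c • ω = v := fun v => ⟨bas.repr v 0, by
    simpa using bas.sum_repr v⟩
  let E : K ≃ₐ[K] B ⧸ m := AlgEquiv.ofBijective (Algebra.ofId K _)
    (algebraMap_quotient_bijective m)
  let σ : B →ₐ[K] K := (E.symm : _ →ₐ[K] _).comp (Ideal.Quotient.mkₐ K m)
  have hσ : ∀ b, b - algebraMap K B (σ b) ∈ m := by
    intro b
    rw [← Ideal.Quotient.eq]
    exact (E.apply_symm_apply (Ideal.Quotient.mk m b)).symm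
  have hσm : ∀ b ∈ m, σ b = 0 := by
    intro b hb
    change E.symm (Ideal.Quotient.mk m b) = 0
    rw [Ideal.Quotient.eq_zero_iff_mem.2 hb, map_zero]
  -- The map sending `b` to the class of `b` minus its value at the point is a derivation. It
  -- factors through the differentials, which are generated by `ω`, so `m / m ^ 2` is spanned by the
  -- image of `ω`; the element `t` below lifts this image.
  let D₀ : B →ₗ[K] m.Cotangent :=
    { toFun := fun b => m.toCotangent ⟨b - algebraMap K B (σ b), hσ b⟩
      map_add' := fun a b => by
        rw [← map_add]
        congr 1
        ext
        simp only [map_add, Submodule.coe_add]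
        ring
      map_smul' := fun c b => by
        rw [← algebraMap_smul B c, ← algebraMap_smul B (RingHom.id K c), ← map_smul]
        congr 1
        ext
        simp only [smul_eq_mul, map_mul, AlgHom.commutes, Submodule.coe_smul, RingHom.id_apply,
          Algebra.algebraMap_self]
        ring }
  let D : Derivation K B m.Cotangent := Derivation.mk' D₀ fun a b => by
    change m.toCotangent _ = a • m.toCotangent _ + b • m.toCotangent _
    rw [← map_smul, ← map_smul, ← map_add, Ideal.toCotangent_eq, pow_two]
    have := Ideal.mul_mem_mul (m.neg_mem (hσ a)) (hσ b)
    convert this using 1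
    simp only [smul_eq_mul, map_mul, Submodule.coe_smul, Submodule.coe_add]
    ring
  obtain ⟨⟨t, ht⟩, htω⟩ := m.toCotangent_surjective (D.liftKaehlerDifferential ω)
  refine ⟨t, ht, fun x hx => ?_⟩
  obtain ⟨c, hc⟩ := hω (KaehlerDifferential.D K B x)
  have h1 : D x = m.toCotangent ⟨x, hx⟩ := by
    change m.toCotangent _ = _
    congr 1
    ext
    change x - algebraMap K B (σ x) = x
    rw [hσm x hx, map_zero, sub_zero]
  have h2 : m.toCotangent ⟨x, hx⟩ = m.toCotangent (c • ⟨t, ht⟩) := by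
    rw [← h1, ← D.liftKaehlerDifferential_comp_D, ← hc, map_smul, map_smul, htω]
  rw [Ideal.toCotangent_eq] at h2
  have h3 : x = c * t + (x - c * t) := by ring
  rw [h3]
  exact add_mem (Ideal.mem_sup_left (Ideal.mul_mem_left _ _ (Ideal.mem_span_singleton_self t)))
    (Ideal.mem_sup_right h2)

lemma maximalIdeal_isPrincipal_of_le {B S : Type*} [CommRing B] [CommRing S] [IsLocalRing S]
    [IsNoetherianRing S] [Algebra B S] (m : Ideal B) [m.IsPrime] [IsLocalization.AtPrime S m]
    {t : B} (ht : t ∈ m) (hm : m ≤ Ideal.span {t} ⊔ m ^ 2) :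
    IsLocalRing.maximalIdeal S = Ideal.span {algebraMap B S t} := by
  have h1 : m.map (algebraMap B S) = IsLocalRing.maximalIdeal S :=
    IsLocalization.AtPrime.map_eq_maximalIdeal m S
  have h2 := Ideal.map_mono (f := algebraMap B S) hm
  rw [Ideal.map_sup, Ideal.map_pow, h1, Ideal.map_span, Set.image_singleton, pow_two] at h2
  refine le_antisymm ?_ ?_
  · exact Submodule.le_of_le_smul_of_le_jacobson_bot (IsNoetherian.noetherian _)
      (IsLocalRing.jacobson_eq_maximalIdeal ⊥ bot_ne_top).ge h2
  · rw [Ideal.span_singleton_le_iff_mem, ← h1]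
    exact Ideal.mem_map_of_mem _ ht

end SmoothCurve

/-! ### Regular elements from Cohen-Macaulayness -/

section CohenMacaulay

variable {R : Type u} [CommRing R] [IsLocalRing R]

/-- An empty regular sequence would mean dimension zero, where the nilradical is the maximal ideal.
-/
lemma exists_regular_of_isCohenMacaulayLocal (h : IsCohenMacaulayLocal R)
    (hN : nilradical R ≠ IsLocalRing.maximalIdeal R) :
    ∃ a ∈ IsLocalRing.maximalIdeal R, ∀ r, a * r = 0 → r = 0 := by
  obtain ⟨rs, hm, hreg, hlen⟩ := h
  match rs, hm, hreg, hlen with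
  | [], _, _, hlen =>
    exfalso
    have : Ring.KrullDimLE 0 R := Ring.krullDimLE_iff.2 (by rw [← hlen]; simp)
    exact hN (Ring.KrullDimLE.nilradical_eq_maximalIdeal R)
  | a :: rs, hm, hreg, _ =>
    refine ⟨a, hm a (by simp), fun r hr => ?_⟩
    have h1 := ((RingTheory.Sequence.isRegular_cons_iff R a rs).1 hreg).1
    exact h1 (by simpa using hr)

lemma exists_uniformizer
    {D : Type*} [CommRing D] [IsDomain D] [IsLocalRing D] (φ : R →+* D)
    (hφ : Function.Surjective φ) (hker : RingHom.ker φ = nilradical R)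
    (hD : (IsLocalRing.maximalIdeal D).IsPrincipal)
    (hN : nilradical R ≠ IsLocalRing.maximalIdeal R) :
    ∃ t ∉ nilradical R, IsLocalRing.maximalIdeal D = Ideal.span {φ t} ∧
      ∀ r ∈ IsLocalRing.maximalIdeal R, ∃ c, r - t * c ∈ nilradical R := by
  obtain ⟨⟨t', ht'⟩⟩ := hD
  obtain ⟨t, rfl⟩ := hφ t'
  have hlocal : IsLocalHom φ := .of_surjective φ hφ
  have hmem : ∀ r, φ r = 0 ↔ r ∈ nilradical R := fun r => by rw [← hker, RingHom.mem_ker]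
  have hprime : (nilradical R).IsPrime := hker ▸ RingHom.ker_isPrime φ
  have hmax : ∀ r ∈ IsLocalRing.maximalIdeal R, ∃ c, r - t * c ∈ nilradical R := by
    intro r hr
    have h1 : φ r ∈ IsLocalRing.maximalIdeal D := map_mem_nonunits_iff φ r |>.2 hr
    rw [ht'] at h1
    obtain ⟨c, hc⟩ := Ideal.mem_span_singleton.1 h1
    obtain ⟨c, rfl⟩ := hφ c
    exact ⟨c, by rw [← hmem, map_sub, map_mul, hc, sub_self]⟩
  have ht : t ∉ nilradical R := by
    intro ht
    refine hN (le_antisymm (IsLocalRing.le_maximalIdeal hprime.ne_top) fun r hr => ?_)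
    obtain ⟨c, hc⟩ := hmax r hr
    have := add_mem hc (Ideal.mul_mem_right c _ ht)
    rwa [sub_add_cancel] at this
  exact ⟨t, ht, ht', hmax⟩

/-- Cohen-Macaulayness of multiple curves: elements that are not nilpotent are not zero divisors. -/
theorem eq_zero_of_mul_eq_zero_of_isCohenMacaulayLocal [IsNoetherianRing R]
    {D : Type*} [CommRing D] [IsDomain D] [IsLocalRing D] (φ : R →+* D)
    (hφ : Function.Surjective φ) (hker : RingHom.ker φ = nilradical R)
    (hD : (IsLocalRing.maximalIdeal D).IsPrincipal)
    (hN : nilradical R ≠ IsLocalRing.maximalIdeal R)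
    (hCM : IsCohenMacaulayLocal R) {s : R} (hs : s ∉ nilradical R) {r : R} (hsr : s * r = 0) :
    r = 0 := by
  have hDN : IsNoetherianRing D := isNoetherianRing_of_surjective R D φ hφ
  obtain ⟨t, ht, ht', hmax⟩ := exists_uniformizer φ hφ hker hD hN
  have hmem : ∀ r, φ r = 0 ↔ r ∈ nilradical R := fun r => by rw [← hker, RingHom.mem_ker]
  obtain ⟨a, ha, hareg⟩ := exists_regular_of_isCohenMacaulayLocal hCM hN
  have hpow : ∀ k : ℕ, ∀ r, a ^ k * r = 0 → r = 0 := by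
    intro k
    induction k with
    | zero => intro r hr; simpa using hr
    | succ k ih => intro r hr; exact hareg _ (ih _ (by rw [← hr]; ring))
  have hφs : φ s ≠ 0 := fun h0 => hs ((hmem s).1 h0)
  -- By Krull's intersection theorem the non-zero `φ s` has finite order, so it divides a power of
  -- the uniformizer `φ t`.
  obtain ⟨k, hk⟩ : ∃ k, φ s ∉ IsLocalRing.maximalIdeal D ^ k := by
    by_contra! hall
    have h0 : φ s ∈ (⨅ k, IsLocalRing.maximalIdeal D ^ k : Ideal D) := by
      rw [Ideal.mem_iInf]; exact hall
    rw [Ideal.iInf_pow_eq_bot_of_isLocalRing _ (Ideal.IsPrime.ne_top inferInstance)] at h0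
    exact hφs h0
  have hdvd : φ s ∣ φ t ^ k := by
    clear hsr
    have key : ∀ k : ℕ, ∀ d : D, d ∉ IsLocalRing.maximalIdeal D ^ k → d ∣ φ t ^ k := by
      intro k
      induction k with
      | zero => intro d hd; simp at hd
      | succ k ih =>
        intro d hd
        by_cases hd' : d ∈ IsLocalRing.maximalIdeal D
        · have hd2 := hd'
          rw [ht'] at hd2
          obtain ⟨c, rfl⟩ := Ideal.mem_span_singleton.1 hd2
          have hc : c ∉ IsLocalRing.maximalIdeal D ^ k := fun hc => hd (by
            rw [pow_succ']
            refine Ideal.mul_mem_mul ?_ hc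
            rw [ht']; exact Ideal.mem_span_singleton_self _)
          rw [pow_succ']
          exact mul_dvd_mul_left _ (ih c hc)
        · rw [IsLocalRing.mem_maximalIdeal, mem_nonunits_iff, not_not] at hd'
          exact hd'.dvd
    exact key k _ hk
  obtain ⟨c, hc⟩ := hdvd
  obtain ⟨c, rfl⟩ := hφ c
  obtain ⟨d, hd⟩ := hmax a ha
  -- Modulo the nilradical `a` is a multiple of `t`, so `a ^ k` is a multiple of `s`. A further
  -- power removes the nilpotent error: `s` divides a power of the regular element `a`, and is
  -- therefore regular.
  have h1 : a ^ k - s * (c * d ^ k) ∈ nilradical R := by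
    rw [← hmem] at hd ⊢
    rw [map_sub, map_mul, sub_eq_zero] at hd
    rw [map_sub, map_pow, hd, mul_pow, hc, map_mul, map_mul, map_pow]
    ring
  obtain ⟨M, hM⟩ := mem_nilradical.1 h1
  have h2 : s ∣ a ^ (k * M) := by
    have h3 := sub_dvd_pow_sub_pow (a ^ k - s * (c * d ^ k)) (a ^ k) M
    rw [hM, zero_sub, ← pow_mul, dvd_neg] at h3
    refine Dvd.dvd.trans ⟨-(c * d ^ k), by ring⟩ h3
  obtain ⟨e, he⟩ := h2
  refine hpow (k * M) r ?_
  rw [he, mul_right_comm, hsr, zero_mul]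

/-- The local structure of a primitive multiple curve at a closed point. -/
theorem exists_isMultipleLocalRing [IsNoetherianRing R] {n : ℕ} {y : R}
    (hy : nilradical R = Ideal.span {y}) (hyn : y ^ n = 0) (hyn' : y ^ (n - 1) ≠ 0) (hn : 0 < n)
    {D : Type*} [CommRing D] [IsDomain D] [IsLocalRing D] (φ : R →+* D)
    (hφ : Function.Surjective φ) (hker : RingHom.ker φ = nilradical R)
    (hD : (IsLocalRing.maximalIdeal D).IsPrincipal)
    (hN : nilradical R ≠ IsLocalRing.maximalIdeal R) (hCM : IsCohenMacaulayLocal R) :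
    ∃ t, IsMultipleLocalRing R n t y := by
  obtain ⟨t, ht, ht', hmax⟩ := exists_uniformizer φ hφ hker hD hN
  have hprime : (nilradical R).IsPrime := hker ▸ RingHom.ker_isPrime φ
  have hlocal : IsLocalHom φ := .of_surjective φ hφ
  refine ⟨t, ⟨hy, hyn, hyn', hn, hprime, fun s hs r hsr =>
    eq_zero_of_mul_eq_zero_of_isCohenMacaulayLocal φ hφ hker hD hN hCM hs hsr⟩,
    inferInstance, ?_, ht⟩
  refine le_antisymm (fun r hr => ?_) ?_
  · obtain ⟨c, hc⟩ := hmax r hr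
    rw [hy] at hc
    obtain ⟨b, hb⟩ := Ideal.mem_span_singleton.1 hc
    refine Ideal.mem_span_pair.2 ⟨c, b, ?_⟩
    linear_combination -hb
  · rw [Ideal.span_le]
    rintro r (rfl | hr)
    · have : φ r ∈ IsLocalRing.maximalIdeal D := by
        rw [ht']; exact Ideal.mem_span_singleton_self _
      exact (map_mem_nonunits_iff φ r).1 this
    · rw [Set.mem_singleton_iff.1 hr]
      have : y ∈ nilradical R := by rw [hy]; exact Ideal.mem_span_singleton_self _
      exact IsLocalRing.le_maximalIdeal hprime.ne_top this

end CohenMacaulay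

/-! ### The reduced subscheme and its stalks -/

section ReducedCurve

variable {X : Scheme.{u}}

/-- The reduced subscheme. -/
abbrev reducedSubscheme (X : Scheme.{u}) : Scheme.{u} := X.nilradical.subscheme

/-- The inclusion of the reduced subscheme. -/
abbrev reducedι (X : Scheme.{u}) : reducedSubscheme X ⟶ X := X.nilradical.subschemeι

lemma nilradical_ideal (U : X.affineOpens) :
    X.nilradical.ideal U = nilradical Γ(X, U) := by
  change ((⊥ : X.IdealSheafData).radical).ideal U = _
  rw [Scheme.IdealSheafData.radical_ideal, Scheme.IdealSheafData.ideal_bot]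
  rfl

instance : IsReduced (reducedSubscheme X) := by
  have (i : X.affineOpens) : IsReduced (X.nilradical.subschemeCover.openCover.X i) := by
    have : _root_.IsReduced (Γ(X, i) ⧸ X.nilradical.ideal i) := by
      rw [← Ideal.isRadical_iff_quotient_reduced, nilradical_ideal]
      exact Ideal.radical_isRadical _
    exact inferInstanceAs (IsReduced (Spec (.of (Γ(X, i) ⧸ X.nilradical.ideal i))))
  exact @IsReduced.of_openCover _ X.nilradical.subschemeCover.openCover this

lemma reducedι_surjective : Function.Surjective (reducedι X) := by
  rw [← Set.range_eq_univ, Scheme.IdealSheafData.range_subschemeι, Scheme.support_nilradical]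
  rfl

lemma reducedι_isHomeomorph : IsHomeomorph (reducedι X) :=
  isHomeomorph_iff_isEmbedding_surjective.2
    ⟨(reducedι X).isEmbedding, reducedι_surjective⟩

instance [IrreducibleSpace X] : IsIntegral (reducedSubscheme X) := by
  have : IrreducibleSpace (reducedSubscheme X) :=
    Function.Surjective.irreducibleSpace
      (f := (reducedι_isHomeomorph (X := X)).homeomorph.symm) (Homeomorph.continuous _)
      (Homeomorph.surjective _)
  exact isIntegral_of_irreducibleSpace_of_isReduced _

/-- A germ that dies on the reduced curve dies on a neighbourhood there, which contains the preimage
of an affine open set of `X`; over it the kernel of restriction is the nilradical. Conversely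
nilpotents die because the target is reduced. -/
lemma reducedι_ker_stalkMap (c : reducedSubscheme X) :
    RingHom.ker ((reducedι X).stalkMap c).hom = nilradical (X.presheaf.stalk (reducedι X c)) := by
  apply le_antisymm
  · intro r hr
    obtain ⟨U, hU, hcU, a, rfl⟩ : ∃ U : X.Opens, IsAffineOpen U ∧ ∃ hcU : reducedι X c ∈ U,
        ∃ a, X.presheaf.germ U (reducedι X c) hcU a = r := by
      obtain ⟨U, hcU, a, rfl⟩ := X.presheaf.exists_germ_eq r
      obtain ⟨V, hV, hcV, hVU⟩ := exists_isAffineOpen_mem_and_subset hcU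
      exact ⟨V, hV, hcV, X.presheaf.map (homOfLE hVU).op a, X.presheaf.germ_res_apply _ _ _ _⟩
    have h0 : (reducedSubscheme X).presheaf.germ (reducedι X ⁻¹ᵁ U) c hcU ((reducedι X).app U a) =
        (reducedSubscheme X).presheaf.germ (reducedι X ⁻¹ᵁ U) c hcU 0 := by
      rw [map_zero, ← Scheme.Hom.germ_stalkMap_apply]
      exact hr
    obtain ⟨W, hcW, i, j, hW⟩ := (reducedSubscheme X).presheaf.germ_eq c hcU hcU _ _ h0
    obtain ⟨W', hW', hWW'⟩ := (reducedι X).isEmbedding.isOpen_iff.1 W.2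
    have hcW' : reducedι X c ∈ (⟨W', hW'⟩ ⊓ U : X.Opens) :=
      ⟨show c ∈ reducedι X ⁻¹' W' by rw [hWW']; exact hcW, hcU⟩
    obtain ⟨V, hV, hcV, hVU⟩ := exists_isAffineOpen_mem_and_subset hcW'
    have hVU' : V ≤ U := fun z hz => (hVU hz).2
    have hVW : reducedι X ⁻¹ᵁ V ≤ W := fun z hz => by
      have : z ∈ reducedι X ⁻¹' W' := (hVU hz).1
      rwa [hWW'] at this
    have h1 : (reducedι X).app V (X.presheaf.map (homOfLE hVU').op a) = 0 := by
      have h2 := congr((reducedSubscheme X).presheaf.map (homOfLE hVW).op $hW)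
      rw [map_zero, map_zero, ← ConcreteCategory.comp_apply, ← Functor.map_comp] at h2
      rw [← ConcreteCategory.comp_apply, (reducedι X).naturality, ConcreteCategory.comp_apply]
      exact h2
    have h2 : X.presheaf.map (homOfLE hVU').op a ∈ nilradical Γ(X, V) := by
      rw [← nilradical_ideal ⟨V, hV⟩, ← Scheme.IdealSheafData.ker_subschemeι_app]
      exact h1
    have h3 := (mem_nilradical.1 h2).map (X.presheaf.germ V (reducedι X c) hcV).hom
    rw [mem_nilradical]
    convert h3
    exact (X.presheaf.germ_res_apply (homOfLE hVU') _ hcV a).symm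
  · intro r hr
    have : _root_.IsReduced ((reducedSubscheme X).presheaf.stalk c) := inferInstance
    exact (((mem_nilradical.1 hr).map ((reducedι X).stalkMap c).hom)).eq_zero

lemma reducedι_stalkMap_surjective (c : reducedSubscheme X) :
    Function.Surjective ((reducedι X).stalkMap c) := (reducedι X).stalkMap_surjective c

end ReducedCurve

/-! ### Uniformizers on smooth curves over an algebraically closed field -/

section Smooth

variable {K : Type u} [Field K]

lemma exists_standardSmooth_nhd {C : Scheme.{u}} (f : C ⟶ Spec (CommRingCat.of K))
    [hf : SmoothOfRelativeDimension 1 f] (c : C) :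
    ∃ (V : C.Opens) (_ : IsAffineOpen V) (_ : c ∈ V) (φ : K →+* Γ(C, V)),
      φ.IsStandardSmoothOfRelativeDimension 1 ∧
      φ = (f.appLE ⊤ V le_top).hom.comp (Scheme.ΓSpecIso (CommRingCat.of K)).inv.hom := by
  obtain ⟨U, hU, V, hV, hcV, e, h⟩ := hf.exists_isStandardSmoothOfRelativeDimension c
  -- The spectrum of a field has one point, so the non-empty open set `U` of the base is everything.
  have hUtop : U = ⊤ := by
    ext z
    refine ⟨fun _ => trivial, fun _ => ?_⟩
    have : z = f c := Subsingleton.elim (α := PrimeSpectrum K) _ _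
    rw [this]
    exact e hcV
  subst hUtop
  refine ⟨V, hV, hcV, _, ?_, rfl⟩
  have h1 : (Scheme.ΓSpecIso (CommRingCat.of K)).inv.hom.IsStandardSmoothOfRelativeDimension 0 :=
    RingHom.IsStandardSmoothOfRelativeDimension.equiv
      (Scheme.ΓSpecIso (CommRingCat.of K)).commRingCatIsoToRingEquiv.symm
  exact h.comp h1

lemma maximalIdeal_stalk_isPrincipal [IsAlgClosed K] {C : Scheme.{u}} (f : C ⟶ Spec (CommRingCat.of K))
    [SmoothOfRelativeDimension 1 f] [IsLocallyNoetherian C] {c : C} (hc : IsClosed {c}) :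
    (IsLocalRing.maximalIdeal (C.presheaf.stalk c)).IsPrincipal := by
  obtain ⟨V, hV, hcV, φ, hφ, -⟩ := exists_standardSmooth_nhd f c
  let _ := φ.toAlgebra
  have : Algebra.IsStandardSmoothOfRelativeDimension 1 K Γ(C, V) := hφ
  have hmax := hV.primeIdealOf_isMaximal_of_isClosed ⟨c, hcV⟩ hc
  obtain ⟨t, ht, hle⟩ := exists_maximal_le_span_sup_sq (K := K) (hV.primeIdealOf ⟨c, hcV⟩).asIdeal
  have := hV.isLocalization_stalk ⟨c, hcV⟩
  let _ : Algebra Γ(C, V) (C.presheaf.stalk c) :=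
    TopCat.Presheaf.algebra_section_stalk C.presheaf ⟨c, hcV⟩
  exact ⟨_, maximalIdeal_isPrincipal_of_le _ ht hle⟩

end Smooth

/-! ### The generic stalk as a localization of the other stalks -/

section GenericLocalization

/-- Both rings are localizations of `A`, at `p` and at its nilradical. Elements outside the
nilradical of `A` become regular in `R` by hypothesis, which gives injectivity. -/
lemma isGenericLocalization_of_isLocalization {A R Q : Type*} [CommRing A] [CommRing R]
    [CommRing Q] [Algebra A R] [Algebra A Q] [Algebra R Q] [IsScalarTower A R Q] (p q : Ideal A)
    [p.IsPrime] [q.IsPrime] (hq : q = nilradical A) [IsLocalization.AtPrime R p]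
    [IsLocalization.AtPrime Q q] (hR : ∀ s ∉ nilradical R, ∀ r, s * r = 0 → r = 0) :
    IsGenericLocalization R Q := by
  have hA : ∀ a : A, a ∉ q → algebraMap A R a ∉ nilradical R := by
    intro a ha h0
    have h1 : IsUnit (algebraMap A Q a) := IsLocalization.map_units Q (⟨a, ha⟩ : q.primeCompl)
    rw [IsScalarTower.algebraMap_apply A R Q] at h1
    have h2 := (mem_nilradical.1 h0).map (algebraMap R Q)
    have : Nontrivial Q := (IsLocalization.AtPrime.isLocalRing Q q).toNontrivial
    exact h2.not_isUnit h1
  refine ⟨?_, ?_, ?_⟩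
  · intro s hs
    obtain ⟨⟨a, b⟩, hab⟩ := IsLocalization.surj p.primeCompl s
    have hbu : IsUnit (algebraMap A R b) := IsLocalization.map_units R b
    have ha : a ∉ q := by
      intro ha
      rw [hq] at ha
      have h1 : algebraMap A R a ∈ nilradical R := (mem_nilradical.1 ha).map (algebraMap A R)
      rw [← hab] at h1
      obtain ⟨v, hv⟩ := hbu
      have h2 := Ideal.mul_mem_right (↑v⁻¹ : R) _ h1
      rw [mul_assoc, ← hv, Units.mul_inv, mul_one] at h2
      exact hs h2
    have h1 : IsUnit (algebraMap A Q a) := IsLocalization.map_units Q (⟨a, ha⟩ : q.primeCompl)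
    have h2 := congrArg (algebraMap R Q) hab
    rw [map_mul, ← IsScalarTower.algebraMap_apply, ← IsScalarTower.algebraMap_apply] at h2
    rw [← h2] at h1
    exact isUnit_of_mul_isUnit_left h1
  · intro x
    obtain ⟨⟨a, b⟩, hab⟩ := IsLocalization.surj q.primeCompl x
    refine ⟨algebraMap A R b, hA _ b.2, algebraMap A R a, ?_⟩
    rw [← IsScalarTower.algebraMap_apply, ← IsScalarTower.algebraMap_apply, mul_comm]
    exact hab
  · rw [injective_iff_map_eq_zero]
    intro r hr
    obtain ⟨⟨a, b⟩, hab⟩ := IsLocalization.surj p.primeCompl r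
    have h2 := congrArg (algebraMap R Q) hab
    rw [map_mul, hr, zero_mul, ← IsScalarTower.algebraMap_apply] at h2
    obtain ⟨c, hc⟩ := (IsLocalization.map_eq_zero_iff q.primeCompl Q a).1 h2.symm
    have h3 : algebraMap A R a = 0 := hR _ (hA _ c.2) _ (by rw [← map_mul, hc, map_zero])
    have hbu : IsUnit (algebraMap A R b) := IsLocalization.map_units R b
    have h4 : r * algebraMap A R b = 0 := hab.trans h3
    exact (hbu.mul_left_eq_zero).1 h4

variable {X : Scheme.{u}}

lemma nilradical_stalk_eq {U : X.Opens} (hU : IsAffineOpen U) {x : X} (hx : x ∈ U) {y : Γ(X, U)}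
    (hy : nilradical Γ(X, U) = Ideal.span {y}) :
    nilradical (X.presheaf.stalk x) = Ideal.span {X.presheaf.germ U x hx y} := by
  let _ : Algebra Γ(X, U) (X.presheaf.stalk x) :=
    TopCat.Presheaf.algebra_section_stalk X.presheaf ⟨x, hx⟩
  have h1 := hU.isLocalization_stalk ⟨x, hx⟩
  have h2 := IsLocalization.map_radical (hU.primeIdealOf ⟨x, hx⟩).asIdeal.primeCompl
    (X.presheaf.stalk x) (⊥ : Ideal Γ(X, U))
  rw [Ideal.map_bot] at h2
  change (nilradical Γ(X, U)).map _ = nilradical _ at h2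
  rw [← h2, hy, Ideal.map_span, Set.image_singleton]
  rfl

variable [IrreducibleSpace X]

lemma genericPoint_mem {U : X.Opens} {x : X} (hx : x ∈ U) : genericPoint X ∈ U :=
  (genericPoint_specializes' x).mem_open U.2 hx

/-- A section that is not invertible at `η` has empty basic open set, so it is nilpotent on the
affine open set. -/
lemma primeIdealOf_genericPoint_eq {U : X.Opens} (hU : IsAffineOpen U)
    (h : genericPoint X ∈ U) :
    (hU.primeIdealOf ⟨genericPoint X, h⟩).asIdeal = nilradical Γ(X, U) := by
  apply le_antisymm
  · intro a ha
    have h1 := hU.isLocalization_stalk ⟨genericPoint X, h⟩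
    let _ : Algebra Γ(X, U) (X.presheaf.stalk (genericPoint X)) :=
      TopCat.Presheaf.algebra_section_stalk X.presheaf ⟨genericPoint X, h⟩
    have h2 : genericPoint X ∉ X.basicOpen a := by
      intro h3
      rw [X.mem_basicOpen a _ h] at h3
      have h4 := (IsLocalization.AtPrime.to_map_mem_maximal_iff
        (X.presheaf.stalk (genericPoint X)) _ a).2 ha
      exact h4 h3
    have h3 : X.basicOpen a = ⊥ := by
      ext z
      exact ⟨fun hz => h2 (genericPoint_mem hz), fun hz => hz.elim⟩
    exact mem_nilradical.2 ((Scheme.isNilpotent_iff_basicOpen_eq_bot_of_isCompact hU.isCompact a).2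
      h3)
  · exact nilradical_le_prime _

lemma ringToGeneric_germ {U : X.Opens} {x : X} (hx : x ∈ U) (a : Γ(X, U)) :
    ringToGeneric x (X.presheaf.germ U x hx a) =
      X.presheaf.germ U (genericPoint X) (genericPoint_mem hx) a :=
  TopCat.Presheaf.germ_stalkSpecializes_apply X.presheaf hx (genericPoint_specializes' x) a

/-- The generic stalk as an algebra over the stalks. -/
abbrev genericAlgebra (x : X) :
    Algebra (X.presheaf.stalk x) (X.presheaf.stalk (genericPoint X)) := (ringToGeneric x).toAlgebra

lemma isGenericLocalization_stalk (x : X)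
    (hR : ∀ s ∉ nilradical (X.presheaf.stalk x), ∀ r, s * r = 0 → r = 0) :
    letI := genericAlgebra x
    IsGenericLocalization (X.presheaf.stalk x) (X.presheaf.stalk (genericPoint X)) := by
  let _ := genericAlgebra x
  obtain ⟨U, hU, hx, -⟩ := exists_isAffineOpen_mem_and_subset (Opens.mem_top x)
  let _ : Algebra Γ(X, U) (X.presheaf.stalk (genericPoint X)) :=
    TopCat.Presheaf.algebra_section_stalk X.presheaf ⟨genericPoint X, genericPoint_mem hx⟩
  let _ : Algebra Γ(X, U) (X.presheaf.stalk x) :=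
    TopCat.Presheaf.algebra_section_stalk X.presheaf ⟨x, hx⟩
  have : IsScalarTower Γ(X, U) (X.presheaf.stalk x) (X.presheaf.stalk (genericPoint X)) :=
    .of_algebraMap_eq fun a => (ringToGeneric_germ hx a).symm
  have h1 := hU.isLocalization_stalk ⟨x, hx⟩
  have h2 := hU.isLocalization_stalk ⟨genericPoint X, genericPoint_mem hx⟩
  exact isGenericLocalization_of_isLocalization (hU.primeIdealOf ⟨x, hx⟩).asIdeal
    (hU.primeIdealOf ⟨genericPoint X, genericPoint_mem hx⟩).asIdeal
    (primeIdealOf_genericPoint_eq hU (genericPoint_mem hx)) hR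

end GenericLocalization

/-! ### Points and local rings of primitive multiple curves -/

section PrimitiveMultipleCurve

/-- Primes of `R` are primes of `D`, a local principal ideal domain, in which every non-zero prime
is maximal. -/
lemma eq_nilradical_or_eq_maximalIdeal {R D : Type*} [CommRing R] [IsLocalRing R]
    [IsNoetherianRing R] [CommRing D] [IsDomain D] [IsLocalRing D] (φ : R →+* D)
    (hφ : Function.Surjective φ) (hker : RingHom.ker φ = nilradical R)
    (hD : (IsLocalRing.maximalIdeal D).IsPrincipal) (P : Ideal R) [hP : P.IsPrime] :
    P = nilradical R ∨ P = IsLocalRing.maximalIdeal R := by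
  have hDN : IsNoetherianRing D := isNoetherianRing_of_surjective R D φ hφ
  have hPk : RingHom.ker φ ≤ P := hker ▸ nilradical_le_prime P
  have hmap : (P.map φ).IsPrime := Ideal.map_isPrime_of_surjective hφ hPk
  have hcomap : (P.map φ).comap φ = P := by
    rw [Ideal.comap_map_of_surjective' φ hφ, sup_eq_left.2 hPk]
  by_cases h0 : P.map φ = ⊥
  · left
    rw [← hcomap, h0, ← hker]; rfl
  · right
    have hPID : IsPrincipalIdealRing D :=
      ((tfae_of_isNoetherianRing_of_isLocalRing_of_isDomain D).out 4 0).1 hD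
    have h1 : (P.map φ).IsMaximal := IsPrime.to_maximal_ideal h0
    have h2 : P.IsMaximal := by
      rw [← hcomap]; exact Ideal.comap_isMaximal_of_surjective φ hφ
    exact IsLocalRing.eq_maximalIdeal h2

variable {K : Type u} [Field K] {X : Scheme.{u}} {s : X ⟶ Spec (CommRingCat.of K)} {n : ℕ}

lemma IsPrimitiveMultipleCurve.isNoetherian (hX : IsPrimitiveMultipleCurve K X s n) :
    IsNoetherian X := by
  have := hX.locallyOfFiniteType
  have := hX.quasiCompact
  have h1 : IsLocallyNoetherian X := LocallyOfFiniteType.isLocallyNoetherian s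
  have h2 : CompactSpace X := (quasiCompact_iff_compactSpace s).1 inferInstance
  exact ⟨⟩

lemma IsPrimitiveMultipleCurve.isLocallyNoetherian_reduced
    (hX : IsPrimitiveMultipleCurve K X s n) : IsLocallyNoetherian (reducedSubscheme X) := by
  have := hX.isNoetherian
  exact LocallyOfFiniteType.isLocallyNoetherian (reducedι X)

lemma exists_isClosed_specializes [CompactSpace X] (x : X) : ∃ z : X, x ⤳ z ∧ IsClosed {z} := by
  obtain ⟨z, hz, hz'⟩ := IsClosed.exists_closed_singleton (S := closure {x}) isClosed_closure
    ⟨x, subset_closure rfl⟩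
  exact ⟨z, specializes_iff_mem_closure.2 hz, hz'⟩

lemma IsPrimitiveMultipleCurve.exists_generator (hX : IsPrimitiveMultipleCurve K X s n) (x : X) :
    ∃ (U : X.Opens) (_ : IsAffineOpen U) (_ : x ∈ U) (y : Γ(X, U)),
      nilradical Γ(X, U) = Ideal.span {y} := by
  obtain ⟨U, hxU, ⟨⟨y, hy⟩⟩⟩ := hX.locallyPrincipal x
  exact ⟨U.1, U.2, hxU, y, by rw [← nilradical_ideal U]; exact hy⟩

lemma IsPrimitiveMultipleCurve.pow_eq_zero (hX : IsPrimitiveMultipleCurve K X s n) {U : X.Opens}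
    (hU : IsAffineOpen U) {y : Γ(X, U)} (hy : y ∈ nilradical Γ(X, U)) : y ^ n = 0 := by
  have h0 : X.nilradical ^ n = ⊥ := hX.multiplicity.1
  have h1 := congr(($h0).ideal ⟨U, hU⟩)
  rw [Scheme.IdealSheafData.ideal_pow, Scheme.IdealSheafData.ideal_bot] at h1
  change X.nilradical.ideal ⟨U, hU⟩ ^ n = ⊥ at h1
  rw [nilradical_ideal] at h1
  have := Ideal.pow_mem_pow hy n
  rwa [h1] at this

variable [IrreducibleSpace X]

lemma IsPrimitiveMultipleCurve.pos (hX : IsPrimitiveMultipleCurve K X s n) : 0 < n := by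
  rcases Nat.eq_zero_or_pos n with rfl | h
  · exfalso
    have h0 : X.nilradical ^ 0 = ⊥ := hX.multiplicity.1
    obtain ⟨U, hU, hxU, -⟩ := exists_isAffineOpen_mem_and_subset (Opens.mem_top (genericPoint X))
    have h1 := congr(($h0).ideal ⟨U, hU⟩)
    rw [Scheme.IdealSheafData.ideal_pow, Scheme.IdealSheafData.ideal_bot] at h1
    have h2 : (⊤ : Ideal Γ(X, U)) = ⊥ := by
      rw [← Ideal.one_eq_top]
      exact h1
    have : Nonempty U := ⟨⟨_, hxU⟩⟩
    exact top_ne_bot h2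
  · exact h

/-- The local rings of the reduced curve. -/
lemma IsPrimitiveMultipleCurve.exists_surjective [IsAlgClosed K]
    (hX : IsPrimitiveMultipleCurve K X s n) {x : X} (hx : IsClosed {x}) :
    ∃ (D : Type u) (_ : CommRing D) (_ : IsDomain D) (_ : IsLocalRing D)
      (φ : X.presheaf.stalk x →+* D), Function.Surjective φ ∧
      RingHom.ker φ = nilradical (X.presheaf.stalk x) ∧
      (IsLocalRing.maximalIdeal D).IsPrincipal := by
  have := hX.isLocallyNoetherian_reduced
  have := hX.smooth
  obtain ⟨c, rfl⟩ := reducedι_surjective x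
  have hc : IsClosed {c} := by
    have := hx.preimage (reducedι X).continuous
    rwa [← Set.image_singleton, Set.preimage_image_eq _ (reducedι X).isEmbedding.injective] at this
  exact ⟨(reducedSubscheme X).presheaf.stalk c, inferInstance, inferInstance, inferInstance,
    ((reducedι X).stalkMap c).hom, reducedι_stalkMap_surjective c, reducedι_ker_stalkMap c,
    maximalIdeal_stalk_isPrincipal (reducedι X ≫ s) hc⟩

variable [IsAlgClosed K]

lemma IsPrimitiveMultipleCurve.eq_of_specializes (hX : IsPrimitiveMultipleCurve K X s n) {z : X}
    (hz : IsClosed {z}) {x : X} (hxz : x ⤳ z) : x = z ∨ x = genericPoint X := by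
  have := hX.isNoetherian
  obtain ⟨D, _, _, _, φ, hφ, hker, hD⟩ := hX.exists_surjective hz
  have key : ∀ x, x ⤳ z → x = z ∨ ∃ p : Spec (X.presheaf.stalk z), X.fromSpecStalk z p = x ∧
      p.asIdeal = nilradical (X.presheaf.stalk z) := by
    intro x hxz
    have hmem : x ∈ Set.range (X.fromSpecStalk z) := by
      rw [Scheme.range_fromSpecStalk]; exact hxz
    obtain ⟨p, rfl⟩ := hmem
    have hp := p.isPrime
    rcases eq_nilradical_or_eq_maximalIdeal φ hφ hker hD p.asIdeal with h | h
    · exact Or.inr ⟨p, rfl, h⟩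
    · left
      have : p = IsLocalRing.closedPoint _ := PrimeSpectrum.ext h
      rw [this, Scheme.fromSpecStalk_closedPoint]
  rcases key x hxz with h | ⟨p, hp, hp'⟩
  · exact Or.inl h
  rcases key _ (genericPoint_specializes' z) with h | ⟨q, hq, hq'⟩
  · left
    rw [← h] at hz
    have h1 : genericPoint X ⤳ x := genericPoint_specializes' x
    have h2 := h1.mem_closed hz rfl
    rw [Set.mem_singleton_iff.1 h2, h]
  · right
    rw [← hp, ← hq]
    congr 1
    exact PrimeSpectrum.ext (hp'.trans hq'.symm)

lemma IsPrimitiveMultipleCurve.isClosed_or_eq_genericPoint (hX : IsPrimitiveMultipleCurve K X s n)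
    (x : X) : IsClosed {x} ∨ x = genericPoint X := by
  have := hX.isNoetherian
  obtain ⟨z, hxz, hz⟩ := exists_isClosed_specializes x
  rcases hX.eq_of_specializes hz hxz with rfl | h
  · exact Or.inl hz
  · exact Or.inr h

/-- A closed set in a Noetherian space is a finite union of irreducible closed sets. Each has a
generic point, and that point is closed because it is not `η`. -/
lemma IsPrimitiveMultipleCurve.finite_of_isClosed (hX : IsPrimitiveMultipleCurve K X s n)
    {Z : Set X} (hZ : IsClosed Z) (hη : genericPoint X ∉ Z) :
    Z.Finite ∧ ∀ z ∈ Z, IsClosed {z} := by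
  have := hX.isNoetherian
  have hcl : ∀ z ∈ Z, IsClosed {z} := fun z hz =>
    (hX.isClosed_or_eq_genericPoint z).resolve_right fun h => hη (h ▸ hz)
  refine ⟨?_, hcl⟩
  obtain ⟨S, hSf, hSc, hSi, rfl⟩ := NoetherianSpace.exists_finite_set_isClosed_irreducible hZ
  refine hSf.sUnion fun t ht => ?_
  obtain ⟨z, hz⟩ := QuasiSober.sober (hSi t ht) (hSc t ht)
  have hz' : t = {z} := by
    rw [← hz.def, (hcl z ⟨t, ht, hz.mem⟩).closure_eq]
  rw [hz']
  exact Set.finite_singleton z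

lemma IsPrimitiveMultipleCurve.nilradical_ne_maximalIdeal
    (hX : IsPrimitiveMultipleCurve K X s n) {x : X} (hx : IsClosed {x})
    (hne : x ≠ genericPoint X) :
    nilradical (X.presheaf.stalk x) ≠ IsLocalRing.maximalIdeal (X.presheaf.stalk x) := by
  intro heq
  have := hX.isNoetherian
  obtain ⟨D, _, _, _, φ, hφ, hker, hD⟩ := hX.exists_surjective hx
  have hmem : genericPoint X ∈ Set.range (X.fromSpecStalk x) := by
    rw [Scheme.range_fromSpecStalk]; exact genericPoint_specializes' x
  obtain ⟨p, hp⟩ := hmem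
  have hpp := p.isPrime
  have h1 : p.asIdeal = IsLocalRing.maximalIdeal _ := by
    rcases eq_nilradical_or_eq_maximalIdeal φ hφ hker hD p.asIdeal with h | h
    · exact h.trans heq
    · exact h
  have : p = IsLocalRing.closedPoint _ := PrimeSpectrum.ext h1
  rw [this, Scheme.fromSpecStalk_closedPoint] at hp
  exact hne hp

lemma IsPrimitiveMultipleCurve.isGenericLocalization (hX : IsPrimitiveMultipleCurve K X s n) {x : X}
    (hx : IsClosed {x}) (hne : x ≠ genericPoint X) :
    letI := genericAlgebra x
    IsGenericLocalization (X.presheaf.stalk x) (X.presheaf.stalk (genericPoint X)) := by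
  have := hX.isNoetherian
  obtain ⟨D, _, _, _, φ, hφ, hker, hD⟩ := hX.exists_surjective hx
  exact isGenericLocalization_stalk x fun s hs r hsr =>
    eq_zero_of_mul_eq_zero_of_isCohenMacaulayLocal φ hφ hker hD
      (hX.nilradical_ne_maximalIdeal hx hne) (hX.cohenMacaulay x) hs hsr

lemma IsPrimitiveMultipleCurve.ringToGeneric_injective (hX : IsPrimitiveMultipleCurve K X s n)
    (x : X) : Function.Injective (ringToGeneric x) := by
  by_cases hne : x = genericPoint X
  · subst hne
    rw [injective_iff_map_eq_zero]
    intro r hr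
    obtain ⟨U, hU, r, rfl⟩ := X.presheaf.exists_germ_eq r
    rwa [ringToGeneric_germ] at hr
  · have hx := (hX.isClosed_or_eq_genericPoint x).resolve_right hne
    exact (hX.isGenericLocalization hx hne).injective

/-- All local rings embed into the generic one, so the vanishing of `g ^ (n - 1)` at `η` would give
`N ^ (n - 1) = 0` everywhere, against the minimality of `n`. -/
lemma IsPrimitiveMultipleCurve.pow_ne_zero (hX : IsPrimitiveMultipleCurve K X s n)
    {g : X.presheaf.stalk (genericPoint X)}
    (hg : nilradical (X.presheaf.stalk (genericPoint X)) = Ideal.span {g}) : g ^ (n - 1) ≠ 0 := by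
  intro h0
  have hlt : n - 1 < n := Nat.sub_lt hX.pos one_pos
  refine absurd (hX.multiplicity.2 (?_ : X.nilradical ^ (n - 1) = ⊥)) (not_le.2 hlt)
  ext U : 2
  rw [Scheme.IdealSheafData.ideal_pow, Scheme.IdealSheafData.ideal_bot]
  change X.nilradical.ideal U ^ (n - 1) = ⊥
  rw [nilradical_ideal, eq_bot_iff]
  intro a ha
  rw [Ideal.mem_bot]
  refine TopCat.Presheaf.section_ext X.sheaf U.1 a 0 fun x hx => ?_
  refine hX.ringToGeneric_injective x ?_
  have h1 : ringToGeneric x (X.presheaf.germ U.1 x hx a) = 0 := by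
    have h2 := map_mem_nilradical_pow
      (σ := (ringToGeneric x).comp (X.presheaf.germ U.1 x hx).hom) ha
    rw [hg, Ideal.span_singleton_pow, h0, Ideal.mem_span_singleton, zero_dvd_iff] at h2
    exact h2
  have h2 : ringToGeneric x (X.presheaf.germ U.1 x hx 0) = 0 := by rw [map_zero, map_zero]
  exact h1.trans h2.symm

/-- The local structure of a primitive multiple curve at a closed point. -/
theorem IsPrimitiveMultipleCurve.exists_isMultipleLocalRing (hX : IsPrimitiveMultipleCurve K X s n)
    {x : X} (hx : IsClosed {x}) (hne : x ≠ genericPoint X) {U : X.Opens} (hU : IsAffineOpen U)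
    (hxU : x ∈ U) {y : Γ(X, U)} (hy : nilradical Γ(X, U) = Ideal.span {y}) :
    ∃ t, IsMultipleLocalRing (X.presheaf.stalk x) n t (X.presheaf.germ U x hxU y) := by
  have := hX.isNoetherian
  obtain ⟨D, _, _, _, φ, hφ, hker, hD⟩ := hX.exists_surjective hx
  refine GenLineBundle.exists_isMultipleLocalRing (nilradical_stalk_eq hU hxU hy) ?_ ?_ hX.pos φ hφ
    hker hD (hX.nilradical_ne_maximalIdeal hx hne) (hX.cohenMacaulay x)
  · rw [← map_pow, hX.pow_eq_zero hU (by rw [hy]; exact Ideal.mem_span_singleton_self y), map_zero]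
  · intro h0
    have h1 := congrArg (ringToGeneric x) h0
    rw [map_zero, map_pow, ringToGeneric_germ] at h1
    exact hX.pow_ne_zero (nilradical_stalk_eq hU (genericPoint_mem hxU) hy) h1

end PrimitiveMultipleCurve

/-! ### Degrees of norms in finite extensions of a polynomial ring -/

section DedekindLength

open IsDedekindDomain FractionalIdeal Polynomial
open scoped nonZeroDivisors

variable {K T : Type*} [Field K] [CommRing T] [IsDedekindDomain T] [Algebra K T]

/-- An ideal between `P * J` and `J` has the form `J * A` with `P ≤ A`, so there are only the two
extremes. -/
lemma sup_span_singleton_eq_of_notMem (P J : Ideal T) (hP : P.IsMaximal) (hJ : J ≠ 0) {x : T}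
    (hx : x ∈ J) (hxP : x ∉ P * J) : Ideal.span {x} ⊔ P * J = J := by
  have hle : Ideal.span {x} ⊔ P * J ≤ J :=
    sup_le ((Ideal.span_singleton_le_iff_mem _).2 hx) Ideal.mul_le_right
  obtain ⟨A, hA⟩ := Ideal.dvd_iff_le.2 hle
  have h1 : J * A ∣ J * P := by
    rw [Ideal.dvd_iff_le, ← hA, mul_comm]
    exact le_sup_right
  have h2 : P ≤ A := Ideal.dvd_iff_le.1 ((mul_dvd_mul_iff_left hJ).1 h1)
  have h3 : A = ⊤ := by
    by_contra h
    have h4 := hP.eq_of_le h h2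
    apply hxP
    rw [h4, mul_comm, ← hA]
    exact Ideal.mem_sup_left (Ideal.mem_span_singleton_self x)
  rw [hA, h3, Ideal.mul_top]

lemma length_quotient_mul (P : HeightOneSpectrum T)
    (hP : Function.Surjective (algebraMap K (T ⧸ P.asIdeal))) {J : Ideal T} (hJ : J ≠ 0) :
    Module.length K (T ⧸ P.asIdeal * J) = Module.length K (T ⧸ J) + 1 := by
  obtain ⟨x, hx, hxP⟩ : ∃ x ∈ J, x ∉ P.asIdeal * J := by
    by_contra! h
    have h1 : P.asIdeal * J = 1 * J := by
      rw [one_mul]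
      exact le_antisymm Ideal.mul_le_right h
    have h2 := mul_right_cancel₀ hJ h1
    exact P.isPrime.ne_top (h2.trans Ideal.one_eq_top)
  have hsup := sup_span_singleton_eq_of_notMem P.asIdeal J P.isMaximal hJ hx hxP
  let A : Submodule K T := J.restrictScalars K
  let B : Submodule K T := (P.asIdeal * J).restrictScalars K
  have hBA : B ≤ A := fun y hy => Ideal.mul_le_right (I := P.asIdeal) hy
  let φ : K →ₗ[K] A ⧸ B.submoduleOf A :=
    (B.submoduleOf A).mkQ ∘ₗ (LinearMap.toSpanSingleton K A ⟨x, hx⟩)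
  have hφ : Function.Bijective φ := by
    constructor
    · rw [injective_iff_map_eq_zero]
      intro c hc
      by_contra hc0
      have h1 : c • x ∈ P.asIdeal * J := (Submodule.Quotient.mk_eq_zero (B.submoduleOf A)).1 hc
      apply hxP
      have h2 := B.smul_mem c⁻¹ h1
      rwa [smul_smul, inv_mul_cancel₀ hc0, one_smul] at h2
    · intro y
      obtain ⟨⟨y, hy⟩, rfl⟩ := Submodule.Quotient.mk_surjective _ y
      have hy' : y ∈ J := hy
      rw [← hsup, Submodule.mem_sup] at hy'
      obtain ⟨a, ha, b, hb, rfl⟩ := hy'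
      obtain ⟨r, rfl⟩ := Ideal.mem_span_singleton'.1 ha
      obtain ⟨c, hc⟩ := hP (Ideal.Quotient.mk _ r)
      have hc' : algebraMap K T c - r ∈ P.asIdeal := Ideal.Quotient.eq.1 hc
      refine ⟨c, (Submodule.Quotient.eq _).2 ?_⟩
      change c • x - (r * x + b) ∈ P.asIdeal * J
      have : c • x - (r * x + b) = (algebraMap K T c - r) * x - b := by
        rw [Algebra.smul_def]; ring
      rw [this]
      exact Ideal.sub_mem _ (Ideal.mul_mem_mul hc' hx) hb
  have h1 : relLength A B = 1 := by
    rw [relLength, ← (LinearEquiv.ofBijective φ hφ).length_eq, Module.length_eq_finrank,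
      Module.finrank_self, Nat.cast_one]
  have h2 : ∀ I : Submodule K T, relLength ⊤ I = Module.length K (T ⧸ I) := fun I =>
    (Submodule.Quotient.equiv (I.submoduleOf ⊤) I (Submodule.topEquiv) (by
      ext z; simp [Submodule.submoduleOf])).length_eq
  have h3 := relLength_trans hBA (le_top : A ≤ ⊤)
  rw [h1, h2, h2] at h3
  exact h3

/-- The dimension of the quotient by a nonzero ideal is the sum of its multiplicities. -/
lemma length_quotient_eq_finsum (F : Type*) [Field F] [Algebra T F] [IsFractionRing T F]
    (hT : ∀ P : HeightOneSpectrum T, Function.Surjective (algebraMap K (T ⧸ P.asIdeal)))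
    (J : Ideal T) (hJ : J ≠ 0) :
    Module.length K (T ⧸ J) ≠ ⊤ ∧ ((Module.length K (T ⧸ J)).toNat : ℤ) =
      ∑ᶠ P : HeightOneSpectrum T, count F P (J : FractionalIdeal T⁰ F) := by
  induction J using UniqueFactorizationMonoid.induction_on_prime with
  | h₁ => exact absurd rfl hJ
  | h₂ J hu =>
    obtain rfl : J = ⊤ := Ideal.isUnit_iff.1 hu
    have : Subsingleton (T ⧸ (⊤ : Ideal T)) := Ideal.Quotient.subsingleton_iff.2 rfl
    have h0 : Module.length K (T ⧸ (⊤ : Ideal T)) = 0 := Module.length_eq_zero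
    rw [h0]
    refine ⟨ENat.zero_ne_top, ?_⟩
    rw [FractionalIdeal.coeIdeal_top]
    simp [count_one]
  | h₃ J p hJ0 hp ih =>
    let P : HeightOneSpectrum T := ⟨p, Ideal.isPrime_of_prime hp, hp.ne_zero⟩
    obtain ⟨ih1, ih2⟩ := ih hJ0
    have h1 : Module.length K (T ⧸ p * J) = Module.length K (T ⧸ J) + 1 :=
      length_quotient_mul P (hT P) hJ0
    rw [h1, ENat.toNat_add ih1 ENat.one_ne_top]
    refine ⟨enat_add_ne_top.2 ⟨ih1, ENat.one_ne_top⟩, ?_⟩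
    have h2 : ∀ Q : HeightOneSpectrum T, count F Q ((p * J : Ideal T) : FractionalIdeal T⁰ F) =
        count F Q (P.asIdeal : FractionalIdeal T⁰ F) + count F Q (J : FractionalIdeal T⁰ F) := by
      intro Q
      rw [FractionalIdeal.coeIdeal_mul, count_mul F Q]
      · exact coeIdeal_ne_zero.2 hp.ne_zero
      · exact coeIdeal_ne_zero.2 hJ0
    rw [finsum_congr h2, finsum_add_distrib, ← ih2, finsum_eq_single _ P, count_self]
    · push_cast; rw [ENat.toNat_one]; push_cast; ring
    · intro Q hQ
      exact count_maximal_coprime F Q hQ.symm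
    · exact Filter.eventually_cofinite.1 (finite_factors (K := F) _)
    · exact Filter.eventually_cofinite.1 (finite_factors (K := F) _)

/-- Both sides are the dimension of `T / (f)` over `K`: the degree of the norm computes it over the
polynomial ring, the valuations through the prime factorization of `(f)`. -/
lemma natDegree_norm_eq_finsum (F : Type*) [Field F] [Algebra T F] [IsFractionRing T F]
    [Algebra K[X] T] [IsScalarTower K K[X] T] [Module.Finite K[X] T] [Module.Free K[X] T]
    (hT : ∀ P : HeightOneSpectrum T, Function.Surjective (algebraMap K (T ⧸ P.asIdeal)))
    (f : T) (hf : f ≠ 0) :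
    ((Algebra.norm K[X] f).natDegree : ℤ) =
      ∑ᶠ P : HeightOneSpectrum T, -WithZero.log (P.valuation F (algebraMap T F f)) := by
  have hs : Ideal.span {f} ≠ 0 := by
    rw [Ideal.zero_eq_bot, Ne, Ideal.span_singleton_eq_bot]; exact hf
  obtain ⟨h1, h2⟩ := length_quotient_eq_finsum (K := K) F hT (Ideal.span {f}) hs
  rw [← finrank_quotient_span_eq_natDegree_norm (F := K) (Module.Free.chooseBasis K[X] T) hf,
    Module.finrank, ← Cardinal.toNat_toENat, ← Module.length_eq_rank]
  refine h2.trans ?_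
  refine finsum_congr fun P => ?_
  classical
  rw [count_coe F P hs, HeightOneSpectrum.valuation_of_algebraMap, P.intValuation_if_neg hf,
    WithZero.log_exp, neg_neg]

lemma residue_surjective_of_finite [IsAlgClosed K]
    [Algebra K[X] T] [IsScalarTower K K[X] T] [Module.Finite K[X] T] (P : Ideal T) [P.IsMaximal] :
    Function.Surjective (algebraMap K (T ⧸ P)) := by
  have : Algebra.FiniteType K T :=
    Algebra.FiniteType.trans (inferInstance : Algebra.FiniteType K K[X]) inferInstance
  let : Field (T ⧸ P) := Ideal.Quotient.field P
  have : Algebra.FiniteType K (T ⧸ P) := inferInstance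
  have : Module.Finite K (T ⧸ P) := finite_of_finite_type_of_isJacobsonRing K (T ⧸ P)
  exact IsAlgClosed.algebraMap_bijective_of_isIntegral.2

end DedekindLength

/-! ### Places of a function field and the product formula -/

section Places

open IsDedekindDomain Polynomial
open scoped nonZeroDivisors

/-- The places of a function field `κ` over `K`, with their normalized discrete valuations. -/
structure IsPlaceSystem (K : Type*) {κ I : Type*} [Field K] [Field κ] [Algebra K κ]
    (A : I → ValuationSubring κ) (ord : I → κ → ℤ) : Prop where
  ord_mul : ∀ i (a b : κ), a ≠ 0 → b ≠ 0 → ord i (a * b) = ord i a + ord i b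
  mem_iff : ∀ i (a : κ), a ≠ 0 → (a ∈ A i ↔ 0 ≤ ord i a)
  exists_uniformizer : ∀ i, ∃ a : κ, a ≠ 0 ∧ ord i a = 1
  algebraMap_mem : ∀ i (c : K), algebraMap K κ c ∈ A i
  injective : Function.Injective A
  surjective : ∀ V : ValuationSubring κ, V ≠ ⊤ → (∀ c : K, algebraMap K κ c ∈ V) → ∃ i, A i = V

variable {K κ I : Type*} [Field K] [Field κ] [Algebra K κ]

lemma ord_zpow_of_mul {o : κ → ℤ} (ho : ∀ a b : κ, a ≠ 0 → b ≠ 0 → o (a * b) = o a + o b) {a : κ}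
    (ha : a ≠ 0) (m : ℤ) : o (a ^ m) = m * o a := by
  have h1 : o 1 = 0 := by simpa using ho 1 1 one_ne_zero one_ne_zero
  have h2 : ∀ m : ℕ, o (a ^ m) = m * o a := by
    intro m
    induction m with
    | zero => simp [h1]
    | succ m ih => rw [pow_succ, ho _ _ (pow_ne_zero _ ha) ha, ih]; push_cast; ring
  obtain ⟨m, rfl | rfl⟩ := m.eq_nat_or_neg
  · rw [zpow_natCast, h2]
  · have h3 := ho (a ^ m) (a ^ (-(m : ℤ))) (pow_ne_zero _ ha) (zpow_ne_zero _ ha)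
    rw [zpow_neg, zpow_natCast, mul_inv_cancel₀ (pow_ne_zero _ ha), h1, h2] at h3
    rw [zpow_neg, zpow_natCast]
    linarith

/-- A normalized discrete valuation is determined by its valuation ring. -/
lemma ord_eq_of_nonneg_iff {o₁ o₂ : κ → ℤ}
    (h₁ : ∀ a b : κ, a ≠ 0 → b ≠ 0 → o₁ (a * b) = o₁ a + o₁ b)
    (h₂ : ∀ a b : κ, a ≠ 0 → b ≠ 0 → o₂ (a * b) = o₂ a + o₂ b)
    (h : ∀ a : κ, a ≠ 0 → (0 ≤ o₁ a ↔ 0 ≤ o₂ a))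
    (u₁ : ∃ a : κ, a ≠ 0 ∧ o₁ a = 1) (u₂ : ∃ a : κ, a ≠ 0 ∧ o₂ a = 1) (f : κ) (hf : f ≠ 0) :
    o₁ f = o₂ f := by
  have h0 : ∀ a : κ, a ≠ 0 → o₁ a = 0 → o₂ a = 0 := by
    intro a ha ha0
    have h3 := (h a ha).1 ha0.ge
    have h4 : o₁ (a ^ (-1 : ℤ)) = 0 := by rw [ord_zpow_of_mul h₁ ha, ha0, mul_zero]
    have h5 := (h _ (zpow_ne_zero _ ha)).1 h4.ge
    rw [ord_zpow_of_mul h₂ ha] at h5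
    linarith
  obtain ⟨p, hp, hp1⟩ := u₁
  obtain ⟨q, hq, hq1⟩ := u₂
  have key : ∀ a : κ, a ≠ 0 → o₂ a = o₁ a * o₂ p := by
    intro a ha
    have h3 := h0 (a * p ^ (-o₁ a)) (mul_ne_zero ha (zpow_ne_zero _ hp))
      (by rw [h₁ _ _ ha (zpow_ne_zero _ hp), ord_zpow_of_mul h₁ hp, hp1]; ring)
    rw [h₂ _ _ ha (zpow_ne_zero _ hp), ord_zpow_of_mul h₂ hp] at h3
    linarith
  have h6 : 0 ≤ o₂ p := (h p hp).1 (by rw [hp1]; exact zero_le_one)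
  have h7 := key q hq
  rw [hq1] at h7
  have h8 : o₂ p = 1 := Int.eq_one_of_mul_eq_one_left h6 h7.symm
  rw [key f hf, h8, mul_one]

/-- Discrete valuation rings are maximal subrings. -/
lemma valuationSubring_eq_of_le {A V : ValuationSubring κ} {o : κ → ℤ}
    (ho : ∀ a b : κ, a ≠ 0 → b ≠ 0 → o (a * b) = o a + o b)
    (hm : ∀ a : κ, a ≠ 0 → (a ∈ A ↔ 0 ≤ o a)) (hle : A ≤ V) (hV : V ≠ ⊤) : A = V := by
  refine le_antisymm hle fun a ha => ?_
  by_contra haA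
  have ha0 : a ≠ 0 := by rintro rfl; exact haA (zero_mem _)
  rw [hm a ha0, not_le] at haA
  refine hV (eq_top_iff.2 fun f _ => ?_)
  rcases eq_or_ne f 0 with rfl | hf
  · exact zero_mem _
  have hz : a ^ (-((o f).natAbs : ℤ)) ≠ 0 := zpow_ne_zero _ ha0
  have h3 : f * a ^ (-((o f).natAbs : ℤ)) ∈ V := by
    apply hle
    rw [hm _ (mul_ne_zero hf hz), ho _ _ hf hz, ord_zpow_of_mul ho ha0]
    have := neg_abs_le (o f)
    have := abs_nonneg (o f)
    rw [Int.natCast_natAbs]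
    nlinarith
  have h4 := mul_mem h3 (pow_mem ha (o f).natAbs)
  rwa [zpow_neg, zpow_natCast, mul_assoc, inv_mul_cancel₀ (pow_ne_zero _ ha0), mul_one] at h4

namespace IsPlaceSystem

variable {A : I → ValuationSubring κ} {ord : I → κ → ℤ} (hA : IsPlaceSystem K A ord)

include hA

lemma ord_zpow (i : I) {a : κ} (ha : a ≠ 0) (m : ℤ) : ord i (a ^ m) = m * ord i a :=
  ord_zpow_of_mul (hA.ord_mul i) ha m

lemma ord_inv (i : I) {a : κ} (ha : a ≠ 0) : ord i a⁻¹ = - ord i a := by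
  have := hA.ord_zpow i ha (-1)
  rw [zpow_neg_one] at this
  linarith

lemma ord_div (i : I) {a b : κ} (ha : a ≠ 0) (hb : b ≠ 0) :
    ord i (a / b) = ord i a - ord i b := by
  rw [div_eq_mul_inv, hA.ord_mul i _ _ ha (inv_ne_zero hb), hA.ord_inv i hb]; ring

lemma ne_top (i : I) : A i ≠ ⊤ := by
  intro h
  obtain ⟨p, hp, hp1⟩ := hA.exists_uniformizer i
  have h1 : p⁻¹ ∈ A i := by rw [h]; trivial
  rw [hA.mem_iff i _ (inv_ne_zero hp), hA.ord_inv i hp, hp1] at h1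
  omega

lemma eq_of_le {i j : I} (h : A i ≤ A j) : i = j :=
  hA.injective (valuationSubring_eq_of_le (hA.ord_mul i) (hA.mem_iff i) h (hA.ne_top j))

end IsPlaceSystem

/-- Valuation rings are integrally closed, so one containing `L` contains everything integral over
`L`. -/
lemma eq_top_of_range_le (L : Type*) {κ : Type*} [Field L] [Field κ] [Algebra L κ]
    [Algebra.IsIntegral L κ] (V : ValuationSubring κ)
    (h : ∀ r : L, algebraMap L κ r ∈ V) : V = ⊤ := by
  rw [eq_top_iff]
  intro x _
  let φ : L →+* V := (algebraMap L κ).codRestrict V h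
  obtain ⟨p, hpm, hp0⟩ := Algebra.IsIntegral.isIntegral (R := L) x
  have h1 : IsIntegral V x := by
    refine ⟨p.map φ, hpm.map φ, ?_⟩
    rw [eval₂_map]
    exact hp0
  obtain ⟨b, hb⟩ := IsIntegrallyClosed.isIntegral_iff.1 h1
  rw [← hb]
  exact b.2

section FiniteCover

variable [Algebra K[X] κ] [IsScalarTower K K[X] κ]

lemma integralClosure_le_valuationSubring (V : ValuationSubring κ)
    (hV : ∀ c : K, algebraMap K κ c ∈ V) (hX : algebraMap K[X] κ X ∈ V)
    (a : integralClosure K[X] κ) : (a : κ) ∈ V := by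
  have hp : ∀ p : K[X], algebraMap K[X] κ p ∈ V := by
    intro p
    induction p using Polynomial.induction_on' with
    | add p q hp hq => rw [map_add]; exact add_mem hp hq
    | monomial n c =>
      rw [← Polynomial.C_mul_X_pow_eq_monomial, map_mul, map_pow]
      refine mul_mem ?_ (pow_mem hX n)
      rw [← Polynomial.algebraMap_eq, ← IsScalarTower.algebraMap_apply]
      exact hV c
  obtain ⟨p, hpm, hp0⟩ := a.2
  let φ : K[X] →+* V := (algebraMap K[X] κ).codRestrict V hp
  have h1 : IsIntegral V (a : κ) := by
    refine ⟨p.map φ, hpm.map φ, ?_⟩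
    rw [eval₂_map]
    exact hp0
  obtain ⟨b, hb⟩ := IsIntegrallyClosed.isIntegral_iff.1 h1
  rw [← hb]
  exact b.2

variable [Algebra (RatFunc K) κ]
  [IsScalarTower K[X] (RatFunc K) κ] [FiniteDimensional (RatFunc K) κ]
  [Algebra.IsSeparable (RatFunc K) κ]
  {A : I → ValuationSubring κ} {ord : I → κ → ℤ}

/-- The places where `X` is regular correspond to the maximal ideals of the integral closure `T` of
`K[X]`, with the same normalized valuations. For `f` in `T` the sum is the degree of its norm;
fractions follow by additivity. -/
lemma finite_ord_ne_zero_and_finsum_eq [IsAlgClosed K] (hA : IsPlaceSystem K A ord) (f : κ) (hf : f ≠ 0) :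
    {i | algebraMap K[X] κ X ∈ A i ∧ ord i f ≠ 0}.Finite ∧
    ∑ᶠ i ∈ {i | algebraMap K[X] κ X ∈ A i}, ord i f =
      (Algebra.norm (RatFunc K) f).intDegree := by
  let T := integralClosure K[X] κ
  have : IsFractionRing T κ := integralClosure.isFractionRing_of_finite_extension (RatFunc K) κ
  have : IsDedekindDomain T := integralClosure.isDedekindDomain K[X] (RatFunc K) κ
  have : Module.Finite K[X] T := IsIntegralClosure.finite K[X] (RatFunc K) κ T
  have : Module.IsTorsionFree K[X] κ := .trans_faithfulSMul K[X] (RatFunc K) κ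
  have : Module.Free K[X] T := IsIntegralClosure.module_free K[X] (RatFunc K) κ T
  have hres : ∀ P : HeightOneSpectrum T, Function.Surjective (algebraMap K (T ⧸ P.asIdeal)) := by
    intro P
    have := P.isMaximal
    exact residue_surjective_of_finite P.asIdeal
  have hv0 : ∀ (P : HeightOneSpectrum T) {a : κ}, a ≠ 0 → P.valuation κ a ≠ 0 := fun P a ha =>
    (Valuation.ne_zero_iff _).2 ha
  have hVK : ∀ (P : HeightOneSpectrum T) (a : T), (a : κ) ∈ (P.valuation κ).valuationSubring :=
    fun P a => P.valuation_le_one a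
  have hVtop : ∀ P : HeightOneSpectrum T, (P.valuation κ).valuationSubring ≠ ⊤ := by
    intro P h
    obtain ⟨a, ha⟩ := P.valuation_exists_uniformizer κ
    have ha0 : a ≠ 0 := by
      rintro rfl
      rw [map_zero] at ha
      exact WithZero.exp_ne_zero ha.symm
    have h1 : a⁻¹ ∈ (P.valuation κ).valuationSubring := by rw [h]; trivial
    have h2 : P.valuation κ a⁻¹ ≤ 1 := h1
    rw [← WithZero.log_le_log (hv0 P (inv_ne_zero ha0)) one_ne_zero, map_inv₀, WithZero.log_inv,
      ha] at h2
    simp at h2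
  have hex : ∀ P : HeightOneSpectrum T, ∃ i, A i = (P.valuation κ).valuationSubring := by
    intro P
    refine hA.surjective _ (hVtop P) fun c => ?_
    have := hVK P (algebraMap K T c)
    exact this
  choose e he using hex
  have hord : ∀ P (a : κ), a ≠ 0 → ord (e P) a = -WithZero.log (P.valuation κ a) := by
    intro P a ha
    refine ord_eq_of_nonneg_iff (o₂ := fun a => -WithZero.log (P.valuation κ a))
      (hA.ord_mul _) ?_ ?_ (hA.exists_uniformizer _) ?_ a ha
    · intro a b ha hb
      rw [map_mul, WithZero.log_mul (hv0 P ha) (hv0 P hb)]; ring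
    · intro a ha
      rw [← hA.mem_iff _ _ ha, he P, neg_nonneg, ← WithZero.log_one,
        WithZero.log_le_log (hv0 P ha) one_ne_zero]
      rfl
    · obtain ⟨a, ha⟩ := P.valuation_exists_uniformizer κ
      refine ⟨a, ?_, ?_⟩
      · rintro rfl
        rw [map_zero] at ha
        exact WithZero.exp_ne_zero ha.symm
      · rw [ha, WithZero.log_exp, neg_neg]
  have hmem : ∀ P, algebraMap K[X] κ X ∈ A (e P) := by
    intro P
    rw [he P]
    exact hVK P (algebraMap K[X] T X)
  have hinj : Function.Injective e := by
    intro P Q hPQ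
    apply HeightOneSpectrum.ext
    ext a
    rcases eq_or_ne a 0 with rfl | ha
    · simp
    have ha' : algebraMap T κ a ≠ 0 := by
      rwa [Ne, FaithfulSMul.algebraMap_eq_zero_iff]
    have h1 := hord P _ ha'
    rw [hPQ, hord Q _ ha', neg_inj] at h1
    have h2 := fun P : HeightOneSpectrum T => P.valuation_lt_one_iff_mem (K := κ) a
    rw [← h2, ← h2, ← WithZero.log_lt_log (hv0 P ha') one_ne_zero,
      ← WithZero.log_lt_log (hv0 Q ha') one_ne_zero, h1]
  -- The maximal ideal of `A i` restricts to a prime of `T`. If it were zero, `A i` would contain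
  -- the fraction field of `T`, which is all of `κ`. So it gives a discrete valuation ring contained
  -- in `A i`, and by maximality the two agree.
  have hsurj : ∀ i, algebraMap K[X] κ X ∈ A i → ∃ P, e P = i := by
    intro i hi
    have hT := integralClosure_le_valuationSubring (A i) (hA.algebraMap_mem i) hi
    let φ : T →+* A i := (algebraMap T κ).codRestrict (A i) hT
    let p : Ideal T := (IsLocalRing.maximalIdeal (A i)).comap φ
    have hp0 : p ≠ ⊥ := by
      intro hp0
      apply hA.ne_top i
      have hunit : ∀ b : T, b ≠ 0 → ((b : κ))⁻¹ ∈ A i := by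
        intro b hb
        have h1 : b ∉ p := by rw [hp0]; exact hb
        have h2 : IsUnit (φ b) := by
          by_contra h3
          exact h1 ((IsLocalRing.mem_maximalIdeal _).2 h3)
        obtain ⟨c, hc⟩ := h2.exists_right_inv
        have h3 : (b : κ) * (c : κ) = 1 := congrArg Subtype.val hc
        rw [inv_eq_of_mul_eq_one_right h3]
        exact c.2
      rw [eq_top_iff]
      intro x _
      obtain ⟨a, b, hb, rfl⟩ := IsFractionRing.div_surjective (A := T) x
      rw [div_eq_mul_inv]
      exact mul_mem (hT a) (hunit b (nonZeroDivisors.ne_zero hb))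
    let P : HeightOneSpectrum T := ⟨p, inferInstance, hp0⟩
    refine ⟨P, hA.eq_of_le ?_⟩
    rw [he P]
    intro x hx
    obtain ⟨a, b, hb⟩ := P.exists_primeCompl_mul_eq_of_integer x hx
    have h2 : IsUnit (φ b) := by
      by_contra h3
      exact b.2 ((IsLocalRing.mem_maximalIdeal _).2 h3)
    obtain ⟨c, hc⟩ := h2.exists_right_inv
    have h3 : ((b : T) : κ) * (c : κ) = 1 := congrArg Subtype.val hc
    have h4 : x = ((a : T) : κ) * (c : κ) := by
      have hb' : x * ((b : T) : κ) = ((a : T) : κ) := hb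
      rw [← hb', mul_assoc, h3, mul_one]
    rw [h4]
    exact mul_mem (hT a) c.2
  have hbij : Set.BijOn e Set.univ {i | algebraMap K[X] κ X ∈ A i} :=
    ⟨fun P _ => hmem P, hinj.injOn, fun i hi => by
      obtain ⟨P, hP⟩ := hsurj i hi
      exact ⟨P, trivial, hP⟩⟩
  have hfin : ∀ a : T, a ≠ 0 → {i | algebraMap K[X] κ X ∈ A i ∧ ord i (a : κ) ≠ 0}.Finite := by
    intro a ha
    have ha' : (a : κ) ≠ 0 := by rwa [Ne, ZeroMemClass.coe_eq_zero]
    have hs : Ideal.span {a} ≠ 0 := by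
      rw [Ideal.zero_eq_bot, Ne, Ideal.span_singleton_eq_bot]; exact ha
    refine ((Ideal.finite_factors hs).image e).subset ?_
    rintro i ⟨hi, hia⟩
    obtain ⟨P, rfl⟩ := hsurj i hi
    refine ⟨P, ?_, rfl⟩
    rw [hord P _ ha'] at hia
    change P.asIdeal ∣ _
    rw [← P.valuation_lt_one_iff_dvd (K := κ), ← WithZero.log_lt_log
      (hv0 P (show algebraMap T κ a ≠ 0 from ha')) one_ne_zero]
    refine lt_of_le_of_ne ?_ (fun h => hia ?_)
    · rw [WithZero.log_le_log (hv0 P (show algebraMap T κ a ≠ 0 from ha')) one_ne_zero]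
      exact P.valuation_le_one a
    · rw [WithZero.log_one] at h
      rw [neg_eq_zero]
      exact h
  have hsum : ∀ a : T, a ≠ 0 → ∑ᶠ i ∈ {i | algebraMap K[X] κ X ∈ A i}, ord i (a : κ) =
      (Algebra.norm (RatFunc K) (a : κ)).intDegree := by
    intro a ha
    have ha' : (a : κ) ≠ 0 := by rwa [Ne, ZeroMemClass.coe_eq_zero]
    have hloc : IsLocalization (Algebra.algebraMapSubmonoid T K[X]⁰) κ :=
      IsIntegralClosure.isLocalization K[X] (RatFunc K) κ T
    have h1 : Algebra.norm (RatFunc K) (a : κ) =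
        algebraMap K[X] (RatFunc K) (Algebra.norm K[X] a) :=
      Algebra.norm_localization K[X] K[X]⁰ a
    rw [h1, RatFunc.intDegree_polynomial, natDegree_norm_eq_finsum κ hres a ha,
      eq_comm]
    refine (finsum_mem_univ _).symm.trans ?_
    exact finsum_mem_eq_of_bijOn (g := fun i => ord i (a : κ)) e hbij
      fun P _ => (hord P _ ha').symm
  obtain ⟨a, b, hb, rfl⟩ := IsFractionRing.div_surjective (A := T) f
  have hb0 : b ≠ 0 := nonZeroDivisors.ne_zero hb
  have ha0 : a ≠ 0 := by rintro rfl; simp at hf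
  have ha' : algebraMap T κ a ≠ 0 := by rwa [Ne, FaithfulSMul.algebraMap_eq_zero_iff]
  have hb' : algebraMap T κ b ≠ 0 := by rwa [Ne, FaithfulSMul.algebraMap_eq_zero_iff]
  have hdiv : ∀ i, ord i (algebraMap T κ a / algebraMap T κ b) =
      ord i (a : κ) - ord i (b : κ) := fun i => hA.ord_div i ha' hb'
  have hfinite : {i | algebraMap K[X] κ X ∈ A i ∧
      ord i (algebraMap T κ a / algebraMap T κ b) ≠ 0}.Finite := by
    refine ((hfin a ha0).union (hfin b hb0)).subset ?_
    rintro i ⟨hi, hne⟩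
    rw [hdiv] at hne
    by_contra h
    simp only [Set.mem_union, Set.mem_ofPred_eq, not_or, not_and, not_not] at h
    exact hne (by rw [h.1 hi, h.2 hi, sub_zero])
  refine ⟨hfinite, ?_⟩
  have h1 : ∀ i, ord i (a : κ) = ord i (algebraMap T κ a / algebraMap T κ b) + ord i (b : κ) :=
    fun i => by rw [hdiv]; ring
  have h2 := finsum_mem_congr (rfl : {i | algebraMap K[X] κ X ∈ A i} = _) (fun i _ => h1 i)
  have hS : ∀ g : I → ℤ, {i | algebraMap K[X] κ X ∈ A i ∧ g i ≠ 0}.Finite →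
      ({i | algebraMap K[X] κ X ∈ A i} ∩ Function.support g).Finite := fun _ h => h
  rw [finsum_mem_add_distrib' (hS _ hfinite) (hS _ (hfin b hb0)), hsum a ha0, hsum b hb0] at h2
  have h3 : Algebra.norm (RatFunc K) (algebraMap T κ a / algebraMap T κ b) =
      Algebra.norm (RatFunc K) (a : κ) * (Algebra.norm (RatFunc K) (b : κ))⁻¹ := by
    rw [div_eq_mul_inv, map_mul, Algebra.norm_inv]; rfl
  have h4 := RatFunc.intDegree_mul (x := Algebra.norm (RatFunc K) (a : κ))
    (y := (Algebra.norm (RatFunc K) (b : κ))⁻¹) ((Algebra.norm_ne_zero_iff (R := RatFunc K)).2 ha')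
    (inv_ne_zero ((Algebra.norm_ne_zero_iff (R := RatFunc K)).2 hb'))
  rw [h3, h4, RatFunc.intDegree_inv]
  linarith

open Classical in
/-- A function which is a unit at all places over infinity has norm of degree zero. -/
lemma intDegree_norm_eq_zero (hA : IsPlaceSystem K A ord) (f : κ) (hf : f ≠ 0)
    (h : ∀ i, algebraMap K[X] κ X ∉ A i → ord i f = 0) :
    (Algebra.norm (RatFunc K) f).intDegree = 0 := by
  let O := (RatFunc.inftyValuation K).valuationSubring
  have hO : ∀ r : RatFunc K, r ≠ 0 → (r ∈ O ↔ r.intDegree ≤ 0) := by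
    intro r hr
    change RatFunc.inftyValuationDef K r ≤ 1 ↔ _
    rw [RatFunc.inftyValuation_of_nonzero K hr, ← WithZero.exp_zero, WithZero.exp_le_exp]
  have key : ∀ g : κ, g ≠ 0 → (∀ i, algebraMap K[X] κ X ∉ A i → ord i g = 0) →
      (Algebra.norm (RatFunc K) g).intDegree ≤ 0 := by
    intro g hg hgi
    have h2 : IsIntegral O g := by
      let R : Subring κ := (integralClosure O κ).toSubring
      have hR : IsIntegrallyClosedIn R κ :=
        inferInstanceAs (IsIntegrallyClosedIn (integralClosure O κ) κ)
      -- Otherwise some valuation ring `V` contains the integral closure of `O`, the valuation ring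
      -- at infinity, but not `g`. Then `V` is a place at which `X` has a pole, and there `g` has
      -- order zero by hypothesis, so it lies in `V`.
      by_contra hint
      have hgR : g ∉ R := hint
      obtain ⟨V, hRV, hgV⟩ := Subring.exists_le_valuationSubring_of_isIntegrallyClosedIn hgR
      have hOV : ∀ r ∈ O, algebraMap (RatFunc K) κ r ∈ V := fun r hr =>
        hRV (show IsIntegral O _ from isIntegral_algebraMap (R := O) (x := ⟨r, hr⟩))
      have hVtop : V ≠ ⊤ := by rintro rfl; exact hgV trivial
      -- Together with `O` the element `X` generates the rational function field, over which `κ` is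
      -- integral; so `X ∈ V` would give `V = ⊤`.
      have hX : algebraMap K[X] κ X ∉ V := by
        intro hX
        rw [IsScalarTower.algebraMap_apply K[X] (RatFunc K) κ, RatFunc.algebraMap_X] at hX
        refine hVtop (eq_top_of_range_le (RatFunc K) V fun r => ?_)
        rcases le_or_gt r.intDegree 0 with hr | hr
        · rcases eq_or_ne r 0 with rfl | hr0
          · rw [map_zero]; exact zero_mem _
          · exact hOV r ((hO r hr0).2 hr)
        · have hr0 : r ≠ 0 := by rintro rfl; simp at hr
          obtain ⟨m, hm⟩ := Int.eq_ofNat_of_zero_le hr.le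
          have hXm : ∀ m : ℕ, (RatFunc.X ^ m : RatFunc K).intDegree = m := by
            intro m
            rw [← RatFunc.algebraMap_X, ← map_pow, RatFunc.intDegree_polynomial, natDegree_X_pow]
          have hX0 : (RatFunc.X ^ m : RatFunc K) ≠ 0 := pow_ne_zero _ RatFunc.X_ne_zero
          have h3 : r * (RatFunc.X ^ m)⁻¹ ∈ O := by
            rw [hO _ (mul_ne_zero hr0 (inv_ne_zero hX0)), RatFunc.intDegree_mul hr0
              (inv_ne_zero hX0), RatFunc.intDegree_inv, hXm]
            omega
          have h4 := mul_mem (hOV _ h3) (pow_mem hX m)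
          rwa [← map_pow, ← map_mul, mul_assoc, inv_mul_cancel₀ hX0, mul_one] at h4
      have hVK : ∀ c : K, algebraMap K κ c ∈ V := by
        intro c
        rw [IsScalarTower.algebraMap_apply K K[X] κ, IsScalarTower.algebraMap_apply K[X]
          (RatFunc K) κ]
        apply hOV
        rcases eq_or_ne c 0 with rfl | hc
        · simp
        · rw [Polynomial.algebraMap_eq, RatFunc.algebraMap_C, hO _ (by simpa using hc),
            RatFunc.intDegree_C]
      obtain ⟨i, rfl⟩ := hA.surjective V hVtop hVK
      apply hgV
      rw [hA.mem_iff i g hg, hgi i hX]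
    have h3 : IsIntegral O (Algebra.norm (RatFunc K) g) := Algebra.isIntegral_norm _ h2
    obtain ⟨b, hb⟩ := IsIntegrallyClosed.isIntegral_iff.1 h3
    rw [← hO _ ((Algebra.norm_ne_zero_iff (R := RatFunc K)).2 hg), ← hb]
    exact b.2
  refine le_antisymm (key f hf h) ?_
  have h5 := key f⁻¹ (inv_ne_zero hf) fun i hi => by rw [hA.ord_inv i hf, h i hi, neg_zero]
  rw [Algebra.norm_inv, RatFunc.intDegree_inv] at h5
  linarith

end FiniteCover

section Product

open IntermediateField

variable [IsAlgClosed K] {A : I → ValuationSubring κ} {ord : I → κ → ℤ}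

/-- The previous results are transported along `K(X) ≅ K(τ)`. The sum over all places is controlled
only if `f` has neither zeros nor poles at the poles of `τ`. -/
lemma finite_ord_ne_zero_of_separating (hA : IsPlaceSystem K A ord) (τ : κ)
    (hτ : Transcendental K τ) (h₁ : FiniteDimensional K⟮τ⟯ κ) (h₂ : Algebra.IsSeparable K⟮τ⟯ κ)
    (f : κ) (hf : f ≠ 0) :
    {i | τ ∈ A i ∧ ord i f ≠ 0}.Finite ∧
      ((∀ i, τ ∉ A i → ord i f = 0) → ∑ᶠ i, ord i f = 0) := by
  let e := RatFunc.algEquivOfTranscendental τ hτ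
  let : Algebra (RatFunc K) κ := ((algebraMap K⟮τ⟯ κ).comp (e : RatFunc K →+* K⟮τ⟯)).toAlgebra
  let : Algebra K[X] κ := (aeval τ : K[X] →ₐ[K] κ).toRingHom.toAlgebra
  have hX : algebraMap K[X] κ X = τ := aeval_X τ
  have : IsScalarTower K K[X] κ := IsScalarTower.of_algebraMap_eq fun c => by
    change _ = aeval τ (algebraMap K K[X] c)
    rw [Polynomial.algebraMap_eq, aeval_C]
  have : IsScalarTower K[X] (RatFunc K) κ := IsScalarTower.of_algebraMap_eq fun p => by
    change aeval τ p = ((e (algebraMap K[X] (RatFunc K) p) : K⟮τ⟯) : κ)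
    rw [RatFunc.algEquivOfTranscendental_algebraMap]
    simp
  have hcomp : (algebraMap (RatFunc K) κ).comp (e.symm.toRingEquiv : K⟮τ⟯ →+* RatFunc K) =
      (RingEquiv.refl κ : κ →+* κ).comp (algebraMap K⟮τ⟯ κ) := by
    ext x
    change ((e (e.symm x) : K⟮τ⟯) : κ) = x
    rw [AlgEquiv.apply_symm_apply]
  have : FiniteDimensional (RatFunc K) κ := Module.Finite.of_equiv_equiv _ _ hcomp
  have : Algebra.IsSeparable (RatFunc K) κ := Algebra.IsSeparable.of_equiv_equiv _ _ hcomp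
  obtain ⟨h3, h4⟩ := finite_ord_ne_zero_and_finsum_eq hA f hf
  rw [hX] at h3 h4
  refine ⟨h3, fun h => ?_⟩
  rw [intDegree_norm_eq_zero hA f hf (by rwa [hX])] at h4
  rw [← h4, ← finsum_mem_univ]
  refine finsum_mem_inter_support_eq' _ _ _ fun i hi => ⟨fun _ => ?_, fun _ => trivial⟩
  by_contra hiA
  exact hi (h i hiA)

/-- The product formula: a function on a complete curve has as many zeros as poles. -/
theorem IsPlaceSystem.finite_and_finsum_eq_zero (hA : IsPlaceSystem K A ord) (t : κ)
    (ht : Transcendental K t) (h₁ : FiniteDimensional K⟮t⟯ κ) (h₂ : Algebra.IsSeparable K⟮t⟯ κ)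
    (f : κ) (hf : f ≠ 0) : {i | ord i f ≠ 0}.Finite ∧ ∑ᶠ i, ord i f = 0 := by
  -- The coordinate `1 / (t - a)` generates the same field as `t` but has its poles where `t = a`.
  -- The constant `a` will be chosen so that `f` is a unit at those places.
  have hinv : ∀ a : K, Transcendental K (t - algebraMap K κ a)⁻¹ ∧
      K⟮(t - algebraMap K κ a)⁻¹⟯ = K⟮t⟯ := by
    intro a
    have h3 : t = ((t - algebraMap K κ a)⁻¹)⁻¹ + algebraMap K κ a := by rw [inv_inv]; ring
    constructor
    · intro h
      apply ht
      rw [h3]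
      exact h.inv.add (isAlgebraic_algebraMap a)
    · apply le_antisymm
      · rw [adjoin_simple_le_iff]
        exact inv_mem (sub_mem (mem_adjoin_simple_self K t) (IntermediateField.algebraMap_mem _ a))
      · rw [adjoin_simple_le_iff]
        have h4 := add_mem (inv_mem (mem_adjoin_simple_self K (t - algebraMap K κ a)⁻¹))
          (IntermediateField.algebraMap_mem _ a)
        rwa [← h3] at h4
  have hsep : ∀ a : K, {i | (t - algebraMap K κ a)⁻¹ ∈ A i ∧ ord i f ≠ 0}.Finite ∧
      ((∀ i, (t - algebraMap K κ a)⁻¹ ∉ A i → ord i f = 0) → ∑ᶠ i, ord i f = 0) := by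
    intro a
    refine finite_ord_ne_zero_of_separating hA _ (hinv a).1 ?_ ?_ f hf
    · rw [(hinv a).2]; exact h₁
    · rw [(hinv a).2]; exact h₂
  have hfin : {i | ord i f ≠ 0}.Finite := by
    refine ((finite_ord_ne_zero_of_separating hA t ht h₁ h₂ f hf).1.union (hsep 0).1).subset ?_
    intro i hi
    rcases (A i).mem_or_inv_mem t with h | h
    · exact Or.inl ⟨h, hi⟩
    · refine Or.inr ⟨?_, hi⟩
      rwa [map_zero, sub_zero]
  refine ⟨hfin, ?_⟩
  -- If `t - a` and `t - b` are both non-units at a place, so is the constant `b - a`, which must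
  -- then vanish. Thus the finitely many places with `ord i f ≠ 0` exclude only finitely many `a`,
  -- and `K` is infinite.
  have hbad : ∀ i, {a : K | (t - algebraMap K κ a)⁻¹ ∉ A i}.Subsingleton := by
    intro i a ha b hb
    by_contra hab
    have hlt : ∀ c : K, (t - algebraMap K κ c)⁻¹ ∉ A i →
        (A i).valuation (t - algebraMap K κ c) < 1 := by
      intro c hc
      rw [← ValuationSubring.valuation_le_one_iff, not_le, map_inv₀] at hc
      have h0 : (A i).valuation (t - algebraMap K κ c) ≠ 0 := by
        intro h0
        rw [h0, inv_zero] at hc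
        exact not_lt_zero hc
      exact (one_lt_inv₀ (zero_lt_iff.2 h0)).1 hc
    have h5 := (A i).valuation.map_sub_lt (hlt a ha) (hlt b hb)
    have h6 : t - algebraMap K κ a - (t - algebraMap K κ b) = algebraMap K κ (b - a) := by
      rw [map_sub]; ring
    have h7 := ((A i).valuation_le_one_iff _).2 (hA.algebraMap_mem i (b - a)⁻¹)
    have h8 : (A i).valuation (algebraMap K κ (b - a)) ≠ 0 := by
      rw [Valuation.ne_zero_iff, Ne, FaithfulSMul.algebraMap_eq_zero_iff, sub_eq_zero]
      exact Ne.symm hab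
    rw [map_inv₀, map_inv₀, inv_le_one₀ (zero_lt_iff.2 h8), ← h6] at h7
    exact not_lt.2 h7 h5
  obtain ⟨a, ha⟩ := (hfin.biUnion fun i _ => (hbad i).finite).exists_notMem
  refine (hsep a).2 fun i hi => ?_
  by_contra h
  exact ha (Set.mem_biUnion (show i ∈ {i | ord i f ≠ 0} from h) hi)

end Product

end Places

/-! ### Separating elements of function fields -/

section Separating

open IntermediateField

/-- The fraction field of a smooth algebra of relative dimension one has a separating element. -/
lemma exists_separating {K B F : Type u} [Field K] [CommRing B] [IsDomain B] [Field F]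
    [Algebra K B] [Algebra B F] [Algebra K F] [IsScalarTower K B F] [IsFractionRing B F]
    [Algebra.IsStandardSmoothOfRelativeDimension 1 K B] :
    ∃ t : F, FiniteDimensional K⟮t⟯ F ∧ Algebra.IsSeparable K⟮t⟯ F := by
  -- The separating element is the image of the coordinate under an étale map to the affine line.
  -- Étale gives unramified over `K(t)`, and an unramified field extension that is essentially of
  -- finite type is finite and separable.
  obtain ⟨g, hg⟩ := Algebra.IsStandardSmoothOfRelativeDimension.exists_etale_mvPolynomial 1 K B
  let t : F := algebraMap B F (g (MvPolynomial.X 0))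
  refine ⟨t, ?_⟩
  let : Algebra (MvPolynomial (Fin 1) K) B := g.toRingHom.toAlgebra
  have : Algebra.Etale (MvPolynomial (Fin 1) K) B := hg
  let φ : MvPolynomial (Fin 1) K →ₐ[K] K⟮t⟯ :=
    MvPolynomial.aeval (fun _ => AdjoinSimple.gen K t)
  let : Algebra (MvPolynomial (Fin 1) K) K⟮t⟯ := φ.toRingHom.toAlgebra
  let : Algebra (MvPolynomial (Fin 1) K) F := ((algebraMap B F).comp g.toRingHom).toAlgebra
  have : IsScalarTower (MvPolynomial (Fin 1) K) B F := IsScalarTower.of_algebraMap_eq fun _ => rfl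
  have : IsScalarTower (MvPolynomial (Fin 1) K) K⟮t⟯ F := by
    refine IsScalarTower.of_algebraMap_eq fun p => ?_
    have h1 : ((IsScalarTower.toAlgHom K B F).comp g) = (IsScalarTower.toAlgHom K K⟮t⟯ F).comp φ := by
      apply MvPolynomial.algHom_ext
      intro i
      obtain rfl : i = 0 := Subsingleton.elim _ _
      simp [φ, t]
    exact DFunLike.congr_fun h1 p
  have : Algebra.FormallyUnramified B F :=
    Algebra.FormallyUnramified.of_isLocalization (nonZeroDivisors B)
  have : Algebra.FormallyUnramified (MvPolynomial (Fin 1) K) F :=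
    Algebra.FormallyUnramified.comp _ B F
  have : Algebra.FormallyUnramified K⟮t⟯ F :=
    Algebra.FormallyUnramified.of_restrictScalars (MvPolynomial (Fin 1) K) K⟮t⟯ F
  have : Algebra.FiniteType K B := by
    have : Algebra.IsStandardSmooth K B :=
      Algebra.IsStandardSmoothOfRelativeDimension.isStandardSmooth 1
    infer_instance
  have : Algebra.EssFiniteType B F := .of_isLocalization _ (nonZeroDivisors B)
  have : Algebra.EssFiniteType K F := Algebra.EssFiniteType.comp K B F
  have : Algebra.EssFiniteType K⟮t⟯ F := Algebra.EssFiniteType.of_comp K K⟮t⟯ F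
  exact ⟨Algebra.FormallyUnramified.finite_of_free K⟮t⟯ F, Algebra.FormallyUnramified.isSeparable K⟮t⟯ F⟩

/-- If `t` were algebraic over `K`, then `κ` would be `K` itself. All elements are then constants,
and a non-zero constant has order zero because it and its inverse lie in every `A i`. -/
theorem IsPlaceSystem.product_formula {K κ I : Type*} [Field K] [Field κ] [Algebra K κ]
    [IsAlgClosed K] {A : I → ValuationSubring κ} {ord : I → κ → ℤ} (hA : IsPlaceSystem K A ord)
    (t : κ) (h₁ : FiniteDimensional K⟮t⟯ κ) (h₂ : Algebra.IsSeparable K⟮t⟯ κ)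
    (f : κ) (hf : f ≠ 0) : {i | ord i f ≠ 0}.Finite ∧ ∑ᶠ i, ord i f = 0 := by
  by_cases ht : Transcendental K t
  · exact hA.finite_and_finsum_eq_zero t ht h₁ h₂ f hf
  have h3 : Algebra.IsAlgebraic K K⟮t⟯ :=
    isAlgebraic_adjoin_simple (not_not.1 ht).isIntegral
  have h4 : Algebra.IsAlgebraic K κ := Algebra.IsAlgebraic.trans K K⟮t⟯ κ
  have h5 : ∀ i, ord i f = 0 := by
    intro i
    obtain ⟨c, rfl⟩ := (IsAlgClosed.algebraMap_bijective_of_isIntegral (k := K) (K := κ)).2 f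
    have h6 := (hA.mem_iff i _ hf).1 (hA.algebraMap_mem i c)
    have h7 := (hA.mem_iff i _ (inv_ne_zero hf)).1 (by
      rw [← map_inv₀]; exact hA.algebraMap_mem i c⁻¹)
    rw [hA.ord_inv i hf] at h7
    omega
  simp [h5]

end Separating

/-! ### Valuation rings and points of a proper curve -/

section Valuative

variable {K : Type u} [Field K] {C : Scheme.{u}} [IsIntegral C] (f : C ⟶ Spec (CommRingCat.of K))

/-- The constants in the stalks of a scheme over a field. -/
def constStalk {C : Scheme.{u}} (f : C ⟶ Spec (CommRingCat.of K)) (c : C) :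
    K →+* C.presheaf.stalk c :=
  (C.presheaf.germ ⊤ c trivial).hom.comp
    (f.appTop.hom.comp (Scheme.ΓSpecIso (CommRingCat.of K)).inv.hom)

lemma specMap_fromSpecStalk_comp {C : Scheme.{u}} (f : C ⟶ Spec (CommRingCat.of K)) (c : C)
    {R : CommRingCat.{u}} (ψ : C.presheaf.stalk c ⟶ R) :
    (Spec.map ψ ≫ C.fromSpecStalk c) ≫ f =
      Spec.map (CommRingCat.ofHom (constStalk f c) ≫ ψ) := by
  refine ext_of_isAffine ?_
  rw [← cancel_epi (Scheme.ΓSpecIso (CommRingCat.of K)).inv, ← Scheme.ΓSpecIso_inv_naturality,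
    Scheme.Hom.comp_appTop, Scheme.Hom.comp_appTop, Scheme.fromSpecStalk_appTop]
  have h1 : CommRingCat.ofHom (constStalk f c) = (Scheme.ΓSpecIso (CommRingCat.of K)).inv ≫
    f.appTop ≫ C.presheaf.germ ⊤ c trivial := rfl
  have h2 : (Spec (C.presheaf.stalk c)).presheaf.map
    (homOfLE (le_top : (⊤ : (Spec (C.presheaf.stalk c)).Opens) ≤ ⊤)).op = 𝟙 _ :=
    CategoryTheory.Functor.map_id _ _
  rw [h1]
  simp only [Category.assoc]
  rw [Scheme.ΓSpecIso_inv_naturality]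
  rfl

/-- The valuative criterion extends the generic point to a map from the spectrum of `V`; the image
of the closed point is the required centre. -/
lemma exists_algebraMap_mem_of_isProper [IsProper f] (V : ValuationSubring C.functionField)
    (hV : ∀ c : K, constStalk f (genericPoint C) c ∈ V) :
    ∃ c : C, ∀ r : C.presheaf.stalk c, algebraMap (C.presheaf.stalk c) C.functionField r ∈ V := by
  have hval : ValuativeCriterion f := by
    have h : IsProper f := inferInstance
    rw [IsProper.eq_valuativeCriterion] at h
    exact h.1.1.1
  let i₂ : CommRingCat.of K ⟶ CommRingCat.of V :=
    CommRingCat.ofHom ((constStalk f (genericPoint C)).codRestrict V hV)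
  let i₁ : Spec (CommRingCat.of C.functionField) ⟶ C := C.fromSpecStalk (genericPoint C)
  let j : CommRingCat.of V ⟶ CommRingCat.of C.functionField :=
    CommRingCat.ofHom (algebraMap V C.functionField)
  let S : ValuativeCommSq f :=
    { R := V
      K := C.functionField
      i₁ := i₁
      i₂ := Spec.map i₂
      commSq := ⟨by
        have h := specMap_fromSpecStalk_comp f (genericPoint C) (𝟙 _)
        rw [Spec.map_id, Category.id_comp] at h
        rw [← Spec.map_comp]
        exact h⟩ }
  obtain ⟨⟨l, hl, -⟩⟩ := (hval.existence S).exists_lift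
  let c := l (IsLocalRing.closedPoint V)
  refine ⟨c, fun r => ?_⟩
  let p : C.presheaf.stalk c ⟶ CommRingCat.of V := Scheme.stalkClosedPointTo l
  have h1 : Spec.map p ≫ C.fromSpecStalk c = l := Scheme.Spec_stalkClosedPointTo_fromSpecStalk l
  have hsp : genericPoint C ⤳ c := (genericPoint_spec C).specializes trivial
  have h2 : Spec.map (p ≫ j) ≫ C.fromSpecStalk c =
      Spec.map (C.presheaf.stalkSpecializes hsp) ≫ C.fromSpecStalk c := by
    rw [Spec.map_comp, Category.assoc, h1, Scheme.SpecMap_stalkSpecializes_fromSpecStalk]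
    exact hl
  have h3 := Spec.map_injective ((cancel_mono _).1 h2)
  have h4 : (algebraMap (C.presheaf.stalk c) C.functionField r) = (p.hom r : V) := by
    exact (congr($(h3).hom r)).symm
  rw [h4]
  exact (p.hom r : V).2

/-- Each of the two points gives a lift of the same valuative square, so the lifts agree. Since the
stalks equal `V` in the function field, the maps to `V` are local and the closed point goes to `c`
and to `d`. -/
lemma eq_of_range_algebraMap_eq [IsProper f] (V : ValuationSubring C.functionField) (c d : C)
    (hc : (algebraMap (C.presheaf.stalk c) C.functionField).range = V.toSubring)
    (hd : (algebraMap (C.presheaf.stalk d) C.functionField).range = V.toSubring) : c = d := by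
  have hval : ValuativeCriterion f := by
    have h : IsProper f := inferInstance
    rw [IsProper.eq_valuativeCriterion] at h
    exact h.1.1.1
  have key : ∀ c : C, (algebraMap (C.presheaf.stalk c) C.functionField).range = V.toSubring →
      ∃ p : C.presheaf.stalk c ⟶ CommRingCat.of V, IsLocalHom p.hom ∧
        p ≫ CommRingCat.ofHom (algebraMap V C.functionField) =
          CommRingCat.ofHom (algebraMap (C.presheaf.stalk c) C.functionField) := by
    intro c hc
    have hmem : ∀ r, algebraMap (C.presheaf.stalk c) C.functionField r ∈ V := fun r => by
      have : algebraMap (C.presheaf.stalk c) C.functionField r ∈ V.toSubring := hc ▸ ⟨r, rfl⟩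
      exact this
    refine ⟨CommRingCat.ofHom ((algebraMap (C.presheaf.stalk c) C.functionField).codRestrict V hmem),
      ⟨fun r hr => ?_⟩, rfl⟩
    obtain ⟨b, hb⟩ := hr.exists_right_inv
    have h1 : (b : C.functionField) ∈ (algebraMap (C.presheaf.stalk c) C.functionField).range := by
      rw [hc]; exact b.2
    obtain ⟨b', hb'⟩ := h1
    refine IsUnit.of_mul_eq_one b' (IsFractionRing.injective (C.presheaf.stalk c) C.functionField ?_)
    rw [map_mul, map_one, hb']
    exact congrArg Subtype.val hb
  obtain ⟨p, hp, hpj⟩ := key c hc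
  obtain ⟨q, hq, hqj⟩ := key d hd
  have hsp : ∀ c : C, genericPoint C ⤳ c := fun c => (genericPoint_spec C).specializes trivial
  have hgen : ∀ (c : C) (p : C.presheaf.stalk c ⟶ CommRingCat.of V),
      p ≫ CommRingCat.ofHom (algebraMap V C.functionField) =
          CommRingCat.ofHom (algebraMap (C.presheaf.stalk c) C.functionField) →
      Spec.map (CommRingCat.ofHom (algebraMap V C.functionField)) ≫
        (Spec.map p ≫ C.fromSpecStalk c) = C.fromSpecStalk (genericPoint C) := by
    intro c p hp
    rw [← Category.assoc, ← Spec.map_comp, hp]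
    exact Scheme.SpecMap_stalkSpecializes_fromSpecStalk (hsp c)
  have hconst : ∀ (c : C) (p : C.presheaf.stalk c ⟶ CommRingCat.of V),
      p ≫ CommRingCat.ofHom (algebraMap V C.functionField) =
          CommRingCat.ofHom (algebraMap (C.presheaf.stalk c) C.functionField) →
      ∀ a : K, ((p.hom (constStalk f c a) : V) : C.functionField) =
        constStalk f (genericPoint C) a := by
    intro c p hp a
    have h1 : ((p.hom (constStalk f c a) : V) : C.functionField) =
      algebraMap (C.presheaf.stalk c) C.functionField (constStalk f c a) :=
      congr($(hp).hom (constStalk f c a))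
    rw [h1]
    exact TopCat.Presheaf.germ_stalkSpecializes_apply C.presheaf (U := ⊤) trivial (hsp c) _
  let S : ValuativeCommSq f :=
    { R := V
      K := C.functionField
      i₁ := C.fromSpecStalk (genericPoint C)
      i₂ := (Spec.map p ≫ C.fromSpecStalk c) ≫ f
      commSq := ⟨by rw [← Category.assoc, hgen c p hpj]⟩ }
  have hcd : (Spec.map q ≫ C.fromSpecStalk d) ≫ f = (Spec.map p ≫ C.fromSpecStalk c) ≫ f := by
    rw [specMap_fromSpecStalk_comp, specMap_fromSpecStalk_comp]
    congr 1
    ext a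
    exact (hconst d q hqj a).trans (hconst c p hpj a).symm
  have := hval.uniqueness S
  have h5 : (⟨Spec.map p ≫ C.fromSpecStalk c, hgen c p hpj, rfl⟩ : S.commSq.LiftStruct) =
      ⟨Spec.map q ≫ C.fromSpecStalk d, hgen d q hqj, hcd⟩ := Subsingleton.elim _ _
  have h6 : Spec.map p ≫ C.fromSpecStalk c = Spec.map q ≫ C.fromSpecStalk d :=
    congrArg CommSq.LiftStruct.l h5
  have h7 : ∀ (c : C) (p : C.presheaf.stalk c ⟶ CommRingCat.of V), IsLocalHom p.hom →
      (Spec.map p ≫ C.fromSpecStalk c)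
        (IsLocalRing.closedPoint V : Spec (CommRingCat.of V)) = c := by
    intro c p hp
    have h8 : Spec.map p (IsLocalRing.closedPoint V : Spec (CommRingCat.of V)) =
      IsLocalRing.closedPoint (C.presheaf.stalk c) := IsLocalRing.comap_closedPoint p.hom
    refine (congrArg (C.fromSpecStalk c) h8).trans ?_
    exact Scheme.fromSpecStalk_closedPoint
  rw [← h7 c p hp, h6, h7 d q hq]

end Valuative

/-! ### The order function of a closed point is a discrete valuation -/

section OrdAt

variable {R Q : Type*} [CommRing R] [CommRing Q] [Algebra R Q] {n : ℕ} {t y : R}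

/-- The map from the local ring to the residue field of the generic stalk. -/
abbrev toResidue (R Q : Type*) [CommRing R] [CommRing Q] [Algebra R Q] : R →+* ResidueField Q :=
  (Ideal.Quotient.mk (nilradical Q)).comp (algebraMap R Q)

lemma mem_cyc_one {c : ResidueField Q} : c ∈ cyc R (1 : ResidueField Q) ↔ ∃ r, toResidue R Q r = c := by
  rw [Submodule.mem_span_singleton]
  exact exists_congr fun r => by rw [Algebra.smul_def, mul_one]; rfl

lemma cyc_le_cyc_one {c : ResidueField Q} : cyc R c ≤ cyc R (1 : ResidueField Q) ↔
    ∃ r, toResidue R Q r = c := by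
  rw [Submodule.span_singleton_le_iff_mem, mem_cyc_one]

variable [IsLocalRing R]

/-- Modulo the nilradical the maximal ideal `(t, y)` becomes principal, so the quotient is a
valuation ring, and the residue field consists of its fractions. -/
lemma exists_toResidue_eq_or_inv (h : IsMultipleLocalRing R n t y) (hQ : IsGenericLocalization R Q)
    (c : ResidueField Q) :
    (∃ r, toResidue R Q r = c) ∨ ∃ r, c * toResidue R Q r = 1 := by
  have := h.isPrime
  have := h.noetherian
  have hp : (nilradical Q).IsPrime := (h.toIsMultipleRing.generic hQ).isPrime
  have hloc : IsLocalRing (R ⧸ nilradical R) := .of_surjective' _ Ideal.Quotient.mk_surjective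
  have hval : ValuationRing (R ⧸ nilradical R) := by
    refine ((tfae_of_isNoetherianRing_of_isLocalRing_of_isDomain (R ⧸ nilradical R)).out 1 4).2 ?_
    have h1 : (IsLocalRing.maximalIdeal (R ⧸ nilradical R)).comap
        (Ideal.Quotient.mk (nilradical R)) = IsLocalRing.maximalIdeal R := by
      have := Ideal.comap_isMaximal_of_surjective (Ideal.Quotient.mk (nilradical R))
        Ideal.Quotient.mk_surjective (K := IsLocalRing.maximalIdeal (R ⧸ nilradical R))
      exact IsLocalRing.eq_maximalIdeal this
    rw [← Ideal.map_comap_of_surjective _ Ideal.Quotient.mk_surjective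
      (IsLocalRing.maximalIdeal (R ⧸ nilradical R)), h1, h.maximalIdeal_eq, Ideal.map_span,
      Set.image_pair]
    have h2 : Ideal.Quotient.mk (nilradical R) y = 0 :=
      Ideal.Quotient.eq_zero_iff_mem.2 (h.mem_nilradical_iff.2 ⟨1, (mul_one y).symm⟩)
    rw [h2, Set.pair_comm]
    exact ⟨⟨Ideal.Quotient.mk (nilradical R) t, Submodule.span_insert_zero⟩⟩
  obtain ⟨q, rfl⟩ := Ideal.Quotient.mk_surjective c
  obtain ⟨s, hs, r, hr⟩ := hQ.exists_mul_eq q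
  have hker : ∀ {a b : R}, (Ideal.Quotient.mk (nilradical R) a) = Ideal.Quotient.mk _ b →
      toResidue R Q a = toResidue R Q b := by
    intro a b hab
    rw [Ideal.Quotient.eq, ← IsMultipleRing.algebraMap_mem_nilradical hQ, map_sub] at hab
    exact Ideal.Quotient.eq.2 hab
  have hs0 : toResidue R Q s ≠ 0 := fun h0 =>
    hs ((IsMultipleRing.algebraMap_mem_nilradical hQ).1 (Ideal.Quotient.eq_zero_iff_mem.1 h0))
  have hr' : toResidue R Q s * Ideal.Quotient.mk _ q = toResidue R Q r := by
    change Ideal.Quotient.mk _ (algebraMap R Q s) * _ = _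
    rw [← map_mul, hr]; rfl
  obtain ⟨d, hd⟩ := ValuationRing.cond (Ideal.Quotient.mk (nilradical R) r)
    (Ideal.Quotient.mk (nilradical R) s)
  obtain ⟨d, rfl⟩ := Ideal.Quotient.mk_surjective d
  rcases hd with hd | hd
  · rw [← map_mul] at hd
    have h1 := hker hd
    refine Or.inr ⟨d, mul_left_cancel₀ hs0 ?_⟩
    rw [← mul_assoc, hr', ← map_mul, h1, mul_one]
  · rw [← map_mul] at hd
    have h1 := hker hd
    refine Or.inl ⟨d, mul_left_cancel₀ hs0 ?_⟩
    rw [hr', ← map_mul, h1]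

lemma ordAt_nonneg_iff (h : IsMultipleLocalRing R n t y) (hQ : IsGenericLocalization R Q)
    {c : ResidueField Q} (hc : c ≠ 0) : 0 ≤ ordAt R c ↔ ∃ r, toResidue R Q r = c := by
  have : (nilradical Q).IsPrime := (h.toIsMultipleRing.generic hQ).isPrime
  constructor
  · intro h0
    by_contra hr
    obtain ⟨r, hr'⟩ := (exists_toResidue_eq_or_inv h hQ c).resolve_left hr
    have h1 : cyc R (1 : ResidueField Q) ≤ cyc R c := by
      rw [Submodule.span_singleton_le_iff_mem, Submodule.mem_span_singleton]
      exact ⟨r, by rw [Algebra.smul_def, mul_comm]; exact hr'⟩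
    have h2 := (cyc_commensurable h hQ hc one_ne_zero).1
    rw [ordAt, idx_symm, idx_of_le h1] at h0
    have h3 : (relLength (cyc R c) (cyc R (1 : ResidueField Q))).toNat = 0 := by omega
    have h4 := (ENat.toNat_eq_zero.1 h3).resolve_right h2
    exact hr (cyc_le_cyc_one.1 (relLength_eq_zero.1 h4))
  · intro hr
    rw [ordAt, idx_of_le (cyc_le_cyc_one.2 hr)]
    exact Int.natCast_nonneg _

/-- The quotient of the two cyclic modules is `R / (t, y)`, the residue field of `R`. -/
lemma ordAt_uniformizer (h : IsMultipleLocalRing R n t y) (hQ : IsGenericLocalization R Q) :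
    ordAt R (toResidue R Q t) = 1 := by
  rw [ordAt, idx_of_le (cyc_le_cyc_one.2 ⟨t, rfl⟩)]
  let A := cyc R (1 : ResidueField Q)
  let B := cyc R (toResidue R Q t)
  let φ : R →ₗ[R] A ⧸ B.submoduleOf A := (B.submoduleOf A).mkQ ∘ₗ
    (LinearMap.toSpanSingleton R A ⟨1, Submodule.mem_span_singleton_self 1⟩)
  have hφ : Function.Surjective φ := by
    intro z
    obtain ⟨⟨z, hz⟩, rfl⟩ := Submodule.Quotient.mk_surjective _ z
    obtain ⟨r, rfl⟩ := Submodule.mem_span_singleton.1 hz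
    exact ⟨r, rfl⟩
  have hker : LinearMap.ker φ = IsLocalRing.maximalIdeal R := by
    ext r
    rw [LinearMap.mem_ker, h.maximalIdeal_eq, Ideal.mem_span_pair]
    refine (Submodule.Quotient.mk_eq_zero (B.submoduleOf A)).trans ?_
    change r • (1 : ResidueField Q) ∈ B ↔ _
    rw [Submodule.mem_span_singleton]
    refine exists_congr fun a => ?_
    have h1 : a • toResidue R Q t = r • (1 : ResidueField Q) ↔ r - a * t ∈ nilradical R := by
      rw [← IsMultipleRing.algebraMap_mem_nilradical hQ, map_sub, ← Ideal.Quotient.eq, eq_comm,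
        map_mul, Algebra.smul_def, Algebra.smul_def, mul_one, map_mul]
      rfl
    rw [h1, h.mem_nilradical_iff]
    refine exists_congr fun b => ?_
    constructor
    · intro hb; rw [mul_comm b, ← hb]; ring
    · rintro rfl; ring
  have h1 : relLength A B = 1 := by
    rw [relLength, ← (LinearMap.quotKerEquivOfSurjective φ hφ).length_eq, hker,
      Module.length_eq_one_iff]
    exact isSimpleModule_iff_isCoatom.2 (IsLocalRing.maximalIdeal.isMaximal R).out
  rw [h1]; rfl

end OrdAt

/-! ### The product formula on the reduced curve -/

section ProductFormula

variable {K : Type u} [Field K] {X : Scheme.{u}} [IrreducibleSpace X]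

/-- The order at a point of a rational function on the reduced curve. -/
def ordStalk (x : X) (c : CurveField X) : ℤ :=
  letI := genericAlgebra x
  ordAt (X.presheaf.stalk x) c

/-- This identifies the generic local ring modulo its nilradical with the function field of the
reduced curve, compatibly with all stalks, so that orders can be computed on either side. -/
lemma exists_functionField_hom (X : Scheme.{u}) [IrreducibleSpace X] :
    ∃ θ : X.presheaf.stalk (genericPoint X) →+* (reducedSubscheme X).functionField,
      Function.Surjective θ ∧ RingHom.ker θ = nilradical _ ∧
      ∀ (c : reducedSubscheme X) (r : X.presheaf.stalk (reducedι X c)),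
        θ (ringToGeneric _ r) = algebraMap ((reducedSubscheme X).presheaf.stalk c)
          (reducedSubscheme X).functionField (((reducedι X).stalkMap c).hom r) := by
  let C := reducedSubscheme X
  have hsp : ∀ c : C, genericPoint C ⤳ c := fun c => (genericPoint_spec C).specializes trivial
  have h1 : reducedι X (genericPoint C) ⤳ genericPoint X := by
    obtain ⟨c, hc⟩ := reducedι_surjective (genericPoint X)
    rw [← hc]
    exact (hsp c).map (reducedι X).continuous
  let θ : X.presheaf.stalk (genericPoint X) →+* C.functionField :=
    ((reducedι X).stalkMap (genericPoint C)).hom.comp (X.presheaf.stalkSpecializes h1).hom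
  have hcomm : ∀ (c : C) (r : X.presheaf.stalk (reducedι X c)),
      θ (ringToGeneric _ r) = algebraMap (C.presheaf.stalk c)
          C.functionField (((reducedι X).stalkMap c).hom r) := by
    intro c r
    have h2 := Scheme.Hom.stalkSpecializes_stalkMap_apply (reducedι X) _ _ (hsp c) r
    refine Eq.trans ?_ h2
    refine congrArg ((reducedι X).stalkMap (genericPoint C)) ?_
    exact TopCat.Presheaf.stalkSpecializes_comp_apply X.presheaf _ _ r
  refine ⟨θ, ?_, ?_, hcomm⟩
  · intro b
    obtain ⟨r, hr⟩ := reducedι_stalkMap_surjective (X := X) (genericPoint C) b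
    refine ⟨ringToGeneric _ r, ?_⟩
    rw [hcomm]
    refine Eq.trans (congrArg _ hr) ?_
    exact congr($(TopCat.Presheaf.stalkSpecializes_refl C.presheaf (genericPoint C)).hom b)
  · apply le_antisymm
    · intro q hq
      have h2 : X.presheaf.stalkSpecializes h1 q ∈ RingHom.ker ((reducedι X).stalkMap (genericPoint C)).hom := hq
      rw [reducedι_ker_stalkMap] at h2
      have h3 : ringToGeneric _ (X.presheaf.stalkSpecializes h1 q) = q := by
        have h4 := TopCat.Presheaf.stalkSpecializes_comp_apply X.presheaf
          (genericPoint_specializes' (reducedι X (genericPoint C))) h1 q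
        refine h4.trans ?_
        exact congr($(TopCat.Presheaf.stalkSpecializes_refl X.presheaf (genericPoint X)).hom q)
      rw [← h3]
      exact IsNilpotent.map (mem_nilradical.1 h2) (ringToGeneric _)
    · intro q hq
      have h2 : IsNilpotent (θ q) := IsNilpotent.map hq θ
      exact h2.eq_zero

lemma algebraMap_constStalk {C : Scheme.{u}} [IsIntegral C] (f : C ⟶ Spec (CommRingCat.of K))
    (c : C) (a : K) : algebraMap (C.presheaf.stalk c) C.functionField (constStalk f c a) =
      constStalk f (genericPoint C) a :=
  TopCat.Presheaf.germ_stalkSpecializes_apply C.presheaf (U := ⊤) trivial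
    ((genericPoint_spec C).specializes trivial) _

variable {s : X ⟶ Spec (CommRingCat.of K)} {n : ℕ}

lemma IsPrimitiveMultipleCurve.exists_isMultipleLocalRing' [IsAlgClosed K]
    (hX : IsPrimitiveMultipleCurve K X s n)
    {x : X} (hx : IsClosed {x}) (hne : x ≠ genericPoint X) :
    ∃ t y, IsMultipleLocalRing (X.presheaf.stalk x) n t y := by
  obtain ⟨U, hU, hxU, y, hy⟩ := hX.exists_generator x
  obtain ⟨t, ht⟩ := hX.exists_isMultipleLocalRing hx hne hU hxU hy
  exact ⟨t, _, ht⟩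

lemma exists_separating_functionField {C : Scheme.{u}} [IsIntegral C]
    (f : C ⟶ Spec (CommRingCat.of K)) [SmoothOfRelativeDimension 1 f] :
    letI : Algebra K C.functionField := (constStalk f (genericPoint C)).toAlgebra
    ∃ t : C.functionField, FiniteDimensional (IntermediateField.adjoin K {t}) C.functionField ∧
      Algebra.IsSeparable (IntermediateField.adjoin K {t}) C.functionField := by
  let : Algebra K C.functionField := (constStalk f (genericPoint C)).toAlgebra
  obtain ⟨V, hV, hcV, φ, hφ, hφ'⟩ := exists_standardSmooth_nhd f (genericPoint C)
  let : Algebra K Γ(C, V) := φ.toAlgebra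
  have : Nonempty V := ⟨⟨_, hcV⟩⟩
  have : Algebra.IsStandardSmoothOfRelativeDimension 1 K Γ(C, V) := hφ
  have : IsFractionRing Γ(C, V) C.functionField := functionField_isFractionRing_of_isAffineOpen C V hV
  have : IsScalarTower K Γ(C, V) C.functionField := by
    refine IsScalarTower.of_algebraMap_eq fun a => ?_
    change constStalk f (genericPoint C) a = C.presheaf.germ V (genericPoint C) hcV (φ a)
    rw [hφ']
    have h1 : f.appLE ⊤ V le_top = f.appTop ≫ C.presheaf.map (homOfLE le_top).op := rfl
    rw [h1]
    exact (TopCat.Presheaf.germ_res_apply C.presheaf (homOfLE (le_top : V ≤ ⊤)) (genericPoint C)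
      hcV _).symm
  exact exists_separating (B := Γ(C, V))

/-- Principal divisors on the reduced curve have degree zero. -/
theorem IsPrimitiveMultipleCurve.product_formula [IsAlgClosed K]
    (hX : IsPrimitiveMultipleCurve K X s n)
    (hη : ¬ IsClosed {genericPoint X}) (c : CurveField X) (hc : c ≠ 0) :
    {x : X | IsClosed {x} ∧ ordStalk x c ≠ 0}.Finite ∧
      ∑ᶠ x ∈ closedPoints X, ordStalk x c = 0 := by
  have := hX.isNoetherian
  have := hX.smooth
  have := hX.proper
  let C := reducedSubscheme X
  let f : C ⟶ Spec (CommRingCat.of K) := reducedι X ≫ s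
  let F := C.functionField
  let : Algebra K F := (constStalk f (genericPoint C)).toAlgebra
  obtain ⟨θ, hsurj, hker, hθ⟩ := exists_functionField_hom X
  let e : CurveField X ≃+* F := (Ideal.quotEquivOfEq hker.symm).trans
    (RingHom.quotientKerEquivOfSurjective hsurj)
  have he : ∀ q, e (Ideal.Quotient.mk _ q) = θ q := fun q => rfl
  have hne : ∀ x : closedPoints X, (x : X) ≠ genericPoint X := fun x hx =>
    hη (hx ▸ mem_closedPoints_iff.1 x.2)
  have hmul := fun x : closedPoints X =>
    hX.exists_isMultipleLocalRing' (mem_closedPoints_iff.1 x.2) (hne x)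
  have hgen := fun x : closedPoints X =>
    hX.isGenericLocalization (mem_closedPoints_iff.1 x.2) (hne x)
  have hmem : ∀ (x : X) (a : F), a ∈ (θ.comp (ringToGeneric x)).range ↔
      ∃ r : X.presheaf.stalk x, Ideal.Quotient.mk _ (ringToGeneric x r) = e.symm a := by
    intro x a
    refine exists_congr fun r => ?_
    rw [RingEquiv.eq_symm_apply, he]
    rfl
  have hinv : ∀ (x : closedPoints X) (a : F), a ∈ (θ.comp (ringToGeneric x.1)).range ∨
      a⁻¹ ∈ (θ.comp (ringToGeneric x.1)).range := by
    intro x a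
    let := genericAlgebra x.1
    obtain ⟨t, y, h⟩ := hmul x
    rcases exists_toResidue_eq_or_inv h (hgen x) (e.symm a) with ⟨r, hr⟩ | ⟨r, hr⟩
    · exact Or.inl ((hmem _ _).2 ⟨r, hr⟩)
    · refine Or.inr ⟨r, (inv_eq_of_mul_eq_one_right ?_).symm⟩
      have h1 := congrArg e hr
      rw [map_mul, map_one, RingEquiv.apply_symm_apply] at h1
      exact h1
  let A : closedPoints X → ValuationSubring F := fun x =>
    { toSubring := (θ.comp (ringToGeneric x.1)).range
      mem_or_inv_mem' := hinv x }
  let ord : closedPoints X → F → ℤ := fun x a => ordStalk x.1 (e.symm a)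
  have he0 : ∀ a : F, a ≠ 0 → e.symm a ≠ 0 := fun a ha => by
    rwa [Ne, EmbeddingLike.map_eq_zero_iff]
  have hcurve : ∀ (c : C) (r : C.presheaf.stalk c),
      algebraMap (C.presheaf.stalk c) F r ∈ (θ.comp (ringToGeneric (reducedι X c))).range := by
    intro c r
    obtain ⟨r, rfl⟩ := reducedι_stalkMap_surjective (X := X) c r
    exact ⟨r, hθ c r⟩
  have hcurve' : ∀ (c : C), (θ.comp (ringToGeneric (reducedι X c))).range =
      (algebraMap (C.presheaf.stalk c) F).range := by
    intro c
    apply le_antisymm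
    · rintro _ ⟨r, rfl⟩
      exact ⟨_, (hθ c r).symm⟩
    · rintro _ ⟨r, rfl⟩
      exact hcurve c r
  have hord_mul : ∀ (i : closedPoints X) (a b : F), a ≠ 0 → b ≠ 0 →
      ord i (a * b) = ord i a + ord i b := by
    intro x a b ha hb
    let := genericAlgebra x.1
    obtain ⟨t, y, h⟩ := hmul x
    change ordAt _ _ = ordAt _ _ + ordAt _ _
    rw [map_mul]
    exact ordAt_mul h (hgen x) (he0 a ha) (he0 b hb)
  have hmem_iff : ∀ (i : closedPoints X) (a : F), a ≠ 0 → (a ∈ A i ↔ 0 ≤ ord i a) := by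
    intro x a ha
    let := genericAlgebra x.1
    obtain ⟨t, y, h⟩ := hmul x
    exact (hmem x.1 a).trans (ordAt_nonneg_iff h (hgen x) (he0 a ha)).symm
  have hunif : ∀ i : closedPoints X, ∃ a : F, a ≠ 0 ∧ ord i a = 1 := by
    intro x
    let := genericAlgebra x.1
    obtain ⟨t, y, h⟩ := hmul x
    refine ⟨e (toResidue _ _ t), ?_, ?_⟩
    · rw [Ne, EmbeddingLike.map_eq_zero_iff]
      intro h0
      exact h.notMem ((IsMultipleRing.algebraMap_mem_nilradical (hgen x)).1
        (Ideal.Quotient.eq_zero_iff_mem.1 h0))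
    · change ordAt _ (e.symm (e _)) = 1
      rw [RingEquiv.symm_apply_apply]
      exact ordAt_uniformizer h (hgen x)
  have hconst : ∀ (i : closedPoints X) (c : K), algebraMap K F c ∈ A i := by
    rintro ⟨x, hx⟩ a
    obtain ⟨c, rfl⟩ := reducedι_surjective x
    have h1 := hcurve c (constStalk f c a)
    rw [algebraMap_constStalk] at h1
    exact h1
  have hle : ∀ (x : closedPoints X) (V : ValuationSubring F), V ≠ ⊤ → A x ≤ V → A x = V := by
    intro x V hV hAV
    exact valuationSubring_eq_of_le (hord_mul x) (hmem_iff x) hAV hV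
  have hA : IsPlaceSystem K A ord := by
    -- Distinct closed points give distinct rings by separatedness. Every valuation ring has a
    -- centre by properness, and the centre is not generic because `V ≠ ⊤`.
    refine ⟨hord_mul, hmem_iff, hunif, hconst, ?_, ?_⟩
    · rintro ⟨x, hx⟩ ⟨x', hx'⟩ hxx
      obtain ⟨c, rfl⟩ := reducedι_surjective x
      obtain ⟨d, rfl⟩ := reducedι_surjective x'
      have h1 := eq_of_range_algebraMap_eq f (A ⟨_, hx⟩) c d (hcurve' c).symm (by
        rw [hxx]; exact (hcurve' d).symm)
      subst h1
      rfl
    · intro V hV hKV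
      obtain ⟨c, hc⟩ := exists_algebraMap_mem_of_isProper f V hKV
      have h1 : (θ.comp (ringToGeneric (reducedι X c))).range ≤ V.toSubring := by
        rw [hcurve']
        rintro _ ⟨r, rfl⟩
        exact hc r
      rcases hX.isClosed_or_eq_genericPoint (reducedι X c) with hcl | hgp
      · exact ⟨⟨_, mem_closedPoints_iff.2 hcl⟩, hle ⟨_, _⟩ V hV h1⟩
      · exfalso
        apply hV
        rw [eq_top_iff]
        intro a _
        obtain ⟨q, rfl⟩ := hsurj a
        rw [hgp] at h1
        exact h1 ⟨q, congrArg θ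
          congr($(TopCat.Presheaf.stalkSpecializes_refl X.presheaf (genericPoint X)).hom q)⟩
  obtain ⟨t, h₁, h₂⟩ := exists_separating_functionField f
  obtain ⟨h3, h4⟩ := hA.product_formula t h₁ h₂ (e c) (by
    rwa [Ne, EmbeddingLike.map_eq_zero_iff])
  have h5 : ∀ i : closedPoints X, ord i (e c) = ordStalk i.1 c := fun i => by
    change ordStalk i.1 (e.symm (e c)) = _
    rw [RingEquiv.symm_apply_apply]
  simp only [h5] at h3 h4
  constructor
  · refine (h3.image Subtype.val).subset ?_
    rintro x ⟨hx, hx0⟩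
    exact ⟨⟨x, mem_closedPoints_iff.2 hx⟩, hx0, rfl⟩
  · rw [← h4]
    exact (finsum_subtype_eq_finsum_cond (· ∈ closedPoints X)).symm

end ProductFormula

/-! ### Sums over closed points with finite support -/

section AlmostAll

/-- The filter of the properties that hold at almost all closed points. -/
def almostClosed (X : Type*) [TopologicalSpace X] : Filter X :=
  Filter.cofinite ⊓ Filter.principal (closedPoints X)

variable {X : Type*} [TopologicalSpace X]

lemma eventually_almostClosed {p : X → Prop} :
    (∀ᶠ x in almostClosed X, p x) ↔ {x | x ∈ closedPoints X ∧ ¬ p x}.Finite := by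
  rw [almostClosed, Filter.eventually_inf_principal, Filter.eventually_cofinite]
  simp only [Classical.not_imp]

lemma eventually_mem_closedPoints : ∀ᶠ x in almostClosed X, x ∈ closedPoints X :=
  Filter.mem_inf_of_right (Filter.mem_principal_self _)

lemma finite_closedPoints_inter_support {f : X → ℤ} (hf : ∀ᶠ x in almostClosed X, f x = 0) :
    (closedPoints X ∩ Function.support f).Finite :=
  eventually_almostClosed.1 hf

lemma finsum_closedPoints_add {f g : X → ℤ} (hf : ∀ᶠ x in almostClosed X, f x = 0)
    (hg : ∀ᶠ x in almostClosed X, g x = 0) :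
    ∑ᶠ x ∈ closedPoints X, (f x + g x) =
      ∑ᶠ x ∈ closedPoints X, f x + ∑ᶠ x ∈ closedPoints X, g x :=
  finsum_mem_add_distrib' (finite_closedPoints_inter_support hf)
    (finite_closedPoints_inter_support hg)

lemma finsum_closedPoints_mul (c : ℤ) (f : X → ℤ) :
    ∑ᶠ x ∈ closedPoints X, c * f x = c * ∑ᶠ x ∈ closedPoints X, f x := by
  rw [finsum_mem_def, finsum_mem_def, ← smul_eq_mul, smul_finsum]
  refine finsum_congr fun x => ?_
  by_cases h : x ∈ closedPoints X <;> simp [h]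

lemma finsum_closedPoints_sub {f g : X → ℤ} (hf : ∀ᶠ x in almostClosed X, f x = 0)
    (hg : ∀ᶠ x in almostClosed X, g x = 0) :
    ∑ᶠ x ∈ closedPoints X, (f x - g x) =
      ∑ᶠ x ∈ closedPoints X, f x - ∑ᶠ x ∈ closedPoints X, g x := by
  have h1 := finsum_closedPoints_add (f := fun x => f x) (g := fun x => -1 * g x) hf
    (hg.mono fun x hx => by rw [hx, mul_zero])
  rw [finsum_closedPoints_mul] at h1
  rw [sub_eq_add_neg, ← neg_one_mul, ← h1]
  exact finsum_mem_congr rfl fun x _ => by ring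

lemma finsum_closedPoints_sum {ι : Type*} (s : Finset ι) {f : ι → X → ℤ}
    (hf : ∀ i ∈ s, ∀ᶠ x in almostClosed X, f i x = 0) :
    ∑ᶠ x ∈ closedPoints X, ∑ i ∈ s, f i x = ∑ i ∈ s, ∑ᶠ x ∈ closedPoints X, f i x := by
  classical
  induction s using Finset.induction_on with
  | empty => simp
  | insert i s hi ih =>
    rw [Finset.sum_insert hi, ← ih fun j hj => hf j (Finset.mem_insert_of_mem hj),
      ← finsum_closedPoints_add (hf i (Finset.mem_insert_self i s))]
    · exact finsum_mem_congr rfl fun x _ => Finset.sum_insert hi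
    · have : ∀ᶠ x in almostClosed X, ∀ j ∈ s, f j x = 0 :=
        (Filter.eventually_all_finset s).2 fun j hj => hf j (Finset.mem_insert_of_mem hj)
      exact this.mono fun x hx => Finset.sum_eq_zero hx

lemma finsum_closedPoints_natCast {f : X → ℕ} (hf : ∀ᶠ x in almostClosed X, f x = 0) :
    ∑ᶠ x ∈ closedPoints X, (f x : ℤ) = ((∑ᶠ x ∈ closedPoints X, f x : ℕ) : ℤ) := by
  have h := eventually_almostClosed.1 hf
  exact ((Nat.castAddMonoidHom ℤ).map_finsum_mem' h).symm

lemma finsum_closedPoints_nonneg {f : X → ℤ} (h0 : ∀ x ∈ closedPoints X, 0 ≤ f x)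
    (hf : ∀ᶠ x in almostClosed X, f x = 0) :
    0 ≤ ∑ᶠ x ∈ closedPoints X, f x ∧
      (∑ᶠ x ∈ closedPoints X, f x = 0 → ∀ x ∈ closedPoints X, f x = 0) := by
  have hfin := finite_closedPoints_inter_support hf
  have hmem : ∀ x ∈ hfin.toFinset, 0 ≤ f x := fun x hx => h0 x ((hfin.mem_toFinset).1 hx).1
  rw [finsum_mem_eq_sum f hfin]
  refine ⟨Finset.sum_nonneg hmem, fun h x hx => ?_⟩
  by_contra hx0
  exact hx0 ((Finset.sum_eq_zero_iff_of_nonneg hmem).1 h x (hfin.mem_toFinset.2 ⟨hx, hx0⟩))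

lemma finsum_closedPoints_le {f g : X → ℤ} (h : ∀ x ∈ closedPoints X, f x ≤ g x)
    (hf : ∀ᶠ x in almostClosed X, f x = 0) (hg : ∀ᶠ x in almostClosed X, g x = 0) :
    ∑ᶠ x ∈ closedPoints X, f x ≤ ∑ᶠ x ∈ closedPoints X, g x ∧
      (∑ᶠ x ∈ closedPoints X, f x = ∑ᶠ x ∈ closedPoints X, g x →
        ∀ x ∈ closedPoints X, f x = g x) := by
  obtain ⟨h1, h2⟩ := finsum_closedPoints_nonneg (f := fun x => g x - f x)
    (fun x hx => sub_nonneg.2 (h x hx)) (by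
      filter_upwards [hf, hg] with x hx hx'
      rw [hx, hx', sub_self])
  rw [finsum_closedPoints_sub hg hf] at h1 h2
  exact ⟨sub_nonneg.1 h1, fun heq x hx => (sub_eq_zero.1 (h2 (sub_eq_zero.2 heq.symm) x hx)).symm⟩

end AlmostAll

/-! ### Generators of the nilradical along the curve -/

section Frame

variable (X : Scheme.{u}) [IrreducibleSpace X] (n : ℕ)

/-- Generators of the nilradical of the local rings of a curve of multiplicity `n`, compared with a
generator at the generic point. -/
structure NilradicalFrame where
  /-- the generator at the generic point -/
  g : X.presheaf.stalk (genericPoint X)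
  /-- the generators at the closed points -/
  y : ∀ x : X, X.presheaf.stalk x
  /-- the quotient of the generators -/
  u : X → X.presheaf.stalk (genericPoint X)
  generic : IsMultipleRing (X.presheaf.stalk (genericPoint X)) n g
  isUnit : ∀ q ∉ nilradical (X.presheaf.stalk (genericPoint X)), IsUnit q
  isMultipleLocalRing : ∀ x ∈ closedPoints X,
    ∃ t, IsMultipleLocalRing (X.presheaf.stalk x) n t (y x)
  isGenericLocalization : ∀ x ∈ closedPoints X, letI := genericAlgebra x
    IsGenericLocalization (X.presheaf.stalk x) (X.presheaf.stalk (genericPoint X))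
  notMem : ∀ x ∈ closedPoints X, u x ∉ nilradical (X.presheaf.stalk (genericPoint X))
  map_eq : ∀ x ∈ closedPoints X, ringToGeneric x (y x) = u x * g
  eventually_eq_one : ∀ᶠ x in almostClosed X, u x = 1
  eventually_mem : ∀ U : X.Opens, genericPoint X ∈ U → ∀ᶠ x in almostClosed X, x ∈ U
  eventually_ord : ∀ c : CurveField X, c ≠ 0 → ∀ᶠ x in almostClosed X, ordStalk x c = 0
  finsum_ord : ∀ c : CurveField X, c ≠ 0 → ∑ᶠ x ∈ closedPoints X, ordStalk x c = 0
  eq_genericPoint : ∀ x : X, x ∈ closedPoints X ∨ x = genericPoint X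

variable {X n} {K : Type u} [Field K] [IsAlgClosed K] {s : X ⟶ Spec (CommRingCat.of K)}

theorem IsPrimitiveMultipleCurve.nonempty_nilradicalFrame (hX : IsPrimitiveMultipleCurve K X s n)
    (hη : ¬ IsClosed {genericPoint X}) : Nonempty (NilradicalFrame X n) := by
  have := hX.isNoetherian
  have hne : ∀ x ∈ closedPoints X, x ≠ genericPoint X := by
    rintro x hx rfl; exact hη (mem_closedPoints_iff.1 hx)
  obtain ⟨x₀, -, hx₀⟩ := exists_isClosed_specializes (genericPoint X)
  have hx₀' : x₀ ∈ closedPoints X := mem_closedPoints_iff.2 hx₀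
  obtain ⟨U₀, hU₀, hxU₀, y₀, hy₀⟩ := hX.exists_generator x₀
  have hηU := genericPoint_mem hxU₀
  let g := X.presheaf.germ U₀ (genericPoint X) hηU y₀
  have hQ := fun x (hx : x ∈ closedPoints X) =>
    hX.isGenericLocalization (mem_closedPoints_iff.1 hx) (hne x hx)
  have hunit : ∀ q ∉ nilradical (X.presheaf.stalk (genericPoint X)), IsUnit q := by
    intro q hq
    let := genericAlgebra x₀
    exact IsMultipleRing.isUnit_of_notMem (hQ x₀ hx₀') hq
  have hg : IsMultipleRing (X.presheaf.stalk (genericPoint X)) n g := by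
    let := genericAlgebra x₀
    obtain ⟨t, ht⟩ := hX.exists_isMultipleLocalRing hx₀ (hne x₀ hx₀') hU₀ hxU₀ hy₀
    have h1 := ht.toIsMultipleRing.generic (hQ x₀ hx₀')
    rwa [show algebraMap (X.presheaf.stalk x₀) (X.presheaf.stalk (genericPoint X)) _ = g from
      ringToGeneric_germ hxU₀ y₀] at h1
  -- On `U₀` the germs of the single section `y₀` are used, so that the comparison factor is `1` at
  -- almost all closed points. At the others any local generator will do, and at `η` it differs from
  -- `g` by a unit.
  have key : ∀ x : X, ∃ (y : X.presheaf.stalk x) (u : X.presheaf.stalk (genericPoint X)),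
      x ∈ closedPoints X → (∃ t, IsMultipleLocalRing (X.presheaf.stalk x) n t y) ∧
      u ∉ nilradical (X.presheaf.stalk (genericPoint X)) ∧ ringToGeneric x y = u * g ∧
      (x ∈ U₀ → u = 1) := by
    intro x
    by_cases hx : x ∈ closedPoints X
    swap
    · exact ⟨0, 0, fun h => absurd h hx⟩
    by_cases hxU : x ∈ U₀
    · refine ⟨X.presheaf.germ U₀ x hxU y₀, 1, fun _ => ⟨hX.exists_isMultipleLocalRing
        (mem_closedPoints_iff.1 hx) (hne x hx) hU₀ hxU hy₀,
        (Ideal.ne_top_iff_one _).1 hg.isPrime.ne_top, ?_, fun _ => rfl⟩⟩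
      rw [one_mul]
      exact ringToGeneric_germ hxU y₀
    · obtain ⟨t, y, hy⟩ := hX.exists_isMultipleLocalRing' (mem_closedPoints_iff.1 hx) (hne x hx)
      let := genericAlgebra x
      obtain ⟨v, hv⟩ := hg.exists_unit_mul_eq hunit
        (hy.toIsMultipleRing.generic (hQ x hx)).nilradical_eq
      exact ⟨y, v, fun _ => ⟨⟨t, hy⟩, fun h => hg.isPrime.ne_top
        (Ideal.eq_top_of_isUnit_mem _ h v.isUnit), hv, fun h => absurd h hxU⟩⟩
  choose y u h using key
  have hmem : ∀ U : X.Opens, genericPoint X ∈ U → ∀ᶠ x in almostClosed X, x ∈ U := fun U hU =>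
    eventually_almostClosed.2 <| (hX.finite_of_isClosed U.isOpen.isClosed_compl
      (fun h => h hU)).1.subset fun x hx => hx.2
  exact ⟨{
    g := g
    y := y
    u := u
    generic := hg
    isUnit := hunit
    isMultipleLocalRing := fun x hx => (h x hx).1
    isGenericLocalization := hQ
    notMem := fun x hx => (h x hx).2.1
    map_eq := fun x hx => (h x hx).2.2.1
    eventually_eq_one := by
      filter_upwards [hmem U₀ hηU, eventually_mem_closedPoints] with x hx hx'
      exact (h x hx').2.2.2 hx
    eventually_mem := hmem
    eventually_ord := fun c hc => eventually_almostClosed.2 <|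
      (hX.product_formula hη c hc).1.subset fun x hx => ⟨mem_closedPoints_iff.1 hx.1, hx.2⟩
    finsum_ord := fun c hc => (hX.product_formula hη c hc).2
    eq_genericPoint := fun x => (hX.isClosed_or_eq_genericPoint x).imp_left
      mem_closedPoints_iff.2 }⟩

/-- If `η` were closed, `X` would be a single point and could not support a sheaf of dimension `1`.
This excludes the degenerate case of a `C` consisting of one point. -/
lemma not_isClosed_genericPoint {F : X.Modules} (hF : sheafDim F = 1) :
    ¬ IsClosed {genericPoint X} := by
  intro h
  have huniv : ∀ x : X, x = genericPoint X := fun x =>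
    (genericPoint_specializes' x).mem_closed h rfl
  have : Subsingleton X := ⟨fun a b => (huniv a).trans (huniv b).symm⟩
  have h1 : topologicalKrullDim {x : X | Nontrivial (Stalk F x)} ≤ 0 :=
    topologicalKrullDim_zero_of_discreteTopology _
  rw [sheafDim] at hF
  rw [hF] at h1
  exact absurd h1 (by decide)

end Frame

/-- The order of the inverse of the residue class of `u`. -/
def residueIdx (R : Type*) {Q : Type*} [CommRing R] [CommRing Q] [Algebra R Q] (u : Q) : ℤ :=
  idx (cyc R (Ideal.Quotient.mk (nilradical Q) u)) (cyc R (1 : ResidueField Q))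

lemma residueIdx_one (R : Type*) (Q : Type*) [CommRing R] [CommRing Q] [Algebra R Q] :
    residueIdx R (1 : Q) = 0 := by
  rw [residueIdx, map_one, idx_self]

/-! ### Rank and degree of sheaves with cyclic generic stalk -/

section Lattices

variable {X : Scheme.{u}} [IrreducibleSpace X] {n : ℕ}

/-- The generic stalk as a module over the stalks of the structure sheaf. -/
abbrev genericModule (F : X.Modules) (x : X) :
    Module (X.presheaf.stalk x) (Stalk F (genericPoint X)) :=
  Module.compHom _ (ringToGeneric x)

lemma genericModule_isScalarTower (F : X.Modules) (x : X) :
    letI := genericAlgebra x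
    letI := genericModule F x
    IsScalarTower (X.presheaf.stalk x) (X.presheaf.stalk (genericPoint X))
      (Stalk F (genericPoint X)) :=
  letI := genericAlgebra x
  letI := genericModule F x
  ⟨fun r q v => mul_smul (ringToGeneric x r) q v⟩

/-- The specialization map as a linear map. -/
def toGenericₗ (F : X.Modules) (x : X) :
    letI := genericModule F x
    Stalk F x →ₗ[X.presheaf.stalk x] Stalk F (genericPoint X) :=
  letI := genericModule F x
  { toFun := toGeneric F x
    map_add' := map_add _
    map_smul' := (toGeneric F x).map_smulₛₗ }

/-- The image of a stalk in the generic stalk. -/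
def latticeAt (F : X.Modules) (x : X) :
    letI := genericModule F x
    Submodule (X.presheaf.stalk x) (Stalk F (genericPoint X)) :=
  letI := genericModule F x
  LinearMap.range (toGenericₗ F x)

/-- The submodule over the local ring at `x` generated by an element of the generic stalk. -/
def spanAt (F : X.Modules) (x : X) (e : Stalk F (genericPoint X)) :
    letI := genericModule F x
    Submodule (X.presheaf.stalk x) (Stalk F (genericPoint X)) :=
  letI := genericModule F x
  Submodule.span _ {e}

/-- The index of `y ^ j L` with respect to `y ^ j Λ`, where `L` is the image of the stalk at `x` in
the generic stalk and `Λ` is generated by `e`. -/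
def powIdx (F : X.Modules) (x : X) (y : X.presheaf.stalk x) (e : Stalk F (genericPoint X))
    (j : ℕ) : ℤ :=
  letI := genericModule F x
  idx ((latticeAt F x).map (powSMul _ y j)) ((spanAt F x e).map (powSMul _ y j))

namespace NilradicalFrame

variable (P : NilradicalFrame X n)

/-- The order at `x` of the quotient of the generators of the nilradical. -/
def weight (x : X) : ℤ :=
  letI := genericAlgebra x
  residueIdx (X.presheaf.stalk x) (P.u x)

lemma eventually_weight : ∀ᶠ x in almostClosed X, P.weight x = 0 := by
  filter_upwards [P.eventually_eq_one] with x hx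
  rw [weight, hx, residueIdx_one]

lemma nontrivial (P : NilradicalFrame X n) : Nontrivial (CurveField X) :=
  Ideal.Quotient.nontrivial_iff.2 P.generic.isPrime.ne_top

/-- Sheaves that embed into their generic stalk, which is generated by `e`, with annihilator the
`m`-th power of the nilradical. -/
structure IsCyclic (F : X.Modules) (m : ℕ) (e : Stalk F (genericPoint X)) : Prop where
  le : m ≤ n
  generator : IsGenerator (X.presheaf.stalk (genericPoint X)) m e
  injective : ∀ x ∈ closedPoints X, Function.Injective (toGeneric F x)
  isLattice : ∀ x ∈ closedPoints X,
    letI := genericAlgebra x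
    letI := genericModule F x
    IsLattice (X.presheaf.stalk (genericPoint X)) (latticeAt F x)
  eventually_eq : ∀ᶠ x in almostClosed X, latticeAt F x = spanAt F x e

variable {P} {F : X.Modules} {m : ℕ} {e : Stalk F (genericPoint X)}

namespace IsCyclic

lemma eventually_powIdx (hF : IsCyclic (n := n) F m e) (j : ℕ) :
    ∀ᶠ x in almostClosed X, powIdx F x (P.y x) e j = 0 := by
  filter_upwards [hF.eventually_eq] with x hx
  let := genericModule F x
  rw [powIdx, hx]
  exact idx_self _

lemma localDegree_eq (hF : IsCyclic (n := n) F m e) {x : X} (hx : x ∈ closedPoints X) {j : ℕ}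
    (hj : j < m)
    (θ : CurveField X ≃ₗ[CurveField X] GrGeneric F j)
    (hθ : ∀ (q : X.presheaf.stalk (genericPoint X)) (v : nilFiltration _ _ j),
      (v : Stalk F (genericPoint X)) = (q * P.g ^ j) • e →
        θ (Ideal.Quotient.mk _ q) = Submodule.Quotient.mk v)
    (c : CurveField X) (hc : c ≠ 0) {ι : Type*} (b : ι → GrGeneric F j)
    (hb : Set.range b = {θ c}) :
    localDegree (grMap (toGeneric F x) j) b =
      powIdx F x (P.y x) e j - powIdx F x (P.y x) e (j + 1) +
        (j * P.weight x + ordStalk x c) := by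
  let := genericAlgebra x
  let := genericModule F x
  have := genericModule_isScalarTower F x
  obtain ⟨t, ht⟩ := P.isMultipleLocalRing x hx
  exact localDegree_grMap ht (P.isGenericLocalization x hx) P.generic (P.notMem x hx)
    (P.map_eq x hx) hF.le hF.generator (toGeneric F x) (toGenericₗ F x) (fun _ => rfl)
    (hF.injective x hx) (hF.isLattice x hx) hj θ hθ c hc b hb

lemma localDegree_eq_zero (P : NilradicalFrame X n) (hF : IsCyclic (n := n) F m e) {x : X}
    (hx : x ∈ closedPoints X) {j : ℕ} (hj : m ≤ j) {ι : Type*} (b : ι → GrGeneric F j) :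
    localDegree (grMap (toGeneric F x) j) b = 0 := by
  let := genericAlgebra x
  let := genericModule F x
  have := genericModule_isScalarTower F x
  obtain ⟨t, ht⟩ := P.isMultipleLocalRing x hx
  exact localDegree_grMap_of_le ht.toIsMultipleRing (P.isGenericLocalization x hx) hF.generator
    (toGeneric F x) (hF.injective x hx) hj b

lemma powIdx_self (P : NilradicalFrame X n) (hF : IsCyclic (n := n) F m e) {x : X}
    (hx : x ∈ closedPoints X) : powIdx F x (P.y x) e m = 0 := by
  let := genericAlgebra x
  let := genericModule F x
  have := genericModule_isScalarTower F x
  obtain ⟨t, ht⟩ := P.isMultipleLocalRing x hx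
  have h1 : powSMul (Stalk F (genericPoint X)) (P.y x) m = 0 := by
    ext v
    obtain ⟨q, rfl⟩ := hF.generator.exists_smul_eq v
    change ringToGeneric x (P.y x ^ m) • q • e = 0
    rw [smul_smul, hF.generator.smul_eq_zero_iff, map_pow]
    refine Ideal.mul_mem_right _ _ (Ideal.pow_mem_pow ?_ m)
    exact map_mem_nilradical_pow (i := 1) (σ := ringToGeneric x) (by
      rw [pow_one]; exact ht.mem_nilradical_iff.2 ⟨1, (mul_one _).symm⟩) |> fun h => by
        rwa [pow_one] at h
  rw [powIdx, h1, Submodule.map_zero, Submodule.map_zero, idx_self]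

lemma grRank_eq_zero (P : NilradicalFrame X n) (hF : IsCyclic (n := n) F m e) {j : ℕ}
    (hj : m ≤ j) : grRank F j = 0 := by
  have := P.nontrivial
  have : Subsingleton (GrGeneric F j) := subsingleton_grPiece P.generic hF.generator hj
  exact Module.finrank_zero_of_subsingleton

lemma grDeg_eq_zero (P : NilradicalFrame X n) (hF : IsCyclic (n := n) F m e) {j : ℕ}
    (hj : m ≤ j) : grDeg F j = 0 :=
  finsum_mem_eq_zero_of_forall_eq_zero fun _ hx => hF.localDegree_eq_zero P hx hj _

lemma grRank_eq_one (P : NilradicalFrame X n) (hF : IsCyclic (n := n) F m e) {j : ℕ}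
    (hj : j < m) : grRank F j = 1 := by
  have := P.nontrivial
  obtain ⟨θ, -⟩ := exists_grEquiv P.generic hF.le hF.generator hj
  rw [grRank, ← θ.finrank_eq]
  exact Module.finrank_self (CurveField X)

/-- The piece is one-dimensional, so the frame, although chosen arbitrarily, is a single non-zero
vector, and its coordinate `c` is the same for all closed points. -/
lemma exists_range_grFrame (P : NilradicalFrame X n) (hF : IsCyclic (n := n) F m e) {j : ℕ}
    (hj : j < m)
    (θ : CurveField X ≃ₗ[CurveField X] GrGeneric F j) :
    ∃ c : CurveField X, c ≠ 0 ∧ Set.range (grFrame F j) = {θ c} := by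
  have := P.generic.isPrime
  have hr := hF.grRank_eq_one P hj
  have : Unique (Fin (grRank F j)) := by rw [hr]; infer_instance
  have hne : Nonempty (Module.Basis (Fin (grRank F j)) (CurveField X) (GrGeneric F j)) :=
    ⟨(Module.Basis.singleton _ (CurveField X)).map θ⟩
  refine ⟨θ.symm (grFrame F j default), ?_, ?_⟩
  · rw [Ne, LinearEquiv.map_eq_zero_iff, grFrame, dif_pos hne]
    exact hne.some.ne_zero _
  · rw [LinearEquiv.apply_symm_apply, Set.range_unique]

/-- The local formula is summed over the closed points. The order of the frame coordinate is the
only term depending on the frame, and it disappears by the product formula. -/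
lemma grDeg_eq (P : NilradicalFrame X n) (hF : IsCyclic (n := n) F m e) {j : ℕ} (hj : j < m) :
    grDeg F j = ∑ᶠ x ∈ closedPoints X, powIdx F x (P.y x) e j -
      ∑ᶠ x ∈ closedPoints X, powIdx F x (P.y x) e (j + 1) +
        j * ∑ᶠ x ∈ closedPoints X, P.weight x := by
  obtain ⟨θ, hθ⟩ := exists_grEquiv P.generic hF.le hF.generator hj
  obtain ⟨c, hc, hb⟩ := hF.exists_range_grFrame P hj θ
  have h1 := hF.eventually_powIdx (P := P) j
  have h2 := hF.eventually_powIdx (P := P) (j + 1)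
  have h3 : ∀ᶠ x in almostClosed X, (j : ℤ) * P.weight x = 0 :=
    P.eventually_weight.mono fun x hx => by rw [hx, mul_zero]
  have h4 := P.eventually_ord c hc
  rw [grDeg, finsum_mem_congr rfl fun x hx => hF.localDegree_eq hx hj θ hθ c hc _ hb,
    finsum_closedPoints_add, finsum_closedPoints_sub h1 h2, finsum_closedPoints_add h3 h4,
    P.finsum_ord c hc, finsum_closedPoints_mul, add_zero]
  · filter_upwards [h1, h2] with x hx hx'
    rw [hx, hx', sub_self]
  · filter_upwards [h3, h4] with x hx hx'
    rw [hx, hx', add_zero]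

lemma genRank_eq (P : NilradicalFrame X n) (hF : IsCyclic (n := n) F m e) : genRank n F = m := by
  rw [genRank, ← Finset.sum_range_add_sum_Ico _ hF.le,
    Finset.sum_congr rfl fun j hj => hF.grRank_eq_one P (Finset.mem_range.1 hj),
    Finset.sum_congr rfl fun j hj => hF.grRank_eq_zero P (Finset.mem_Ico.1 hj).1]
  simp

/-- Over the graded pieces the indices telescope down to the one with `j = 0`, as the last one
vanishes because `y ^ m` kills the generic stalk. The weights occur with multiplicity `0 + 1 + ... +
(m - 1)`. -/
theorem genDeg_eq (P : NilradicalFrame X n) (hF : IsCyclic (n := n) F m e) :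
    (genDeg n F : ℚ) = (∑ᶠ x ∈ closedPoints X, powIdx F x (P.y x) e 0 : ℤ) +
      (m * (m - 1) / 2 : ℚ) * (∑ᶠ x ∈ closedPoints X, P.weight x : ℤ) := by
  have h1 : genDeg n F = ∑ j ∈ Finset.range m, grDeg F j := by
    rw [genDeg, ← Finset.sum_range_add_sum_Ico _ hF.le,
      Finset.sum_congr (s₁ := Finset.Ico m n) rfl
        fun j hj => hF.grDeg_eq_zero P (Finset.mem_Ico.1 hj).1]
    simp
  have h2 : ∑ᶠ x ∈ closedPoints X, powIdx F x (P.y x) e m = 0 :=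
    finsum_mem_eq_zero_of_forall_eq_zero fun _ hx => hF.powIdx_self P hx
  have h3 : ((∑ j ∈ Finset.range m, j : ℕ) : ℚ) = m * (m - 1) / 2 := by
    have := Finset.sum_range_id_mul_two m
    rcases Nat.eq_zero_or_pos m with rfl | hm
    · simp
    · have h4 : ((∑ j ∈ Finset.range m, j : ℕ) : ℚ) * 2 = m * (m - 1) := by
        have := congrArg (Nat.cast (R := ℚ)) this
        rw [Nat.cast_mul, Nat.cast_mul, Nat.cast_pred hm] at this
        exact_mod_cast this
      linarith
  have h4 : genDeg n F = ∑ᶠ x ∈ closedPoints X, powIdx F x (P.y x) e 0 +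
      (∑ j ∈ Finset.range m, j : ℕ) * ∑ᶠ x ∈ closedPoints X, P.weight x := by
    rw [h1, Finset.sum_congr rfl fun j hj => hF.grDeg_eq P (Finset.mem_range.1 hj),
      Finset.sum_add_distrib, Finset.sum_range_sub', h2, sub_zero, ← Finset.sum_mul]
    push_cast
    rfl
  rw [← h3, h4]
  push_cast
  rfl

end IsCyclic

end NilradicalFrame

end Lattices

/-! ### Spreading out generators, and torsion-freeness of pure sheaves -/

section Cyclic

variable {X : Scheme.{u}}

lemma germSpan_eq_span (F : X.Modules) {ι : Type*} (U : X.Opens) (s : ι → Γ(F, U)) {x : X}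
    (hx : x ∈ U) : germSpan F U s x = Submodule.span (X.presheaf.stalk x)
      (Set.range fun i => (F.presheaf.germ U x hx (s i) : Stalk F x)) :=
  iInf_pos hx

variable [IrreducibleSpace X] {n : ℕ}

lemma toGeneric_genericPoint (F : X.Modules) (m : Stalk F (genericPoint X)) :
    toGeneric F (genericPoint X) m = m := by
  obtain ⟨U, hU, m, rfl⟩ := F.presheaf.exists_germ_eq m
  exact toGeneric_germ F _ U hU m

namespace NilradicalFrame

/-- At `η` the finitely many local generators are multiples of `e`. These relations hold on open
sets containing `η`, and such sets miss only finitely many closed points. -/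
lemma eventually_span_germ (P : NilradicalFrame X n) {F : X.Modules}
    (hF : SheafOfModules.IsFiniteType (R := X.ringCatSheaf) F) {V : X.Opens}
    (hV : genericPoint X ∈ V) (e : Γ(F, V))
    (he : ∀ v : Stalk F (genericPoint X), ∃ q : X.presheaf.stalk (genericPoint X),
      q • (F.presheaf.germ V (genericPoint X) hV e : Stalk F (genericPoint X)) = v) :
    ∀ᶠ x in almostClosed X, ∃ hx : x ∈ V, Submodule.span (X.presheaf.stalk x)
      {(F.presheaf.germ V x hx e : Stalk F x)} = ⊤ := by
  obtain ⟨U, hU, ι, _, s, hs⟩ := exists_germSpan_eq_top F hF (genericPoint X)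
  let W : X.Opens := U ⊓ V
  let iU : W ⟶ U := homOfLE inf_le_left
  let iV : W ⟶ V := homOfLE inf_le_right
  have hW : genericPoint X ∈ W := ⟨hU, hV⟩
  have key : ∀ i : ι, ∃ (V' : X.Opens) (j : V' ⟶ W), genericPoint X ∈ V' ∧
      F.presheaf.map j.op (F.presheaf.map iU.op (s i)) ∈ Submodule.span Γ(X, V')
        (Set.range fun _ : Unit => F.presheaf.map j.op (F.presheaf.map iV.op e)) := by
    intro i
    refine exists_map_mem_span F (fun _ : Unit => F.presheaf.map iV.op e) _ hW _ ?_
    have h1 : F.presheaf.germ W _ hW (F.presheaf.map iV.op e) = F.presheaf.germ V _ hV e :=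
      TopCat.Presheaf.germ_res_apply F.presheaf iV _ hW e
    rw [Set.range_const, Submodule.mem_span_singleton]
    obtain ⟨q, hq⟩ := he (F.presheaf.germ W _ hW (F.presheaf.map iU.op (s i)))
    exact ⟨q, by rw [h1]; exact hq⟩
  choose V' j hV' hj using key
  have h2 : ∀ᶠ x in almostClosed X, ∀ i, x ∈ V' i :=
    Filter.eventually_all.2 fun i => P.eventually_mem _ (hV' i)
  filter_upwards [P.eventually_mem W hW, h2] with x hx hx'
  refine ⟨hx.2, ?_⟩
  rw [eq_top_iff, ← hs x hx.1, germSpan_eq_span F U s hx.1, Submodule.span_le]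
  rintro _ ⟨i, rfl⟩
  have h3 := hj i
  rw [Set.range_const, Submodule.mem_span_singleton] at h3
  obtain ⟨r, hr⟩ := h3
  have h4 := congrArg (F.presheaf.germ (V' i) x (hx' i)) hr
  rw [germ_smul] at h4
  have h5 : ∀ m : Γ(F, W), F.presheaf.germ (V' i) x (hx' i) (F.presheaf.map (j i).op m) =
    F.presheaf.germ W x hx m := fun m => TopCat.Presheaf.germ_res_apply F.presheaf _ _ _ m
  have h6 : F.presheaf.germ W x hx (F.presheaf.map iV.op e) = F.presheaf.germ V x hx.2 e :=
    TopCat.Presheaf.germ_res_apply F.presheaf _ _ _ _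
  have h7 : F.presheaf.germ W x hx (F.presheaf.map iU.op (s i)) = F.presheaf.germ U x hx.1 (s i) :=
    TopCat.Presheaf.germ_res_apply F.presheaf _ _ _ _
  rw [h5, h5, h6, h7] at h4
  exact Submodule.mem_span_singleton.2 ⟨_, h4⟩

lemma isLattice_latticeAt {F : X.Modules}
    (hF : SheafOfModules.IsFiniteType (R := X.ringCatSheaf) F) (x : X) :
    letI := genericAlgebra x
    letI := genericModule F x
    IsLattice (X.presheaf.stalk (genericPoint X)) (latticeAt F x) := by
  let := genericAlgebra x
  let := genericModule F x
  obtain ⟨U, hU, ι, _, s, hs⟩ := exists_germSpan_eq_top F hF x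
  have h1 := hs x hU
  have hη := (genericPoint_specializes' x).mem_open U.isOpen hU
  have h2 := hs _ hη
  rw [germSpan_eq_span F U s hU] at h1
  rw [germSpan_eq_span F U s hη] at h2
  constructor
  · have h3 : (⊤ : Submodule (X.presheaf.stalk x) (Stalk F x)).FG := by
      rw [← h1]
      exact Submodule.fg_span (Set.finite_range _)
    have h4 := h3.map (toGenericₗ F x)
    rwa [Submodule.map_top] at h4
  · rw [eq_top_iff, ← h2, Submodule.span_le]
    rintro _ ⟨i, rfl⟩
    exact Submodule.subset_span ⟨F.presheaf.germ U x hU (s i), toGeneric_germ F x U hU (s i)⟩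

theorem isCyclic (P : NilradicalFrame X n) {F : X.Modules} (hF : SheafOfModules.IsFiniteType (R := X.ringCatSheaf) F)
    (hinj : ∀ x ∈ closedPoints X, Function.Injective (toGeneric F x)) {m : ℕ} (hm : m ≤ n)
    {e : Stalk F (genericPoint X)}
    (he : IsGenerator (X.presheaf.stalk (genericPoint X)) m e) : IsCyclic (n := n) F m e where
  le := hm
  generator := he
  injective := hinj
  isLattice x _ := isLattice_latticeAt hF x
  eventually_eq := by
    obtain ⟨V, hV, e, rfl⟩ := F.presheaf.exists_germ_eq e
    filter_upwards [P.eventually_span_germ hF hV e he.exists_smul_eq] with x hx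
    obtain ⟨hx, h⟩ := hx
    let := genericModule F x
    have h1 : (Submodule.span (X.presheaf.stalk x)
        {(F.presheaf.germ V x hx e : Stalk F x)}).map (toGenericₗ F x) =
          (⊤ : Submodule (X.presheaf.stalk x) (Stalk F x)).map (toGenericₗ F x) := by rw [h]
    rw [Submodule.map_top, Submodule.map_span, Set.image_singleton] at h1
    refine h1.symm.trans ?_
    have h2 : toGenericₗ F x (F.presheaf.germ V x hx e : Stalk F x) =
      (F.presheaf.germ V _ hV e : Stalk F (genericPoint X)) := toGeneric_germ F x V hx e
    rw [h2]
    rfl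

/-- Pure sheaves embed into their generic stalk. -/
theorem toGeneric_injective [IsLocallyNoetherian X] (P : NilradicalFrame X n) {F : X.Modules}
    (hF : IsCoherent F)
    (hp : IsPure F) (x : X) : Function.Injective (toGeneric F x) := by
  -- `T` consists of the sections that vanish at `η`. It is coherent with zero generic stalk, so its
  -- support is a finite set of closed points and has dimension at most `0`; purity then forces `T =
  -- 0`.
  let T := genericSubsheaf F ⊥
  have hT : IsCoherent T := isCoherent_genericSubsheaf F hF ⊥
  have h0 : Subsingleton (Stalk T (genericPoint X)) := by
    refine subsingleton_of_forall_eq 0 fun v => ?_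
    refine stalkMap_injective (genericSubsheafι F ⊥) _ ?_
    have h1 : stalkMap (genericSubsheafι F ⊥) _ v ∈
      LinearMap.range (stalkMap (genericSubsheafι F ⊥) (genericPoint X)) := ⟨v, rfl⟩
    rw [range_stalkMap_genericSubsheafι, Submodule.mem_comap, toGeneric_genericPoint,
      Submodule.mem_bot] at h1
    rw [h1, map_zero]
  have h1 : ∀ᶠ x in almostClosed X, ¬ Nontrivial (Stalk T x) := by
    filter_upwards [P.eventually_span_germ hT.finiteType (Opens.mem_top (genericPoint X)) 0
      fun v => ⟨0, Subsingleton.elim _ _⟩] with x hx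
    obtain ⟨hx, h⟩ := hx
    rw [map_zero, Submodule.span_zero_singleton] at h
    rw [not_nontrivial_iff_subsingleton]
    exact (Submodule.subsingleton_iff (X.presheaf.stalk x)).1 (subsingleton_of_bot_eq_top h)
  have hmem : ∀ x : X, Nontrivial (Stalk T x) → x ∈ closedPoints X := fun x hx =>
    (P.eq_genericPoint x).resolve_right fun h => by
      subst h; exact not_subsingleton _ h0
  have hzero : Limits.IsZero T := by
    by_contra hne
    have hdim := hp.dim_subsheaf T (genericSubsheafι F ⊥) inferInstance hT hne
    have hfin : Set.Finite {x : X | Nontrivial (Stalk T x)} :=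
      (eventually_almostClosed.1 h1).subset fun x hx => ⟨hmem x hx, not_not.2 hx⟩
    have : Finite {x : X | Nontrivial (Stalk T x)} := hfin
    have : T1Space {x : X | Nontrivial (Stalk T x)} := ⟨fun z => by
      have := (mem_closedPoints_iff.1 (hmem z.1 z.2)).preimage continuous_subtype_val
        (X := {x : X | Nontrivial (Stalk T x)})
      convert this
      ext w
      simp [Subtype.ext_iff]⟩
    have h2 : topologicalKrullDim {x : X | Nontrivial (Stalk T x)} ≤ 0 :=
      topologicalKrullDim_zero_of_discreteTopology _
    rw [sheafDim] at hdim
    rw [hdim] at h2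
    exact absurd h2 (by decide)
  rw [injective_iff_map_eq_zero]
  intro v hv
  have h3 : v ∈ LinearMap.range (stalkMap (genericSubsheafι F ⊥) x) := by
    rw [range_stalkMap_genericSubsheafι]
    exact hv
  obtain ⟨w, rfl⟩ := h3
  have := stalk_subsingleton_of_isZero T hzero x
  rw [Subsingleton.elim w 0, map_zero]

end NilradicalFrame

end Cyclic

/-! ### The degree of the conormal sheaf -/

section Conormal

variable {X : Scheme.{u}}

lemma smul_res_one (U : X.Opens) (r : Γ(X, U)) :
    (r • (structureModule X).presheaf.map (homOfLE le_top).op (1 : Γ(X, ⊤)) :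
      Γ(structureModule X, U)) = (r : Γ(X, U)) := by
  have h1 : X.presheaf.map (homOfLE le_top : U ⟶ ⊤).op (1 : Γ(X, ⊤)) = 1 := map_one _
  exact (congrArg (r * ·) h1).trans (mul_one r)

lemma germ_smul_germ_one (x : X) (U : X.Opens) (hU : x ∈ U) (r : Γ(X, U)) :
    (X.presheaf.germ U x hU r : X.presheaf.stalk x) •
      ((structureModule X).presheaf.germ ⊤ x (Opens.mem_top x) (1 : Γ(X, ⊤)) :
        Stalk (structureModule X) x) =
      ((structureModule X).presheaf.germ U x hU (r : Γ(X, U)) : Stalk (structureModule X) x) := by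
  have h1 := TopCat.Presheaf.germ_res_apply (structureModule X).presheaf (homOfLE le_top) x hU
    (1 : Γ(X, ⊤))
  rw [← h1]
  exact (germ_smul (structureModule X) x U hU r _).symm.trans
    (congrArg ((structureModule X).presheaf.germ U x hU) (smul_res_one U r))

lemma exists_smul_germ_one (x : X) (m : Stalk (structureModule X) x) :
    ∃ r : X.presheaf.stalk x, r • ((structureModule X).presheaf.germ ⊤ x (Opens.mem_top x)
      (1 : Γ(X, ⊤)) : Stalk (structureModule X) x) = m := by
  obtain ⟨U, hU, m, rfl⟩ := (structureModule X).presheaf.exists_germ_eq m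
  exact ⟨X.presheaf.germ U x hU (m : Γ(X, U)), germ_smul_germ_one x U hU m⟩

lemma smul_germ_one_eq_zero_iff (x : X) (r : X.presheaf.stalk x) :
    r • ((structureModule X).presheaf.germ ⊤ x (Opens.mem_top x)
      (1 : Γ(X, ⊤)) : Stalk (structureModule X) x) = 0 ↔ r = 0 := by
  refine ⟨fun h => ?_, fun h => by rw [h, zero_smul]⟩
  obtain ⟨U, hU, r, rfl⟩ := X.presheaf.exists_germ_eq r
  have h2 : (structureModule X).presheaf.germ U x hU (r : Γ(X, U)) =
      (structureModule X).presheaf.germ U x hU 0 :=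
    ((germ_smul_germ_one x U hU r).symm.trans h).trans (map_zero _).symm
  obtain ⟨V, hV, iU, iU', h3⟩ := (structureModule X).presheaf.germ_eq x hU hU _ _ h2
  have h5 : X.presheaf.map iU.op r = 0 := h3.trans (map_zero _)
  have h4 := TopCat.Presheaf.germ_res_apply X.presheaf iU x hV r
  exact h4.symm.trans ((congrArg _ h5).trans (map_zero _))

variable [IrreducibleSpace X] {n : ℕ}

/-- The degree formula for `G_1` is applied to the structure sheaf with generator `1`. There the
lattices are the reference lattices, so all indices vanish and only the weights are left. -/
theorem NilradicalFrame.conormalDeg_eq (P : NilradicalFrame X n) (hn : 1 < n) :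
    conormalDeg X = ∑ᶠ x ∈ closedPoints X, P.weight x := by
  let e : Stalk (structureModule X) (genericPoint X) :=
    (structureModule X).presheaf.germ ⊤ _ (Opens.mem_top _) (1 : Γ(X, ⊤))
  have he : IsGenerator (X.presheaf.stalk (genericPoint X)) n e := by
    refine ⟨exists_smul_germ_one _, fun q => ?_⟩
    rw [smul_germ_one_eq_zero_iff, P.generic.nilradical_eq, Ideal.span_singleton_pow,
      P.generic.pow_eq_zero, Ideal.mem_span_singleton, zero_dvd_iff]
  have hmap : ∀ x : X, toGeneric (structureModule X) x
      ((structureModule X).presheaf.germ ⊤ x (Opens.mem_top x) (1 : Γ(X, ⊤))) = e := fun x =>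
    toGeneric_germ _ _ _ _ _
  have hA : ∀ x, latticeAt (structureModule X) x = spanAt (structureModule X) x e := by
    intro x
    let := genericModule (structureModule X) x
    refine le_antisymm ?_ ?_
    · rintro _ ⟨m, rfl⟩
      obtain ⟨r, rfl⟩ := exists_smul_germ_one x m
      rw [map_smul]
      refine Submodule.smul_mem _ _ ?_
      rw [show toGenericₗ (structureModule X) x _ = e from hmap x]
      exact Submodule.mem_span_singleton_self e
    · refine (Submodule.span_singleton_le_iff_mem _ _).2 ⟨_, hmap x⟩
  have hE : NilradicalFrame.IsCyclic (n := n) (structureModule X) n e :=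
    { le := le_rfl
      generator := he
      injective := by
        intro x hx
        rw [injective_iff_map_eq_zero]
        intro m hm
        obtain ⟨r, rfl⟩ := exists_smul_germ_one x m
        rw [LinearMap.map_smulₛₗ, hmap] at hm
        have h1 := (smul_germ_one_eq_zero_iff _ _).1 hm
        let := genericAlgebra x
        have h2 : r = 0 := (P.isGenericLocalization x hx).injective (h1.trans (map_zero _).symm)
        rw [h2, zero_smul]
      isLattice := by
        intro x hx
        let := genericAlgebra x
        let := genericModule (structureModule X) x
        have := genericModule_isScalarTower (structureModule X) x
        rw [hA]
        exact he.isLattice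
      eventually_eq := Filter.Eventually.of_forall hA }
  have h0 : ∀ j, ∑ᶠ x ∈ closedPoints X, powIdx (structureModule X) x (P.y x) e j = 0 := fun j =>
    finsum_mem_eq_zero_of_forall_eq_zero fun x _ => by
      let := genericModule (structureModule X) x
      rw [powIdx, hA]
      exact idx_self _
  rw [conormalDeg, hE.grDeg_eq P hn, h0, h0]
  simp

end Conormal

/-! ### Submodules of the generic stalk -/

section Uniserial

variable {Q : Type*} [CommRing Q] {n : ℕ} {g : Q} {V : Type*} [AddCommGroup V] [Module Q V]

/-- The submodules of a cyclic module over a ring whose ideals are the powers of the nilradical. -/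
lemma IsGenerator.exists_eq_span_pow (h : IsMultipleRing Q n g)
    (hu : ∀ q ∉ nilradical Q, IsUnit q) {e : V} (he : IsGenerator Q n e) (B : Submodule Q V)
    (hB : B ≠ ⊥) : ∃ i < n, B = Submodule.span Q {g ^ i • e} := by
  classical
  have hex : ∃ i, g ^ i • e ∈ B := ⟨n, by rw [h.pow_eq_zero, zero_smul]; exact zero_mem _⟩
  have hle : B ≤ Submodule.span Q {g ^ Nat.find hex • e} := by
    intro v hv
    obtain ⟨q, rfl⟩ := he.exists_smul_eq v
    rcases h.exists_eq_pow_mul q with rfl | ⟨k, hk, w, hw, rfl⟩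
    · rw [zero_smul]; exact zero_mem _
    · obtain ⟨w, rfl⟩ := hu w hw
      have h1 : g ^ k • e ∈ B := by
        have := B.smul_mem (↑w⁻¹ : Q) hv
        rwa [smul_smul, mul_comm (g ^ k), ← mul_assoc, Units.inv_mul, one_mul] at this
      have h2 := Nat.find_min' hex h1
      refine Submodule.mem_span_singleton.2 ⟨g ^ (k - Nat.find hex) * w, ?_⟩
      rw [smul_smul, mul_right_comm, ← pow_add, Nat.sub_add_cancel h2]
  refine ⟨Nat.find hex, ?_, le_antisymm hle
    ((Submodule.span_singleton_le_iff_mem _ _).2 (Nat.find_spec hex))⟩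
  by_contra! hn
  have h1 : g ^ Nat.find hex = 0 := pow_eq_zero_of_le hn h.pow_eq_zero
  rw [h1, zero_smul, Submodule.span_zero_singleton] at hle
  exact hB (le_bot_iff.1 hle)

/-- The annihilator of `g ^ i e` is generated by `g ^ (n - i)`. This is what gives a subsheaf with
generic stalk `g ^ i V` the generalized rank `n - i`. -/
lemma IsGenerator.of_map_eq_pow_smul (h : IsMultipleRing Q n g) {e : V} (he : IsGenerator Q n e)
    {V' : Type*} [AddCommGroup V'] [Module Q V'] (f : V' →ₗ[Q] V) (hf : Function.Injective f)
    {i : ℕ} (hi : i ≤ n) (hr : LinearMap.range f ≤ Submodule.span Q {g ^ i • e}) {e' : V'}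
    (he' : f e' = g ^ i • e) : IsGenerator Q (n - i) e' where
  exists_smul_eq v := by
    obtain ⟨q, hq⟩ := Submodule.mem_span_singleton.1 (hr ⟨v, rfl⟩)
    exact ⟨q, hf (by rw [map_smul, he', hq])⟩
  smul_eq_zero_iff q := by
    have h1 : q • e' = 0 ↔ (g ^ i * q) • e = 0 := by
      rw [← map_eq_zero_iff f hf, map_smul, he', smul_smul, mul_comm]
    rw [h1, he.smul_eq_zero_iff, h.nilradical_eq, Ideal.span_singleton_pow,
      Ideal.span_singleton_pow, h.pow_eq_zero, Ideal.mem_span_singleton, zero_dvd_iff,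
      Ideal.mem_span_singleton]
    refine ⟨fun h2 => ?_, ?_⟩
    · obtain ⟨c, hc⟩ := h.pow_mul_eq_zero hi h2
      exact ⟨c, hc⟩
    · rintro ⟨c, rfl⟩
      rw [← mul_assoc, ← pow_add, Nat.add_sub_cancel' hi, h.pow_eq_zero, zero_mul]

lemma latticeIndex_zero {R Q V : Type u} [CommRing R] [CommRing Q] [Algebra R Q] [AddCommGroup V]
    [Module Q V] [Module R V] [IsScalarTower R Q V] (y : R) (A : Submodule R V) :
    latticeIndex Q y A 0 = 0 := by
  rw [latticeIndex, relLength_eq_zero]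
  refine Submodule.map_mono ?_
  rintro a ⟨ha, -⟩
  exact ⟨a, ha, by simp⟩

lemma latticeIndex_span {R Q V : Type u} [CommRing R] [CommRing Q] [Algebra R Q] [AddCommGroup V]
    [Module Q V] [Module R V] [IsScalarTower R Q V] {y : R} (h : IsMultipleRing R n y)
    (hQ : IsGenericLocalization R Q) {e : V} (he : IsGenerator Q n e) {j : ℕ} (hj : j ≤ n) :
    latticeIndex Q y (Submodule.span R {e}) j = 0 := by
  rw [latticeIndex, relLength_eq_zero, span_singleton_inf_range_powSMul h hQ le_rfl he hj]

/-- The index of the image of a lattice in the quotient by the nilradical. -/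
def restrIdx (R : Type u) (Q : Type u) {V : Type u} [CommRing R] [CommRing Q] [Algebra R Q]
    [AddCommGroup V] [Module Q V] [Module R V] [IsScalarTower R Q V] (A B : Submodule R V) : ℤ :=
  idx (A.map (modPow R (Q := Q) V 1)) (B.map (modPow R (Q := Q) V 1))

lemma restrIdx_self (R : Type u) (Q : Type u) {V : Type u} [CommRing R] [CommRing Q] [Algebra R Q]
    [AddCommGroup V] [Module Q V] [Module R V] [IsScalarTower R Q V] (A : Submodule R V) :
    restrIdx R Q A A = 0 := idx_self _

end Uniserial

/-! ### Global sums of local indices -/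

section Indices

variable {X : Scheme.{u}} [IrreducibleSpace X] {n : ℕ}

/-- The index of the intersection of the image of the stalk at `x` with `N ^ i F_η`, with respect to
the lattice generated by `v`. -/
def interIdx (F : X.Modules) (x : X) (y : X.presheaf.stalk x) (i : ℕ)
    (v : Stalk F (genericPoint X)) : ℤ :=
  letI := genericModule F x
  idx (latticeAt F x ⊓ LinearMap.range (powSMul (Stalk F (genericPoint X)) y i)) (spanAt F x v)

/-- The index of the image of the stalk at `x` in `F_η / N F_η`. -/
def restrIdxAt (F : X.Modules) (x : X) (e : Stalk F (genericPoint X)) : ℤ :=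
  letI := genericAlgebra x
  letI := genericModule F x
  haveI := genericModule_isScalarTower F x
  restrIdx (X.presheaf.stalk x) (X.presheaf.stalk (genericPoint X)) (latticeAt F x) (spanAt F x e)

namespace NilradicalFrame.IsCyclic

variable {F : X.Modules} {e : Stalk F (genericPoint X)}

lemma eventually_restrIdxAt (hF : IsCyclic (n := n) F n e) :
    ∀ᶠ x in almostClosed X, restrIdxAt F x e = 0 := by
  filter_upwards [hF.eventually_eq] with x hx
  let := genericAlgebra x
  let := genericModule F x
  have := genericModule_isScalarTower F x
  rw [restrIdxAt, hx]
  exact restrIdx_self _ _ _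

lemma localIndex_eq (P : NilradicalFrame X n) (hF : IsCyclic (n := n) F n e) {x : X}
    (hx : x ∈ closedPoints X) {j : ℕ} (hj : j < n) :
    letI := genericAlgebra x
    letI := genericModule F x
    haveI := genericModule_isScalarTower F x
    localIndex F j x =
      (latticeIndex (X.presheaf.stalk (genericPoint X)) (P.y x) (latticeAt F x) j).toNat := by
  let := genericAlgebra x
  let := genericModule F x
  have := genericModule_isScalarTower F x
  obtain ⟨t, ht⟩ := P.isMultipleLocalRing x hx
  exact congrArg ENat.toNat (length_torsionKer_pureQuot ht (P.isGenericLocalization x hx)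
    hF.generator (toGenericₗ F x) (hF.injective x hx) (hF.isLattice x hx) hj)

lemma localIndex_zero (P : NilradicalFrame X n) (hF : IsCyclic (n := n) F n e) {x : X}
    (hx : x ∈ closedPoints X) : localIndex F 0 x = 0 := by
  let := genericAlgebra x
  let := genericModule F x
  have := genericModule_isScalarTower F x
  rw [hF.localIndex_eq P hx P.generic.pos, latticeIndex_zero]
  rfl

lemma eventually_localIndex (P : NilradicalFrame X n) (hF : IsCyclic (n := n) F n e) {j : ℕ}
    (hj : j < n) : ∀ᶠ x in almostClosed X, localIndex F j x = 0 := by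
  filter_upwards [hF.eventually_eq, eventually_mem_closedPoints] with x hx hx'
  let := genericAlgebra x
  let := genericModule F x
  have := genericModule_isScalarTower F x
  obtain ⟨t, ht⟩ := P.isMultipleLocalRing x hx'
  rw [hF.localIndex_eq P hx' hj, hx]
  exact congrArg ENat.toNat (latticeIndex_span ht.toIsMultipleRing (P.isGenericLocalization x hx')
    hF.generator hj.le)

lemma interIdx_eq (P : NilradicalFrame X n) (hF : IsCyclic (n := n) F n e) {x : X}
    (hx : x ∈ closedPoints X) {i : ℕ} (hi : i ≤ n) :
    (letI := genericModule F x
    Commensurable (latticeAt F x ⊓ LinearMap.range (powSMul (Stalk F (genericPoint X)) (P.y x) i))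
      (spanAt F x (P.g ^ i • e))) ∧
    interIdx F x (P.y x) i (P.g ^ i • e) = ∑ j ∈ Finset.Ico i n, (localIndex F j x : ℤ) +
      ((n : ℤ) - i) * (restrIdxAt F x e + i * P.weight x) := by
  let := genericAlgebra x
  let := genericModule F x
  have := genericModule_isScalarTower F x
  obtain ⟨t, ht⟩ := P.isMultipleLocalRing x hx
  obtain ⟨h1, h2⟩ := idx_inf_range_pow_smul ht (P.isGenericLocalization x hx) P.generic
    (P.notMem x hx) (P.map_eq x hx) hF.generator (hF.isLattice x hx) hi
  refine ⟨h1, h2.trans ?_⟩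
  rw [Finset.sum_congr rfl fun j hj =>
    congrArg (Nat.cast (R := ℤ)) (hF.localIndex_eq P hx (Finset.mem_Ico.1 hj).2)]
  rfl

lemma eventually_interIdx (P : NilradicalFrame X n) (hF : IsCyclic (n := n) F n e) {i : ℕ}
    (hi : i ≤ n) : ∀ᶠ x in almostClosed X, interIdx F x (P.y x) i (P.g ^ i • e) = 0 := by
  have h1 : ∀ᶠ x in almostClosed X, ∀ j ∈ Finset.Ico i n, localIndex F j x = 0 :=
    (Filter.eventually_all_finset _).2 fun j hj =>
      hF.eventually_localIndex P (Finset.mem_Ico.1 hj).2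
  filter_upwards [h1, hF.eventually_restrIdxAt, P.eventually_weight, eventually_mem_closedPoints]
    with x h1 h2 h3 h4
  rw [(hF.interIdx_eq P h4 hi).2, h2, h3,
    Finset.sum_eq_zero fun j hj => by rw [h1 j hj, Nat.cast_zero]]
  ring

lemma index_zero (P : NilradicalFrame X n) (hF : IsCyclic (n := n) F n e) : index F 0 = 0 :=
  finsum_mem_eq_zero_of_forall_eq_zero fun _ hx => hF.localIndex_zero P hx

theorem finsum_interIdx (P : NilradicalFrame X n) (hF : IsCyclic (n := n) F n e) {i : ℕ}
    (hi : i ≤ n) : ∑ᶠ x ∈ closedPoints X, interIdx F x (P.y x) i (P.g ^ i • e) =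
      ∑ j ∈ Finset.Ico i n, (index F j : ℤ) +
      ((n : ℤ) - i) * (∑ᶠ x ∈ closedPoints X, restrIdxAt F x e +
        i * ∑ᶠ x ∈ closedPoints X, P.weight x) := by
  have h1 : ∀ j ∈ Finset.Ico i n, ∀ᶠ x in almostClosed X, localIndex F j x = 0 := fun j hj =>
    hF.eventually_localIndex P (Finset.mem_Ico.1 hj).2
  have h1' : ∀ j ∈ Finset.Ico i n, ∀ᶠ x in almostClosed X, (localIndex F j x : ℤ) = 0 :=
    fun j hj => (h1 j hj).mono fun x hx => by rw [hx, Nat.cast_zero]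
  have h2 := hF.eventually_restrIdxAt
  have h3 : ∀ᶠ x in almostClosed X, (i : ℤ) * P.weight x = 0 :=
    P.eventually_weight.mono fun x hx => by rw [hx, mul_zero]
  rw [finsum_mem_congr rfl fun x hx => (hF.interIdx_eq P hx hi).2, finsum_closedPoints_add,
    finsum_closedPoints_mul, finsum_closedPoints_add h2 h3, finsum_closedPoints_mul,
    finsum_closedPoints_sum _ h1', Finset.sum_congr rfl fun j hj =>
      finsum_closedPoints_natCast (h1 j hj)]
  · rfl
  · filter_upwards [(Filter.eventually_all_finset _).2 h1'] with x hx
    exact Finset.sum_eq_zero hx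
  · filter_upwards [h2, h3] with x h2 h3
    rw [h2, h3, add_zero, mul_zero]

end NilradicalFrame.IsCyclic

end Indices

/-! ### Slopes of subsheaves of a generalized line bundle -/

section Subsheaves

variable {X : Scheme.{u}} [IrreducibleSpace X] {n : ℕ} {E F : X.Modules}

/-- The image in the generic stalk of `F` of a stalk of a sheaf that maps to `F`. -/
def imageAt (f : E ⟶ F) (x : X) :
    letI := genericModule F x
    Submodule (X.presheaf.stalk x) (Stalk F (genericPoint X)) :=
  letI := genericModule F x
  LinearMap.range (toGenericₗ F x ∘ₗ stalkMap f x)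

/-- The map on generic stalks, as a linear map over the local ring at `x`. -/
def genericStalkMap (f : E ⟶ F) (x : X) :
    letI := genericModule E x
    letI := genericModule F x
    Stalk E (genericPoint X) →ₗ[X.presheaf.stalk x] Stalk F (genericPoint X) :=
  letI := genericModule E x
  letI := genericModule F x
  { toFun := stalkMap f (genericPoint X)
    map_add' := map_add _
    map_smul' := fun r m => map_smul (stalkMap f (genericPoint X)) (ringToGeneric x r) m }

lemma map_latticeAt (f : E ⟶ F) (x : X) :
    letI := genericModule E x
    letI := genericModule F x
    (latticeAt E x).map (genericStalkMap f x) = imageAt f x := by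
  let := genericModule E x
  let := genericModule F x
  rw [latticeAt, imageAt, ← LinearMap.range_comp]
  congr 1
  ext m
  exact (toGeneric_stalkMap f x m).symm

lemma map_spanAt (f : E ⟶ F) (x : X) {e : Stalk E (genericPoint X)} {v : Stalk F (genericPoint X)}
    (h : stalkMap f (genericPoint X) e = v) :
    letI := genericModule E x
    letI := genericModule F x
    (spanAt E x e).map (genericStalkMap f x) = spanAt F x v := by
  let := genericModule E x
  let := genericModule F x
  rw [spanAt, Submodule.map_span, Set.image_singleton, spanAt, ← h]
  rfl

lemma powIdx_zero_eq (f : E ⟶ F) [Mono f] (x : X) (y : X.presheaf.stalk x)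
    {e : Stalk E (genericPoint X)} {v : Stalk F (genericPoint X)}
    (h : stalkMap f (genericPoint X) e = v) :
    letI := genericModule F x
    powIdx E x y e 0 = idx (imageAt f x) (spanAt F x v) := by
  let := genericModule E x
  let := genericModule F x
  have h0 : powSMul (Stalk E (genericPoint X)) y 0 = LinearMap.id := by
    ext v
    change y ^ 0 • v = v
    rw [pow_zero, one_smul]
  have hinj : Function.Injective (genericStalkMap f x) := stalkMap_injective f (genericPoint X)
  rw [powIdx, h0, Submodule.map_id, Submodule.map_id, ← idx_map_of_injective hinj, map_latticeAt,
    map_spanAt f x h]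

lemma NilradicalFrame.mem_range_powSMul_iff (P : NilradicalFrame X n) {e : Stalk F (genericPoint X)}
    (he : IsGenerator (X.presheaf.stalk (genericPoint X)) n e) {x : X} (hx : x ∈ closedPoints X)
    (i : ℕ) (v : Stalk F (genericPoint X)) :
    letI := genericModule F x
    v ∈ LinearMap.range (powSMul (Stalk F (genericPoint X)) (P.y x) i) ↔
      v ∈ Submodule.span (X.presheaf.stalk (genericPoint X)) {P.g ^ i • e} := by
  let := genericModule F x
  obtain ⟨w, hw⟩ := P.isUnit _ (P.notMem x hx)
  have hy : ∀ v : Stalk F (genericPoint X), powSMul (Stalk F (genericPoint X)) (P.y x) i v =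
      ((w : X.presheaf.stalk (genericPoint X)) ^ i * P.g ^ i) • v := by
    intro v
    change ringToGeneric x (P.y x ^ i) • v = _
    rw [map_pow, P.map_eq x hx, ← hw, mul_pow]
  constructor
  · rintro ⟨v, rfl⟩
    obtain ⟨q, rfl⟩ := he.exists_smul_eq v
    rw [hy, smul_smul, mul_right_comm, mul_smul]
    exact Submodule.smul_mem _ _ (Submodule.mem_span_singleton_self _)
  · intro hv
    obtain ⟨q, rfl⟩ := Submodule.mem_span_singleton.1 hv
    refine ⟨((↑w⁻¹ : X.presheaf.stalk (genericPoint X)) ^ i * q) • e, ?_⟩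
    rw [hy, smul_smul, smul_smul]
    congr 1
    have : (w : X.presheaf.stalk (genericPoint X)) ^ i * ↑w⁻¹ ^ i = 1 := by
      rw [← mul_pow, Units.mul_inv, one_pow]
    linear_combination (P.g ^ i * q) * this

lemma imageAt_le (P : NilradicalFrame X n) (f : E ⟶ F) {e : Stalk F (genericPoint X)}
    (he : IsGenerator (X.presheaf.stalk (genericPoint X)) n e) {i : ℕ}
    (hr : LinearMap.range (stalkMap f (genericPoint X)) ≤
      Submodule.span (X.presheaf.stalk (genericPoint X)) {P.g ^ i • e})
    {x : X} (hx : x ∈ closedPoints X) :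
    letI := genericModule F x
    imageAt f x ≤ latticeAt F x ⊓ LinearMap.range (powSMul (Stalk F (genericPoint X)) (P.y x) i) := by
  let := genericModule F x
  rintro _ ⟨m, rfl⟩
  refine ⟨⟨_, rfl⟩, (P.mem_range_powSMul_iff he hx i _).2 (hr ⟨toGeneric E x m, ?_⟩)⟩
  exact (toGeneric_stalkMap f x m).symm

lemma imageAt_genericSubsheafι (P : NilradicalFrame X n) {e : Stalk F (genericPoint X)}
    (he : IsGenerator (X.presheaf.stalk (genericPoint X)) n e) (i : ℕ) {x : X}
    (hx : x ∈ closedPoints X) :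
    letI := genericModule F x
    imageAt (genericSubsheafι F
      (Submodule.span (X.presheaf.stalk (genericPoint X)) {P.g ^ i • e})) x =
      latticeAt F x ⊓ LinearMap.range (powSMul (Stalk F (genericPoint X)) (P.y x) i) := by
  let := genericModule F x
  refine le_antisymm (imageAt_le P _ he ?_ hx) ?_
  · rintro _ ⟨m, rfl⟩
    have : stalkMap (genericSubsheafι F (Submodule.span (X.presheaf.stalk (genericPoint X))
      {P.g ^ i • e})) (genericPoint X) m ∈ LinearMap.range (stalkMap _ (genericPoint X)) := ⟨m, rfl⟩
    rwa [range_stalkMap_genericSubsheafι, Submodule.mem_comap, toGeneric_genericPoint] at this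
  · rintro _ ⟨⟨m, rfl⟩, hm⟩
    have h1 := (P.mem_range_powSMul_iff he hx i _).1 hm
    have h2 : m ∈ LinearMap.range (stalkMap (genericSubsheafι F
        (Submodule.span (X.presheaf.stalk (genericPoint X)) {P.g ^ i • e})) x) := by
      rw [range_stalkMap_genericSubsheafι]; exact h1
    obtain ⟨m, rfl⟩ := h2
    exact ⟨m, rfl⟩

lemma injective_toGeneric_of_mono (f : E ⟶ F) [Mono f] {x : X}
    (h : Function.Injective (toGeneric F x)) : Function.Injective (toGeneric E x) := by
  have h1 : Function.Injective (toGeneric F x ∘ stalkMap f x) :=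
    h.comp (stalkMap_injective f x)
  have h2 : toGeneric F x ∘ stalkMap f x = stalkMap f (genericPoint X) ∘ toGeneric E x :=
    funext fun m => toGeneric_stalkMap f x m
  rw [h2] at h1
  exact h1.of_comp

variable {e : Stalk F (genericPoint X)}

/-- The stalks of `E` embed into its generic stalk, so a non-zero `E` has a non-zero generic stalk;
the uniserial structure of `F_η` does the rest. -/
lemma NilradicalFrame.exists_range_eq_span (P : NilradicalFrame X n)
    (hF : IsCyclic (n := n) F n e) (f : E ⟶ F) [Mono f] (hE0 : ¬ Limits.IsZero E) :
    ∃ i < n, LinearMap.range (stalkMap f (genericPoint X)) =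
        Submodule.span (X.presheaf.stalk (genericPoint X)) {P.g ^ i • e} := by
  have hinj : ∀ x ∈ closedPoints X, Function.Injective (toGeneric E x) := fun x hx =>
    injective_toGeneric_of_mono f (hF.injective x hx)
  refine hF.generator.exists_eq_span_pow P.generic P.isUnit _ fun h0 => ?_
  have hsub : ∀ m : Stalk E (genericPoint X), m = 0 := fun m => by
    refine stalkMap_injective f _ ?_
    rw [map_zero]
    have : stalkMap f _ m ∈ LinearMap.range (stalkMap f (genericPoint X)) := ⟨m, rfl⟩
    rwa [h0] at this
  refine hE0 (isZero_of_stalk_subsingleton E fun x => ?_)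
  rcases P.eq_genericPoint x with hx | rfl
  · exact ⟨fun a b => hinj x hx ((hsub _).trans (hsub _).symm)⟩
  · exact ⟨fun a b => (hsub a).trans (hsub b).symm⟩

/-- The slope of the subsheaf of `F` of the sections that lie in `N ^ i F_η`. -/
def NilradicalFrame.slopeBound (P : NilradicalFrame X n) (F : X.Modules)
    (e : Stalk F (genericPoint X)) (i : ℕ) : ℚ :=
  ((∑ᶠ x ∈ closedPoints X, interIdx F x (P.y x) i (P.g ^ i • e) : ℤ) +
    (((n : ℚ) - i) * ((n : ℚ) - i - 1) / 2) * (∑ᶠ x ∈ closedPoints X, P.weight x : ℤ)) /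
      ((n : ℚ) - i)

/-- The slope of a non-zero subsheaf. -/
theorem NilradicalFrame.slope_le (P : NilradicalFrame X n)
    (hF : IsCyclic (n := n) F n e) (hE : IsCoherent E) (f : E ⟶ F) [Mono f]
    {i : ℕ} (hi : i < n) (hr : LinearMap.range (stalkMap f (genericPoint X)) =
        Submodule.span (X.presheaf.stalk (genericPoint X)) {P.g ^ i • e}) :
    slope n E ≤ P.slopeBound F e i ∧
      (slope n E = P.slopeBound F e i ↔ ∀ x ∈ closedPoints X, letI := genericModule F x
          imageAt f x =
            latticeAt F x ⊓ LinearMap.range (powSMul (Stalk F (genericPoint X)) (P.y x) i)) := by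
  have hinj : ∀ x ∈ closedPoints X, Function.Injective (toGeneric E x) := fun x hx =>
    injective_toGeneric_of_mono f (hF.injective x hx)
  obtain ⟨e', he'⟩ : P.g ^ i • e ∈ LinearMap.range (stalkMap f (genericPoint X)) := by
    rw [hr]; exact Submodule.mem_span_singleton_self _
  have hgen := hF.generator.of_map_eq_pow_smul P.generic (stalkMap f (genericPoint X))
    (stalkMap_injective f _) hi.le hr.le he'
  -- `E` is itself cyclic, with generator `e'` lying over `g ^ i e`, so its degree is the sum of the
  -- indices of its lattices plus a term that depends only on `n - i`. Lattices in `F_η` can thus be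
  -- compared point by point.
  have hEc := P.isCyclic hE.finiteType hinj (Nat.sub_le n i) hgen
  have hdeg := hEc.genDeg_eq P
  rw [Nat.cast_sub hi.le] at hdeg
  have hle : ∀ x ∈ closedPoints X,
      powIdx E x (P.y x) e' 0 ≤ interIdx F x (P.y x) i (P.g ^ i • e) ∧
      letI := genericModule F x
      (powIdx E x (P.y x) e' 0 = interIdx F x (P.y x) i (P.g ^ i • e) ↔ imageAt f x =
        latticeAt F x ⊓ LinearMap.range (powSMul (Stalk F (genericPoint X)) (P.y x) i)) := by
    intro x hx
    obtain ⟨t, ht⟩ := P.isMultipleLocalRing x hx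
    let := genericAlgebra x
    let := genericModule F x
    let := genericModule E x
    have := genericModule_isScalarTower E x
    have h1 := imageAt_le P f hF.generator hr.le hx
    have h2 := (hF.interIdx_eq P hx hi.le).1
    have h3 : Commensurable (imageAt f x) (spanAt F x (P.g ^ i • e)) := by
      have h4 : Commensurable (latticeAt E x) (spanAt E x e') :=
        (hEc.isLattice x hx).commensurable ht (P.isGenericLocalization x hx)
          hEc.generator.isLattice
      have h5 := h4.map (genericStalkMap f x)
      rwa [map_latticeAt, map_spanAt f x he'] at h5
    rw [powIdx_zero_eq f x (P.y x) he', interIdx]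
    refine ⟨idx_le_of_le h1 h2 h3, eq_of_idx_eq h1 h2 h3, fun h => ?_⟩
    rw [h]
  obtain ⟨hsum, hsum'⟩ := finsum_closedPoints_le (fun x hx => (hle x hx).1)
    (hEc.eventually_powIdx (P := P) 0) (hF.eventually_interIdx P hi.le)
  have hpos : (0 : ℚ) < (n : ℚ) - i := sub_pos.2 (Nat.cast_lt.2 hi)
  rw [slope, slopeBound, hEc.genRank_eq P, hdeg, Nat.cast_sub hi.le]
  constructor
  · refine div_le_div_of_nonneg_right (add_le_add_left ?_ _) hpos.le
    exact_mod_cast hsum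
  -- Equality of the sums of termwise ordered families forces equality at each closed point, and
  -- there inclusion with equal index is equality of lattices.
  · rw [div_left_inj' hpos.ne', add_left_inj, Int.cast_inj]
    exact ⟨fun h x hx => (hle x hx).2.1 (hsum' h x hx), fun h =>
      finsum_mem_congr rfl fun x hx => (hle x hx).2.2 (h x hx)⟩

end Subsheaves

/-! ### From slopes to the inequalities -/

section Slopes

/-- Here `A` and `B` stand for the sums of the indices from `i` on and below `i`, `D` for the total
index modulo the nilradical and `W` for the conormal degree. After clearing denominators `D`
cancels. -/
lemma slope_inequality_iff {n i A B D W : ℚ} (hi : i < n) (hn : 0 < n) :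
    ((A + (n - i) * (D + i * W) + (n - i) * (n - i - 1) / 2 * W) / (n - i) ≤
        (B + A + n * D + n * (n - 1) / 2 * W) / n ↔
      i * A - (n - i) * B ≤ -(i * n * (n - i) / 2) * W) ∧
    ((A + (n - i) * (D + i * W) + (n - i) * (n - i - 1) / 2 * W) / (n - i) <
        (B + A + n * D + n * (n - 1) / 2 * W) / n ↔
      i * A - (n - i) * B < -(i * n * (n - i) / 2) * W) := by
  have hpos : 0 < n - i := sub_pos.2 hi
  have key : (B + A + n * D + n * (n - 1) / 2 * W) * (n - i) -
      (A + (n - i) * (D + i * W) + (n - i) * (n - i - 1) / 2 * W) * n =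
      -(i * n * (n - i) / 2) * W - (i * A - (n - i) * B) := by ring
  constructor
  · rw [div_le_div_iff₀ hpos hn, ← sub_nonneg, key, sub_nonneg]
  · rw [div_lt_div_iff₀ hpos hn, ← sub_pos, key, sub_pos]

variable {X : Scheme.{u}}

lemma stalkMap_surjective {E F : X.Modules} (f : E ⟶ F) [IsIso f] (x : X) :
    Function.Surjective (stalkMap f x) := by
  intro m
  obtain ⟨U, hU, m, rfl⟩ := F.presheaf.exists_germ_eq m
  refine ⟨E.presheaf.germ U x hU ((inv f).app U m), ?_⟩
  rw [stalkMap_germ]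
  congr 1
  simp

variable [IrreducibleSpace X] {n : ℕ} {E F : X.Modules} {e : Stalk F (genericPoint X)}

lemma imageAt_eq_of_surjective (f : E ⟶ F) {x : X} (h : Function.Surjective (stalkMap f x)) :
    imageAt f x = latticeAt F x := by
  let := genericModule F x
  rw [imageAt, latticeAt, LinearMap.range_comp, LinearMap.range_eq_top.2 h, Submodule.map_top]

lemma range_powSMul_zero (x : X) (y : X.presheaf.stalk x) :
    letI := genericModule F x
    LinearMap.range (powSMul (Stalk F (genericPoint X)) y 0) = ⊤ := by
  let := genericModule F x
  refine LinearMap.range_eq_top.2 fun v => ⟨v, ?_⟩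
  change y ^ 0 • v = v
  rw [pow_zero, one_smul]

namespace NilradicalFrame

variable (P : NilradicalFrame X n)

lemma span_pow_zero (hF : IsCyclic (n := n) F n e) :
    Submodule.span (X.presheaf.stalk (genericPoint X)) {P.g ^ 0 • e} = ⊤ := by
  rw [pow_zero, one_smul, eq_top_iff]
  intro v _
  exact Submodule.mem_span_singleton.2 (hF.generator.exists_smul_eq v)

lemma slope_eq_slopeBound_zero (hF : IsCyclic (n := n) F n e) (hc : IsCoherent F) :
    slope n F = P.slopeBound F e 0 := by
  refine (P.slope_le hF hc (𝟙 F) P.generic.pos ?_).2.2 fun x hx => ?_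
  · rw [P.span_pow_zero hF, LinearMap.range_eq_top]
    exact stalkMap_surjective _ _
  · let := genericModule F x
    rw [range_powSMul_zero, inf_top_eq]
    exact imageAt_eq_of_surjective _ (stalkMap_surjective _ _)

/-- Equality in the bound with `i = 0` means that `E` and `F` have the same lattice at every closed
point, and the generic stalks agree by hypothesis; so `f` is bijective on all stalks. -/
lemma isIso_of_slope_eq (hF : IsCyclic (n := n) F n e) (hE : IsCoherent E) (f : E ⟶ F) [Mono f]
    (hr : LinearMap.range (stalkMap f (genericPoint X)) =
        Submodule.span (X.presheaf.stalk (genericPoint X)) {P.g ^ 0 • e})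
    (h : slope n E = P.slopeBound F e 0) : IsIso f := by
  refine isIso_of_stalkMap_bijective f fun x => ⟨stalkMap_injective f x, ?_⟩
  rcases P.eq_genericPoint x with hx | rfl
  · have h1 := (P.slope_le hF hE f P.generic.pos hr).2.1 h x hx
    let := genericModule F x
    rw [range_powSMul_zero, inf_top_eq] at h1
    intro m
    have h2 : toGenericₗ F x m ∈ imageAt f x := by
      rw [h1]; exact ⟨m, rfl⟩
    obtain ⟨m', hm'⟩ := h2
    exact ⟨m', hF.injective x hx hm'⟩
  · rw [← LinearMap.range_eq_top, hr, P.span_pow_zero hF]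

/-- The bounds for the slopes are attained. -/
lemma exists_slope_eq [IsLocallyNoetherian X] (hF : IsCyclic (n := n) F n e) (hc : IsCoherent F)
    {i : ℕ} (hi0 : 0 < i) (hi : i < n) :
    ∃ (E : X.Modules) (f : E ⟶ F), Mono f ∧ IsCoherent E ∧ ¬ Limits.IsZero E ∧ ¬ IsIso f ∧
      slope n E = P.slopeBound F e i := by
  let W := Submodule.span (X.presheaf.stalk (genericPoint X)) {P.g ^ i • e}
  have hr : LinearMap.range (stalkMap (genericSubsheafι F W) (genericPoint X)) = W := by
    rw [range_stalkMap_genericSubsheafι]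
    ext v
    rw [Submodule.mem_comap, toGeneric_genericPoint]
  have hE := isCoherent_genericSubsheaf F hc W
  refine ⟨genericSubsheaf F W, genericSubsheafι F W, inferInstance, hE, fun h0 => ?_, fun hiso => ?_,
    (P.slope_le hF hE _ hi hr).2.2 fun x hx => imageAt_genericSubsheafι P hF.generator i hx⟩
  -- The subsheaf is non-zero because `g ^ i e ≠ 0` for `i < n`, and proper because `e` is not a
  -- multiple of `g ^ i e` when `i > 0`.
  · obtain ⟨v, hv⟩ : P.g ^ i • e ∈
        LinearMap.range (stalkMap (genericSubsheafι F W) (genericPoint X)) := by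
      rw [hr]; exact Submodule.mem_span_singleton_self _
    have := stalk_subsingleton_of_isZero _ h0 (genericPoint X)
    rw [Subsingleton.elim v 0, map_zero] at hv
    have h1 := (hF.generator.smul_eq_zero_iff _).1 hv.symm
    rw [P.generic.nilradical_eq, Ideal.span_singleton_pow, P.generic.pow_eq_zero,
      Ideal.mem_span_singleton, zero_dvd_iff] at h1
    exact P.generic.pow_ne_zero (pow_eq_zero_of_le (by omega) h1)
  · rw [LinearMap.range_eq_top.2 (stalkMap_surjective _ _)] at hr
    have h1 : e ∈ W := hr ▸ Submodule.mem_top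
    obtain ⟨q, hq⟩ := Submodule.mem_span_singleton.1 h1
    have h2 : (1 - q * P.g ^ i) • e = 0 := by
      rw [sub_smul, one_smul, mul_smul, hq, sub_self]
    have h3 := Ideal.pow_le_self P.generic.pos.ne' ((hF.generator.smul_eq_zero_iff _).1 h2)
    have h4 : q * P.g ^ i ∈ nilradical (X.presheaf.stalk (genericPoint X)) :=
      Ideal.mul_mem_left _ _ (Ideal.pow_mem_of_mem _
        (P.generic.mem_nilradical_iff.2 ⟨1, (mul_one _).symm⟩) i hi0)
    have h5 := add_mem h3 h4
    rw [sub_add_cancel] at h5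
    exact (Ideal.ne_top_iff_one _).1 P.generic.isPrime.ne_top h5

lemma slopeBound_iff (hF : IsCyclic (n := n) F n e) {i : ℕ} (hi : i ∈ Finset.Icc 1 (n - 1)) :
    (P.slopeBound F e i ≤ P.slopeBound F e 0 ↔
      (i : ℚ) * ∑ j ∈ Finset.Icc i (n - 1), (index F j : ℚ)
          - ((n : ℚ) - i) * ∑ j ∈ Finset.Ico 1 i, (index F j : ℚ)
        ≤ -((i : ℚ) * n * ((n : ℚ) - i) / 2) * (conormalDeg X : ℚ)) ∧
    (P.slopeBound F e i < P.slopeBound F e 0 ↔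
      (i : ℚ) * ∑ j ∈ Finset.Icc i (n - 1), (index F j : ℚ)
          - ((n : ℚ) - i) * ∑ j ∈ Finset.Ico 1 i, (index F j : ℚ)
        < -((i : ℚ) * n * ((n : ℚ) - i) / 2) * (conormalDeg X : ℚ)) := by
  rw [Finset.mem_Icc] at hi
  have hin : i < n := by omega
  have h1 : Finset.Icc i (n - 1) = Finset.Ico i n := by
    ext j; simp only [Finset.mem_Icc, Finset.mem_Ico]; omega
  -- The slope of `F` involves the indices from `j = 0` on; the one with `j = 0` vanishes, which is
  -- why the sums in the criterion start at `1`.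
  have h2 : ∑ j ∈ Finset.Ico 0 n, (index F j : ℚ) =
      ∑ j ∈ Finset.Ico 1 i, (index F j : ℚ) + ∑ j ∈ Finset.Ico i n, (index F j : ℚ) := by
    rw [Finset.sum_Ico_consecutive _ hi.1 hin.le, Finset.sum_eq_sum_Ico_succ_bot (by omega),
      hF.index_zero P, Nat.cast_zero, zero_add]
  have h3 := slope_inequality_iff (n := n) (i := i) (A := ∑ j ∈ Finset.Ico i n, (index F j : ℚ))
    (B := ∑ j ∈ Finset.Ico 1 i, (index F j : ℚ))
    (D := (∑ᶠ x ∈ closedPoints X, restrIdxAt F x e : ℤ)) (W := conormalDeg X)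
    (Nat.cast_lt.2 hin) (Nat.cast_pos.2 P.generic.pos)
  rw [h1, slopeBound, slopeBound, hF.finsum_interIdx P hin.le, hF.finsum_interIdx P n.zero_le,
    ← P.conormalDeg_eq (by omega)]
  push_cast
  rw [h2]
  simp only [sub_zero, zero_mul, add_zero]
  exact h3

end NilradicalFrame

end Slopes

end GenLineBundle

end

theorem mainTheorem2 {K : Type u} [Field K] [IsAlgClosed K]
    (X : Scheme.{u}) [IrreducibleSpace X] (s : X ⟶ Spec (CommRingCat.of K)) (n : ℕ)
    (hX : GenLineBundle.IsPrimitiveMultipleCurve K X s n)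
    (F : X.Modules) (hF : GenLineBundle.IsGenLineBundle F) :
    (GenLineBundle.IsSemistable n F ↔
      ∀ i ∈ Finset.Icc 1 (n - 1),
        (i : ℚ) * ∑ j ∈ Finset.Icc i (n - 1), (GenLineBundle.index F j : ℚ)
            - ((n : ℚ) - i) * ∑ j ∈ Finset.Ico 1 i, (GenLineBundle.index F j : ℚ)
          ≤ -((i : ℚ) * n * ((n : ℚ) - i) / 2) * (GenLineBundle.conormalDeg X : ℚ)) ∧
    (GenLineBundle.IsStable n F ↔
      ∀ i ∈ Finset.Icc 1 (n - 1),
        (i : ℚ) * ∑ j ∈ Finset.Icc i (n - 1), (GenLineBundle.index F j : ℚ)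
            - ((n : ℚ) - i) * ∑ j ∈ Finset.Ico 1 i, (GenLineBundle.index F j : ℚ)
          < -((i : ℚ) * n * ((n : ℚ) - i) / 2) * (GenLineBundle.conormalDeg X : ℚ)) := by
  have := hX.isNoetherian
  -- Purity enters twice: here, to ensure that `η` is not a closed point, and below, to embed the
  -- stalks into the generic stalk.
  obtain ⟨P⟩ := hX.nonempty_nilradicalFrame
    (GenLineBundle.not_isClosed_genericPoint hF.pure.dim_eq_one)
  obtain ⟨θ⟩ := hF.generic
  have he : GenLineBundle.IsGenerator (X.presheaf.stalk (genericPoint X)) n (θ.symm 1) := by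
    refine ⟨fun v => ⟨θ v, ?_⟩, fun q => ?_⟩
    · rw [← map_smul, smul_eq_mul, mul_one, LinearEquiv.symm_apply_apply]
    · rw [← map_smul, smul_eq_mul, mul_one, LinearEquiv.map_eq_zero_iff, P.generic.nilradical_eq,
        Ideal.span_singleton_pow, P.generic.pow_eq_zero, Ideal.mem_span_singleton, zero_dvd_iff]
  have hc := P.isCyclic hF.coherent.finiteType
    (fun x _ => P.toGeneric_injective hF.coherent hF.pure x) le_rfl he
  have h0 := P.slope_eq_slopeBound_zero hc hF.coherent
  constructor
  · refine ⟨fun h i hi => ?_, fun h E f hf hE hE0 => ?_⟩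
    · obtain ⟨h1, h2⟩ := Finset.mem_Icc.1 hi
      obtain ⟨E, f, hf, hE, hE0, -, hs⟩ := P.exists_slope_eq hc hF.coherent
        (i := i) (by omega) (by omega)
      rw [← (P.slopeBound_iff hc hi).1, ← hs, ← h0]
      exact h E f hf hE hE0
    · obtain ⟨i, hi, hr⟩ := P.exists_range_eq_span hc f hE0
      have h1 := (P.slope_le hc hE f hi hr).1
      rw [h0]
      -- Subsheaves of full generalized rank have `i = 0` and satisfy the bound without any
      -- condition on the indices.
      rcases Nat.eq_zero_or_pos i with rfl | hi0
      · exact h1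
      · have hi' : i ∈ Finset.Icc 1 (n - 1) := Finset.mem_Icc.2 ⟨hi0, by omega⟩
        exact h1.trans ((P.slopeBound_iff hc hi').1.2 (h i hi'))
  · refine ⟨fun h i hi => ?_, fun h E f hf hE hE0 hiso => ?_⟩
    · obtain ⟨h1, h2⟩ := Finset.mem_Icc.1 hi
      obtain ⟨E, f, hf, hE, hE0, hiso, hs⟩ := P.exists_slope_eq hc hF.coherent
        (i := i) (by omega) (by omega)
      rw [← (P.slopeBound_iff hc hi).2, ← hs, ← h0]
      exact h E f hf hE hE0 hiso
    · obtain ⟨i, hi, hr⟩ := P.exists_range_eq_span hc f hE0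
      have h1 := (P.slope_le hc hE f hi hr).1
      rw [h0]
      rcases Nat.eq_zero_or_pos i with rfl | hi0
      -- At full generalized rank strictness comes from properness of the subsheaf and not from the
      -- inequalities.
      · exact lt_of_le_of_ne h1 fun heq => hiso (P.isIso_of_slope_eq hc hE f hr heq)
      · have hi' : i ∈ Finset.Icc 1 (n - 1) := Finset.mem_Icc.2 ⟨hi0, by omega⟩
        exact h1.trans_lt ((P.slopeBound_iff hc hi').2.2 (h i hi'))
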